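/- **Notation.** Let $k\ge 0$ be an integer and $0<\alpha<1$. $\mathcal C^{k,\alpha}$ is the Banach space of real functions of class $C^{k,\alpha}$ on $\partial\Delta$, $\mathcal C^{k,\alpha}_{\mathbb C}=\mathcal C^{k,\alpha}+i\,\mathcal C^{k,\alpha}$, and $\mathcal A^{k,\alpha}\subset\mathcal C_{\mathbb C}^{k,\alpha}$ is the space of analytic discs (boundary values of functions continuous on $\overline\Delta$ and holomorphic in $\Delta$). $\mathcal A^{k,\alpha}_{0^m}=(1-\zeta)^m\mathcal A^{k,\alpha}$, and $\mathcal C^{k,\alpha}_{0^m}$ is the space of real functions of the form $(1-\zeta)^m v$, $v\in\mathcal C^{k,\alpha}_{\mathbb C}$; both carry the norm $\|(1-\zeta)^m v\|=\|v\|$. Put $$Y=(\mathcal A_{0}^{k,\alpha})^4\times\mathcal A^{k,\alpha}_{0^3}\times\mathcal A^{k,\alpha}_{0^5}\times(\mathcal A^{k,\alpha})^2,\qquad Z=(\mathcal C^{k,\alpha}_0)^2\times(\mathcal C^{k,\alpha}_{0^3})^2\times(\mathcal C^{k,\alpha}_{0^5})^2\times(\mathcal C^{k,\alpha})^2 ,$$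 the components of $Y$ being $(z_1,z_2,w_1,w_2,\tilde z_1,\tilde z_2,\tilde w_1,\tilde w_2)$. For $M=\{r_1=r_2=0\}$, a *$3$-stationary lift* for $M$ is a map $\boldsymbol f=(f,\tilde f)$ to $T^*\mathbb C^4$, continuous on $\overline\Delta$, holomorphic in $\Delta$, with $f$ non-constant, such that for all $\zeta\in\partial\Delta$ we have $f(\zeta)\in M$ and $\tilde f(\zeta)\in\zeta^3\,\mathrm{span}_{\mathbb R}\{\partial r_1(f(\zeta)),\partial r_2(f(\zeta))\}\setminus\{0\}$. **Model.** Let $\rho_1=\Re w_1-|z_1|^4$, $\rho_2=\Re w_2-|z_2|^6$, let $$\boldsymbol f_0(\zeta)=\Big(1-\zeta,\;1-\zeta,\;6-8\zeta+2\zeta^2,\;20-30\zeta+12\zeta^2-2\zeta^3,\;-\zeta(1-\zeta)^3,\;(1-\zeta)^5,\;\tfrac{\zeta^3}{4},\;\tfrac{\zeta^3}{6}\Big),$$ and let $F(\rho,\cdot):Y\to Z$, $F(\rho,\boldsymbol f)(\zeta)=\tilde\rho(\zeta)(\boldsymbol f(\zeta))$, where, with $a_1=\tilde z_1+4\tilde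 w_1z_1\bar z_1^2$ and $a_2=\tilde z_2+6\tilde w_2z_2^2\bar z_2^3$, $$\tilde\rho(\zeta)=\big(\rho_1,\ \rho_2,\ a_1+\bar a_1,\ ia_1-i\bar a_1,\ a_2+\bar a_2,\ ia_2-i\bar a_2,\ i\tilde w_1\zeta^{-3}-i\zeta^3\overline{\tilde w_1},\ i\tilde w_2\zeta^{-3}-i\zeta^3\overline{\tilde w_2}\big).$$ Let $G(\zeta)$ be the $8\times8$ matrix of the derivatives of $\tilde\rho(\zeta)$ at $\boldsymbol f_0(\zeta)$ with respect to $(\bar w_1,\bar w_2,\bar z_1,\bar{\tilde z}_1,\bar z_2,\bar{\tilde z}_2,\bar{\tilde w}_1,\bar{\tilde w}_2)$. For a smooth $A:\partial\Delta\to GL_N(\mathbb C)$, the partial indices $\kappa_1,\dots,\kappa_N$ of $-\overline{A}^{-1}A$ are the exponents in a Birkhoff factorization $-\overline A^{-1}A=B^+\mathrm{diag}(\zeta^{\kappa_1},\dots,\zeta^{\kappa_N})B^-$ on $\partial\Delta$, where $B^+:\overline\Delta\to GL_N(\mathbb C)$ and $B^-:(\mathbb C\cup\{\infty\})\setminus\Delta\to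 GL_N(\mathbb C)$ are smooth, and holomorphic off $\partial\Delta$; the Maslov index is $\kappa=\sum_j\kappa_j$. **Perturbations.** Let $\delta>0$ be such that the base disc of $\boldsymbol f_0$ maps $\overline\Delta$ into $(\delta\Delta)^4$. Put $d_1=4,d_2=6$. For $\eta>0$ let $U_\eta$ be the set of $r=\rho+\theta(z,\Im w)$ on $(\delta\Delta)^4$, $\theta=(\theta_1,\theta_2)$ real, such that each $\theta_\ell$ is the sum of an expression $$\sum_{|I|+|J|=D+1}z^I\bar z^J r_{IJ0}(z)+\sum_{1\le|l|\le D}\ \sum_{|I|+|J|=D-|l|}z^I\bar z^J(\Im w)^l\,r_{IJl}(z,\Im w)$$ with $D=\max(d_1,d_2)=6$, $z=(z_1,z_2)$, and an expression of the same form with $D=d_\ell$ and $z$ replaced by the single variable $z_\ell$, all (complex-valued) coefficients $r_{IJl}$ being of class $C^{k+3}$ with all derivatives of order $\le k+3$ bounded by $\eta$ on the relevant polydisc times $(-\delta,\delta)^2$. **Lemma.** 1. $\boldsymbol f_0\in Y$ is a $3$-stationary lift for $\{\rho=0\}$. $F(\rho,\cdot)$ maps $Y$ to $Z$ and is differentiable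 at $\boldsymbol f_0$, with derivative $\partial_2F(\rho,\boldsymbol f_0)\boldsymbol f=2\Re[\overline{G}\boldsymbol f]$ (coordinates of $\boldsymbol f$ ordered as the columns of $G$). 2. $\partial_2F(\rho,\boldsymbol f_0):Y\to Z$ is onto, and its kernel has real dimension $20$. 3. $G=\widetilde G\cdot\mathrm{diag}\big(1,1,(1-\bar\zeta)^2,1,(1-\bar\zeta)^4,1,1,1\big)$ on $\partial\Delta$ with a smooth $\widetilde G:\partial\Delta\to GL_8(\mathbb C)$ that is block upper triangular with diagonal blocks of sizes $2,4,2$. The block-diagonal part of $\widetilde G$ (also invertible) has partial indices $0,0,4,4,5,5,6,6$, and the Maslov index of $\widetilde G$ is $\kappa=30$. 4. There are $\varepsilon>0$ and $\eta>0$ such that for every $r\in U_\eta$ the set of all $\boldsymbol f\in Y$ with $\|\boldsymbol f-\boldsymbol f_0\|_Y<\varepsilon$ that are $3$-stationary lifts for $\{p\in(\delta\Delta)^4 : r(p)=0\}$ is a non-empty $C^1$ submanifold of $Y$ of real dimension $20$. -/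

import Mathlib

open scoped NNReal ContDiff

namespace StatDisc

/-! ### Hölder spaces on the unit circle -/

/-- The `2π`-periodic function `t ↦ f (e^{it})`. -/
noncomputable def lift {V : Type*} (f : Circle → V) (t : ℝ) : V := f (Circle.exp t)

theorem lift_add {f g : Circle → ℝ} : lift (f + g) = lift f + lift g := rfl

theorem lift_smul {c : ℝ} {f : Circle → ℝ} : lift (c • f) = c • lift f := rfl

/-- Real functions on the circle of class `C^{k,α}`. -/
def holderSubmodule (k : ℕ) (α : ℝ≥0) : Submodule ℝ (Circle → ℝ) where
  carrier := {f | ContDiff ℝ k (lift f) ∧ MemHolder α (iteratedDeriv k (lift f))}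
  zero_mem' := by
    have h : lift (0 : Circle → ℝ) = fun _ => (0 : ℝ) := rfl
    refine ⟨by rw [h]; exact contDiff_const, ?_⟩
    have h2 : iteratedDeriv k (lift (0 : Circle → ℝ)) = 0 := by
      ext t
      rw [h, iteratedDeriv_const]
      simp
    rw [h2]
    exact memHolder_zero
  add_mem' := by
    rintro f g ⟨hf, hf'⟩ ⟨hg, hg'⟩
    refine ⟨by rw [lift_add]; exact hf.add hg, ?_⟩
    have h2 : iteratedDeriv k (lift (f + g)) =
        iteratedDeriv k (lift f) + iteratedDeriv k (lift g) := by
      ext t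
      rw [lift_add]
      exact iteratedDeriv_add hf.contDiffAt hg.contDiffAt
    rw [h2]
    exact hf'.add hg'
  smul_mem' := by
    rintro c f ⟨hf, hf'⟩
    refine ⟨by rw [lift_smul]; exact contDiff_const.smul hf, ?_⟩
    have h2 : iteratedDeriv k (lift (c • f)) = c • iteratedDeriv k (lift f) := by
      ext t
      rw [lift_smul]
      exact iteratedDeriv_const_smul hf.contDiffAt c
    rw [h2]
    exact hf'.smul

/-- The Banach space `C^{k,α}` of real functions on the circle. -/
def CReal (k : ℕ) (α : ℝ≥0) : Type := holderSubmodule k α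

variable {k : ℕ} {α : ℝ≥0}

instance : AddCommGroup (CReal k α) := inferInstanceAs (AddCommGroup (holderSubmodule k α))
instance : Module ℝ (CReal k α) := inferInstanceAs (Module ℝ (holderSubmodule k α))

/-- The `j`-th derivative in the angular variable. -/
noncomputable def CReal.D (j : ℕ) (f : CReal k α) : ℝ → ℝ := iteratedDeriv j (lift f.1)

/-- The usual norm `∑_{j ≤ k} sup |f^{(j)}| + [f^{(k)}]_α`. -/
noncomputable instance : Norm (CReal k α) :=
  ⟨fun f => ∑ j ∈ Finset.range (k + 1), (⨆ t, |f.D j t|) + nnHolderNorm α (f.D k)⟩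

theorem CReal.norm_def (f : CReal k α) :
    ‖f‖ = ∑ j ∈ Finset.range (k + 1), (⨆ t, |f.D j t|) + nnHolderNorm α (f.D k) := rfl

theorem CReal.D_add {j : ℕ} (hj : j ≤ k) (f g : CReal k α) : (f + g).D j = f.D j + g.D j := by
  ext t
  exact iteratedDeriv_add ((f.2.1.of_le (by exact_mod_cast hj)).contDiffAt)
    ((g.2.1.of_le (by exact_mod_cast hj)).contDiffAt)

theorem CReal.D_smul {j : ℕ} (hj : j ≤ k) (c : ℝ) (f : CReal k α) : (c • f).D j = c • f.D j := by
  ext t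
  exact iteratedDeriv_const_smul ((f.2.1.of_le (by exact_mod_cast hj)).contDiffAt) c

theorem CReal.D_periodic (j : ℕ) (f : CReal k α) : Function.Periodic (f.D j) (2 * Real.pi) := by
  intro t
  have h : (fun s => lift f.1 (s + 2 * Real.pi)) = lift f.1 := by
    ext s
    simp [lift]
  have h2 := congrFun (iteratedDeriv_comp_add_const j (lift f.1) (2 * Real.pi)) t
  rw [h] at h2
  exact h2.symm

theorem CReal.bddAbove {j : ℕ} (hj : j ≤ k) (f : CReal k α) :
    BddAbove (Set.range fun t => |f.D j t|) := by
  have hc : Continuous (f.D j) := f.2.1.continuous_iteratedDeriv j (by exact_mod_cast hj)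
  have hp : Function.Periodic (fun t => |f.D j t|) (2 * Real.pi) := fun t => by
    simp only [f.D_periodic j t]
  rw [← hp.image_Icc Real.two_pi_pos 0]
  exact (isCompact_Icc.image hc.abs).bddAbove

theorem CReal.core : NormedSpace.Core ℝ (CReal k α) where
  norm_nonneg f := by
    rw [CReal.norm_def]
    exact add_nonneg (Finset.sum_nonneg fun j _ => Real.iSup_nonneg fun t => abs_nonneg _)
      (NNReal.coe_nonneg _)
  norm_smul c f := by
    rw [CReal.norm_def, CReal.norm_def, mul_add, Finset.mul_sum]
    congr 1
    · refine Finset.sum_congr rfl fun j hj => ?_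
      rw [CReal.D_smul (Finset.mem_range_succ_iff.1 hj), Real.mul_iSup_of_nonneg (norm_nonneg c)]
      simp [abs_mul]
    · have h : nnHolderNorm α (c • f.D k) = ‖c‖₊ * nnHolderNorm α (f.D k) :=
        MemHolder.nnHolderNorm_smul f.2.2 c
      rw [CReal.D_smul le_rfl, h]
      simp
  norm_triangle f g := by
    rw [CReal.norm_def, CReal.norm_def, CReal.norm_def]
    have h1 : ∑ j ∈ Finset.range (k + 1), (⨆ t, |(f + g).D j t|) ≤
        ∑ j ∈ Finset.range (k + 1), (⨆ t, |f.D j t|) +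
        ∑ j ∈ Finset.range (k + 1), (⨆ t, |g.D j t|) := by
      rw [← Finset.sum_add_distrib]
      refine Finset.sum_le_sum fun j hj => ?_
      have hj' := Finset.mem_range_succ_iff.1 hj
      refine ciSup_le fun t => ?_
      rw [CReal.D_add hj', Pi.add_apply]
      exact (abs_add_le _ _).trans
        (add_le_add (le_ciSup (f.bddAbove hj') t) (le_ciSup (g.bddAbove hj') t))
    have h2 : (nnHolderNorm α ((f + g).D k) : ℝ) ≤
        nnHolderNorm α (f.D k) + nnHolderNorm α (g.D k) := by
      rw [CReal.D_add le_rfl]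
      exact_mod_cast MemHolder.nnHolderNorm_add_le f.2.2 g.2.2
    linarith
  norm_eq_zero_iff f := by
    constructor
    · intro h
      rw [CReal.norm_def] at h
      have hn : ∀ j ∈ Finset.range (k + 1), 0 ≤ ⨆ t, |f.D j t| :=
        fun j _ => Real.iSup_nonneg fun t => abs_nonneg _
      have h0 := (add_eq_zero_iff_of_nonneg (Finset.sum_nonneg hn) (NNReal.coe_nonneg _)).1 h
      have h1 := (Finset.sum_eq_zero_iff_of_nonneg hn).1 h0.1 0 (by simp)
      apply Subtype.ext
      funext z
      obtain ⟨t, rfl⟩ : ∃ t, Circle.exp t = z := ⟨Complex.arg z, Circle.exp_arg z⟩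
      have h2 := le_ciSup (f.bddAbove (Nat.zero_le k)) t
      rw [h1] at h2
      have h3 := abs_nonpos_iff.1 h2
      have h4 : f.1 (Circle.exp t) = 0 := by simpa [CReal.D, lift] using h3
      exact h4
    · rintro rfl
      have hz : ∀ j ≤ k, (0 : CReal k α).D j = 0 := fun j hj => by
        have := CReal.D_smul hj 0 (0 : CReal k α)
        simpa using this
      rw [CReal.norm_def, hz k le_rfl, Finset.sum_eq_zero]
      · simp
      · intro j hj
        rw [hz j (Finset.mem_range_succ_iff.1 hj)]
        simp

noncomputable instance : NormedAddCommGroup (CReal k α) := NormedAddCommGroup.ofCore CReal.core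
noncomputable instance : NormedSpace ℝ (CReal k α) := NormedSpace.ofCore CReal.core

/-- Complex functions on the circle whose real and imaginary parts are of class `C^{k,α}`. -/
def cHolderSubmodule (k : ℕ) (α : ℝ≥0) : Submodule ℝ (Circle → ℂ) where
  carrier := {f | (fun ζ => (f ζ).re) ∈ holderSubmodule k α ∧
    (fun ζ => (f ζ).im) ∈ holderSubmodule k α}
  zero_mem' := ⟨(holderSubmodule k α).zero_mem, (holderSubmodule k α).zero_mem⟩
  add_mem' := fun hf hg => ⟨(holderSubmodule k α).add_mem hf.1 hg.1,
    (holderSubmodule k α).add_mem hf.2 hg.2⟩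
  smul_mem' := fun c f hf => by
    have h1 : (fun ζ => ((c • f) ζ).re) = c • fun ζ => (f ζ).re := by ext; simp
    have h2 : (fun ζ => ((c • f) ζ).im) = c • fun ζ => (f ζ).im := by ext; simp
    refine ⟨?_, ?_⟩
    · rw [h1]; exact (holderSubmodule k α).smul_mem c hf.1
    · rw [h2]; exact (holderSubmodule k α).smul_mem c hf.2

/-- The Banach space `C_ℂ^{k,α} = C^{k,α} + i C^{k,α}`. -/
def CComplex (k : ℕ) (α : ℝ≥0) : Type := cHolderSubmodule k α

noncomputable instance : AddCommGroup (CComplex k α) := inferInstanceAs (AddCommGroup (cHolderSubmodule k α))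
noncomputable instance : Module ℝ (CComplex k α) := inferInstanceAs (Module ℝ (cHolderSubmodule k α))

/-- Real part. -/
def CComplex.re : CComplex k α →ₗ[ℝ] CReal k α where
  toFun f := ⟨fun ζ => (f.1 ζ).re, f.2.1⟩
  map_add' _ _ := rfl
  map_smul' c f := Subtype.ext (funext fun ζ => Complex.smul_re c (f.1 ζ))

/-- Imaginary part. -/
def CComplex.im : CComplex k α →ₗ[ℝ] CReal k α where
  toFun f := ⟨fun ζ => (f.1 ζ).im, f.2.2⟩
  map_add' _ _ := rfl
  map_smul' c f := Subtype.ext (funext fun ζ => Complex.smul_im c (f.1 ζ))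

/-- `‖f‖ = ‖Re f‖ + ‖Im f‖`. -/
noncomputable instance : Norm (CComplex k α) := ⟨fun f => ‖f.re‖ + ‖f.im‖⟩

theorem CComplex.norm_def (f : CComplex k α) : ‖f‖ = ‖f.re‖ + ‖f.im‖ := rfl

theorem CComplex.core : NormedSpace.Core ℝ (CComplex k α) where
  norm_nonneg f := add_nonneg (norm_nonneg _) (norm_nonneg _)
  norm_smul c f := by
    simp only [CComplex.norm_def, map_smul, norm_smul, mul_add]
  norm_triangle f g := by
    simp only [CComplex.norm_def, map_add]
    linarith [norm_add_le f.re g.re, norm_add_le f.im g.im]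
  norm_eq_zero_iff f := by
    constructor
    · intro h
      rw [CComplex.norm_def, add_eq_zero_iff_of_nonneg (norm_nonneg _) (norm_nonneg _),
        norm_eq_zero, norm_eq_zero] at h
      apply Subtype.ext
      funext ζ
      exact Complex.ext (congrFun (congrArg Subtype.val h.1) ζ)
        (congrFun (congrArg Subtype.val h.2) ζ)
    · rintro rfl
      simp [CComplex.norm_def]

noncomputable instance : NormedAddCommGroup (CComplex k α) :=
  NormedAddCommGroup.ofCore CComplex.core
noncomputable instance : NormedSpace ℝ (CComplex k α) := NormedSpace.ofCore CComplex.core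

/-! ### Analytic discs and the spaces `Y`, `Z` -/

/-- The space `𝒜^{k,α}` of analytic discs, as the subspace of `C_ℂ^{k,α}` of boundary values of
functions continuous on the closed disc and holomorphic in the open disc. -/
def A (k : ℕ) (α : ℝ≥0) : Submodule ℝ (CComplex k α) where
  carrier := {f | ∃ F : ℂ → ℂ, DiffContOnCl ℂ F (Metric.ball 0 1) ∧ ∀ ζ : Circle, F ζ = f.1 ζ}
  zero_mem' := ⟨0, diffContOnCl_const, fun _ => rfl⟩
  add_mem' := by
    rintro f g ⟨F, hF, hF'⟩ ⟨G, hG, hG'⟩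
    exact ⟨F + G, hF.add hG, fun ζ => congrArg₂ (· + ·) (hF' ζ) (hG' ζ)⟩
  smul_mem' := by
    rintro c f ⟨F, hF, hF'⟩
    exact ⟨c • F, hF.const_smul c, fun ζ => congrArg (c • ·) (hF' ζ)⟩

/-- Multiplication by `(1 - ζ)^m`. -/
noncomputable def mulPow (m : ℕ) (v : CComplex k α) (ζ : Circle) : ℂ := (1 - (ζ : ℂ)) ^ m * v.1 ζ

/-- The space `C_{0^m}^{k,α}` of real functions of the form `(1 - ζ)^m v` with `v ∈ C_ℂ^{k,α}`.
Its elements are recorded by `v`, which is determined by the function, so that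
`‖(1 - ζ)^m v‖ = ‖v‖`. -/
def CZero (k : ℕ) (α : ℝ≥0) (m : ℕ) : Submodule ℝ (CComplex k α) where
  carrier := {v | ∀ ζ, (mulPow m v ζ).im = 0}
  zero_mem' := fun ζ => by
    show ((1 - (ζ : ℂ)) ^ m * (0 : ℂ)).im = 0
    simp
  add_mem' := by
    intro v w hv hw ζ
    have h : mulPow m (v + w) ζ = mulPow m v ζ + mulPow m w ζ := mul_add _ (v.1 ζ) (w.1 ζ)
    rw [h, Complex.add_im, hv ζ, hw ζ, add_zero]
  smul_mem' := by
    intro c v hv ζ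
    have h : mulPow m (c • v) ζ = c • mulPow m v ζ := mul_smul_comm c _ (v.1 ζ)
    rw [h, Complex.smul_im, hv ζ, smul_zero]

/-- The degrees `d₁ = 4`, `d₂ = 6` of the model. -/
def deg : Fin 2 → ℕ := ![4, 6]

/-- Vanishing orders at `ζ = 1` of the components `(z₁, z₂, w₁, w₂, z̃₁, z̃₂, w̃₁, w̃₂)` of discs. -/
def yOrd : Fin 8 → ℕ := ![1, 1, 1, 1, deg 0 - 1, deg 1 - 1, 0, 0]

/-- Vanishing orders at `ζ = 1` of the components of the target space. -/
def zOrd : Fin 8 → ℕ := ![1, 1, deg 0 - 1, deg 0 - 1, deg 1 - 1, deg 1 - 1, 0, 0]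

/-- `Y = (𝒜₀)² × (𝒜₀)² × 𝒜_{0^{d₁-1}} × 𝒜_{0^{d₂-1}} × 𝒜²` with the product norm. As an element
`(1 - ζ)^m f` of `𝒜_{0^m}` has norm `‖f‖`, it is recorded by `f`; see `Y.eval`. -/
abbrev Y (k : ℕ) (α : ℝ≥0) : Type := Fin 8 → A k α

/-- The boundary values of the disc in `T^*ℂ⁴` given by an element of `Y`. -/
noncomputable def Y.eval (f : Y k α) (ζ : Circle) (i : Fin 8) : ℂ :=
  mulPow (yOrd i) (f i : CComplex k α) ζ

/-- `Z = (C₀)² × (C_{0^{d₁-1}})² × (C_{0^{d₂-1}})² × (C)²` with the product norm. -/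
abbrev Z (k : ℕ) (α : ℝ≥0) : Type := (i : Fin 8) → CZero k α (zOrd i)

/-- The (real-valued) functions on the circle given by an element of `Z`. -/
noncomputable def Z.eval (φ : Z k α) (ζ : Circle) (i : Fin 8) : ℂ :=
  mulPow (zOrd i) (φ i : CComplex k α) ζ

/-! ### Wirtinger derivatives, stationary lifts -/

/-- `∂φ/∂z_j`. -/
noncomputable def wirt {n : ℕ} (φ : (Fin n → ℂ) → ℂ) (p : Fin n → ℂ) (j : Fin n) : ℂ :=
  (fderiv ℝ φ p (Pi.single j 1) - Complex.I * fderiv ℝ φ p (Pi.single j Complex.I)) / 2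

/-- `∂φ/∂z̄_j`. -/
noncomputable def wirtBar {n : ℕ} (φ : (Fin n → ℂ) → ℂ) (p : Fin n → ℂ) (j : Fin n) : ℂ :=
  (fderiv ℝ φ p (Pi.single j 1) + Complex.I * fderiv ℝ φ p (Pi.single j Complex.I)) / 2

/-- The base point `(z, w)` of a covector `(z, w, z̃, w̃) ∈ T^*ℂ⁴`. -/
def base (q : Fin 8 → ℂ) : Fin 4 → ℂ := fun j => q (Fin.castAdd 4 j)

/-- The fibre part `(z̃, w̃)` of a covector `(z, w, z̃, w̃) ∈ T^*ℂ⁴`. -/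
def fibre (q : Fin 8 → ℂ) : Fin 4 → ℂ := fun j => q (Fin.natAdd 4 j)

/-- The set `𝒩^{k₀}M(ζ)` for `M = {p ∈ Ω | r p = 0}`: the base point lies in `M` and the fibre part
in `ζ^{k₀} span_ℝ{∂r₁, ∂r₂} ∖ {0}`. -/
def conormal (Ω : Set (Fin 4 → ℂ)) (r : (Fin 4 → ℂ) → Fin 2 → ℝ) (k₀ : ℕ) (ζ : ℂ) :
    Set (Fin 8 → ℂ) :=
  {q | base q ∈ Ω ∧ (∀ ℓ, r (base q) ℓ = 0) ∧ fibre q ≠ 0 ∧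
    ∃ c : Fin 2 → ℝ, ∀ j, fibre q j =
      ζ ^ k₀ * ∑ ℓ, (c ℓ : ℂ) * wirt (fun p => (r p ℓ : ℂ)) (base q) j}

/-- `f` is (the boundary value of) a `k₀`-stationary lift for `M = {p ∈ Ω | r p = 0}` whose
underlying disc is not constant. -/
def IsStationaryLift (Ω : Set (Fin 4 → ℂ)) (r : (Fin 4 → ℂ) → Fin 2 → ℝ) (k₀ : ℕ)
    (f : Circle → Fin 8 → ℂ) : Prop :=
  (∃ F : ℂ → Fin 8 → ℂ, DiffContOnCl ℂ F (Metric.ball 0 1) ∧ ∀ ζ : Circle, F ζ = f ζ) ∧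
  (∀ ζ : Circle, f ζ ∈ conormal Ω r k₀ ζ) ∧
  ¬ ∃ p, ∀ ζ : Circle, base (f ζ) = p

/-! ### The model and its perturbations -/

/-- The polydisc `(δΔ)⁴`. -/
def polydisc (δ : ℝ) : Set (Fin 4 → ℂ) := {p | ∀ j, ‖p j‖ < δ}

/-- The set `(δΔ)ⁿ × (-δ, δ)²`. -/
def paramBox (n : ℕ) (δ : ℝ) : Set ((Fin n → ℂ) × (Fin 2 → ℝ)) :=
  {p | (∀ j, ‖p.1 j‖ < δ) ∧ ∀ j, |p.2 j| < δ}

/-- The `z`-part and the `Im w`-part of a point of `ℂ⁴`. -/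
def zPart (p : Fin 4 → ℂ) : Fin 2 → ℂ := ![p 0, p 1]

/-- See `zPart`. -/
def wPart (p : Fin 4 → ℂ) : Fin 2 → ℂ := ![p 2, p 3]

/-- `r_ℓ = Re w_ℓ - |z_ℓ|^{d_ℓ} + θ_ℓ(z, Im w)`. -/
noncomputable def defFun (θ : (Fin 2 → ℂ) → (Fin 2 → ℝ) → Fin 2 → ℝ) (p : Fin 4 → ℂ)
    (ℓ : Fin 2) : ℝ :=
  (wPart p ℓ).re - ‖zPart p ℓ‖ ^ deg ℓ + θ (zPart p) (fun j => (wPart p j).im) ℓ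

/-- The model `ρ₁ = Re w₁ - |z₁|⁴`, `ρ₂ = Re w₂ - |z₂|⁶`. -/
noncomputable def rho : (Fin 4 → ℂ) → Fin 2 → ℝ := defFun 0

/-- Coefficient families `r_{IJl}(z, Im w)` for multi-indices `I, J ∈ ℕⁿ`, `l ∈ ℕ²`. -/
abbrev Coeffs (n : ℕ) : Type :=
  (Fin n → ℕ) → (Fin n → ℕ) → (Fin 2 → ℕ) → (Fin n → ℂ) × (Fin 2 → ℝ) → ℂ

/-- All pairs `(I, J)` of multi-indices in `ℕⁿ` with `|I| + |J| = D`. -/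
def multiPairs (n D : ℕ) : Finset ((Fin n → ℕ) × (Fin n → ℕ)) :=
  ((Fintype.piFinset fun _ => Finset.range (D + 1)) ×ˢ
    (Fintype.piFinset fun _ => Finset.range (D + 1))).filter
      fun p => ∑ j, p.1 j + ∑ j, p.2 j = D

/-- All multi-indices `l ∈ ℕ²` with `1 ≤ |l| ≤ D`. -/
def multiIdx (D : ℕ) : Finset (Fin 2 → ℕ) :=
  (Fintype.piFinset fun _ => Finset.range (D + 1)).filter fun l => 1 ≤ ∑ j, l j ∧ ∑ j, l j ≤ D

/-- `∑_{|I|+|J| = D} z^I z̄^J R_{IJl}(z, y')`. -/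
noncomputable def homPart {n : ℕ} (D : ℕ) (R : Coeffs n) (l : Fin 2 → ℕ) (z : Fin n → ℂ)
    (y' : Fin 2 → ℝ) : ℂ :=
  ∑ p ∈ multiPairs n D,
    (∏ j, z j ^ p.1 j) * (∏ j, (starRingEnd ℂ (z j)) ^ p.2 j) * R p.1 p.2 l (z, y')

/-- `∑_{|I|+|J| = D+1} z^I z̄^J R_{IJ0}(z) + ∑_{1≤|l|≤D} ∑_{|I|+|J| = D-|l|} z^I z̄^J y^l R_{IJl}(z, y)`;
in the first sum `R_{IJ0}(z)` is read as `R_{IJ0}(z, 0)`. -/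
noncomputable def expansion {n : ℕ} (D : ℕ) (R : Coeffs n) (z : Fin n → ℂ) (y : Fin 2 → ℝ) : ℂ :=
  homPart (D + 1) R 0 z 0 +
    ∑ l ∈ multiIdx D, (∏ j, (y j : ℂ) ^ l j) * homPart (D - ∑ j, l j) R l z y

/-- All coefficients are of class `C^s` on `(δΔ)ⁿ × (-δ, δ)²` with `C^s` norm at most `η`. -/
def Coeffs.Small {n : ℕ} (s : ℕ) (δ η : ℝ) (R : Coeffs n) : Prop :=
  ∀ I J l, ContDiffOn ℝ s (R I J l) (paramBox n δ) ∧
    ∀ j ≤ s, ∀ p ∈ paramBox n δ, ‖iteratedFDeriv ℝ j (R I J l) p‖ ≤ η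

/-- `ρ + θ` is an admissible defining function at distance at most `η` from `ρ`: on the polydisc
the real function `θ_ℓ` is the sum of
* an expansion with `D = d_ℓ` in which only `z_ℓ` and `Im w` occur, and
* an expansion with `D = max(d₁, d₂)` in which all of `z₁, z₂, Im w` may occur,
with coefficients of `C^{k+3}` norm at most `η`. -/
def IsPerturbation (k : ℕ) (δ η : ℝ) (θ : (Fin 2 → ℂ) → (Fin 2 → ℝ) → Fin 2 → ℝ) : Prop :=
  ∃ (S : Fin 2 → Coeffs 1) (R : Fin 2 → Coeffs 2),
    (∀ ℓ, (S ℓ).Small (k + 3) δ η) ∧ (∀ ℓ, (R ℓ).Small (k + 3) δ η) ∧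
    ∀ z y, (z, y) ∈ paramBox 2 δ → ∀ ℓ, (θ z y ℓ : ℂ) =
      expansion (deg ℓ) (S ℓ) (fun _ => z ℓ) y + expansion (max (deg 0) (deg 1)) (R ℓ) z y

/-- The initial lift, in the coordinates `(z₁, z₂, w₁, w₂, z̃₁, z̃₂, w̃₁, w̃₂)`. -/
noncomputable def initialLift (ζ : ℂ) : Fin 8 → ℂ :=
  ![1 - ζ, 1 - ζ, 6 - 8 * ζ + 2 * ζ ^ 2, 20 - 30 * ζ + 12 * ζ ^ 2 - 2 * ζ ^ 3,
    -ζ * (1 - ζ) ^ 3, (1 - ζ) ^ 5, ζ ^ 3 / 4, ζ ^ 3 / 6]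

/-- The eight defining functions `ρ̃(ζ)` of `𝒩³M_H(ζ)`. -/
noncomputable def rhoTilde (ζ : ℂ) (q : Fin 8 → ℂ) : Fin 8 → ℂ :=
  let c := starRingEnd ℂ
  let a₁ := q 4 + 4 * q 6 * q 0 * c (q 0) ^ 2
  let a₂ := q 5 + 6 * q 7 * q 1 ^ 2 * c (q 1) ^ 3
  ![((q 2).re : ℂ) - (‖q 0‖ : ℂ) ^ 4,
    ((q 3).re : ℂ) - (‖q 1‖ : ℂ) ^ 6,
    a₁ + c a₁,
    Complex.I * a₁ - Complex.I * c a₁,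
    a₂ + c a₂,
    Complex.I * a₂ - Complex.I * c a₂,
    Complex.I * (q 6 / ζ ^ 3) - Complex.I * ζ ^ 3 * c (q 6),
    Complex.I * (q 7 / ζ ^ 3) - Complex.I * ζ ^ 3 * c (q 7)]

/-! ### The symbol, partial indices, Maslov index -/

/-- The order `(w₁, w₂, z₁, z̃₁, z₂, z̃₂, w̃₁, w̃₂)` in which the columns of the symbol are listed. -/
def col : Fin 8 → Fin 8 := ![2, 3, 0, 4, 1, 5, 6, 7]

/-- The symbol `G(ζ)`: the matrix of the derivatives of `ρ̃(ζ)` with respect to the conjugate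
coordinates, at the initial lift. -/
noncomputable def symbol (ζ : Circle) : Matrix (Fin 8) (Fin 8) ℂ :=
  Matrix.of fun i j => wirtBar (fun q => rhoTilde ζ q i) (initialLift ζ) (col j)

/-- The degenerate diagonal factor `diag(1, 1, (1 - ζ̄)², 1, (1 - ζ̄)⁴, 1, 1, 1)`. -/
noncomputable def degenFactor (ζ : Circle) : Matrix (Fin 8) (Fin 8) ℂ :=
  let b : ℂ := 1 - starRingEnd ℂ (ζ : ℂ)
  Matrix.diagonal ![1, 1, b ^ 2, 1, b ^ 4, 1, 1, 1]

/-- The three blocks (of sizes 2, 4, 2) of rows and columns. -/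
def blk : Fin 8 → Fin 3 := ![0, 0, 1, 1, 1, 1, 2, 2]

/-- The block-diagonal part of a matrix with respect to `blk`. -/
def blockDiagPart (M : Matrix (Fin 8) (Fin 8) ℂ) : Matrix (Fin 8) (Fin 8) ℂ :=
  Matrix.of fun i j => if blk i = blk j then M i j else 0

/-- A smooth map from the closed unit disc to `GL_N(ℂ)`, holomorphic in the open disc. -/
def IsSmoothHolGL {N : ℕ} (B : ℂ → Matrix (Fin N) (Fin N) ℂ) : Prop :=
  (∀ ζ ∈ Metric.closedBall (0 : ℂ) 1, IsUnit (B ζ).det) ∧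
  (∀ i j, ContDiffOn ℝ ∞ (fun ζ => B ζ i j) (Metric.closedBall 0 1)) ∧
  ∀ i j, DifferentiableOn ℂ (fun ζ => B ζ i j) (Metric.ball 0 1)

/-- `κ₁, …, κ_N` are the partial indices of `-\bar{A}⁻¹ A`, where `A` is a smooth map from the circle
to `GL_N(ℂ)`: there is a Birkhoff factorization `-\bar{A}⁻¹ A = B⁺ diag(ζ^{κ_j}) B⁻`. The factor `B⁻`,
defined outside the open disc including `∞`, is written as `B⁻(ζ) = C(1/ζ)`. -/
def HasPartialIndices {N : ℕ} (A : Circle → Matrix (Fin N) (Fin N) ℂ) (κ : Fin N → ℤ) : Prop :=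
  (∀ i j, ContDiff ℝ ∞ (lift fun ζ => A ζ i j)) ∧ (∀ ζ, IsUnit (A ζ).det) ∧
  ∃ Bplus C : ℂ → Matrix (Fin N) (Fin N) ℂ, IsSmoothHolGL Bplus ∧ IsSmoothHolGL C ∧
    ∀ ζ : Circle, -(((A ζ).map (starRingEnd ℂ))⁻¹ * A ζ) =
      Bplus ζ * Matrix.diagonal (fun j => (ζ : ℂ) ^ κ j) * C ((ζ : ℂ)⁻¹)

/-- The Maslov index of `-\bar{A}⁻¹ A` is the sum of its partial indices. -/
def HasMaslovIndex {N : ℕ} (A : Circle → Matrix (Fin N) (Fin N) ℂ) (m : ℤ) : Prop :=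
  ∃ κ : Fin N → ℤ, HasPartialIndices A κ ∧ ∑ j, κ j = m

/-! ### Submanifolds of Banach spaces -/

/-- `S` is an (embedded) `C¹` submanifold of dimension `d > 0` of the real normed space `E`: near each
of its points, a `C¹` diffeomorphism between open subsets of `E` straightens `S` to a linear
subspace of dimension `d`. -/
def IsC1Submanifold {E : Type*} [NormedAddCommGroup E] [NormedSpace ℝ E] (d : ℕ) (S : Set E) :
    Prop :=
  ∀ p ∈ S, ∃ (Φ : OpenPartialHomeomorph E E) (V : Submodule ℝ E),
    p ∈ Φ.source ∧ ContDiffOn ℝ 1 Φ Φ.source ∧ ContDiffOn ℝ 1 Φ.symm Φ.target ∧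
    FiniteDimensional ℝ V ∧ Module.finrank ℝ V = d ∧
    ∀ x ∈ Φ.source, x ∈ S ↔ Φ x ∈ V

end StatDisc

/-! Elements of `Y` and `Z` are recorded by what is left after a power of 1 - ζ has been divided
out. On the circle conj(1 - ζ) = -ζ⁻¹(1 - ζ), so each component of F(ρ, f) is the real part of (1 -
ζ)^m times a polynomial in f, its conjugate and fixed powers of ζ (`modelPart`). Hence F(ρ, ·) is a
C¹ map of Banach spaces, and its derivative at f₀ has the explicit form `modelLin`.

The linearized system is triangular. The components w̃ solve scalar problems Re(2iζ⁻³s) = ψ. Each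
pair of real rows for (z̃, z) is one complex equation, t + ζu + 2ζū = χ or t - 2u - 3ū = χ. Finally
the components w solve Re((1 - ζ)v) = q. All of these reduce to the unique splitting of a C^{k,α}
function as a + ζ⁻¹ḡ with analytic discs a and g (`exists_add_conj`, `eq_zero_of_add_conj`), which
rests on Privalov's theorem for Herglotz integrals (`exists_boundary_value`). The data left free are
Taylor coefficients at the origin: 7 real parameters for each w̃, 4 for z₁ and 2 for z₂. So the
derivative together with `taylor` is an isomorphism onto Z × ℝ²⁰ (`modelEquiv`), which gives
surjectivity and the kernel at the same time.

After regrouping rows and columns, the desingularized symbol is a direct sum of two 4×4 matrices.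
Explicit polynomial Birkhoff factors of determinant 1 exhibit the indices, for the full matrix and
for its block-diagonal part.

For a perturbation, the real coefficients of the conormal covector are forced to be 2 Re(ζ⁻³w̃).
Eliminating them turns stationarity into F(ρ, f) + P(f) = 0 (`mem_conormal_iff`,
`isStationaryLift_iff`). The orders required in the expansions of θ are exactly what makes each row
of P divisible by the needed power of 1 - ζ. Composition with smooth functions is a C¹ operator on
Hölder functions (`exists_nemytskii`), so P is small in C¹ when the coefficients are small. A
quantitative implicit function argument (`exists_submanifold_of_perturbation`) then shows that the
zero set is a submanifold of dimension 20. -/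

namespace StatDisc

/-! ### Hölder bounds for vector-valued functions on the line -/

section HolderBound

variable {F G H V : Type} [NormedAddCommGroup F] [NormedSpace ℝ F] [NormedAddCommGroup G]
  [NormedSpace ℝ G] [NormedAddCommGroup H] [NormedSpace ℝ H] [NormedAddCommGroup V]
  [NormedSpace ℝ V] {a : ℝ}

/-- All derivatives of `u` of order at most `k` are bounded by `K`, and the `k`-th one is
`a`-Hölder with constant `K`. -/
def HolderBound (a : ℝ) : ℕ → (ℝ → F) → ℝ → Prop
  | 0, u, K => (∀ t, ‖u t‖ ≤ K) ∧ ∀ s t, ‖u s - u t‖ ≤ K * |s - t| ^ a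
  | k + 1, u, K => (∀ t, ‖u t‖ ≤ K) ∧
      ∃ u' : ℝ → F, (∀ t, HasDerivAt u (u' t) t) ∧ HolderBound a k u' K

theorem HolderBound.bound {k : ℕ} {u : ℝ → F} {K : ℝ} (h : HolderBound a k u K) (t : ℝ) :
    ‖u t‖ ≤ K := by
  cases k <;> exact h.1 t

theorem HolderBound.nonneg {k : ℕ} {u : ℝ → F} {K : ℝ} (h : HolderBound a k u K) : 0 ≤ K :=
  (norm_nonneg _).trans (h.bound 0)

theorem HolderBound.mono {k : ℕ} {u : ℝ → F} {K L : ℝ} (h : HolderBound a k u K) (hKL : K ≤ L) :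
    HolderBound a k u L := by
  induction k generalizing u with
  | zero =>
    exact ⟨fun t => (h.1 t).trans hKL, fun s t => (h.2 s t).trans
      (mul_le_mul_of_nonneg_right hKL (by positivity))⟩
  | succ k ih =>
    obtain ⟨h1, u', h2, h3⟩ := h
    exact ⟨fun t => (h1 t).trans hKL, u', h2, ih h3⟩

theorem HolderBound.congr {k : ℕ} {u v : ℝ → F} {K : ℝ} (h : HolderBound a k u K)
    (e : ∀ t, u t = v t) : HolderBound a k v K :=
  funext e ▸ h

theorem HolderBound.add {k : ℕ} {u v : ℝ → F} {K L : ℝ} (h : HolderBound a k u K)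
    (h' : HolderBound a k v L) : HolderBound a k (fun t => u t + v t) (K + L) := by
  induction k generalizing u v with
  | zero =>
    refine ⟨fun t => norm_add_le_of_le (h.1 t) (h'.1 t), fun s t => ?_⟩
    rw [add_sub_add_comm, add_mul]
    exact norm_add_le_of_le (h.2 s t) (h'.2 s t)
  | succ k ih =>
    obtain ⟨h1, u', h2, h3⟩ := h
    obtain ⟨h1', v', h2', h3'⟩ := h'
    exact ⟨fun t => norm_add_le_of_le (h1 t) (h1' t), _, fun t => (h2 t).add (h2' t), ih h3 h3'⟩

theorem HolderBound.clm {k : ℕ} {u : ℝ → F} {K : ℝ} (h : HolderBound a k u K) (L : F →L[ℝ] G) :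
    HolderBound a k (fun t => L (u t)) (‖L‖ * K) := by
  induction k generalizing u with
  | zero =>
    refine ⟨fun t => L.le_opNorm_of_le (h.1 t), fun s t => ?_⟩
    rw [← map_sub, mul_assoc]
    exact L.le_opNorm_of_le (h.2 s t)
  | succ k ih =>
    obtain ⟨h1, u', h2, h3⟩ := h
    exact ⟨fun t => L.le_opNorm_of_le (h1 t), _, fun t => L.hasFDerivAt.comp_hasDerivAt t (h2 t),
      ih h3⟩

theorem HolderBound.neg {k : ℕ} {u : ℝ → F} {K : ℝ} (h : HolderBound a k u K) :
    HolderBound a k (fun t => - u t) K := by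
  induction k generalizing u with
  | zero =>
    refine ⟨fun t => by simpa using h.1 t, fun s t => ?_⟩
    rw [neg_sub_neg, norm_sub_rev]
    exact h.2 s t
  | succ k ih =>
    obtain ⟨h1, u', h2, h3⟩ := h
    exact ⟨fun t => by simpa using h1 t, _, fun t => (h2 t).neg, ih h3⟩

theorem HolderBound.sub {k : ℕ} {u v : ℝ → F} {K L : ℝ} (h : HolderBound a k u K)
    (h' : HolderBound a k v L) : HolderBound a k (fun t => u t - v t) (K + L) := by
  simpa only [sub_eq_add_neg] using h.add h'.neg

theorem HolderBound.const (k : ℕ) (c : F) : HolderBound a k (fun _ => c) ‖c‖ := by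
  have h0 : ∀ (k : ℕ) (K : ℝ), 0 ≤ K → HolderBound a k (fun _ => (0 : F)) K := by
    intro k
    induction k with
    | zero => exact fun K hK => ⟨fun t => by simpa using hK, fun s t => by simp; positivity⟩
    | succ k ih =>
      exact fun K hK => ⟨fun t => by simpa using hK, _, fun t => hasDerivAt_const t _, ih K hK⟩
  cases k with
  | zero => exact ⟨fun t => le_rfl, fun s t => by simp; positivity⟩
  | succ k => exact ⟨fun t => le_rfl, _, fun t => hasDerivAt_const t _, h0 k _ (norm_nonneg _)⟩

/-- Interpolation between the two bounds on y: if |x| ≤ 1 then |x| ≤ |x|^a and the Lipschitz bound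
suffices; otherwise |x|^a ≥ 1 and the uniform bound does. -/
theorem abs_le_rpow_or {a : ℝ} (ha1 : a ≤ 1) {x y K : ℝ} (h1 : y ≤ K * |x|)
    (h2 : y ≤ 2 * K) (hK : 0 ≤ K) (ha0 : 0 < a) : y ≤ 2 * K * |x| ^ a := by
  rcases le_total |x| 1 with h | h
  · have h3 : |x| ≤ |x| ^ a := by
      rcases eq_or_lt_of_le (abs_nonneg x) with h0 | h0
      · rw [← h0, Real.zero_rpow ha0.ne']
      · conv_lhs => rw [← Real.rpow_one |x|]
        exact Real.rpow_le_rpow_of_exponent_ge h0 h ha1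
    have h4 : K * |x| ≤ K * |x| ^ a := mul_le_mul_of_nonneg_left h3 hK
    have h5 : 0 ≤ K * |x| ^ a := by positivity
    linarith
  · have h3 : 1 ≤ |x| ^ a := Real.one_le_rpow h ha0.le
    have h4 : 2 * K * 1 ≤ 2 * K * |x| ^ a := mul_le_mul_of_nonneg_left h3 (by positivity)
    linarith

theorem HolderBound.of_hasDerivAt (ha0 : 0 < a) (ha1 : a ≤ 1) {u u' : ℝ → F} {K : ℝ}
    (h : ∀ t, ‖u t‖ ≤ K) (hd : ∀ t, HasDerivAt u (u' t) t) (h' : ∀ t, ‖u' t‖ ≤ K) :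
    HolderBound a 0 u (2 * K) := by
  have hK : 0 ≤ K := (norm_nonneg _).trans (h 0)
  refine ⟨fun t => (h t).trans (by linarith), fun s t => ?_⟩
  refine abs_le_rpow_or ha1 ?_ ?_ hK ha0
  · have := convex_univ.norm_image_sub_le_of_norm_hasDerivWithin_le
      (f := u) (f' := u') (fun x _ => (hd x).hasDerivWithinAt) (fun x _ => h' x)
      (Set.mem_univ t) (Set.mem_univ s)
    simpa using this
  · exact (norm_sub_le _ _).trans (by linarith [h s, h t])

/-- Only the lowest level is new: there a bound on the next derivative replaces the Hölder
condition, at the cost of the factor 2. -/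
theorem HolderBound.of_succ (ha0 : 0 < a) (ha1 : a ≤ 1) {k : ℕ} {u : ℝ → F} {K : ℝ}
    (h : HolderBound a (k + 1) u K) : HolderBound a k u (2 * K) := by
  induction k generalizing u with
  | zero =>
    obtain ⟨h1, u', h2, h3⟩ := h
    exact HolderBound.of_hasDerivAt ha0 ha1 h1 h2 h3.1
  | succ k ih =>
    obtain ⟨h1, u', h2, h3⟩ := h
    exact ⟨fun t => (h1 t).trans (by linarith [(norm_nonneg _).trans (h1 0)]), u', h2, ih h3⟩

/-- Leibniz rule. Each differentiation produces two terms, and in each of them the undifferentiated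
factor loses one order through `HolderBound.of_succ`, hence a factor 4 per step. -/
theorem HolderBound.bilin (ha0 : 0 < a) (ha1 : a ≤ 1) (B : F →L[ℝ] G →L[ℝ] H) {k : ℕ}
    {u : ℝ → F} {v : ℝ → G} {K L : ℝ} (h : HolderBound a k u K) (h' : HolderBound a k v L) :
    HolderBound a k (fun t => B (u t) (v t)) (2 * 4 ^ k * ‖B‖ * K * L) := by
  have key : ∀ (x : F) (y : G) (p q : ℝ), ‖x‖ ≤ p → ‖y‖ ≤ q → ‖B x y‖ ≤ ‖B‖ * p * q := by
    intro x y p q hx hy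
    refine (B.le_opNorm₂ x y).trans ?_
    have := (norm_nonneg _).trans hx
    gcongr
  have hK := h.nonneg
  have hL := h'.nonneg
  induction k generalizing u v K L with
  | zero =>
    refine ⟨fun t => (key _ _ _ _ (h.1 t) (h'.1 t)).trans ?_, fun s t => ?_⟩
    · have : 0 ≤ ‖B‖ * K * L := by positivity
      linarith
    · have e : B (u s) (v s) - B (u t) (v t) = B (u s - u t) (v s) + B (u t) (v s - v t) := by
        simp
      rw [e]
      refine (norm_add_le_of_le (key _ _ _ _ (h.2 s t) (h'.1 s))
        (key _ _ _ _ (h.1 t) (h'.2 s t))).trans (le_of_eq ?_)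
      ring
  | succ k ih =>
    obtain ⟨h1, u', h2, h3⟩ := id h
    obtain ⟨h1', v', h2', h3'⟩ := id h'
    refine ⟨fun t => (key _ _ _ _ (h1 t) (h1' t)).trans ?_,
      fun t => B (u t) (v' t) + B (u' t) (v t), fun t => ?_, ?_⟩
    · have : 0 ≤ ‖B‖ * K * L := by positivity
      have h4 : (1 : ℝ) ≤ 2 * 4 ^ (k + 1) := by
        have := one_le_pow₀ (M₀ := ℝ) (a := 4) (n := k + 1) (by norm_num)
        linarith
      nlinarith
    · exact B.hasDerivAt_of_bilinear (fun _ => h2 t) (fun _ => h2' t)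
    · have p1 := ih (h.of_succ ha0 ha1) h3' (by positivity) hL
      have p2 := ih h3 (h'.of_succ ha0 ha1) hK (by positivity)
      refine (p1.add p2).mono (le_of_eq ?_)
      ring

/-! ### Composition with smooth maps -/

/-- `R` is of class `C^s` on `U`, with derivatives of order at most `s` bounded by `η`. -/
def SmoothBound (s : ℕ) (U : Set V) (R : V → F) (η : ℝ) : Prop :=
  ContDiffOn ℝ s R U ∧ ∀ j ≤ s, ∀ p ∈ U, ‖iteratedFDeriv ℝ j R p‖ ≤ η

theorem SmoothBound.fderiv {s : ℕ} {U : Set V} (hU : IsOpen U) {R : V → F} {η : ℝ}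
    (h : SmoothBound (s + 1) U R η) : SmoothBound s U (fderiv ℝ R) η :=
  ⟨h.1.fderiv_of_isOpen hU (by norm_cast), fun j hj p hp => by
    rw [norm_iteratedFDeriv_fderiv]
    exact h.2 (j + 1) (by omega) p hp⟩

theorem SmoothBound.norm_le {s : ℕ} {U : Set V} {R : V → F} {η : ℝ}
    (h : SmoothBound s U R η) {p : V} (hp : p ∈ U) : ‖R p‖ ≤ η := by
  have := h.2 0 (Nat.zero_le _) p hp
  rwa [norm_iteratedFDeriv_zero] at this

theorem SmoothBound.differentiableAt {s : ℕ} {U : Set V} (hU : IsOpen U) {R : V → F} {η : ℝ}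
    (h : SmoothBound (s + 1) U R η) {p : V} (hp : p ∈ U) : DifferentiableAt ℝ R p :=
  ((h.1.differentiableOn (by norm_cast)).differentiableAt (hU.mem_nhds hp))

theorem SmoothBound.of_succ {s : ℕ} {U : Set V} {R : V → F} {η : ℝ}
    (h : SmoothBound (s + 1) U R η) : SmoothBound s U R η :=
  ⟨h.1.of_le (by norm_cast; omega), fun j hj => h.2 j (by omega)⟩

theorem SmoothBound.lipschitz {s : ℕ} {U : Set V} (hU : IsOpen U) (hc : Convex ℝ U) {R : V → F}
    {η : ℝ} (h : SmoothBound (s + 1) U R η) {p q : V} (hp : p ∈ U) (hq : q ∈ U) :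
    ‖R q - R p‖ ≤ η * ‖q - p‖ :=
  hc.norm_image_sub_le_of_norm_fderiv_le (fun _ hx => h.differentiableAt hU hx)
    (fun _ hx => (h.fderiv hU).norm_le hx) hp hq

/-- Chain rule and induction. The constant must not depend on `R`, and the target space is
quantified inside, because the induction replaces `R` by its derivative, which takes values in a
space of linear maps. One derivative beyond k supplies the Lipschitz bound at the lowest level. -/
theorem HolderBound.comp_bound (ha0 : 0 < a) (ha1 : a ≤ 1) {U : Set V} (hU : IsOpen U)
    (hc : Convex ℝ U) (k : ℕ) (K : ℝ) : ∃ C : ℝ, 0 ≤ C ∧ ∀ (F : Type) [NormedAddCommGroup F]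
      [NormedSpace ℝ F] (R : V → F) (η : ℝ), SmoothBound (k + 1) U R η → ∀ X : ℝ → V,
      HolderBound a k X K → (∀ t, X t ∈ U) → HolderBound a k (fun t => R (X t)) (C * η) := by
  induction k generalizing K with
  | zero =>
    refine ⟨1 + |K|, by positivity, fun F _ _ R η hR X hX hXU => ⟨fun t => ?_, fun s t => ?_⟩⟩
    · have h1 := hR.norm_le (hXU t)
      have h2 := (norm_nonneg _).trans h1
      nlinarith [abs_nonneg K]
    · have h1 := hR.lipschitz hU hc (hXU t) (hXU s)
      have h2 := hX.2 s t
      have h3 := (norm_nonneg _).trans (hR.norm_le (hXU t))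
      have h4 : (0 : ℝ) ≤ |s - t| ^ a := by positivity
      have h5 : η * ‖X s - X t‖ ≤ η * (|K| * |s - t| ^ a) :=
        mul_le_mul_of_nonneg_left (h2.trans (mul_le_mul_of_nonneg_right (le_abs_self K) h4)) h3
      have h6 : 0 ≤ η * |s - t| ^ a := by positivity
      nlinarith
  | succ k ih =>
    obtain ⟨C, hC, h⟩ := ih (2 * K)
    refine ⟨1 + 2 * 4 ^ k * C * |K|, by positivity, fun F _ _ R η hR X hX hXU => ?_⟩
    have hη := (norm_nonneg _).trans (hR.norm_le (hXU 0))
    obtain ⟨h1, X', h2, h3⟩ := id hX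
    refine ⟨fun t => (hR.norm_le (hXU t)).trans ?_, fun t => _root_.fderiv ℝ R (X t) (X' t),
      fun t => (hR.differentiableAt hU (hXU t)).hasFDerivAt.comp_hasDerivAt t (h2 t), ?_⟩
    · have : 0 ≤ 2 * 4 ^ k * C * |K| * η := by positivity
      linarith
    · have p1 := h _ _ η (hR.fderiv hU) X (hX.of_succ ha0 ha1) hXU
      have p2 := HolderBound.bilin ha0 ha1 (ContinuousLinearMap.id ℝ (V →L[ℝ] F)) p1 h3
      refine p2.mono ?_
      have hK := h3.nonneg
      rw [abs_of_nonneg hK]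
      have h5 : ‖ContinuousLinearMap.id ℝ (V →L[ℝ] F)‖ ≤ 1 := ContinuousLinearMap.norm_id_le
      calc 2 * 4 ^ k * ‖ContinuousLinearMap.id ℝ (V →L[ℝ] F)‖ * (C * η) * K
          ≤ 2 * 4 ^ k * 1 * (C * η) * K := by gcongr
        _ ≤ _ := by linarith

/-- Compactness of `C` gives a thickening inside `U` and uniform continuity of the derivative near
`C`; the mean value inequality on small balls then makes the first-order Taylor remainder uniformly
small. -/
theorem exists_uniform_differentiability {U C : Set V} (hU : IsOpen U) (hC : IsCompact C)
    (hCU : C ⊆ U) {Q : V → F} (hQ : ContDiffOn ℝ 1 Q U) {ε : ℝ} (hε : 0 < ε) :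
    ∃ δ > 0, ∀ p ∈ C, ∀ q : V, ‖q‖ ≤ δ → p + q ∈ U ∧ ‖fderiv ℝ Q (p + q) - fderiv ℝ Q p‖ ≤ ε ∧
      ‖Q (p + q) - Q p - fderiv ℝ Q p q‖ ≤ ε * ‖q‖ := by
  have hcont : ContinuousOn (fderiv ℝ Q) U := hQ.continuousOn_fderiv_of_isOpen hU le_rfl
  obtain ⟨δ₁, hδ₁, h1⟩ := hC.exists_cthickening_subset_open hU hCU
  have h2 := hC.uniformContinuousAt_of_continuousAt (fderiv ℝ Q)
    (fun x hx => hcont.continuousAt (hU.mem_nhds (hCU hx))) (Metric.dist_mem_uniformity hε)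
  obtain ⟨δ₂, hδ₂, h2⟩ := Metric.mem_uniformity_dist.1 h2
  have key : ∀ p ∈ C, ∀ q : V, ‖q‖ ≤ min δ₁ (δ₂ / 2) → p + q ∈ U ∧
      ‖fderiv ℝ Q (p + q) - fderiv ℝ Q p‖ ≤ ε := by
    intro p hp q hq
    constructor
    · apply h1
      refine Metric.mem_cthickening_of_dist_le (p + q) p δ₁ C hp ?_
      simpa [dist_eq_norm] using hq.trans (min_le_left _ _)
    · have h3 : dist p (p + q) < δ₂ := by
        have := hq.trans (min_le_right _ _)
        simp only [dist_self_add_right]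
        linarith
      have := h2 h3 hp
      rw [Set.mem_ofPred_eq, dist_comm, dist_eq_norm] at this
      exact this.le
  refine ⟨min δ₁ (δ₂ / 2), by positivity, fun p hp q hq => ⟨(key p hp q hq).1, (key p hp q hq).2, ?_⟩⟩
  have hd : ∀ x ∈ Metric.closedBall p (min δ₁ (δ₂ / 2)), HasFDerivWithinAt Q (fderiv ℝ Q x)
      (Metric.closedBall p (min δ₁ (δ₂ / 2))) x := by
    intro x hx
    rw [mem_closedBall_iff_norm] at hx
    have := (key p hp (x - p) hx).1
    rw [add_sub_cancel] at this
    exact ((hQ.differentiableOn one_ne_zero).differentiableAt (hU.mem_nhds this)).hasFDerivAt.hasFDerivWithinAt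
  have := (convex_closedBall p (min δ₁ (δ₂ / 2))).norm_image_sub_le_of_norm_hasFDerivWithin_le'
    (φ := fderiv ℝ Q p) (C := ε) hd (fun x hx => by
      rw [mem_closedBall_iff_norm] at hx
      have := (key p hp (x - p) hx).2
      rwa [add_sub_cancel] at this) (x := p) (y := p + q)
      (Metric.mem_closedBall_self (by positivity)) (by simpa [mem_closedBall_iff_norm] using hq)
  simpa using this

theorem hasDerivAt_segment (x v : V) (σ : ℝ) : HasDerivAt (fun σ : ℝ => x + σ • v) v σ := by
  simpa using (((hasDerivAt_id σ).smul_const v).const_add x)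

theorem norm_segment_le {x y : V} {δ σ : ℝ} (hx : ‖x‖ ≤ δ) (hy : ‖y‖ ≤ δ)
    (hσ : σ ∈ Set.Icc (0 : ℝ) 1) : ‖x + σ • (y - x)‖ ≤ δ := by
  have := (convex_closedBall (0 : V) δ).add_smul_sub_mem (x := x) (y := y) (t := σ)
    (by simpa using hx) (by simpa using hy) hσ
  simpa using this

/-- Continuity at `X` of composition with `R`, in the Hölder norm. At the lowest level it comes from
the uniform continuity of the derivative on `C`; the inductive step differentiates the increment and
applies the hypothesis to the derivative of `R`. -/
theorem HolderBound.comp_cont (ha0 : 0 < a) (ha1 : a ≤ 1) {U C : Set V} (hU : IsOpen U)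
    (hc : Convex ℝ U) (hC : IsCompact C) (hCc : Convex ℝ C) (hCU : C ⊆ U) (k : ℕ) :
    ∀ (F : Type) [NormedAddCommGroup F] [NormedSpace ℝ F] (R : V → F) (η : ℝ),
      SmoothBound (k + 1) U R η → ∀ (X : ℝ → V) (K : ℝ), HolderBound a k X K → (∀ t, X t ∈ C) →
      ∀ ε > 0, ∃ δ > 0, ∀ H : ℝ → V, HolderBound a k H δ →
        HolderBound a k (fun t => R (X t + H t) - R (X t)) ε := by
  induction k with
  | zero =>
    intro F _ _ R η hR X K hX hXC ε hε
    have hη := (norm_nonneg _).trans (hR.norm_le (hCU (hXC 0)))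
    have hK := hX.nonneg
    obtain ⟨δ₀, hδ₀, h0⟩ := exists_uniform_differentiability hU hC hCU (Q := R)
      (by simpa using hR.1) (ε := ε / (2 * (K + 1))) (by positivity)
    refine ⟨min δ₀ (ε / (2 * (η + 1))), by positivity, fun H hH => ?_⟩
    have hH1 : ∀ t, ‖H t‖ ≤ δ₀ := fun t => (hH.1 t).trans (min_le_left _ _)
    have e1 : η * (ε / (2 * (η + 1))) ≤ ε / 2 := by
      rw [show η * (ε / (2 * (η + 1))) = ε / 2 * (η / (η + 1)) by field_simp]
      exact mul_le_of_le_one_right (by positivity) ((div_le_one (by positivity)).2 (by linarith))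
    have e2 : ε / (2 * (K + 1)) * K ≤ ε / 2 := by
      rw [show ε / (2 * (K + 1)) * K = ε / 2 * (K / (K + 1)) by field_simp]
      exact mul_le_of_le_one_right (by positivity) ((div_le_one (by positivity)).2 (by linarith))
    constructor
    · intro t
      have h1 := hR.lipschitz hU hc (hCU (hXC t)) (h0 _ (hXC t) _ (hH1 t)).1
      rw [add_sub_cancel_left] at h1
      have h2 := mul_le_mul_of_nonneg_left ((hH.1 t).trans (min_le_right _ _)) hη
      linarith
    · intro s t
      -- The difference of the increments at s and t is the change, for σ from 0 to 1, of R(P + q) -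
      -- R(P) along two simultaneous segments, so it is controlled by the σ-derivative.
      set P : ℝ → V := fun σ => X t + σ • (X s - X t)
      set q : ℝ → V := fun σ => H t + σ • (H s - H t)
      have hP : ∀ σ ∈ Set.Icc (0 : ℝ) 1, P σ ∈ C := fun σ hσ =>
        hCc.add_smul_sub_mem (hXC t) (hXC s) hσ
      have hq : ∀ σ ∈ Set.Icc (0 : ℝ) 1, ‖q σ‖ ≤ δ₀ := fun σ hσ =>
        norm_segment_le (hH1 t) (hH1 s) hσ
      have hP' : ∀ σ, HasDerivAt P (X s - X t) σ := fun σ => hasDerivAt_segment _ _ σ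
      have hq' : ∀ σ, HasDerivAt q (H s - H t) σ := fun σ => hasDerivAt_segment _ _ σ
      have := norm_image_sub_le_of_norm_deriv_le_segment_01'
        (f := fun σ => R (P σ + q σ) - R (P σ))
        (f' := fun σ => _root_.fderiv ℝ R (P σ + q σ) ((X s - X t) + (H s - H t)) -
          _root_.fderiv ℝ R (P σ) (X s - X t)) (C := ε * |s - t| ^ a)
        (fun σ hσ => by
          have i1 := h0 _ (hP σ hσ) _ (hq σ hσ)
          exact (((hR.differentiableAt hU i1.1).hasFDerivAt.comp_hasDerivAt σ
            ((hP' σ).add (hq' σ))).sub ((hR.differentiableAt hU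
              (hCU (hP σ hσ))).hasFDerivAt.comp_hasDerivAt σ (hP' σ))).hasDerivWithinAt)
        (fun σ hσ => by
          have hσ := Set.Ico_subset_Icc_self hσ
          have i1 := h0 _ (hP σ hσ) _ (hq σ hσ)
          have e : _root_.fderiv ℝ R (P σ + q σ) ((X s - X t) + (H s - H t)) -
              _root_.fderiv ℝ R (P σ) (X s - X t) =
              (_root_.fderiv ℝ R (P σ + q σ) - _root_.fderiv ℝ R (P σ)) (X s - X t) +
              _root_.fderiv ℝ R (P σ + q σ) (H s - H t) := by
            simp; abel
          rw [e]
          have h4 : (0 : ℝ) ≤ |s - t| ^ a := by positivity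
          have j1 := ContinuousLinearMap.le_of_opNorm_le_of_le _ i1.2.1 (hX.2 s t)
          have j2 := ContinuousLinearMap.le_of_opNorm_le_of_le _
            ((hR.fderiv hU).norm_le i1.1) ((hH.2 s t).trans
              (mul_le_mul_of_nonneg_right (min_le_right _ _) h4))
          refine (norm_add_le_of_le j1 j2).trans ?_
          have := mul_le_mul_of_nonneg_right e1 h4
          have := mul_le_mul_of_nonneg_right e2 h4
          linarith)
      simpa [P, q] using this
  | succ k ih =>
    intro F _ _ R η hR X K hX hXC ε hε
    have hη := (norm_nonneg _).trans (hR.norm_le (hCU (hXC 0)))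
    have hK := hX.nonneg
    obtain ⟨B, hB0, hB⟩ := HolderBound.comp_bound ha0 ha1 hU hc k (2 * K)
    have hX2 := hX.of_succ ha0 ha1
    obtain ⟨h1, X', h2, h3⟩ := id hX
    set c : ℝ := 2 * 4 ^ k
    have hc0 : 0 < c := by positivity
    have hid : ‖ContinuousLinearMap.id ℝ (V →L[ℝ] F)‖ ≤ 1 := ContinuousLinearMap.norm_id_le
    -- The bound 1 keeps the derivative at X + H under control in the term with H'; the other bound
    -- makes the term with X' at most ε/2.
    obtain ⟨δ₁, hδ₁, i1⟩ := ih _ (_root_.fderiv ℝ R) η (hR.fderiv hU) X _ hX2 hXC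
      (min 1 (ε / (2 * c * (K + 1)))) (by positivity)
    obtain ⟨δ₀, hδ₀, i0⟩ := exists_uniform_differentiability hU hC hCU (Q := R)
      (hR.1.of_le (by norm_cast; omega)) one_pos
    set δ := min (min (δ₁ / 2) δ₀) (min (ε / (2 * c * (B * η + 1))) (ε / (η + 1)))
    have hδ : 0 < δ := by positivity
    refine ⟨δ, hδ, fun H hH => ?_⟩
    obtain ⟨g1, H', g2, g3⟩ := id hH
    have hXH : ∀ t, X t + H t ∈ U := fun t =>
      (i0 _ (hXC t) _ ((g1 t).trans ((min_le_left _ _).trans (min_le_right _ _)))).1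
    refine ⟨fun t => ?_, fun t => (_root_.fderiv ℝ R (X t + H t) - _root_.fderiv ℝ R (X t)) (X' t + H' t) +
      _root_.fderiv ℝ R (X t) (H' t), fun t => ?_, ?_⟩
    · have h1 := hR.lipschitz hU hc (hCU (hXC t)) (hXH t)
      rw [add_sub_cancel_left] at h1
      refine h1.trans ((mul_le_mul_of_nonneg_left ((g1 t).trans
        ((min_le_right _ _).trans (min_le_right _ _))) hη).trans ?_)
      rw [mul_div_assoc', div_le_iff₀ (by positivity)]
      nlinarith
    · have := (((hR.differentiableAt hU (hXH t)).hasFDerivAt.comp_hasDerivAt t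
        ((h2 t).add (g2 t))).sub ((hR.differentiableAt hU
              (hCU (hXC t))).hasFDerivAt.comp_hasDerivAt t (h2 t)))
      refine this.congr_deriv ?_
      simp
      abel
    · have hHk : HolderBound a k H δ₁ := (hH.of_succ ha0 ha1).mono (by
        have : δ ≤ δ₁ / 2 := (min_le_left _ _).trans (min_le_left _ _)
        linarith)
      have p1 := i1 H hHk
      have p0 := hB _ _ η (hR.fderiv hU) X hX2 (fun t => hCU (hXC t))
      have q1 := HolderBound.bilin ha0 ha1 (ContinuousLinearMap.id ℝ (V →L[ℝ] F)) p1 h3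
      have q2 := HolderBound.bilin ha0 ha1 (ContinuousLinearMap.id ℝ (V →L[ℝ] F))
        (p1.add p0) g3
      refine HolderBound.mono (K := ε / 2 + ε / 2) ?_ (by linarith)
      have q1' := q1.mono (L := ε / 2) (by
        calc 2 * 4 ^ k * ‖ContinuousLinearMap.id ℝ (V →L[ℝ] F)‖ *
              min 1 (ε / (2 * c * (K + 1))) * K
            ≤ c * 1 * (ε / (2 * c * (K + 1))) * K := by
              gcongr
              exact min_le_right _ _
          _ = ε / 2 * (K / (K + 1)) := by field_simp
          _ ≤ ε / 2 := mul_le_of_le_one_right (by positivity)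
              ((div_le_one (by positivity)).2 (by linarith)))
      have q2' := q2.mono (L := ε / 2) (by
        calc 2 * 4 ^ k * ‖ContinuousLinearMap.id ℝ (V →L[ℝ] F)‖ *
              (min 1 (ε / (2 * c * (K + 1))) + B * η) * δ
            ≤ c * 1 * (1 + B * η) * (ε / (2 * c * (B * η + 1))) := by
              gcongr
              · exact min_le_left _ _
              · exact (min_le_right _ _).trans (min_le_left _ _)
          _ = ε / 2 := by field_simp; ring)
      refine (q1'.add q2').congr fun t => ?_
      simp
      abel

/-- Differentiating R'(X)H along the curve yields R''(X)(X', H), while the Taylor remainder of R'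
applied to X' contains R''(X)(H, X'). Symmetry identifies the two. -/
theorem SmoothBound.fderiv_fderiv_symm {s : ℕ} {U : Set V} (hU : IsOpen U) {R : V → F} {η : ℝ}
    (h : SmoothBound (s + 2) U R η) {p : V} (hp : p ∈ U) (v w : V) :
    _root_.fderiv ℝ (_root_.fderiv ℝ R) p v w = _root_.fderiv ℝ (_root_.fderiv ℝ R) p w v := by
  have h1 : ContDiffAt ℝ 2 R p :=
    (h.1.of_le (by norm_cast; omega)).contDiffAt (hU.mem_nhds hp)
  exact h1.isSymmSndFDerivAt (by simp) v w

/-- Fréchet differentiability of composition in the Hölder norm. The derivative of the Taylor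
remainder of `R` is the remainder of R' applied to X' + 0·H', plus (R'(X + H) - R'(X)) applied to
H'. The first term is handled by induction, the second by `HolderBound.comp_cont`; together they
need two derivatives beyond k. -/
theorem HolderBound.comp_diff (ha0 : 0 < a) (ha1 : a ≤ 1) {U C : Set V} (hU : IsOpen U)
    (hc : Convex ℝ U) (hC : IsCompact C) (hCc : Convex ℝ C) (hCU : C ⊆ U) (k : ℕ) :
    ∀ (F : Type) [NormedAddCommGroup F] [NormedSpace ℝ F] (R : V → F) (η : ℝ),
      SmoothBound (k + 2) U R η → ∀ (X : ℝ → V) (K : ℝ), HolderBound a k X K → (∀ t, X t ∈ C) →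
      ∀ ε > 0, ∃ δ > 0, ∀ (H : ℝ → V) (M : ℝ), M ≤ δ → HolderBound a k H M →
        HolderBound a k (fun t => R (X t + H t) - R (X t) - fderiv ℝ R (X t) (H t)) (ε * M) := by
  induction k with
  | zero =>
    intro F _ _ R η hR X K hX hXC ε hε
    have hK := hX.nonneg
    obtain ⟨δ₀, hδ₀, h0⟩ := exists_uniform_differentiability hU hC hCU (Q := R)
      (hR.1.of_le (by norm_cast)) (ε := ε / 2) (by positivity)
    obtain ⟨δ₁, hδ₁, h1⟩ := exists_uniform_differentiability hU hC hCU (Q := _root_.fderiv ℝ R)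
      (by simpa using (hR.fderiv hU).1) (ε := ε / (2 * (K + 1))) (by positivity)
    refine ⟨min δ₀ δ₁, by positivity, fun H M hM hH => ?_⟩
    have hM0 := hH.nonneg
    have hH0 : ∀ t, ‖H t‖ ≤ δ₀ := fun t => (hH.1 t).trans (hM.trans (min_le_left _ _))
    have e2 : ε / (2 * (K + 1)) * K ≤ ε / 2 := by
      rw [show ε / (2 * (K + 1)) * K = ε / 2 * (K / (K + 1)) by field_simp]
      exact mul_le_of_le_one_right (by positivity) ((div_le_one (by positivity)).2 (by linarith))
    constructor
    · intro t
      refine (h0 _ (hXC t) _ (hH0 t)).2.2.trans ?_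
      have := mul_le_mul_of_nonneg_left (hH.1 t) hε.le
      nlinarith [norm_nonneg (H t)]
    · intro s t
      set P : ℝ → V := fun σ => X t + σ • (X s - X t)
      set q : ℝ → V := fun σ => H t + σ • (H s - H t)
      have hP : ∀ σ ∈ Set.Icc (0 : ℝ) 1, P σ ∈ C := fun σ hσ =>
        hCc.add_smul_sub_mem (hXC t) (hXC s) hσ
      have hq : ∀ σ ∈ Set.Icc (0 : ℝ) 1, ‖q σ‖ ≤ M := fun σ hσ =>
        norm_segment_le (hH.1 t) (hH.1 s) hσ
      have hP' : ∀ σ, HasDerivAt P (X s - X t) σ := fun σ => hasDerivAt_segment _ _ σ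
      have hq' : ∀ σ, HasDerivAt q (H s - H t) σ := fun σ => hasDerivAt_segment _ _ σ
      have := norm_image_sub_le_of_norm_deriv_le_segment_01'
        (f := fun σ => R (P σ + q σ) - R (P σ) - _root_.fderiv ℝ R (P σ) (q σ))
        (f' := fun σ => _root_.fderiv ℝ R (P σ + q σ) ((X s - X t) + (H s - H t)) -
          _root_.fderiv ℝ R (P σ) (X s - X t) -
          (_root_.fderiv ℝ (_root_.fderiv ℝ R) (P σ) (X s - X t) (q σ) +
            _root_.fderiv ℝ R (P σ) (H s - H t))) (C := ε * M * |s - t| ^ a)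
        (fun σ hσ => by
          have i1 := h0 _ (hP σ hσ) _ ((hq σ hσ).trans (hM.trans (min_le_left _ _)))
          exact ((((hR.differentiableAt hU i1.1).hasFDerivAt.comp_hasDerivAt σ
            ((hP' σ).add (hq' σ))).sub ((hR.differentiableAt hU
              (hCU (hP σ hσ))).hasFDerivAt.comp_hasDerivAt σ (hP' σ))).sub
              ((((hR.fderiv hU).differentiableAt hU
              (hCU (hP σ hσ))).hasFDerivAt.comp_hasDerivAt σ (hP' σ)).clm_apply
                (hq' σ))).hasDerivWithinAt)
        (fun σ hσ => by
          have hσ := Set.Ico_subset_Icc_self hσ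
          have i0 := h0 _ (hP σ hσ) _ ((hq σ hσ).trans (hM.trans (min_le_left _ _)))
          have i1 := h1 _ (hP σ hσ) _ ((hq σ hσ).trans (hM.trans (min_le_right _ _)))
          rw [hR.fderiv_fderiv_symm hU (hCU (hP σ hσ))]
          have e : _root_.fderiv ℝ R (P σ + q σ) ((X s - X t) + (H s - H t)) -
              _root_.fderiv ℝ R (P σ) (X s - X t) -
              (_root_.fderiv ℝ (_root_.fderiv ℝ R) (P σ) (q σ) (X s - X t) +
                _root_.fderiv ℝ R (P σ) (H s - H t)) =
              (_root_.fderiv ℝ R (P σ + q σ) - _root_.fderiv ℝ R (P σ) -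
                _root_.fderiv ℝ (_root_.fderiv ℝ R) (P σ) (q σ)) (X s - X t) +
              (_root_.fderiv ℝ R (P σ + q σ) - _root_.fderiv ℝ R (P σ)) (H s - H t) := by
            simp; abel
          rw [e]
          have h4 : (0 : ℝ) ≤ |s - t| ^ a := by positivity
          have j1 := ContinuousLinearMap.le_of_opNorm_le_of_le _ (i1.2.2.trans
            (mul_le_mul_of_nonneg_left (hq σ hσ) (by positivity))) (hX.2 s t)
          have j2 := ContinuousLinearMap.le_of_opNorm_le_of_le _ i0.2.1 (hH.2 s t)
          refine (norm_add_le_of_le j1 j2).trans ?_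
          have := mul_le_mul_of_nonneg_right e2 (mul_nonneg hM0 h4)
          linarith)
      simpa [P, q] using this
  | succ k ih =>
    intro F _ _ R η hR X K hX hXC ε hε
    have hK := hX.nonneg
    have hX2 := hX.of_succ ha0 ha1
    obtain ⟨h1, X', h2, h3⟩ := id hX
    set c : ℝ := 2 * 4 ^ k
    have hc0 : 0 < c := by positivity
    have hid : ‖ContinuousLinearMap.id ℝ (V →L[ℝ] F)‖ ≤ 1 := ContinuousLinearMap.norm_id_le
    obtain ⟨δ₁, hδ₁, i1⟩ := ih _ (_root_.fderiv ℝ R) η (hR.fderiv hU) X _ hX2 hXC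
      (ε / (4 * c * (K + 1))) (by positivity)
    obtain ⟨δ₂, hδ₂, i2⟩ := HolderBound.comp_cont ha0 ha1 hU hc hC hCc hCU k _ (_root_.fderiv ℝ R) η
      (hR.fderiv hU).of_succ X _ hX2 hXC (ε / (2 * c)) (by positivity)
    obtain ⟨δ₀, hδ₀, i0⟩ := exists_uniform_differentiability hU hC hCU (Q := R)
      (hR.1.of_le (by norm_cast; omega)) hε
    refine ⟨min δ₀ (min (δ₁ / 2) (δ₂ / 2)), by positivity, fun H M hM hH => ?_⟩
    have hM0 := hH.nonneg
    have hM1 : 2 * M ≤ δ₁ := by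
      have := hM.trans ((min_le_right _ _).trans (min_le_left _ _)); linarith
    have hM2 : 2 * M ≤ δ₂ := by
      have := hM.trans ((min_le_right _ _).trans (min_le_right _ _)); linarith
    obtain ⟨g1, H', g2, g3⟩ := id hH
    have i3 : ∀ t, _ := fun t => i0 _ (hXC t) _ ((g1 t).trans (hM.trans (min_le_left _ _)))
    refine ⟨fun t => (i3 t).2.2.trans (mul_le_mul_of_nonneg_left (g1 t) hε.le),
      fun t => (_root_.fderiv ℝ R (X t + H t) - _root_.fderiv ℝ R (X t) -
        _root_.fderiv ℝ (_root_.fderiv ℝ R) (X t) (H t)) (X' t) +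
      (_root_.fderiv ℝ R (X t + H t) - _root_.fderiv ℝ R (X t)) (H' t), fun t => ?_, ?_⟩
    · have := (((hR.differentiableAt hU (i3 t).1).hasFDerivAt.comp_hasDerivAt t
        ((h2 t).add (g2 t))).sub ((hR.differentiableAt hU
              (hCU (hXC t))).hasFDerivAt.comp_hasDerivAt t (h2 t))).sub
              ((((hR.fderiv hU).differentiableAt hU
              (hCU (hXC t))).hasFDerivAt.comp_hasDerivAt t (h2 t)).clm_apply (g2 t))
      refine this.congr_deriv ?_
      rw [hR.fderiv_fderiv_symm hU (hCU (hXC t))]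
      simp
      abel
    · have hHk := hH.of_succ ha0 ha1
      have p1 := i1 H _ hM1 hHk
      have p2 := i2 H (hHk.mono hM2)
      have q1 := HolderBound.bilin ha0 ha1 (ContinuousLinearMap.id ℝ (V →L[ℝ] F)) p1 h3
      have q2 := HolderBound.bilin ha0 ha1 (ContinuousLinearMap.id ℝ (V →L[ℝ] F)) p2 g3
      have q1' := q1.mono (L := ε / 2 * M) (by
        calc 2 * 4 ^ k * ‖ContinuousLinearMap.id ℝ (V →L[ℝ] F)‖ *
              (ε / (4 * c * (K + 1)) * (2 * M)) * K
            ≤ c * 1 * (ε / (4 * c * (K + 1)) * (2 * M)) * K := by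
              gcongr
          _ = ε / 2 * M * (K / (K + 1)) := by field_simp; ring
          _ ≤ ε / 2 * M := mul_le_of_le_one_right (by positivity)
              ((div_le_one (by positivity)).2 (by linarith)))
      have q2' := q2.mono (L := ε / 2 * M) (by
        calc 2 * 4 ^ k * ‖ContinuousLinearMap.id ℝ (V →L[ℝ] F)‖ * (ε / (2 * c)) * M
            ≤ c * 1 * (ε / (2 * c)) * M := by gcongr
          _ = ε / 2 * M := by field_simp)
      exact (q1'.add q2').mono (by linarith)

/-! ### Completeness -/

theorem HolderBound.of_tendsto {u : ℕ → ℝ → F} {v : ℝ → F} {K : ℝ}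
    (h : ∀ n, HolderBound a 0 (u n) K)
    (hv : ∀ t, Filter.Tendsto (fun n => u n t) Filter.atTop (nhds (v t))) :
    HolderBound a 0 v K :=
  ⟨fun t => le_of_tendsto' (hv t).norm fun n => (h n).1 t, fun s t =>
    le_of_tendsto' ((hv s).sub (hv t)).norm fun n => (h n).2 s t⟩

/-- Uniform convergence of the derivatives allows differentiation of the pointwise limit, and the
Hölder inequality passes to pointwise limits. Uniqueness of derivatives shows that the chosen
derivatives of a Cauchy sequence are again Cauchy, which drives the induction. -/
theorem HolderBound.exists_limit [CompleteSpace F] (k : ℕ) (u : ℕ → ℝ → F)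
    (hu : ∀ n, ∃ K, HolderBound a k (u n) K)
    (hc : ∀ ε > 0, ∃ N, ∀ m ≥ N, ∀ n ≥ N, HolderBound a k (fun t => u m t - u n t) ε) :
    ∃ v : ℝ → F, ∀ ε > 0, ∃ N, ∀ n ≥ N, HolderBound a k (fun t => u n t - v t) ε := by
  have hlim : ∀ t, ∃ y, Filter.Tendsto (fun n => u n t) Filter.atTop (nhds y) := by
    intro t
    refine cauchySeq_tendsto_of_complete (Metric.cauchySeq_iff.2 fun ε hε => ?_)
    obtain ⟨N, hN⟩ := hc (ε / 2) (by positivity)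
    refine ⟨N, fun m hm n hn => ?_⟩
    rw [dist_eq_norm]
    have := (hN m hm n hn).bound t
    linarith
  choose v hv using hlim
  have hbd : ∀ ε > 0, ∃ N, ∀ n ≥ N, ∀ t, ‖u n t - v t‖ ≤ ε := fun ε hε => by
    obtain ⟨N, hN⟩ := hc ε hε
    exact ⟨N, fun n hn t => le_of_tendsto ((hv t).const_sub (u n t)).norm
      (Filter.eventually_atTop.2 ⟨N, fun m hm => (hN n hn m hm).bound t⟩)⟩
  refine ⟨v, ?_⟩
  induction k generalizing u v with
  | zero =>
    intro ε hε
    obtain ⟨N, hN⟩ := hc ε hε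
    refine ⟨N, fun n hn => HolderBound.of_tendsto (u := fun m t => u n t - u (m + N) t)
      (fun m => hN n hn (m + N) (by omega)) fun t => ?_⟩
    exact ((hv t).comp (Filter.tendsto_add_atTop_nat N)).const_sub _
  | succ k ih =>
    choose K hK using hu
    choose u' h1 h2 using fun n => (hK n).2
    have hc' : ∀ ε > 0, ∃ N, ∀ m ≥ N, ∀ n ≥ N, HolderBound a k (fun t => u' m t - u' n t) ε := by
      intro ε hε
      obtain ⟨N, hN⟩ := hc ε hε
      refine ⟨N, fun m hm n hn => ?_⟩
      obtain ⟨-, w, hw, hw'⟩ := hN m hm n hn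
      refine hw'.congr fun t => ?_
      exact (hw t).unique ((h1 m t).sub (h1 n t))
    have hlim' : ∀ t, ∃ y, Filter.Tendsto (fun n => u' n t) Filter.atTop (nhds y) := by
      intro t
      refine cauchySeq_tendsto_of_complete (Metric.cauchySeq_iff.2 fun ε hε => ?_)
      obtain ⟨N, hN⟩ := hc' (ε / 2) (by positivity)
      refine ⟨N, fun m hm n hn => ?_⟩
      rw [dist_eq_norm]
      have := (hN m hm n hn).bound t
      linarith
    choose v' hv' using hlim'
    have hbd' : ∀ ε > 0, ∃ N, ∀ n ≥ N, ∀ t, ‖u' n t - v' t‖ ≤ ε := fun ε hε => by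
      obtain ⟨N, hN⟩ := hc' ε hε
      exact ⟨N, fun n hn t => le_of_tendsto ((hv' t).const_sub (u' n t)).norm
        (Filter.eventually_atTop.2 ⟨N, fun m hm => (hN n hn m hm).bound t⟩)⟩
    have hd : ∀ t, HasDerivAt v (v' t) t := by
      refine hasDerivAt_of_tendstoUniformly (f := u) (f' := u') (l := Filter.atTop) ?_
        (Filter.Eventually.of_forall fun n t => h1 n t) hv
      rw [Metric.tendstoUniformly_iff]
      intro ε hε
      obtain ⟨N, hN⟩ := hbd' (ε / 2) (by positivity)
      filter_upwards [Filter.eventually_ge_atTop N] with n hn t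
      rw [dist_comm, dist_eq_norm]
      linarith [hN n hn t]
    intro ε hε
    obtain ⟨N₁, hN₁⟩ := hbd ε hε
    obtain ⟨N₂, hN₂⟩ := ih u' (fun n => ⟨_, h2 n⟩) hc' v' hv' hbd' ε hε
    exact ⟨max N₁ N₂, fun n hn => ⟨hN₁ n (le_of_max_le_left hn), _,
      fun t => (h1 n t).sub (hd t), hN₂ n (le_of_max_le_right hn)⟩⟩

end HolderBound

end StatDisc



namespace StatDisc

/-! ### The Hölder spaces on the circle in terms of Hölder bounds -/

section

variable {k : ℕ} {α : ℝ≥0} {F : Type} [NormedAddCommGroup F] [NormedSpace ℝ F]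

omit [NormedSpace ℝ F] in
theorem holderWith_of_norm_sub_le {u : ℝ → F} {K : ℝ≥0}
    (h : ∀ s t, ‖u s - u t‖ ≤ K * |s - t| ^ (α : ℝ)) : HolderWith K α u := by
  intro s t
  rw [edist_dist, edist_dist, ENNReal.ofReal_rpow_of_nonneg (dist_nonneg (x := s) (y := t)) α.coe_nonneg,
    ← ENNReal.ofReal_coe_nnreal, ← ENNReal.ofReal_mul K.coe_nonneg]
  refine ENNReal.ofReal_le_ofReal ?_
  rw [dist_eq_norm, Real.dist_eq]
  exact h s t

theorem HolderBound.continuous (hα0 : 0 < α) {u : ℝ → F} {K : ℝ}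
    (h : HolderBound α k u K) : Continuous u := by
  have hK := h.nonneg
  cases k with
  | zero =>
    lift K to ℝ≥0 using hK
    exact (holderWith_of_norm_sub_le h.2).continuous hα0
  | succ k => exact continuous_iff_continuousAt.2 fun t => (h.2.choose_spec.1 t).continuousAt

/-- The bridge between the recursive bounds, suited to induction on k, and the iterated derivatives
that define the norm of `CReal`. -/
theorem holderBound_iff (hα0 : 0 < α) {u : ℝ → F} {K : ℝ} : HolderBound α k u K ↔
    ContDiff ℝ k u ∧ (∀ j ≤ k, ∀ t, ‖iteratedDeriv j u t‖ ≤ K) ∧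
      ∀ s t, ‖iteratedDeriv k u s - iteratedDeriv k u t‖ ≤ K * |s - t| ^ (α : ℝ) := by
  induction k generalizing u with
  | zero =>
    simp only [Nat.le_zero, iteratedDeriv_zero, forall_eq]
    exact ⟨fun h => ⟨contDiff_zero.2 (HolderBound.continuous hα0 h : Continuous u), h⟩, fun h => h.2⟩
  | succ k ih =>
    constructor
    · rintro ⟨h1, u', h2, h3⟩
      have e : deriv u = u' := funext fun t => (h2 t).deriv
      obtain ⟨i1, i2, i3⟩ := ih.1 h3
      refine ⟨?_, fun j hj t => ?_, fun s t => ?_⟩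
      · push_cast
        rw [contDiff_succ_iff_deriv]
        exact ⟨fun t => (h2 t).differentiableAt, by simp, e ▸ i1⟩
      · cases j with
        | zero => simpa using h1 t
        | succ j =>
          rw [iteratedDeriv_succ', e]
          exact i2 j (by omega) t
      · rw [iteratedDeriv_succ', e]
        exact i3 s t
    · rintro ⟨h1, h2, h3⟩
      refine ⟨fun t => by simpa using h2 0 (Nat.zero_le _) t, deriv u, fun t =>
        (h1.differentiable (by norm_cast)).differentiableAt.hasDerivAt, ?_⟩
      push_cast at h1
      rw [contDiff_succ_iff_deriv] at h1
      refine ih.2 ⟨h1.2.2, fun j hj t => ?_, fun s t => ?_⟩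
      · rw [← iteratedDeriv_succ']
        exact h2 (j + 1) (by omega) t
      · rw [← iteratedDeriv_succ']
        exact h3 s t

theorem CReal.holderBound (hα0 : 0 < α) (f : CReal k α) : HolderBound α k (lift f.1) ‖f‖ := by
  have h0 : ∀ j ∈ Finset.range (k + 1), 0 ≤ ⨆ t, |f.D j t| :=
    fun j _ => Real.iSup_nonneg fun t => abs_nonneg _
  rw [holderBound_iff hα0, CReal.norm_def]
  refine ⟨f.2.1, fun j hj t => ?_, fun s t => ?_⟩
  · have h1 : |f.D j t| ≤ ⨆ t, |f.D j t| := le_ciSup (f.bddAbove hj) t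
    have h2 := Finset.single_le_sum h0 (Finset.mem_range_succ_iff.2 hj)
    have h3 : (0 : ℝ) ≤ nnHolderNorm α (f.D k) := NNReal.coe_nonneg _
    exact h1.trans (by linarith)
  · have h1 := (MemHolder.holderWith f.2.2).dist_le s t
    rw [dist_eq_norm, Real.dist_eq] at h1
    refine h1.trans (mul_le_mul_of_nonneg_right ?_ (by positivity))
    exact le_add_of_nonneg_left (Finset.sum_nonneg h0)

theorem mem_holderSubmodule_of_bound (hα0 : 0 < α) {f : Circle → ℝ} {K : ℝ}
    (h : HolderBound α k (lift f) K) : f ∈ holderSubmodule k α := by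
  have hK := h.nonneg
  lift K to ℝ≥0 using hK
  rw [holderBound_iff hα0] at h
  exact ⟨h.1, K, holderWith_of_norm_sub_le h.2.2⟩

/-- The norm is a sum of k + 1 suprema and one Hölder seminorm, each at most K. -/
theorem CReal.norm_le_of_bound (hα0 : 0 < α) (f : CReal k α) {K : ℝ}
    (h : HolderBound α k (lift f.1) K) : ‖f‖ ≤ (k + 2) * K := by
  have hK := h.nonneg
  lift K to ℝ≥0 using hK
  rw [holderBound_iff hα0] at h
  rw [CReal.norm_def]
  have h1 : ∑ j ∈ Finset.range (k + 1), (⨆ t, |f.D j t|) ≤ ∑ j ∈ Finset.range (k + 1), (K : ℝ) :=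
    Finset.sum_le_sum fun j hj => ciSup_le fun t => h.2.1 j (Finset.mem_range_succ_iff.1 hj) t
  have h2 : nnHolderNorm α (f.D k) ≤ K := (holderWith_of_norm_sub_le h.2.2).nnholderNorm_le
  have h3 : (nnHolderNorm α (f.D k) : ℝ) ≤ K := h2
  simp only [Finset.sum_const, Finset.card_range, nsmul_eq_mul] at h1
  push_cast at h1
  linarith

/-! ### The complete algebra of complex Hölder functions -/

namespace CComplex

instance : FunLike (CComplex k α) Circle ℂ where
  coe f := f.1
  coe_injective := Subtype.val_injective

theorem val_apply (f : CComplex k α) (ζ : Circle) : f.1 ζ = f ζ := rfl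

@[simp] theorem add_apply (f g : CComplex k α) (ζ : Circle) : (f + g) ζ = f ζ + g ζ := rfl
@[simp] theorem sub_apply (f g : CComplex k α) (ζ : Circle) : (f - g) ζ = f ζ - g ζ := by
  show (f - g).1 ζ = f.1 ζ - g.1 ζ
  exact congrFun (AddSubgroupClass.coe_sub (S := Submodule ℝ (Circle → ℂ))
    (H := cHolderSubmodule k α) f g) ζ
@[simp] theorem neg_apply (f : CComplex k α) (ζ : Circle) : (-f) ζ = -f ζ :=
  congrFun (NegMemClass.coe_neg (S := Submodule ℝ (Circle → ℂ)) (H := cHolderSubmodule k α) f) ζ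
@[simp] theorem zero_apply (ζ : Circle) : (0 : CComplex k α) ζ = 0 := rfl
@[simp] theorem smul_apply (c : ℝ) (f : CComplex k α) (ζ : Circle) : (c • f) ζ = c * f ζ := rfl

theorem holderBound (hα0 : 0 < α) (f : CComplex k α) : HolderBound α k (lift f) ‖f‖ := by
  have h1 := (f.re.holderBound hα0).clm Complex.ofRealCLM
  have h2 := ((f.im.holderBound hα0).clm Complex.ofRealCLM).clm
    (ContinuousLinearMap.mul ℝ ℂ Complex.I)
  have h3 : ‖ContinuousLinearMap.mul ℝ ℂ Complex.I‖ ≤ 1 := by simp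
  have h4 : ‖Complex.ofRealCLM‖ = 1 := Complex.ofRealCLM_norm
  refine ((h1.add h2).mono ?_).congr fun t => ?_
  · rw [norm_def, h4, one_mul, one_mul]
    have := mul_le_mul_of_nonneg_right h3 (norm_nonneg f.im)
    linarith
  · show ((f (Circle.exp t)).re : ℂ) + Complex.I * ((f (Circle.exp t)).im : ℂ) = _
    rw [mul_comm]
    exact Complex.re_add_im _

theorem re_bound {f : Circle → ℂ} {K : ℝ} (h : HolderBound α k (lift f) K) :
    HolderBound α k (lift fun ζ => (f ζ).re) K := by
  have : HolderBound α k (fun t => (lift f t).re) K := by simpa using h.clm Complex.reCLM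
  exact this

theorem im_bound {f : Circle → ℂ} {K : ℝ} (h : HolderBound α k (lift f) K) :
    HolderBound α k (lift fun ζ => (f ζ).im) K := by
  have : HolderBound α k (fun t => (lift f t).im) K := by simpa using h.clm Complex.imCLM
  exact this

/-- The element of `C_ℂ^{k,α}` given by a function with a Hölder bound. -/
def ofBound (hα0 : 0 < α) (f : Circle → ℂ) (h : ∃ K, HolderBound α k (lift f) K) :
    CComplex k α :=
  ⟨f, mem_holderSubmodule_of_bound hα0 (re_bound h.choose_spec),
    mem_holderSubmodule_of_bound hα0 (im_bound h.choose_spec)⟩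

@[simp] theorem ofBound_apply (hα0 : 0 < α) (f : Circle → ℂ)
    (h : ∃ K, HolderBound α k (lift f) K) (ζ : Circle) : ofBound hα0 f h ζ = f ζ := rfl

theorem norm_le_of_bound (hα0 : 0 < α) (f : CComplex k α) {K : ℝ}
    (h : HolderBound α k (lift f) K) : ‖f‖ ≤ 2 * (k + 2) * K := by
  have h1 := CReal.norm_le_of_bound hα0 f.re (re_bound h)
  have h2 := CReal.norm_le_of_bound hα0 f.im (im_bound h)
  rw [norm_def]
  linarith

theorem norm_apply_le (hα0 : 0 < α) (f : CComplex k α) (ζ : Circle) : ‖f ζ‖ ≤ ‖f‖ := by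
  obtain ⟨t, rfl⟩ : ∃ t, Circle.exp t = ζ := ⟨Complex.arg ζ, Circle.exp_arg ζ⟩
  exact (f.holderBound hα0).bound t

theorem continuous_lift (hα0 : 0 < α) (f : CComplex k α) : Continuous (lift f) :=
  (f.holderBound hα0).continuous hα0

/-- Two elements of `C_ℂ^{k,α}` which agree off `1` are equal. -/
theorem ext_off_one (hα0 : 0 < α) {f g : CComplex k α} (h : ∀ ζ : Circle, ζ ≠ 1 → f ζ = g ζ) :
    f = g := by
  refine DFunLike.ext _ _ fun ζ => ?_
  by_cases hζ : ζ = 1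
  · subst hζ
    have h1 : Filter.Tendsto (lift f) (nhdsWithin 0 {0}ᶜ) (nhds (lift f 0)) :=
      (f.continuous_lift hα0).continuousAt.tendsto.mono_left nhdsWithin_le_nhds
    have h2 : Filter.Tendsto (lift g) (nhdsWithin 0 {0}ᶜ) (nhds (lift g 0)) :=
      (g.continuous_lift hα0).continuousAt.tendsto.mono_left nhdsWithin_le_nhds
    have h3 : lift f =ᶠ[nhdsWithin 0 {0}ᶜ] lift g := by
      have h4 : Set.Ioo (-Real.pi) Real.pi ∈ nhdsWithin (0 : ℝ) {0}ᶜ :=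
        mem_nhdsWithin_of_mem_nhds (Ioo_mem_nhds (by simpa using Real.pi_pos) Real.pi_pos)
      filter_upwards [h4, self_mem_nhdsWithin] with t ht ht0
      refine h _ fun he => ht0 ?_
      have := Circle.arg_exp ht.1 ht.2.le
      rw [he] at this
      simpa using this.symm
    have := tendsto_nhds_unique (h1.congr' h3) h2
    simpa [lift] using this
  · exact h ζ hζ

/-- The evaluation functional. -/
noncomputable def evalCLM (hα0 : 0 < α) (ζ : Circle) : CComplex k α →L[ℝ] ℂ :=
  LinearMap.mkContinuous ⟨⟨fun f => f ζ, fun _ _ => rfl⟩, fun _ _ => rfl⟩ 1 fun f => by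
    rw [one_mul]
    exact f.norm_apply_le hα0 ζ

@[simp] theorem evalCLM_apply (hα0 : 0 < α) (ζ : Circle) (f : CComplex k α) :
    evalCLM hα0 ζ f = f ζ := rfl

variable [hα : Fact (0 < α ∧ α < 1)]

theorem mul_bound {f g : Circle → ℂ} {K L : ℝ}
    (hf : HolderBound α k (lift f) K) (hg : HolderBound α k (lift g) L) :
    HolderBound α k (lift fun ζ => f ζ * g ζ) (2 * 4 ^ k * K * L) := by
  have := HolderBound.bilin (by exact_mod_cast hα.out.1) (by exact_mod_cast hα.out.2.le)
    (ContinuousLinearMap.mul ℝ ℂ) hf hg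
  have h2 : HolderBound α k (fun t => lift f t * lift g t) (2 * 4 ^ k * K * L) := by
    simpa using this
  exact h2

noncomputable instance : Mul (CComplex k α) :=
  ⟨fun f g => ofBound hα.out.1 (fun ζ => f ζ * g ζ)
    ⟨_, mul_bound (f.holderBound hα.out.1) (g.holderBound hα.out.1)⟩⟩

@[simp] theorem mul_apply (f g : CComplex k α) (ζ : Circle) : (f * g) ζ = f ζ * g ζ := rfl

/-- Constants. -/
noncomputable def const (c : ℂ) : CComplex k α :=
  ofBound hα.out.1 (fun _ => c) ⟨_, HolderBound.const k c⟩

@[simp] theorem const_apply (c : ℂ) (ζ : Circle) : (const c : CComplex k α) ζ = c := rfl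

noncomputable instance : One (CComplex k α) := ⟨const 1⟩

@[simp] theorem one_apply (ζ : Circle) : (1 : CComplex k α) ζ = 1 := rfl

noncomputable instance : CommRing (CComplex k α) :=
  { (inferInstance : AddCommGroup (CComplex k α)) with
    mul := (· * ·)
    one := 1
    left_distrib := fun f g h => DFunLike.ext _ _ fun ζ => mul_add _ _ _
    right_distrib := fun f g h => DFunLike.ext _ _ fun ζ => add_mul _ _ _
    zero_mul := fun f => DFunLike.ext _ _ fun ζ => zero_mul _
    mul_zero := fun f => DFunLike.ext _ _ fun ζ => mul_zero _
    mul_assoc := fun f g h => DFunLike.ext _ _ fun ζ => mul_assoc _ _ _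
    one_mul := fun f => DFunLike.ext _ _ fun ζ => one_mul _
    mul_one := fun f => DFunLike.ext _ _ fun ζ => mul_one _
    mul_comm := fun f g => DFunLike.ext _ _ fun ζ => mul_comm _ _ }

@[simp] theorem pow_apply (f : CComplex k α) (n : ℕ) (ζ : Circle) : (f ^ n) ζ = f ζ ^ n := by
  induction n with
  | zero => simp
  | succ n ih => rw [pow_succ, pow_succ, mul_apply, ih]

/-- Multiplication as a bilinear map. -/
noncomputable def mulCLM : CComplex k α →L[ℝ] CComplex k α →L[ℝ] CComplex k α :=
  LinearMap.mkContinuous₂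
    (LinearMap.mk₂ ℝ (fun f g => f * g) (fun _ _ _ => add_mul _ _ _)
      (fun c f g => DFunLike.ext _ _ fun ζ => by simp [mul_assoc]) (fun _ _ _ => mul_add _ _ _)
      (fun c f g => DFunLike.ext _ _ fun ζ => by simp [mul_left_comm]))
    (2 * (k + 2) * (2 * 4 ^ k)) fun f g => by
      refine (norm_le_of_bound hα.out.1 (f * g)
        (mul_bound (f.holderBound hα.out.1) (g.holderBound hα.out.1))).trans (le_of_eq ?_)
      ring

@[simp] theorem mulCLM_apply (f g : CComplex k α) : mulCLM f g = f * g := rfl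

/-- Complex conjugation. -/
noncomputable def conj : CComplex k α →L[ℝ] CComplex k α :=
  LinearMap.mkContinuous
    ⟨⟨fun f => ofBound hα.out.1 (fun ζ => starRingEnd ℂ (f ζ))
        ⟨_, (f.holderBound hα.out.1).clm Complex.conjCLE.toContinuousLinearMap⟩,
      fun f g => DFunLike.ext _ _ fun ζ => map_add (starRingEnd ℂ) (f ζ) (g ζ)⟩,
      fun c f => DFunLike.ext _ _ fun ζ => by simp⟩
    (2 * (k + 2) * ‖Complex.conjCLE.toContinuousLinearMap‖) fun f => by
      rw [mul_assoc]
      exact norm_le_of_bound hα.out.1 _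
        ((f.holderBound hα.out.1).clm Complex.conjCLE.toContinuousLinearMap)

@[simp] theorem conj_apply (f : CComplex k α) (ζ : Circle) :
    conj f ζ = starRingEnd ℂ (f ζ) := rfl

/-- In the angular variable the derivative of ζⁿ is inζⁿ, a multiple of the function itself, so
bounds of every order follow by induction. -/
theorem zpow_bound {a : ℝ} (ha0 : 0 < a) (ha1 : a ≤ 1) (n : ℤ) (k : ℕ) :
    ∃ K, HolderBound a k (lift fun ζ => ((ζ ^ n : Circle) : ℂ)) K := by
  have hd : ∀ t, HasDerivAt (lift fun ζ => ((ζ ^ n : Circle) : ℂ))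
      (n * Complex.I * lift (fun ζ => ((ζ ^ n : Circle) : ℂ)) t) t := by
    intro t
    have e : (lift fun ζ => ((ζ ^ n : Circle) : ℂ)) =
        fun t : ℝ => Complex.exp (n * Complex.I * t) := by
      ext t
      simp only [lift, Circle.coe_zpow, Circle.coe_exp]
      rw [← Complex.exp_int_mul]
      ring_nf
    rw [e]
    have h1 : HasDerivAt (fun t : ℝ => (n * Complex.I * t : ℂ)) (n * Complex.I) t := by
      simpa using (Complex.ofRealCLM.hasDerivAt (x := t)).const_mul (n * Complex.I : ℂ)
    simpa [mul_comm] using h1.cexp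
  have hb : ∀ t, ‖lift (fun ζ => ((ζ ^ n : Circle) : ℂ)) t‖ = 1 := fun t => by simp [lift]
  induction k with
  | zero =>
    refine ⟨_, HolderBound.of_hasDerivAt ha0 ha1 (K := 1 + ‖(n * Complex.I : ℂ)‖)
      (fun t => ?_) hd fun t => ?_⟩
    · rw [hb]; simp
    · rw [norm_mul, hb, mul_one]; simp
  | succ k ih =>
    obtain ⟨K, hK⟩ := ih
    refine ⟨1 + ‖ContinuousLinearMap.mul ℝ ℂ (n * Complex.I)‖ * K, fun t => ?_, _, hd, ?_⟩
    · rw [hb]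
      have := hK.nonneg
      have : 0 ≤ ‖ContinuousLinearMap.mul ℝ ℂ (n * Complex.I)‖ * K := by positivity
      linarith
    · exact (hK.clm (ContinuousLinearMap.mul ℝ ℂ (n * Complex.I))).mono (by linarith)

/-- The function `ζ ↦ ζ^n`. -/
noncomputable def zp (n : ℤ) : CComplex k α :=
  ofBound hα.out.1 (fun ζ => ((ζ ^ n : Circle) : ℂ))
    (zpow_bound (by exact_mod_cast hα.out.1) (by exact_mod_cast hα.out.2.le) n k)

@[simp] theorem zp_apply (n : ℤ) (ζ : Circle) : (zp n : CComplex k α) ζ = (ζ : ℂ) ^ n :=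
  Circle.coe_zpow ζ n

instance : CompleteSpace (CComplex k α) := by
  refine UniformSpace.complete_of_cauchySeq_tendsto fun u hu => ?_
  obtain ⟨v, hv⟩ := HolderBound.exists_limit (a := α) k (fun n => lift (u n))
    (fun n => ⟨_, (u n).holderBound hα.out.1⟩) (fun ε hε => by
      obtain ⟨N, hN⟩ := Metric.cauchySeq_iff.1 hu ε hε
      refine ⟨N, fun m hm n hn => ?_⟩
      have h1 := hN m hm n hn
      rw [dist_eq_norm] at h1
      exact (((u m - u n).holderBound hα.out.1).mono h1.le).congr fun t => by simp [lift])
  have hlim : ∀ t, Filter.Tendsto (fun n => lift (u n) t) Filter.atTop (nhds (v t)) := by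
    intro t
    refine Metric.tendsto_atTop.2 fun ε hε => ?_
    obtain ⟨N, hN⟩ := hv (ε / 2) (by positivity)
    exact ⟨N, fun n hn => by rw [dist_eq_norm]; linarith [(hN n hn).bound t]⟩
  -- The limit is found as a function on the line; as a limit of 2π-periodic functions it descends
  -- to the circle.
  have hper : ∀ t, lift (fun ζ : Circle => v (Complex.arg ζ)) t = v t := fun t => by
    refine tendsto_nhds_unique (hlim _) ((hlim t).congr fun n => ?_)
    show u n (Circle.exp t) = u n (Circle.exp (Complex.arg (Circle.exp t)))
    rw [Circle.exp_arg]
  obtain ⟨N, hN⟩ := hv 1 one_pos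
  have h1 := ((u N).holderBound hα.out.1).sub (hN N le_rfl)
  refine ⟨ofBound hα.out.1 (fun ζ : Circle => v (Complex.arg ζ))
    ⟨_, h1.congr fun t => by rw [hper]; simp⟩, ?_⟩
  refine Metric.tendsto_atTop.2 fun ε hε => ?_
  obtain ⟨N, hN⟩ := hv (ε / (2 * (2 * (k + 2)))) (by positivity)
  refine ⟨N, fun n hn => ?_⟩
  rw [dist_eq_norm]
  refine (norm_le_of_bound hα.out.1 _ ((hN n hn).congr fun t => ?_)).trans_lt
    (show 2 * ((k : ℝ) + 2) * (ε / (2 * (2 * (k + 2)))) < ε from ?_)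
  · rw [← hper t]; simp [lift]
  · have : 2 * ((k : ℝ) + 2) * (ε / (2 * (2 * (k + 2)))) = ε / 2 := by field_simp
    linarith

end CComplex

end

end StatDisc



namespace StatDisc

/-! ### Herglotz integrals of Hölder functions -/

section Herglotz

open Real Filter Topology

/-- The distance from e^{ix} to r is at least 1 - r, and its distance to 1 is 2|sin(x/2)| ≥ |x|/2 by
Jordan's inequality. The triangle inequality combines these; 8 is not sharp. -/
theorem norm_exp_sub_ge {r x : ℝ} (hr0 : 0 ≤ r) (hr1 : r < 1) (hx : |x| ≤ π) :
    (1 - r + |x|) / 8 ≤ ‖circleMap 0 1 x - r‖ := by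
  have h1 : 1 - r ≤ ‖circleMap 0 1 x - r‖ := by
    have := norm_sub_norm_le (circleMap 0 1 x) (r : ℂ)
    rw [norm_circleMap_zero, Complex.norm_real, norm_eq_abs, abs_of_nonneg hr0, abs_one] at this
    exact this
  have h2 : |x| / 2 ≤ ‖circleMap 0 1 x - 1‖ := by
    have e : circleMap 0 1 x - 1 = Complex.exp (Complex.I * x) - 1 := by
      simp [circleMap, mul_comm]
    rw [e, Complex.norm_exp_I_mul_ofReal_sub_one, norm_mul, norm_two, norm_eq_abs]
    have h3 := mul_abs_le_abs_sin (x := x / 2) (by rw [abs_div, abs_two]; linarith)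
    rw [abs_div, abs_two] at h3
    have h4 : |x| / 4 ≤ 2 / π * (|x| / 2) := by
      rw [div_mul_div_comm, div_le_div_iff₀ (by norm_num) (by positivity)]
      nlinarith [pi_le_four, abs_nonneg x]
    linarith
  have h3 : ‖circleMap 0 1 x - 1‖ ≤ ‖circleMap 0 1 x - r‖ + (1 - r) := by
    have e : circleMap 0 1 x - 1 = (circleMap 0 1 x - r) + ((r - 1 : ℝ) : ℂ) := by push_cast; ring
    rw [e]
    refine (norm_add_le _ _).trans ?_
    rw [Complex.norm_real, norm_eq_abs, abs_of_neg (by linarith)]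
    linarith
  linarith

theorem integral_add_rpow_le {b c a : ℝ} (hb : 0 < b) (hc : 0 ≤ c) (ha : a < 1) :
    ∫ x in b..(b + c), x ^ (a - 2) ≤ b ^ (a - 1) / (1 - a) := by
  have h0 : (0 : ℝ) ∉ Set.uIcc b (b + c) := by
    rw [Set.uIcc_of_le (by linarith)]
    exact fun h => absurd h.1 (by linarith)
  rw [integral_rpow (Or.inr ⟨by linarith, h0⟩), show a - 2 + 1 = -(1 - a) by ring,
    div_neg, ← neg_div, show a - 1 = -(1 - a) by ring]
  refine div_le_div_of_nonneg_right ?_ (by linarith)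
  have : 0 ≤ (b + c) ^ (-(1 - a)) := by positivity
  linarith

/-- The common core of the kernel estimates: an integrand peaked at angle s with width b, where b
will be 1 - r. Its majorant is integrated explicitly on both sides of the peak. -/
theorem norm_circleAverage_le {g : ℂ → ℂ} {a b W s : ℝ} (hb : 0 < b) (ha : a < 1) (hW : 0 ≤ W)
    (h : ∀ x, |x| ≤ π → ‖g (circleMap 0 1 (s + x))‖ ≤ W * (b + |x|) ^ (a - 2)) :
    ‖circleAverage g 0 1‖ ≤ W / (1 - a) * b ^ (a - 1) := by
  -- The shift puts the peak at π, the middle of the interval of integration.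
  rw [circleAverage_eq_integral_add (s - π), norm_smul, norm_inv, norm_eq_abs, abs_of_pos two_pi_pos]
  have hcont : Continuous fun θ : ℝ => W * (b + |θ - π|) ^ (a - 2) :=
    continuous_const.mul (Continuous.rpow_const (by fun_prop) fun θ =>
      Or.inl (by positivity))
  have h1 : ‖∫ θ in (0 : ℝ)..2 * π, g (circleMap 0 1 (θ + (s - π)))‖ ≤
      ∫ θ in (0 : ℝ)..2 * π, W * (b + |θ - π|) ^ (a - 2) := by
    refine intervalIntegral.norm_integral_le_of_norm_le two_pi_pos.le
      (Filter.Eventually.of_forall fun θ hθ => ?_) (hcont.intervalIntegrable _ _)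
    have := h (θ - π) (abs_le.2 ⟨by linarith [hθ.1], by linarith [hθ.2]⟩)
    rwa [show s + (θ - π) = θ + (s - π) by ring] at this
  have h2 : ∫ θ in (0 : ℝ)..π, W * (b + |θ - π|) ^ (a - 2) = W * ∫ x in b..(b + π), x ^ (a - 2) := by
    rw [intervalIntegral.integral_const_mul]
    congr 1
    have := intervalIntegral.integral_comp_sub_left (fun x => x ^ (a - 2)) (b + π)
      (a := 0) (b := π)
    simp only [add_sub_cancel_right, sub_zero] at this
    rw [← this]
    refine intervalIntegral.integral_congr fun θ hθ => ?_
    rw [Set.uIcc_of_le pi_pos.le] at hθ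
    rw [abs_of_nonpos (by linarith [hθ.2])]
    ring_nf
  have h3 : ∫ θ in π..2 * π, W * (b + |θ - π|) ^ (a - 2) = W * ∫ x in b..(b + π), x ^ (a - 2) := by
    rw [intervalIntegral.integral_const_mul]
    congr 1
    have := intervalIntegral.integral_comp_add_right (fun x => x ^ (a - 2)) (b - π)
      (a := π) (b := 2 * π)
    rw [show π + (b - π) = b by ring, show 2 * π + (b - π) = b + π by ring] at this
    rw [← this]
    refine intervalIntegral.integral_congr fun θ hθ => ?_
    rw [Set.uIcc_of_le (by linarith [pi_pos])] at hθ
    rw [abs_of_nonneg (by linarith [hθ.1])]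
    ring_nf
  rw [← intervalIntegral.integral_add_adjacent_intervals (hcont.intervalIntegrable 0 π)
    (hcont.intervalIntegrable π (2 * π)), h2, h3] at h1
  have h4 := mul_le_mul_of_nonneg_left (integral_add_rpow_le hb pi_pos.le ha) hW
  calc (2 * π)⁻¹ * _ ≤ (2 * π)⁻¹ * (2 * (W * (b ^ (a - 1) / (1 - a)))) := by
        gcongr
        linarith
    _ = π⁻¹ * (W / (1 - a) * b ^ (a - 1)) := by field_simp
    _ ≤ 1 * (W / (1 - a) * b ^ (a - 1)) := by
        have h5 : 0 ≤ W / (1 - a) * b ^ (a - 1) :=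
          mul_nonneg (div_nonneg hW (by linarith)) (by positivity)
        gcongr
        exact inv_le_one_of_one_le₀ (by linarith [pi_gt_three])
    _ = _ := one_mul _

/-- The extension of a function on the circle to the plane which is constant on rays. -/
noncomputable def radialExt (χ : Circle → ℂ) (τ : ℂ) : ℂ := χ (Circle.exp (Complex.arg τ))

theorem circleMap_eq_exp (t : ℝ) : circleMap 0 1 t = Circle.exp t := by
  simp [circleMap, Circle.coe_exp]

theorem radialExt_circleMap (χ : Circle → ℂ) (t : ℝ) :
    radialExt χ (circleMap 0 1 t) = lift χ t := by
  rw [radialExt, circleMap_eq_exp, Circle.exp_arg, lift]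

/-- The Herglotz integral. -/
noncomputable def herglotz (χ : Circle → ℂ) (z : ℂ) : ℂ :=
  circleAverage (fun τ => herglotzRieszKernel 0 z τ • radialExt χ τ) 0 1

/-- The derivative of the Herglotz integral. -/
noncomputable def herglotzDeriv (χ : Circle → ℂ) (z : ℂ) : ℂ :=
  circleAverage (fun τ => (2 * τ / (τ - z) ^ 2) • radialExt χ τ) 0 1

theorem circleIntegrable_radialExt {χ : Circle → ℂ} (h : Continuous (lift χ)) :
    CircleIntegrable (radialExt χ) 0 1 := by
  unfold CircleIntegrable
  simp only [radialExt_circleMap]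
  exact h.intervalIntegrable _ _

theorem hasDerivAt_herglotz {χ : Circle → ℂ} (h : Continuous (lift χ)) {z : ℂ}
    (hz : z ∈ Metric.ball (0 : ℂ) 1) : HasDerivAt (herglotz χ) (herglotzDeriv χ z) z :=
  hasDerivAt_circleAverage_herglotzRieszKernel_smul (circleIntegrable_radialExt h) hz

/-- The kernel equals 2τ/(τ - z) - 1, so Cauchy's formula gives 2c - c. -/
theorem herglotz_const (c : ℂ) {z : ℂ} (hz : z ∈ Metric.ball (0 : ℂ) 1) :
    herglotz (fun _ => c) z = c := by
  have h1 : DiffContOnCl ℂ (fun _ : ℂ => c) (Metric.ball 0 |1|) := diffContOnCl_const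
  have h2 := h1.circleAverage_smul_div (w := z) (by simpa using hz)
  have h0 : ∀ τ ∈ Metric.sphere (0 : ℂ) |1|, τ - z ≠ 0 := fun τ hτ h => by
    rw [sub_eq_zero] at h
    subst h
    simp at hτ hz
    linarith
  have hci : CircleIntegrable (fun τ : ℂ => ((τ - 0) / (τ - z)) • c) 0 1 := by
    refine ContinuousOn.circleIntegrable zero_le_one fun τ hτ => ?_
    have := h0 τ (by simpa using hτ)
    exact ContinuousAt.continuousWithinAt (by fun_prop (disch := assumption))
  have e : herglotz (fun _ => c) z = circleAverage (fun τ => (2 : ℂ) • (((τ - 0) / (τ - z)) • c) - c) 0 1 := by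
    refine circleAverage_congr_sphere fun τ hτ => ?_
    have := h0 τ hτ
    simp only [herglotzRieszKernel_def, radialExt, smul_eq_mul, sub_zero]
    field_simp
    ring
  rw [e, circleAverage_fun_sub (hci.const_fun_smul) (circleIntegrable_const _ _ _),
    circleAverage_fun_smul, h2, circleAverage_const]
  simp only [smul_eq_mul]
  ring

theorem herglotz_sub {χ ψ : Circle → ℂ} (hχ : Continuous (lift χ)) (hψ : Continuous (lift ψ))
    {z : ℂ} (hz : z ∈ Metric.ball (0 : ℂ) 1) :
    herglotz (fun ζ => χ ζ - ψ ζ) z = herglotz χ z - herglotz ψ z := by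
  have hk := continuousOn_herglotzRieszKernel_sphere hz
  unfold herglotz
  refine Eq.trans ?_ (circleAverage_fun_sub ((circleIntegrable_radialExt hχ).continuousOn_smul hk)
    ((circleIntegrable_radialExt hψ).continuousOn_smul hk))
  congr 1
  ext τ
  simp only [radialExt, smul_eq_mul]
  ring

variable {α : ℝ≥0} {χ : Circle → ℂ} {K : ℝ}

theorem mul_circleMap_mem_ball {r : ℝ} (hr0 : 0 ≤ r) (hr1 : r < 1) (s : ℝ) :
    r * circleMap 0 1 s ∈ Metric.ball (0 : ℂ) 1 := by
  simpa [abs_of_nonneg hr0] using hr1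

theorem norm_circleMap_sub_ge {r x s : ℝ} (hr0 : 0 ≤ r) (hr1 : r < 1) (hx : |x| ≤ π) :
    (1 - r + |x|) / 8 ≤ ‖circleMap 0 1 (s + x) - r * circleMap 0 1 s‖ := by
  have e : circleMap 0 1 (s + x) - r * circleMap 0 1 s =
      circleMap 0 1 s * (circleMap 0 1 x - r) := by
    simp only [circleMap, Complex.ofReal_add, add_mul, Complex.exp_add]
    push_cast
    ring
  rw [e, norm_mul, norm_circleMap_zero, abs_one, one_mul]
  exact norm_exp_sub_ge hr0 hr1 hx

theorem holder_div_sq_le (h : HolderBound α 0 (lift χ) K) {r x s : ℝ}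
    (hr0 : 0 ≤ r) (hr1 : r < 1) (hx : |x| ≤ π) :
    ‖lift χ (s + x) - lift χ s‖ / ‖circleMap 0 1 (s + x) - r * circleMap 0 1 s‖ ^ 2 ≤
      64 * K * (1 - r + |x|) ^ ((α : ℝ) - 2) := by
  have hK := h.nonneg
  have hb : 0 < 1 - r + |x| := by have := abs_nonneg x; linarith
  have h1 := h.2 (s + x) s
  rw [add_sub_cancel_left] at h1
  have h2 := norm_circleMap_sub_ge (s := s) hr0 hr1 hx
  have h3 : |x| ^ (α : ℝ) ≤ (1 - r + |x|) ^ (α : ℝ) :=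
    rpow_le_rpow (abs_nonneg _) (by linarith) α.coe_nonneg
  rw [rpow_sub hb, rpow_two]
  calc _ ≤ (K * (1 - r + |x|) ^ (α : ℝ)) / ((1 - r + |x|) / 8) ^ 2 := by
        gcongr
        exact h1.trans (by gcongr)
    _ = _ := by field_simp; ring

/-- Subtracting the value of χ at the boundary point e^{is} changes the Herglotz integral by a
constant only. Afterwards the numerator is O(|x|^α), which compensates part of the double pole of
the kernel. -/
theorem norm_herglotzDeriv_le (hα0 : 0 < α) (hα1 : α < 1) (h : HolderBound α 0 (lift χ) K)
    {r s : ℝ} (hr0 : 0 ≤ r) (hr1 : r < 1) :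
    ‖herglotzDeriv χ (r * circleMap 0 1 s)‖ ≤ 128 * K / (1 - α) * (1 - r) ^ ((α : ℝ) - 1) := by
  have hz := mul_circleMap_mem_ball hr0 hr1 s
  have hc := h.continuous hα0
  have e : herglotzDeriv χ (r * circleMap 0 1 s) =
      herglotzDeriv (fun ζ => χ ζ - lift χ s) (r * circleMap 0 1 s) := by
    have h1 : HasDerivAt (herglotz fun ζ => χ ζ - lift χ s)
        (herglotzDeriv χ (r * circleMap 0 1 s)) (r * circleMap 0 1 s) := by
      refine ((hasDerivAt_herglotz hc hz).sub_const (lift χ s)).congr_of_eventuallyEq ?_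
      filter_upwards [Metric.isOpen_ball.mem_nhds hz] with w hw
      rw [herglotz_sub hc (ψ := fun _ => lift χ s) continuous_const hw, herglotz_const _ hw]
    exact h1.unique (hasDerivAt_herglotz (χ := fun ζ => χ ζ - lift χ s) (hc.sub continuous_const) hz)
  rw [e]
  refine norm_circleAverage_le (s := s) (by linarith) (by exact_mod_cast hα1)
    (by have := h.nonneg; positivity) fun x hx => ?_
  rw [radialExt_circleMap, norm_smul, norm_div, norm_mul, norm_circleMap_zero, norm_pow, abs_one,
    mul_one, Complex.norm_ofNat, div_mul_eq_mul_div, mul_div_assoc]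
  have := holder_div_sq_le (s := s) h hr0 hr1 hx
  simp only [lift] at this ⊢
  linarith

/-- For real data the real part of the Herglotz integral is the Poisson integral. The numerator 1 -
r² of the Poisson kernel contributes the extra factor 1 - r compared with the derivative estimate.
-/
theorem norm_re_herglotz_sub_le (hα0 : 0 < α) (hα1 : α < 1) (h : HolderBound α 0 (lift χ) K)
    (hre : ∀ ζ, (χ ζ).im = 0) {r s : ℝ} (hr0 : 0 ≤ r) (hr1 : r < 1) :
    |(herglotz χ (r * circleMap 0 1 s)).re - (lift χ s).re| ≤
      128 * K / (1 - α) * (1 - r) ^ (α : ℝ) := by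
  have hz := mul_circleMap_mem_ball hr0 hr1 s
  have hc := h.continuous hα0
  have hK := h.nonneg
  set z := r * circleMap 0 1 s
  have e : (herglotz χ z).re - (lift χ s).re =
      (herglotz (fun ζ => χ ζ - lift χ s) z).re := by
    rw [herglotz_sub hc (ψ := fun _ => lift χ s) continuous_const hz, herglotz_const _ hz,
      Complex.sub_re]
  have hci : CircleIntegrable (fun τ => herglotzRieszKernel 0 z τ •
      radialExt (fun ζ => χ ζ - lift χ s) τ) 0 1 :=
    (circleIntegrable_radialExt (χ := fun ζ => χ ζ - lift χ s)
      (hc.sub continuous_const)).continuousOn_smul (continuousOn_herglotzRieszKernel_sphere hz)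
  have e2 := Complex.ofRealCLM.comp Complex.reCLM |>.circleAverage_comp_comm hci
  have e3 : |(herglotz (fun ζ => χ ζ - lift χ s) z).re| =
      ‖circleAverage (⇑(Complex.ofRealCLM.comp Complex.reCLM) ∘ fun τ =>
        herglotzRieszKernel 0 z τ • radialExt (fun ζ => χ ζ - lift χ s) τ) 0 1‖ := by
    rw [e2]
    simp [herglotz]
  rw [e, e3]
  have h1 := norm_circleAverage_le (s := s) (b := 1 - r) (a := α) (W := 128 * K * (1 - r))
    (g := ⇑(Complex.ofRealCLM.comp Complex.reCLM) ∘ fun τ =>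
        herglotzRieszKernel 0 z τ • radialExt (fun ζ => χ ζ - lift χ s) τ) (by linarith)
    (by exact_mod_cast hα1) (mul_nonneg (by positivity) (by linarith)) fun x hx => by
      have hi : radialExt (fun ζ => χ ζ - lift χ s) (circleMap 0 1 (s + x)) =
          (((lift χ (s + x) - lift χ s).re : ℝ) : ℂ) := by
        rw [radialExt_circleMap]
        apply Complex.ext <;> simp [lift, hre]
      have hp := poissonKernel_eq_re_herglotzRieszKernel (c := 0) (w := z)
      have hp' := congrFun hp (circleMap 0 1 (s + x))
      simp only [Function.comp_apply, ContinuousLinearMap.comp_apply, hi, smul_eq_mul,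
        Complex.reCLM_apply, Complex.ofRealCLM_apply, Complex.norm_real, Complex.re_mul_ofReal]
        at hp' ⊢
      rw [← hp', poissonKernel_def, norm_mul, norm_eq_abs, norm_eq_abs]
      have h2 := holder_div_sq_le (s := s) h hr0 hr1 hx
      have h3 : ‖z‖ = r := by simp [z, abs_of_nonneg hr0]
      simp only [sub_zero, norm_circleMap_zero, abs_one, h3]
      rw [abs_div, abs_of_nonneg (by nlinarith : (0 : ℝ) ≤ 1 ^ 2 - r ^ 2), abs_pow, abs_norm]
      have h4 : |(lift χ (s + x) - lift χ s).re| ≤ ‖lift χ (s + x) - lift χ s‖ :=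
        Complex.abs_re_le_norm _
      calc (1 ^ 2 - r ^ 2) / ‖circleMap 0 1 (s + x) - z‖ ^ 2 * |(lift χ (s + x) - lift χ s).re|
          ≤ (1 ^ 2 - r ^ 2) / ‖circleMap 0 1 (s + x) - z‖ ^ 2 * ‖lift χ (s + x) - lift χ s‖ := by
            refine mul_le_mul_of_nonneg_left h4 (div_nonneg (by nlinarith) (by positivity))
        _ = (1 - r ^ 2) * (‖lift χ (s + x) - lift χ s‖ / ‖circleMap 0 1 (s + x) - z‖ ^ 2) := by
            ring
        _ ≤ (2 * (1 - r)) * (64 * K * (1 - r + |x|) ^ ((α : ℝ) - 2)) := by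
            refine mul_le_mul (by nlinarith) h2 (by positivity) (by linarith)
        _ = _ := by ring
  refine h1.trans (le_of_eq ?_)
  rw [rpow_sub_one (by linarith)]
  have : (1 - r) ≠ 0 := by linarith
  field_simp

/-- Along a radius the derivative is O((1 - x)^{α-1}), which is integrable up to x = 1 and
integrates to the power α of 1 - r. -/
theorem norm_herglotz_radial_le (hα0 : 0 < α) (hα1 : α < 1) (h : HolderBound α 0 (lift χ) K)
    {r r' s : ℝ} (hr0 : 0 ≤ r) (hrr : r ≤ r') (hr1 : r' < 1) :
    ‖herglotz χ (r' * circleMap 0 1 s) - herglotz χ (r * circleMap 0 1 s)‖ ≤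
      128 * K / (1 - α) / α * (1 - r) ^ (α : ℝ) := by
  have hc := h.continuous hα0
  have hK := h.nonneg
  have hα' : (α : ℝ) < 1 := by exact_mod_cast hα1
  have hα0' : (0 : ℝ) < α := by exact_mod_cast hα0
  set M : ℝ := 128 * K / (1 - α)
  have hM : 0 ≤ M := div_nonneg (by positivity) (by linarith)
  have hd : ∀ x ∈ Set.Icc r r', HasDerivAt (fun x : ℝ => herglotz χ (x * circleMap 0 1 s) -
      herglotz χ (r * circleMap 0 1 s))
      (herglotzDeriv χ (x * circleMap 0 1 s) * circleMap 0 1 s) x := by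
    intro x hx
    have h1 := hasDerivAt_herglotz hc (mul_circleMap_mem_ball (hr0.trans hx.1)
      (hx.2.trans_lt hr1) s)
    have h2 : HasDerivAt (fun x : ℝ => (x * circleMap 0 1 s : ℂ)) (circleMap 0 1 s) x := by
      simpa using (Complex.ofRealCLM.hasDerivAt (x := x)).mul_const (circleMap 0 1 s)
    exact (h1.comp x h2).sub_const _
  have hB : ∀ x ∈ Set.Icc r r', HasDerivAt (fun x : ℝ => M / α * ((1 - r) ^ (α : ℝ) -
      (1 - x) ^ (α : ℝ))) (M * (1 - x) ^ ((α : ℝ) - 1)) x := by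
    intro x hx
    have h1 : 1 - x ≠ 0 := by linarith [hx.2]
    have h2 := (((hasDerivAt_id x).const_sub 1).rpow_const (p := (α : ℝ)) (Or.inl h1)).const_sub
      ((1 - r) ^ (α : ℝ))
    refine (h2.const_mul (M / α)).congr_deriv ?_
    field_simp
    simp
  have := image_norm_le_of_norm_deriv_right_le_deriv_boundary'
    (fun x hx => (hd x hx).continuousAt.continuousWithinAt)
    (fun x hx => (hd x (Set.Ico_subset_Icc_self hx)).hasDerivWithinAt)
    (B := fun x : ℝ => M / α * ((1 - r) ^ (α : ℝ) - (1 - x) ^ (α : ℝ)))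
    (by simp)
    (fun x hx => (hB x hx).continuousAt.continuousWithinAt)
    (fun x hx => (hB x (Set.Ico_subset_Icc_self hx)).hasDerivWithinAt)
    (fun x hx => by
      rw [norm_mul, norm_circleMap_zero, abs_one, mul_one]
      exact norm_herglotzDeriv_le hα0 hα1 h (hr0.trans hx.1) (hx.2.trans hr1))
    (Set.right_mem_Icc.2 hrr)
  refine this.trans (mul_le_mul_of_nonneg_left ?_ (by positivity))
  have : 0 ≤ (1 - r') ^ (α : ℝ) := rpow_nonneg (by linarith) _
  linarith

theorem norm_herglotz_tangential_le (hα0 : 0 < α) (hα1 : α < 1) (h : HolderBound α 0 (lift χ) K)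
    {r s t : ℝ} (hr0 : 0 ≤ r) (hr1 : r < 1) :
    ‖herglotz χ (r * circleMap 0 1 s) - herglotz χ (r * circleMap 0 1 t)‖ ≤
      128 * K / (1 - α) * (1 - r) ^ ((α : ℝ) - 1) * |s - t| := by
  have hd : ∀ x ∈ Set.univ, HasDerivWithinAt (fun x : ℝ => herglotz χ (r * circleMap 0 1 x))
      (herglotzDeriv χ (r * circleMap 0 1 x) * (r * (circleMap 0 1 x * Complex.I)))
      Set.univ x := fun x _ =>
    ((hasDerivAt_herglotz (h.continuous hα0) (mul_circleMap_mem_ball hr0 hr1 x)).comp_of_eq x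
      ((hasDerivAt_circleMap 0 1 x).const_mul (r : ℂ)) rfl).hasDerivWithinAt
  have := convex_univ.norm_image_sub_le_of_norm_hasDerivWithin_le hd
    (C := 128 * K / (1 - α) * (1 - r) ^ ((α : ℝ) - 1)) (fun x _ => ?_)
    (Set.mem_univ t) (Set.mem_univ s)
  · simpa using this
  · have h1 := norm_herglotzDeriv_le (s := x) hα0 hα1 h hr0 hr1
    have h2 : ‖(r : ℂ) * (circleMap 0 1 x * Complex.I)‖ ≤ 1 := by
      simpa [abs_of_nonneg hr0] using hr1.le
    rw [norm_mul]
    have := mul_le_mul h1 h2 (norm_nonneg _) ((norm_nonneg _).trans h1)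
    simpa using this

/-- A sequence of radii increasing to one. -/
noncomputable def radius (n : ℕ) : ℝ := 1 - 1 / ((n : ℝ) + 1)

theorem radius_nonneg (n : ℕ) : 0 ≤ radius n := by
  have : (1 : ℝ) / ((n : ℝ) + 1) ≤ 1 := by
    rw [div_le_one (by positivity)]
    linarith [n.cast_nonneg (α := ℝ)]
  unfold radius
  linarith

theorem radius_lt_one (n : ℕ) : radius n < 1 := by
  have : 0 < (1 : ℝ) / ((n : ℝ) + 1) := by positivity
  unfold radius
  linarith

theorem tendsto_radius : Tendsto radius atTop (𝓝 1) := by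
  have := (tendsto_one_div_add_atTop_nhds_zero_nat (𝕜 := ℝ)).const_sub 1
  rw [sub_zero] at this
  exact this

theorem eventually_rpow_radius_lt (hα0 : 0 < α) (M : ℝ) {ε : ℝ} (hε : 0 < ε) :
    ∀ᶠ n in atTop, M * (1 - radius n) ^ (α : ℝ) < ε := by
  have h1 : Tendsto (fun n => M * (1 - radius n) ^ (α : ℝ)) atTop (𝓝 0) := by
    have h2 := ((tendsto_radius.const_sub 1).rpow_const (p := (α : ℝ))
      (Or.inr α.coe_nonneg)).const_mul M
    have h3 : (0 : ℝ) < α := by exact_mod_cast hα0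
    simpa [zero_rpow h3.ne'] using h2
  exact h1.eventually (gt_mem_nhds hε)

/-- The Hardy–Littlewood argument: the growth (1 - r)^{α-1} of the derivative gives uniformly
convergent radial limits, and these limits are α-Hölder. -/
theorem exists_boundary_value_zero (hα0 : 0 < α) (hα1 : α < 1)
    (h : HolderBound α 0 (lift χ) K) : ∃ (a : ℝ → ℂ) (L : ℝ), HolderBound α 0 a L ∧
      TendstoUniformly (fun n t => herglotz χ (radius n * circleMap 0 1 t)) a atTop := by
  have hK := h.nonneg
  have hα' : (α : ℝ) < 1 := by exact_mod_cast hα1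
  have hα0' : (0 : ℝ) < α := by exact_mod_cast hα0
  set M : ℝ := 128 * K / (1 - α)
  have hM : 0 ≤ M := div_nonneg (by positivity) (by linarith)
  have hMα : 0 ≤ M / α := by positivity
  have hlim : ∀ t, ∃ y, Tendsto (fun n => herglotz χ (radius n * circleMap 0 1 t)) atTop (𝓝 y) := by
    intro t
    refine cauchySeq_tendsto_of_complete (Metric.cauchySeq_iff'.2 fun ε hε => ?_)
    obtain ⟨N, hN⟩ := (eventually_rpow_radius_lt hα0 (M / α) hε).exists
    refine ⟨N, fun n hn => ?_⟩
    rw [dist_eq_norm]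
    refine (norm_herglotz_radial_le hα0 hα1 h (radius_nonneg N) ?_ (radius_lt_one n)).trans_lt hN
    unfold radius
    gcongr
  choose a ha using hlim
  have hrad : ∀ r t : ℝ, 0 ≤ r → r < 1 → ‖a t - herglotz χ (r * circleMap 0 1 t)‖ ≤
      M / α * (1 - r) ^ (α : ℝ) := by
    intro r t hr0 hr1
    refine le_of_tendsto ((ha t).sub_const _).norm ?_
    filter_upwards [tendsto_radius.eventually (lt_mem_nhds hr1)] with n hn
    exact norm_herglotz_radial_le hα0 hα1 h hr0 hn.le (radius_lt_one n)
  have hb : ∀ t, ‖a t‖ ≤ ‖herglotz χ 0‖ + M / α := fun t => by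
    have := hrad 0 t le_rfl one_pos
    simp only [Complex.ofReal_zero, zero_mul, sub_zero, one_rpow, mul_one] at this
    linarith [norm_sub_norm_le (a t) (herglotz χ 0)]
  set B := ‖herglotz χ 0‖ + M / α
  have hB : 0 ≤ B := by positivity
  refine ⟨a, 2 * B + 2 * (M / α) + M, ⟨fun t => (hb t).trans (by linarith), fun s t => ?_⟩, ?_⟩
  · rcases eq_or_ne s t with rfl | hst
    · simp only [sub_self, norm_zero, abs_zero, zero_rpow hα0'.ne', mul_zero, le_refl]
    have h0 : 0 < |s - t| := abs_pos.2 (sub_ne_zero.2 hst)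
    rcases le_or_gt |s - t| 1 with hle | hgt
    -- The two boundary points are joined by moving radially in to depth |s - t|, across at radius
    -- r, and radially out; each leg costs O(|s - t|^α).
    · set r := 1 - |s - t|
      have hr : 1 - r = |s - t| := by simp [r]
      have i1 := hrad r s (by simp only [r]; linarith) (by simp only [r]; linarith)
      have i2 := hrad r t (by simp only [r]; linarith) (by simp only [r]; linarith)
      have i3 := norm_herglotz_tangential_le (s := s) (t := t) (r := r) hα0 hα1 h
        (by simp only [r]; linarith) (by simp only [r]; linarith)
      rw [hr] at i1 i2 i3
      rw [mul_assoc, ← rpow_add_one h0.ne', sub_add_cancel] at i3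
      have e : a s - a t = (a s - herglotz χ (r * circleMap 0 1 s)) +
          (herglotz χ (r * circleMap 0 1 s) - herglotz χ (r * circleMap 0 1 t)) -
          (a t - herglotz χ (r * circleMap 0 1 t)) := by ring
      rw [e]
      have i4 := norm_sub_le_of_le (norm_add_le_of_le i1 i3) i2
      have : 0 ≤ B * |s - t| ^ (α : ℝ) := by positivity
      refine i4.trans ?_
      simp only [M] at *
      linarith
    · have i1 : 1 ≤ |s - t| ^ (α : ℝ) := one_le_rpow hgt.le hα0'.le
      have i2 := norm_sub_le_of_le (hb s) (hb t)
      have : (2 * B + 2 * (M / α) + M) * 1 ≤ (2 * B + 2 * (M / α) + M) * |s - t| ^ (α : ℝ) :=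
        mul_le_mul_of_nonneg_left i1 (by positivity)
      linarith
  · rw [Metric.tendstoUniformly_iff]
    intro ε hε
    filter_upwards [eventually_rpow_radius_lt hα0 (M / α) hε] with n hn t
    rw [dist_eq_norm]
    exact (hrad _ t (radius_nonneg n) (radius_lt_one n)).trans_lt hn

/-- Integration by parts over the circle, with no boundary term by periodicity. It says that the
Herglotz integral commutes with the angular derivative, which carries Privalov's theorem from k to k
+ 1. -/
theorem herglotz_deriv_eq {χ χ' : Circle → ℂ} (hc : Continuous (lift χ'))
    (hd : ∀ t, HasDerivAt (lift χ) (lift χ' t) t) {z : ℂ} (hz : z ∈ Metric.ball (0 : ℂ) 1) :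
    herglotz χ' z = Complex.I * z * herglotzDeriv χ z := by
  have hne : ∀ t, circleMap 0 1 t - z ≠ 0 := fun t => sub_ne_zero.2 (circleMap_ne_mem_ball hz t)
  have hw : ∀ t, HasDerivAt (fun t => (circleMap 0 1 t + z) / (circleMap 0 1 t - z))
      (-(2 * Complex.I * circleMap 0 1 t * z / (circleMap 0 1 t - z) ^ 2)) t := by
    intro t
    have h1 := hasDerivAt_circleMap 0 1 t
    refine ((h1.add_const z).div (h1.sub_const z) (hne t)).congr_deriv ?_
    have := hne t
    field_simp
    ring
  have hcw : Continuous fun t : ℝ => -(2 * Complex.I * circleMap 0 1 t * z /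
      (circleMap 0 1 t - z) ^ 2) := by
    have := fun t => pow_ne_zero 2 (hne t)
    fun_prop (disch := assumption)
  have key := intervalIntegral.integral_mul_deriv_eq_deriv_mul (a := 0) (b := 2 * π)
    (fun t _ => hw t) (fun t _ => hd t) (hcw.intervalIntegrable _ _) (hc.intervalIntegrable _ _)
  have hper : lift χ (2 * π) = lift χ 0 := by simp [lift]
  have hper' : circleMap 0 1 (2 * π) = circleMap 0 1 0 := by simp [circleMap]
  rw [hper, hper', sub_self, zero_sub] at key
  unfold herglotz herglotzDeriv
  rw [circleAverage_def, circleAverage_def, mul_smul_comm, ← intervalIntegral.integral_const_mul]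
  congr 1
  simp only [radialExt_circleMap, herglotzRieszKernel_def, sub_zero, smul_eq_mul]
  rw [key, ← intervalIntegral.integral_neg]
  refine intervalIntegral.integral_congr fun t _ => ?_
  ring

/-- Privalov's theorem: the Herglotz integral of a function of class `C^{k,α}` has boundary
values of class `C^{k,α}`. -/
theorem exists_boundary_value (hα0 : 0 < α) (hα1 : α < 1) (k : ℕ) : ∀ (χ : Circle → ℂ) (K : ℝ),
    HolderBound α k (lift χ) K → ∃ (a : ℝ → ℂ) (L : ℝ), HolderBound α k a L ∧
      TendstoUniformly (fun n t => herglotz χ (radius n * circleMap 0 1 t)) a atTop := by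
  induction k with
  | zero => exact fun χ K h => exists_boundary_value_zero hα0 hα1 h
  | succ k ih =>
    intro χ K h
    obtain ⟨a, L, h1, h2⟩ := ih χ _
      (h.of_succ (by exact_mod_cast hα0) (by exact_mod_cast hα1.le))
    obtain ⟨-, u', hd, hu'⟩ := id h
    -- The derivative is only given on the line; the periodicity of `lift χ` makes it a function on
    -- the circle, to which the induction hypothesis applies.
    have hper : ∀ t, lift (fun ζ : Circle => u' (Complex.arg ζ)) t = u' t := by
      intro t
      have h3 : ∀ s, HasDerivAt (fun x => lift χ (x + (t - s))) (u' t) s := fun s => by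
        have := hd t
        rw [show t = s + (t - s) by ring] at this
        simpa using this.comp_add_const s (t - s)
      have h4 := hd (Complex.arg (Circle.exp t))
      have h5 := h3 (Complex.arg (Circle.exp t))
      have e : (fun x => lift χ (x + (t - Complex.arg (Circle.exp t)))) = lift χ := by
        ext x
        simp only [lift, Circle.exp_add, Circle.exp_sub, Circle.exp_arg]
        simp
      rw [e] at h5
      exact h4.unique h5
    set χ' : Circle → ℂ := fun ζ : Circle => u' (Complex.arg ζ)
    have hχ' : lift χ' = u' := funext hper
    obtain ⟨a', L', h1', h2'⟩ := ih χ' K (hχ' ▸ hu')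
    refine ⟨a, max L L', ⟨fun t => (h1.bound t).trans (le_max_left _ _), a', fun t => ?_,
      h1'.mono (le_max_right _ _)⟩, h2⟩
    refine hasDerivAt_of_tendstoUniformly h2' (Eventually.of_forall fun n t => ?_)
      (fun t => h2.tendsto_at t) t
    have hz := mul_circleMap_mem_ball (radius_nonneg n) (radius_lt_one n) t
    refine ((hasDerivAt_herglotz (h.continuous hα0) hz).comp t
      ((hasDerivAt_circleMap 0 1 t).const_mul (radius n : ℂ))).congr_deriv ?_
    rw [herglotz_deriv_eq (hχ' ▸ hu'.continuous hα0) (hχ' ▸ hd) hz]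
    ring

end Herglotz

end StatDisc



namespace StatDisc

variable {k : ℕ} {α : ℝ≥0}

/-! ### Analytic discs -/

theorem HolderBound.exists_zero {F : Type} [NormedAddCommGroup F] [NormedSpace ℝ F] {a K : ℝ}
    {u : ℝ → F} (h : HolderBound a k u K) (ha0 : 0 < a) (ha1 : a ≤ 1) :
    ∃ L, HolderBound a 0 u L := by
  induction k generalizing K with
  | zero => exact ⟨K, h⟩
  | succ k ih => exact ih (h.of_succ ha0 ha1)

theorem frontier_ball_mem {w : ℂ} (hw : w ∈ frontier (Metric.ball (0 : ℂ) 1)) :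
    ∃ ζ : Circle, (ζ : ℂ) = w := by
  rw [frontier_ball _ one_ne_zero] at hw
  exact ⟨⟨w, by simpa [Submonoid.unitSphere] using hw⟩, rfl⟩

/-- By the maximum principle, uniform convergence on the circle makes the sequence uniformly Cauchy
on the closed disc, and the limit is continuous there and holomorphic inside. -/
theorem exists_diffContOnCl_of_tendsto {F : ℕ → ℂ → ℂ} {f : Circle → ℂ}
    (hF : ∀ n, DiffContOnCl ℂ (F n) (Metric.ball 0 1))
    (h : ∀ ε > 0, ∃ N, ∀ n ≥ N, ∀ ζ : Circle, ‖F n ζ - f ζ‖ ≤ ε) :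
    ∃ G : ℂ → ℂ, DiffContOnCl ℂ G (Metric.ball 0 1) ∧ ∀ ζ : Circle, G ζ = f ζ := by
  have hcl : closure (Metric.ball (0 : ℂ) 1) = Metric.closedBall 0 1 := closure_ball _ one_ne_zero
  have hC : ∀ ε > 0, ∃ N, ∀ m ≥ N, ∀ n ≥ N, ∀ z ∈ Metric.closedBall (0 : ℂ) 1,
      ‖F m z - F n z‖ ≤ ε := by
    intro ε hε
    obtain ⟨N, hN⟩ := h (ε / 2) (by positivity)
    refine ⟨N, fun m hm n hn z hz => ?_⟩
    refine Complex.norm_le_of_forall_mem_frontier_norm_le Metric.isBounded_ball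
      ((hF m).sub (hF n)) (fun w hw => ?_) (hcl ▸ hz)
    obtain ⟨ζ, rfl⟩ := frontier_ball_mem hw
    have e : (F m - F n) ζ = (F m ζ - f ζ) - (F n ζ - f ζ) := by simp
    rw [e]
    exact (norm_sub_le_of_le (hN m hm ζ) (hN n hn ζ)).trans (by linarith)
  have hlim : ∀ z : ℂ, ∃ y, z ∈ Metric.closedBall (0 : ℂ) 1 →
      Filter.Tendsto (fun n => F n z) Filter.atTop (nhds y) := by
    intro z
    by_cases hz : z ∈ Metric.closedBall (0 : ℂ) 1
    · obtain ⟨y, hy⟩ := cauchySeq_tendsto_of_complete (u := fun n => F n z)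
        (Metric.cauchySeq_iff.2 fun ε hε => by
          obtain ⟨N, hN⟩ := hC (ε / 2) (by positivity)
          exact ⟨N, fun m hm n hn => by
            rw [dist_eq_norm]; linarith [hN m hm n hn z hz]⟩)
      exact ⟨y, fun _ => hy⟩
    · exact ⟨0, fun h => absurd h hz⟩
  choose G hG using hlim
  have hu : TendstoUniformlyOn F G Filter.atTop (Metric.closedBall 0 1) := by
    rw [Metric.tendstoUniformlyOn_iff]
    intro ε hε
    obtain ⟨N, hN⟩ := hC (ε / 2) (by positivity)
    filter_upwards [Filter.eventually_ge_atTop N] with n hn z hz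
    rw [dist_comm, dist_eq_norm]
    have := le_of_tendsto ((hG z hz).const_sub (F n z)).norm
      (Filter.eventually_atTop.2 ⟨N, fun m hm => hN n hn m hm z hz⟩)
    linarith
  refine ⟨G, ⟨?_, ?_⟩, fun ζ => ?_⟩
  · exact (hu.mono Metric.ball_subset_closedBall).tendstoLocallyUniformlyOn.differentiableOn
      (Filter.Eventually.of_forall fun n => (hF n).differentiableOn) Metric.isOpen_ball
  · rw [hcl]
    exact hu.continuousOn (Filter.Eventually.of_forall fun n => hcl ▸ (hF n).continuousOn).frequently
  · refine tendsto_nhds_unique (hG ζ (mem_closedBall_zero_iff.2 ζ.norm_coe.le)) (Metric.tendsto_atTop.2 fun ε hε => ?_)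
    obtain ⟨N, hN⟩ := h (ε / 2) (by positivity)
    exact ⟨N, fun n hn => by rw [dist_eq_norm]; linarith [hN n hn ζ]⟩

namespace A

theorem mem_iff {f : CComplex k α} : f ∈ A k α ↔
    ∃ F : ℂ → ℂ, DiffContOnCl ℂ F (Metric.ball 0 1) ∧ ∀ ζ : Circle, F ζ = f ζ := Iff.rfl

variable [hα : Fact (0 < α ∧ α < 1)]

theorem isClosed : IsClosed (A k α : Set (CComplex k α)) := by
  refine isClosed_of_closure_subset fun f hf => ?_
  obtain ⟨u, hu, hlim⟩ := mem_closure_iff_seq_limit.1 hf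
  choose F hF hF' using fun n => mem_iff.1 (hu n)
  refine exists_diffContOnCl_of_tendsto hF fun ε hε => ?_
  obtain ⟨N, hN⟩ := Metric.tendsto_atTop.1 hlim ε hε
  refine ⟨N, fun n hn ζ => ?_⟩
  have h1 := (u n - f).norm_apply_le hα.out.1 ζ
  rw [hF']
  have h2 := hN n hn
  rw [dist_eq_norm] at h2
  exact h1.trans h2.le

instance : CompleteSpace (A k α) := isClosed.completeSpace_coe

theorem mul_mem {f g : CComplex k α} (hf : f ∈ A k α) (hg : g ∈ A k α) : f * g ∈ A k α := by
  obtain ⟨F, hF, hF'⟩ := hf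
  obtain ⟨G, hG, hG'⟩ := hg
  exact ⟨F • G, hF.smul hG, fun ζ => congrArg₂ (· * ·) (hF' ζ) (hG' ζ)⟩

theorem const_mem (c : ℂ) : (CComplex.const c : CComplex k α) ∈ A k α :=
  ⟨fun _ => c, diffContOnCl_const, fun _ => rfl⟩

theorem zp_mem (n : ℕ) : (CComplex.zp n : CComplex k α) ∈ A k α :=
  ⟨fun z => z ^ n, (differentiable_id.pow n).diffContOnCl, fun ζ => by
    rw [CComplex.val_apply, CComplex.zp_apply]
    simp⟩

end A

/-! ### Means, shifts and the splitting into analytic and antianalytic parts -/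

namespace CComplex

variable [hα : Fact (0 < α ∧ α < 1)]

theorem circle_ne_zero (ζ : Circle) : (ζ : ℂ) ≠ 0 := Circle.coe_ne_zero ζ

@[simp] theorem conj_circle (ζ : Circle) : starRingEnd ℂ (ζ : ℂ) = (ζ : ℂ)⁻¹ := by
  rw [← Circle.coe_inv_eq_conj, Circle.coe_inv]

/-- The mean value over the circle. -/
noncomputable def mean : CComplex k α →L[ℝ] ℂ :=
  LinearMap.mkContinuous
    ⟨⟨fun f => (2 * Real.pi)⁻¹ • ∫ t in (0 : ℝ)..2 * Real.pi, lift f t, fun f g => by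
        rw [← smul_add, ← intervalIntegral.integral_add
          ((f.continuous_lift hα.out.1).intervalIntegrable _ _)
          ((g.continuous_lift hα.out.1).intervalIntegrable _ _)]
        rfl⟩, fun c f => by
        rw [RingHom.id_apply, smul_comm, ← intervalIntegral.integral_smul]
        rfl⟩ 1 fun f => by
      rw [one_mul]
      show ‖(2 * Real.pi)⁻¹ • ∫ t in (0 : ℝ)..2 * Real.pi, lift f t‖ ≤ ‖f‖
      have h1 := intervalIntegral.norm_integral_le_of_norm_le_const (a := 0) (b := 2 * Real.pi)
        (f := lift f) (C := ‖f‖) fun t _ => (f.norm_apply_le hα.out.1 _)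
      rw [sub_zero, abs_of_pos Real.two_pi_pos] at h1
      rw [norm_smul, norm_inv, Real.norm_eq_abs, abs_of_pos Real.two_pi_pos,
        inv_mul_le_iff₀ Real.two_pi_pos]
      linarith

theorem mean_apply (f : CComplex k α) :
    mean f = (2 * Real.pi)⁻¹ • ∫ t in (0 : ℝ)..2 * Real.pi, lift f t := rfl

theorem mean_eq {f : CComplex k α} {F : ℂ → ℂ} (hF : DiffContOnCl ℂ F (Metric.ball 0 1))
    (h : ∀ ζ : Circle, F ζ = f ζ) : mean f = F 0 := by
  have h1 : DiffContOnCl ℂ F (Metric.ball 0 |1|) := by simpa using hF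
  rw [← h1.circleAverage, Real.circleAverage_def, mean_apply]
  congr 1
  refine intervalIntegral.integral_congr fun t _ => ?_
  rw [circleMap_eq_exp, h]
  rfl

theorem mean_const (c : ℂ) : mean (const c : CComplex k α) = c :=
  mean_eq (F := fun _ => c) diffContOnCl_const fun _ => rfl

/-- On analytic discs the mean is evaluation at the origin, hence multiplicative. -/
theorem mean_mul {f g : CComplex k α} (hf : f ∈ A k α) (hg : g ∈ A k α) :
    mean (f * g) = mean f * mean g := by
  obtain ⟨F, hF, hF'⟩ := hf
  obtain ⟨G, hG, hG'⟩ := hg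
  rw [mean_eq hF hF', mean_eq hG hG']
  exact mean_eq (F := F • G) (hF.smul hG) fun ζ => congrArg₂ (· * ·) (hF' ζ) (hG' ζ)

theorem mean_zp_one : mean (zp 1 : CComplex k α) = 0 :=
  mean_eq (F := fun z => z) differentiable_id.diffContOnCl fun ζ => by simp

theorem eq_zero_of_mean_mul_conj {f : CComplex k α} (h : mean (f * conj f) = 0) : f = 0 := by
  by_contra hf
  have hc := f.continuous_lift hα.out.1
  obtain ⟨ζ, hζ⟩ : ∃ ζ, f ζ ≠ 0 := by
    by_contra! h0
    exact hf (DFunLike.ext _ _ h0)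
  have hpos : 0 < ∫ t in (0 : ℝ)..2 * Real.pi, ‖lift f t‖ ^ 2 := by
    obtain ⟨t, ht, he⟩ := (Circle.periodic_exp).exists_mem_Ico₀ Real.two_pi_pos (Complex.arg ζ)
    rw [Circle.exp_arg] at he
    refine intervalIntegral.integral_pos Real.two_pi_pos (by fun_prop) (fun _ _ => by positivity)
      ⟨t, Set.Ico_subset_Icc_self ht, ?_⟩
    have : lift f t ≠ 0 := by rwa [lift, ← he]
    positivity
  have h2 : mean (f * conj f) = (((2 * Real.pi)⁻¹ * ∫ t in (0 : ℝ)..2 * Real.pi,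
      ‖lift f t‖ ^ 2 : ℝ) : ℂ) := by
    rw [mean_apply, Complex.ofReal_mul, ← intervalIntegral.integral_ofReal, Complex.real_smul]
    congr 1
    refine intervalIntegral.integral_congr fun t _ => ?_
    simp [lift, Complex.mul_conj, Complex.normSq_eq_norm_sq]
  rw [h2] at h
  have h3 := Complex.ofReal_eq_zero.1 h
  have := Real.pi_pos
  have : 0 < (2 * Real.pi)⁻¹ * ∫ t in (0 : ℝ)..2 * Real.pi, ‖lift f t‖ ^ 2 := by positivity
  linarith

/-- The decomposition of a function into an analytic and an antianalytic part is unique. -/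
theorem eq_zero_of_add_conj {a g : CComplex k α} (ha : a ∈ A k α) (hg : g ∈ A k α)
    (h : a + zp (-1) * conj g = 0) : a = 0 ∧ g = 0 := by
  have hpt : ∀ ζ, a ζ + (ζ : ℂ)⁻¹ * starRingEnd ℂ (g ζ) = 0 := fun ζ => by
    have := DFunLike.congr_fun h ζ
    simpa using this
  -- The relation gives ā = -ζg, so |a|² = -ζag is the boundary value of an analytic disc vanishing
  -- at the origin. Its mean is zero, which forces a = 0.
  have e : a * conj a = -(zp 1 * (a * g)) := by
    refine DFunLike.ext _ _ fun ζ => ?_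
    have h1 := congrArg (starRingEnd ℂ) (eq_neg_of_add_eq_zero_left (hpt ζ))
    simp only [map_neg, map_mul, map_inv₀, conj_circle, inv_inv, Complex.conj_conj] at h1
    simp only [mul_apply, conj_apply, neg_apply, zp_apply, zpow_one, h1]
    ring
  have ha0 : a = 0 := by
    apply eq_zero_of_mean_mul_conj
    rw [e, map_neg, mean_mul (by exact_mod_cast A.zp_mem 1) (A.mul_mem ha hg), mean_zp_one,
      zero_mul, neg_zero]
  refine ⟨ha0, DFunLike.ext _ _ fun ζ => ?_⟩
  have := hpt ζ
  rw [ha0, zero_apply, zero_add] at this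
  simpa using this

/-- An analytic disc which is real on the circle and whose mean has vanishing real part is zero. -/
theorem eq_zero_of_im_eq_zero {h : CComplex k α} (hh : h ∈ A k α) (him : ∀ ζ, (h ζ).im = 0)
    (hm : (mean h).re = 0) : h = 0 := by
  have e : conj h = h := DFunLike.ext _ _ fun ζ => Complex.conj_eq_iff_im.2 (him ζ)
  have hm0 : mean h = 0 := by
    refine Complex.ext hm ?_
    rw [mean_apply, Complex.smul_im]
    have h1 := Complex.imCLM.intervalIntegral_comp_comm
      ((h.continuous_lift hα.out.1).intervalIntegrable (μ := MeasureTheory.volume) 0 (2 * Real.pi))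
    simp only [Complex.imCLM_apply] at h1
    rw [← h1]
    simp [lift, him]
  apply eq_zero_of_mean_mul_conj
  -- Since h is real, |h|² = h², whose mean is the square of the mean of h.
  rw [e, mean_mul hh hh, hm0, zero_mul]

/-- Constants as a linear map. -/
noncomputable def constCLM : ℂ →L[ℝ] CComplex k α :=
  LinearMap.toContinuousLinearMap ⟨⟨const, fun _ _ => rfl⟩, fun c z => DFunLike.ext _ _ fun ζ => by
    simp⟩

@[simp] theorem constCLM_apply (c : ℂ) : (constCLM c : CComplex k α) = const c := rfl

/-- The shift `f ↦ (f - f(0)) / ζ`. -/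
noncomputable def shift : CComplex k α →L[ℝ] CComplex k α :=
  (mulCLM (zp (-1))).comp (ContinuousLinearMap.id ℝ _ - constCLM.comp mean)

theorem shift_eq (f : CComplex k α) : shift f = zp (-1) * (f - const (mean f)) := rfl

theorem shift_apply (f : CComplex k α) (ζ : Circle) :
    shift f ζ = (ζ : ℂ)⁻¹ * (f ζ - mean f) := by
  rw [shift_eq]
  simp

theorem eq_mean_add (f : CComplex k α) (ζ : Circle) : f ζ = mean f + ζ * shift f ζ := by
  rw [shift_apply]
  have := circle_ne_zero ζ
  field_simp
  ring

/-- The divided difference at the origin has a removable singularity there. -/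
theorem shift_mem {f : CComplex k α} (hf : f ∈ A k α) : shift f ∈ A k α := by
  obtain ⟨F, hF, hF'⟩ := hf
  have h1 : Metric.ball (0 : ℂ) 1 ∈ nhds (0 : ℂ) := Metric.ball_mem_nhds _ one_pos
  refine ⟨dslope F 0, ⟨(Complex.differentiableOn_dslope h1).2 hF.differentiableOn, ?_⟩,
    fun ζ => ?_⟩
  · exact (continuousOn_dslope (Filter.mem_of_superset h1 subset_closure)).2
      ⟨hF.continuousOn, hF.differentiableOn.differentiableAt h1⟩
  · rw [dslope_of_ne _ (circle_ne_zero ζ), slope_def_field, val_apply, shift_apply, hF', val_apply,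
      mean_eq hF hF', sub_zero, div_eq_inv_mul]

theorem mean_const_add (c : ℂ) {g : CComplex k α} (hg : g ∈ A k α) :
    mean (const c + zp 1 * g) = c := by
  rw [map_add, mean_const, mean_mul (by exact_mod_cast A.zp_mem 1) hg, mean_zp_one, zero_mul,
    add_zero]

theorem shift_const_add (c : ℂ) {g : CComplex k α} (hg : g ∈ A k α) :
    shift (const c + zp 1 * g) = g := by
  refine DFunLike.ext _ _ fun ζ => ?_
  have := circle_ne_zero ζ
  rw [shift_apply, mean_const_add c hg]
  simp

theorem const_add_mem (c : ℂ) {g : CComplex k α} (hg : g ∈ A k α) :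
    const c + zp 1 * g ∈ A k α :=
  (A k α).add_mem (A.const_mem c) (A.mul_mem (by exact_mod_cast A.zp_mem 1) hg)

/-- Every real function of class `C^{k,α}` is the real part of an analytic disc. -/
theorem exists_re_eq (f : CComplex k α) (hf : ∀ ζ, (f ζ).im = 0) :
    ∃ h ∈ A k α, ∀ ζ, (h ζ).re = (f ζ).re := by
  have hα0 := hα.out.1
  have hα1 := hα.out.2
  have hα' : (α : ℝ) < 1 := by exact_mod_cast hα1
  -- The disc is the Herglotz integral of f. It lies in `A` because its dilates by `radius n` are
  -- holomorphic past the closed disc and converge uniformly on the circle; its real part is f by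
  -- the Poisson estimate.
  obtain ⟨a, L, ha, hlim⟩ := exists_boundary_value hα0 hα1 k f _ (f.holderBound hα0)
  obtain ⟨K, hK⟩ := (f.holderBound hα0).exists_zero (by exact_mod_cast hα0)
    (by exact_mod_cast hα1.le)
  have hper : ∀ t, lift (fun ζ : Circle => a (Complex.arg ζ)) t = a t := fun t => by
    refine tendsto_nhds_unique (hlim.tendsto_at _) ((hlim.tendsto_at t).congr fun n => ?_)
    rw [circleMap_eq_exp, circleMap_eq_exp, Circle.exp_arg]
  set h : CComplex k α := ofBound hα0 (fun ζ : Circle => a (Complex.arg ζ))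
    ⟨L, ha.congr fun t => (hper t).symm⟩
  have hh : ∀ t, h (Circle.exp t) = a t := hper
  refine ⟨h, ?_, fun ζ => ?_⟩
  · refine exists_diffContOnCl_of_tendsto (F := fun n z => herglotz f (radius n * z))
      (fun n => ?_) fun ε hε => ?_
    · refine DifferentiableOn.diffContOnCl ?_
      rw [closure_ball _ one_ne_zero]
      intro z hz
      have hz' : (radius n * z : ℂ) ∈ Metric.ball (0 : ℂ) 1 := by
        rw [mem_ball_zero_iff, norm_mul, Complex.norm_real, Real.norm_eq_abs,
          abs_of_nonneg (radius_nonneg n)]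
        rw [mem_closedBall_zero_iff] at hz
        have := radius_lt_one n
        have := radius_nonneg n
        nlinarith [norm_nonneg z]
      exact ((hasDerivAt_herglotz (f.continuous_lift hα0) hz').comp z
        ((hasDerivAt_id z).const_mul (radius n : ℂ))).differentiableAt.differentiableWithinAt
    · obtain ⟨N, hN⟩ := Filter.eventually_atTop.1 (Metric.tendstoUniformly_iff.1 hlim ε hε)
      refine ⟨N, fun n hn ζ => ?_⟩
      have := hN n hn (Complex.arg ζ)
      rw [dist_comm, dist_eq_norm, circleMap_eq_exp, Circle.exp_arg] at this
      exact this.le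
  · obtain ⟨t, rfl⟩ : ∃ t, Circle.exp t = ζ := ⟨Complex.arg ζ, Circle.exp_arg ζ⟩
    have h1 : Filter.Tendsto (fun n => (herglotz f (radius n * circleMap 0 1 t)).re)
        Filter.atTop (nhds (h (Circle.exp t)).re) := by
      rw [hh]
      exact (Complex.continuous_re.tendsto _).comp (hlim.tendsto_at t)
    have h2 : Filter.Tendsto (fun n => (herglotz f (radius n * circleMap 0 1 t)).re)
        Filter.atTop (nhds (f (Circle.exp t)).re) := by
      refine Metric.tendsto_atTop.2 fun ε hε => ?_
      obtain ⟨N, hN⟩ := Filter.eventually_atTop.1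
        (eventually_rpow_radius_lt hα0 (128 * K / (1 - α)) hε)
      refine ⟨N, fun n hn => ?_⟩
      rw [Real.dist_eq]
      exact (norm_re_herglotz_sub_le hα0 hα1 hK hf (radius_nonneg n)
        (radius_lt_one n)).trans_lt (hN n hn)
    exact tendsto_nhds_unique h1 h2

/-- Every function of class `C^{k,α}` is the sum of an analytic disc and an antianalytic one. -/
theorem exists_add_conj (f : CComplex k α) :
    ∃ a ∈ A k α, ∃ g ∈ A k α, f = a + zp (-1) * conj g := by
  have hr : ∀ c : ℂ, ∃ h ∈ A k α, ∀ ζ, (h ζ).re = (c * f ζ).re := by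
    intro c
    obtain ⟨h, hh, he⟩ := exists_re_eq
      (const (1 / 2) * (const c * f + conj (const c * f)) : CComplex k α) (fun ζ => by
        simp
        ring)
    refine ⟨h, hh, fun ζ => ?_⟩
    rw [he]
    simp
    ring
  obtain ⟨p, hp, hp'⟩ := hr 1
  obtain ⟨q, hq, hq'⟩ := hr (-Complex.I)
  -- Here Re p = Re f and Re q = Im f, so f = Re p + i Re q = (p + iq)/2 + conj((p - iq)/2). The
  -- constant term of the conjugate part is then moved to the analytic part, which leaves a factor
  -- ζ⁻¹ in front.
  set a := const (1 / 2) * (p + const Complex.I * q)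
  set g := const (1 / 2) * (p - const Complex.I * q)
  have ha : a ∈ A k α := A.mul_mem (A.const_mem _)
    ((A k α).add_mem hp (A.mul_mem (A.const_mem _) hq))
  have hg : g ∈ A k α := A.mul_mem (A.const_mem _)
    ((A k α).sub_mem hp (A.mul_mem (A.const_mem _) hq))
  refine ⟨a + const (starRingEnd ℂ (mean g)), (A k α).add_mem ha (A.const_mem _), shift g,
    shift_mem hg, DFunLike.ext _ _ fun ζ => ?_⟩
  have h1 : starRingEnd ℂ (g ζ) = starRingEnd ℂ (mean g) +
      (ζ : ℂ)⁻¹ * starRingEnd ℂ (shift g ζ) := by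
    rw [eq_mean_add g ζ]
    simp
  have h2 : f ζ = a ζ + starRingEnd ℂ (g ζ) := by
    have i1 := hp' ζ
    have i2 := hq' ζ
    apply Complex.ext
    · simp [a, g] at i1 i2 ⊢
      linarith
    · simp [a, g] at i1 i2 ⊢
      linarith
  rw [h2, h1]
  simp
  ring

end CComplex

end StatDisc



namespace StatDisc

variable {k : ℕ} {α : ℝ≥0}

/-! ### Real parts -/

theorem one_sub_ne_zero {ζ : Circle} (h : ζ ≠ 1) : (1 - (ζ : ℂ)) ≠ 0 := fun he =>
  h (Circle.ext (by rw [Circle.coe_one]; exact (sub_eq_zero.1 he).symm))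

theorem mulPow_apply (m : ℕ) (v : CComplex k α) (ζ : Circle) :
    mulPow m v ζ = (1 - (ζ : ℂ)) ^ m * v ζ := rfl

theorem ofReal_re_eq {m : ℕ} (φ : CZero k α m) (ζ : Circle) :
    (((1 - (ζ : ℂ)) ^ m * (φ : CComplex k α) ζ).re : ℂ) =
      (1 - (ζ : ℂ)) ^ m * (φ : CComplex k α) ζ :=
  Complex.ext rfl (by rw [Complex.ofReal_im]; exact (φ.2 ζ).symm)

variable [hα : Fact (0 < α ∧ α < 1)]

theorem CZero.isClosed (m : ℕ) : IsClosed (CZero k α m : Set (CComplex k α)) := by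
  have e : (CZero k α m : Set (CComplex k α)) = ⋂ ζ : Circle, {v | (mulPow m v ζ).im = 0} := by
    ext v
    simp [CZero]
  rw [e]
  refine isClosed_iInter fun ζ => isClosed_eq ?_ continuous_const
  exact Complex.continuous_im.comp (continuous_const.mul
    (CComplex.evalCLM hα.out.1 ζ).continuous)

instance (m : ℕ) : CompleteSpace (CZero k α m) := (CZero.isClosed m).completeSpace_coe

theorem CZero.ext_off_one {m : ℕ} {φ ψ : CZero k α m}
    (h : ∀ ζ : Circle, mulPow m (φ : CComplex k α) ζ = mulPow m (ψ : CComplex k α) ζ) :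
    φ = ψ := by
  refine Subtype.ext (CComplex.ext_off_one hα.out.1 fun ζ hζ => ?_)
  exact mul_left_cancel₀ (pow_ne_zero m (one_sub_ne_zero hζ)) (h ζ)

/-- The left side is conj(1 - ζ) on the circle. This identity lets powers of 1 - ζ be pulled out of
conjugates, and it is the source of every ζ⁻¹ and sign in the operators below. -/
theorem one_sub_inv (ζ : Circle) : 1 - (ζ : ℂ)⁻¹ = -(ζ : ℂ)⁻¹ * (1 - ζ) := by
  have := CComplex.circle_ne_zero ζ
  field_simp
  ring

/-- The map `v ↦ u` with `(1 - ζ)^m u = Re ((1 - ζ)^m v)`, with values in `CComplex`. -/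
noncomputable def realPartAux (m : ℕ) : CComplex k α →L[ℝ] CComplex k α :=
  (1 / 2 : ℝ) • (ContinuousLinearMap.id ℝ (CComplex k α) +
    (CComplex.mulCLM (CComplex.const ((-1) ^ m) * CComplex.zp (-m))).comp CComplex.conj)

theorem mulPow_realPartAux (m : ℕ) (v : CComplex k α) (ζ : Circle) :
    mulPow m (realPartAux m v) ζ = (((1 - (ζ : ℂ)) ^ m * v ζ).re : ℂ) := by
  have e : (1 - (ζ : ℂ)) ^ m * ((-1) ^ m * ((ζ : ℂ) ^ m)⁻¹) =
      starRingEnd ℂ ((1 - (ζ : ℂ)) ^ m) := by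
    rw [map_pow, map_sub, map_one, CComplex.conj_circle, one_sub_inv, mul_pow, neg_pow (ζ : ℂ)⁻¹, inv_pow]
    ring
  have e2 : mulPow m (realPartAux m v) ζ = ((1 / 2 : ℝ) : ℂ) *
      ((1 - (ζ : ℂ)) ^ m * v ζ + starRingEnd ℂ ((1 - (ζ : ℂ)) ^ m * v ζ)) := by
    rw [mulPow_apply, map_mul, ← e]
    simp [realPartAux]
    ring
  rw [e2, Complex.add_conj]
  push_cast
  ring

/-- The map `v ↦ u` with `(1 - ζ)^m u = Re ((1 - ζ)^m v)`. -/
noncomputable def realPart (m : ℕ) : CComplex k α →L[ℝ] CZero k α m :=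
  (realPartAux m).codRestrict (CZero k α m) fun v (ζ : Circle) => by
    rw [mulPow_realPartAux, Complex.ofReal_im]

theorem mulPow_realPart (m : ℕ) (v : CComplex k α) (ζ : Circle) :
    mulPow m (realPart m v : CComplex k α) ζ = (((1 - (ζ : ℂ)) ^ m * v ζ).re : ℂ) :=
  mulPow_realPartAux m v ζ

/-- The imaginary unit as a constant function. -/
noncomputable abbrev cI : CComplex k α := CComplex.const Complex.I

/-- The hypothesis says that (1 - ζ)^m·2χ has real part given by `φ` and imaginary part given by
minus `ψ`. Thus two real rows Re and Re ∘ i amount to one complex equation. -/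
theorem realPart_pair {m : ℕ} (φ ψ : CZero k α m) (χ : CComplex k α)
    (h : (2 : ℝ) • χ = (φ : CComplex k α) - cI * (ψ : CComplex k α)) :
    realPart m ((2 : ℝ) • χ) = φ ∧ realPart m (cI * (2 : ℝ) • χ) = ψ := by
  have h1 : ∀ ζ : Circle, (((2 : ℝ) • χ) ζ) = (φ : CComplex k α) ζ -
      Complex.I * (ψ : CComplex k α) ζ := fun ζ => DFunLike.congr_fun h ζ
  have h2 := fun ζ => ofReal_re_eq φ ζ
  have h3 := fun ζ => ofReal_re_eq ψ ζ
  constructor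
  · refine CZero.ext_off_one fun ζ => ?_
    rw [mulPow_realPart, mulPow_apply, h1, mul_sub, mul_left_comm, ← h2, ← h3]
    simp
  · refine CZero.ext_off_one fun ζ => ?_
    rw [mulPow_realPart, mulPow_apply, CComplex.mul_apply, h1, CComplex.const_apply, mul_left_comm,
      mul_sub, mul_left_comm _ Complex.I, ← h2, ← h3]
    simp

theorem eq_zero_of_realPart_pair {m : ℕ} {χ : CComplex k α} (h : realPart m ((2 : ℝ) • χ) = 0)
    (h' : realPart m (cI * (2 : ℝ) • χ) = 0) : χ = 0 := by
  refine CComplex.ext_off_one hα.out.1 fun ζ hζ => ?_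
  have h1 := mulPow_realPart m ((2 : ℝ) • χ) ζ
  have h2 := mulPow_realPart m (cI * (2 : ℝ) • χ) ζ
  rw [h, mulPow_apply, Submodule.coe_zero, CComplex.zero_apply, mul_zero] at h1
  rw [h', mulPow_apply, Submodule.coe_zero, CComplex.zero_apply, mul_zero] at h2
  have h3 := Complex.ofReal_eq_zero.1 h1.symm
  have h4 := Complex.ofReal_eq_zero.1 h2.symm
  rw [CComplex.mul_apply, CComplex.const_apply, mul_left_comm] at h4
  have h5 : (1 - (ζ : ℂ)) ^ m * ((2 : ℝ) • χ) ζ = 0 :=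
    Complex.ext h3 (by rw [Complex.I_mul_re] at h4; rw [Complex.zero_im]; linarith)
  rcases mul_eq_zero.1 h5 with h6 | h6
  · exact absurd h6 (pow_ne_zero m (one_sub_ne_zero hζ))
  · simpa using h6

/-! ### Scalar Riemann-Hilbert problems -/

open CComplex

/-- Reality of (1 - ζ)q means q = -ζ⁻¹q̄. With q = a + ζ⁻¹ḡ, uniqueness of the splitting gives g =
-a, and then v = 2a works. -/
theorem exists_realPart_one_eq (q : CZero k α 1) : ∃ v ∈ A k α, realPart 1 v = q := by
  obtain ⟨a, ha, g, hg, h⟩ := exists_add_conj (q : CComplex k α)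
  have hq : (q : CComplex k α) = -(zp (-1) * conj (q : CComplex k α)) := by
    refine CComplex.ext_off_one hα.out.1 fun ζ hζ => ?_
    have h1 := q.2 ζ
    rw [← Complex.conj_eq_iff_im, mulPow_apply, pow_one, map_mul] at h1
    have h2 : starRingEnd ℂ (1 - (ζ : ℂ)) = -(ζ : ℂ)⁻¹ * (1 - ζ) := by
      rw [← one_sub_inv]; simp
    rw [h2] at h1
    have h3 := one_sub_ne_zero hζ
    apply mul_left_cancel₀ h3
    rw [← h1]
    simp
    ring
  have h4 : (a + g) + zp (-1) * conj (a + g) = 0 := by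
    rw [h] at hq
    refine DFunLike.ext _ _ fun ζ => ?_
    have h5 := DFunLike.congr_fun hq ζ
    have := circle_ne_zero ζ
    simp only [CComplex.add_apply, CComplex.mul_apply, CComplex.neg_apply, CComplex.zp_apply, CComplex.conj_apply, map_add, map_mul,
      zpow_neg, zpow_one, map_inv₀, conj_circle, inv_inv, Complex.conj_conj, CComplex.zero_apply] at h5 ⊢
    linear_combination h5 - g ζ * (inv_mul_cancel₀ this)
  have h5 := (eq_zero_of_add_conj ((A k α).add_mem ha hg) ((A k α).add_mem ha hg) h4).1
  refine ⟨(2 : ℝ) • a, (A k α).smul_mem _ ha, CZero.ext_off_one fun ζ => ?_⟩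
  have hg' : g = -a := eq_neg_of_add_eq_zero_right h5
  rw [mulPow_realPart, mulPow_apply, h, hg']
  apply Complex.ext
  · rw [Complex.ofReal_re]
    have h6 : (1 - (ζ : ℂ)) ^ 1 * ((a + zp (-1) * conj (-a) : CComplex k α) ζ) =
        (1 - (ζ : ℂ)) * a ζ + starRingEnd ℂ ((1 - (ζ : ℂ)) * a ζ) := by
      rw [map_mul, map_sub, map_one, conj_circle, one_sub_inv]
      simp
      ring
    rw [h6, Complex.add_re, Complex.conj_re, CComplex.smul_apply, pow_one, mul_left_comm,
      Complex.re_ofReal_mul]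
    ring
  · rw [Complex.ofReal_im]
    have := q.2 ζ
    rw [mulPow_apply, h, hg'] at this
    exact this.symm

/-- Dividing v's equation by 1 - ζ leaves v - ζ⁻¹v̄ = 0, a trivial splitting of zero. -/
theorem eq_zero_of_realPart_one {v : CComplex k α} (hv : v ∈ A k α) (h : realPart 1 v = 0) :
    v = 0 := by
  refine (eq_zero_of_add_conj hv ((A k α).neg_mem hv) ?_).1
  refine CComplex.ext_off_one hα.out.1 fun ζ hζ => ?_
  have h1 := mulPow_realPart 1 v ζ
  rw [h, mulPow_apply, Submodule.coe_zero, CComplex.zero_apply, mul_zero] at h1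
  have h3 : (1 - (ζ : ℂ)) * v ζ + starRingEnd ℂ ((1 - (ζ : ℂ)) * v ζ) = 0 := by
    rw [Complex.add_conj]
    rw [pow_one] at h1
    rw [Complex.ofReal_eq_zero.1 h1.symm]
    simp
  rw [map_mul, map_sub, map_one, conj_circle, one_sub_inv] at h3
  apply mul_left_cancel₀ (one_sub_ne_zero hζ)
  simp only [CComplex.add_apply, CComplex.mul_apply, CComplex.neg_apply, CComplex.zp_apply,
    CComplex.conj_apply, CComplex.zero_apply, map_neg, zpow_neg, zpow_one]
  linear_combination h3

/-- The antianalytic part of 2ζū sees only the Taylor coefficients of u of order at least 2. They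
are fixed by the antianalytic part of χ, c₀ and c₁ remain free, and t absorbs everything analytic.
-/
theorem exists_eq_add_two_conj (χ : CComplex k α) (c₀ c₁ : ℂ) : ∃ t ∈ A k α, ∃ u ∈ A k α,
    t + zp 1 * u + (2 : ℝ) • (zp 1 * conj u) = χ ∧ mean u = c₀ ∧ mean (shift u) = c₁ := by
  obtain ⟨a, ha, g, hg, h⟩ := exists_add_conj χ
  have hs : (1 / 2 : ℝ) • g ∈ A k α := (A k α).smul_mem _ hg
  have hz : (zp 1 : CComplex k α) ∈ A k α := by exact_mod_cast A.zp_mem 1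
  set u : CComplex k α := const c₀ + zp 1 * (const c₁ + zp 1 * (1 / 2 : ℝ) • g)
  have hu : u ∈ A k α := const_add_mem c₀ (const_add_mem c₁ hs)
  refine ⟨a - zp 1 * u - const (2 * starRingEnd ℂ c₀) * zp 1 - const (2 * starRingEnd ℂ c₁),
    (A k α).sub_mem ((A k α).sub_mem ((A k α).sub_mem ha (A.mul_mem hz hu))
      (A.mul_mem (A.const_mem _) hz)) (A.const_mem _), u, hu, DFunLike.ext _ _ fun ζ => ?_,
    mean_const_add _ (const_add_mem _ hs), ?_⟩
  · rw [h]
    have := circle_ne_zero ζ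
    simp only [u, CComplex.add_apply, CComplex.sub_apply, CComplex.mul_apply, CComplex.zp_apply, zpow_one, CComplex.const_apply, CComplex.smul_apply,
      CComplex.conj_apply, map_add, map_mul, conj_circle, Complex.conj_ofReal, zpow_neg]
    push_cast
    field_simp
    ring
  · rw [shift_const_add _ (const_add_mem _ hs), mean_const_add _ hs]

theorem eq_zero_of_add_two_conj {t u : CComplex k α} (ht : t ∈ A k α) (hu : u ∈ A k α)
    (h : t + zp 1 * u + (2 : ℝ) • (zp 1 * conj u) = 0) (h₀ : mean u = 0)
    (h₁ : mean (shift u) = 0) : t = 0 ∧ u = 0 := by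
  have hz : (zp 1 : CComplex k α) ∈ A k α := by exact_mod_cast A.zp_mem 1
  have hus : ∀ ζ, u ζ = ζ * (ζ * shift (shift u) ζ) := fun ζ => by
    rw [eq_mean_add u, eq_mean_add (shift u), h₀, h₁, zero_add, zero_add]
  obtain ⟨h2, h3⟩ := eq_zero_of_add_conj (a := t + zp 1 * u)
    (g := (2 : ℝ) • shift (shift u)) ((A k α).add_mem ht (A.mul_mem hz hu))
    ((A k α).smul_mem _ (shift_mem (shift_mem hu))) (by
      rw [← h]
      refine DFunLike.ext _ _ fun ζ => ?_
      have := circle_ne_zero ζ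
      simp only [CComplex.add_apply, CComplex.mul_apply, CComplex.zp_apply, zpow_one, CComplex.smul_apply, CComplex.conj_apply, hus ζ, map_mul,
        conj_circle, Complex.conj_ofReal, zpow_neg]
      field_simp)
  have h4 : u = 0 := DFunLike.ext _ _ fun ζ => by
    have := DFunLike.congr_fun h3 ζ
    simp at this
    rw [hus, this]
    simp
  refine ⟨?_, h4⟩
  rwa [h4, mul_zero, add_zero] at h2

/-- Without the factor ζ in front of ū only the constant coefficient of u is invisible to the
antianalytic part, so one complex parameter is free. -/
theorem exists_eq_sub_three_conj (χ : CComplex k α) (c₀ : ℂ) : ∃ t ∈ A k α, ∃ u ∈ A k α,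
    t - (2 : ℝ) • u - (3 : ℝ) • conj u = χ ∧ mean u = c₀ := by
  obtain ⟨a, ha, g, hg, h⟩ := exists_add_conj χ
  have hs : (-1 / 3 : ℝ) • g ∈ A k α := (A k α).smul_mem _ hg
  set u : CComplex k α := const c₀ + zp 1 * (-1 / 3 : ℝ) • g
  have hu : u ∈ A k α := const_add_mem c₀ hs
  refine ⟨a + (2 : ℝ) • u + const (3 * starRingEnd ℂ c₀),
    (A k α).add_mem ((A k α).add_mem ha ((A k α).smul_mem _ hu)) (A.const_mem _), u, hu,
    DFunLike.ext _ _ fun ζ => ?_, mean_const_add _ hs⟩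
  rw [h]
  have := circle_ne_zero ζ
  simp only [u, CComplex.add_apply, CComplex.sub_apply, CComplex.mul_apply, CComplex.zp_apply, zpow_one, CComplex.const_apply, CComplex.smul_apply,
    CComplex.conj_apply, map_add, map_mul, conj_circle, Complex.conj_ofReal, zpow_neg]
  push_cast
  field_simp
  ring

theorem eq_zero_of_sub_three_conj {t u : CComplex k α} (ht : t ∈ A k α) (hu : u ∈ A k α)
    (h : t - (2 : ℝ) • u - (3 : ℝ) • conj u = 0) (h₀ : mean u = 0) : t = 0 ∧ u = 0 := by
  have hus : ∀ ζ, u ζ = ζ * shift u ζ := fun ζ => by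
    rw [eq_mean_add u, h₀, zero_add]
  obtain ⟨h2, h3⟩ := eq_zero_of_add_conj (a := t - (2 : ℝ) • u)
    (g := (-3 : ℝ) • shift u) ((A k α).sub_mem ht ((A k α).smul_mem _ hu))
    ((A k α).smul_mem _ (shift_mem hu)) (by
      rw [← h]
      refine DFunLike.ext _ _ fun ζ => ?_
      have := circle_ne_zero ζ
      simp only [CComplex.add_apply, CComplex.sub_apply, CComplex.mul_apply, CComplex.zp_apply, zpow_one, CComplex.smul_apply, CComplex.conj_apply,
        hus ζ, map_mul, conj_circle, Complex.conj_ofReal, zpow_neg]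
      push_cast
      field_simp
      ring)
  have h4 : u = 0 := DFunLike.ext _ _ fun ζ => by
    have := DFunLike.congr_fun h3 ζ
    simp at this
    rw [hus, this]
    simp
  refine ⟨?_, h4⟩
  rwa [h4, smul_zero, sub_zero] at h2

/-- With s = c₀ + c₁ζ + c₂ζ² + ζ³g the condition prescribes Im g on the circle. This determines g up
to a real constant, which is used to adjust Re g(0) to x. -/
theorem exists_realPart_zero_eq (ψ : CZero k α 0) (c₀ c₁ c₂ : ℂ) (x : ℝ) : ∃ s ∈ A k α,
    realPart 0 (cI * ((2 : ℝ) • (zp (-3) * s))) = ψ ∧ mean s = c₀ ∧ mean (shift s) = c₁ ∧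
      mean (shift (shift s)) = c₂ ∧ (mean (shift (shift (shift s)))).re = x := by
  set p : CComplex k α := zp (-3) * (const c₀ + const c₁ * zp 1 + const c₂ * zp 2)
  obtain ⟨h, hh, he⟩ := exists_re_eq (k := k) (α := α)
    (const (-1 / 2) * ((ψ : CComplex k α) - ((realPart 0 (cI * ((2 : ℝ) • p)) : CZero k α 0) : CComplex k α))) (by
      intro ζ
      have h1 := ψ.2 ζ
      have h2 := (realPart 0 (cI * ((2 : ℝ) • p))).2 ζ
      rw [mulPow_apply, pow_zero, one_mul] at h1 h2
      have h3 : ((-1 / 2 : ℂ)) = ((-1 / 2 : ℝ) : ℂ) := by push_cast; ring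
      rw [CComplex.mul_apply, CComplex.const_apply, h3, Complex.im_ofReal_mul, CComplex.sub_apply, Complex.sub_im, h1, h2]
      ring)
  set y : ℝ := x - (Complex.I * mean h).re
  set g : CComplex k α := cI * h + const y
  have hg : g ∈ A k α := (A k α).add_mem (A.mul_mem (A.const_mem _) hh) (A.const_mem _)
  have hg2 := const_add_mem c₂ hg
  have hg1 := const_add_mem c₁ hg2
  refine ⟨const c₀ + zp 1 * (const c₁ + zp 1 * (const c₂ + zp 1 * g)), const_add_mem c₀ hg1,
    CZero.ext_off_one fun ζ => ?_, mean_const_add _ hg1, ?_, ?_, ?_⟩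
  · have h1 := he ζ
    have hζ := circle_ne_zero ζ
    have h2 := mulPow_realPart 0 (cI * ((2 : ℝ) • p)) ζ
    have h3 := ofReal_re_eq ψ ζ
    rw [mulPow_realPart, mulPow_apply]
    rw [mulPow_apply] at h2
    simp only [pow_zero, one_mul] at h2 h3 ⊢
    rw [← h3]
    congr 1
    have e : (cI * (2 : ℝ) • (zp (-3) * (const c₀ + zp 1 * (const c₁ + zp 1 * (const c₂ + zp 1 * g))))
        : CComplex k α) ζ = (cI * (2 : ℝ) • p : CComplex k α) ζ - ((2 : ℝ) : ℂ) * h ζ +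
          ((2 : ℝ) : ℂ) * (Complex.I * (y : ℝ)) := by
      simp only [p, g, CComplex.add_apply, CComplex.mul_apply, CComplex.zp_apply, zpow_one, CComplex.const_apply, CComplex.smul_apply, zpow_neg]
      have hz3 : (ζ : ℂ) ^ (3 : ℤ) = (ζ : ℂ) ^ 3 := by norm_cast
      have hz2 : (ζ : ℂ) ^ (2 : ℤ) = (ζ : ℂ) ^ 2 := by norm_cast
      rw [hz2, hz3]
      field_simp
      linear_combination (h ζ * (ζ : ℂ) ^ 3) * Complex.I_sq
    have h3 : ((-1 / 2 : ℂ)) = ((-1 / 2 : ℝ) : ℂ) := by push_cast; ring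
    rw [CComplex.mul_apply, CComplex.const_apply, CComplex.sub_apply, h2, h3,
      Complex.re_ofReal_mul, Complex.sub_re, Complex.ofReal_re] at h1
    rw [e, Complex.add_re, Complex.sub_re, Complex.re_ofReal_mul, Complex.re_ofReal_mul, h1,
      Complex.I_mul_re, Complex.ofReal_im]
    ring
  · rw [shift_const_add _ hg1, mean_const_add _ hg2]
  · rw [shift_const_add _ hg1, shift_const_add _ hg2, mean_const_add _ hg]
  · rw [shift_const_add _ hg1, shift_const_add _ hg2, shift_const_add _ hg, map_add, mean_const,
      mean_mul (A.const_mem _) hh, mean_const]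
    simp [y]

/-- The vanishing coefficients give s = ζ³g, the equation says that g is real on the circle, and Re
g(0) = 0 then forces g = 0. -/
theorem eq_zero_of_realPart_zero {s : CComplex k α} (hs : s ∈ A k α)
    (h : realPart 0 (cI * ((2 : ℝ) • (zp (-3) * s))) = 0) (h₀ : mean s = 0)
    (h₁ : mean (shift s) = 0) (h₂ : mean (shift (shift s)) = 0)
    (h₃ : (mean (shift (shift (shift s)))).re = 0) : s = 0 := by
  have hss : ∀ ζ, s ζ = ζ ^ 3 * shift (shift (shift s)) ζ := fun ζ => by
    rw [eq_mean_add s, eq_mean_add (shift s), eq_mean_add (shift (shift s)), h₀, h₁, h₂]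
    ring
  have h4 : shift (shift (shift s)) = 0 := by
    refine eq_zero_of_im_eq_zero (shift_mem (shift_mem (shift_mem hs))) (fun ζ => ?_) h₃
    have h1 := mulPow_realPart 0 (cI * ((2 : ℝ) • (zp (-3) * s))) ζ
    rw [h, mulPow_apply, Submodule.coe_zero, CComplex.zero_apply, mul_zero] at h1
    have h2 := Complex.ofReal_eq_zero.1 h1.symm
    have hζ := circle_ne_zero ζ
    have e : (cI * ((2 : ℝ) • (zp (-3) * s)) : CComplex k α) ζ =
        ((2 : ℝ) : ℂ) * (Complex.I * shift (shift (shift s)) ζ) := by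
      simp only [CComplex.mul_apply, CComplex.zp_apply, CComplex.const_apply, CComplex.smul_apply, zpow_neg, hss ζ]
      have hz3 : (ζ : ℂ) ^ (3 : ℤ) = (ζ : ℂ) ^ 3 := by norm_cast
      rw [hz3]
      field_simp
    rw [e, pow_zero, one_mul, Complex.re_ofReal_mul, Complex.I_mul_re] at h2
    linarith
  exact DFunLike.ext _ _ fun ζ => by rw [hss, h4]; simp

end StatDisc



namespace StatDisc

/-! ### The defining functions as real parts and their derivatives -/

/-- Functions whose real parts are the components of `rhoTilde`. -/
noncomputable def polyRow (ζ : ℂ) (q : Fin 8 → ℂ) : Fin 8 → ℂ :=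
  let c := starRingEnd ℂ
  let a₁ := q 4 + 4 * q 6 * q 0 * c (q 0) ^ 2
  let a₂ := q 5 + 6 * q 7 * q 1 ^ 2 * c (q 1) ^ 3
  ![q 2 - q 0 ^ 2 * c (q 0) ^ 2, q 3 - q 1 ^ 3 * c (q 1) ^ 3,
    2 * a₁, Complex.I * (2 * a₁), 2 * a₂, Complex.I * (2 * a₂),
    Complex.I * (2 * (q 6 * (ζ ^ 3)⁻¹)), Complex.I * (2 * (q 7 * (ζ ^ 3)⁻¹))]

/-- The derivative of `polyRow`. -/
noncomputable def polyRowDeriv (ζ : ℂ) (q v : Fin 8 → ℂ) : Fin 8 → ℂ :=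
  let c := starRingEnd ℂ
  let b₁ := v 4 + 4 * v 6 * q 0 * c (q 0) ^ 2 + 4 * q 6 * v 0 * c (q 0) ^ 2 +
    8 * q 6 * q 0 * c (q 0) * c (v 0)
  let b₂ := v 5 + 6 * v 7 * q 1 ^ 2 * c (q 1) ^ 3 + 12 * q 7 * q 1 * v 1 * c (q 1) ^ 3 +
    18 * q 7 * q 1 ^ 2 * c (q 1) ^ 2 * c (v 1)
  ![v 2 - (2 * q 0 * v 0 * c (q 0) ^ 2 + 2 * q 0 ^ 2 * c (q 0) * c (v 0)),
    v 3 - (3 * q 1 ^ 2 * v 1 * c (q 1) ^ 3 + 3 * q 1 ^ 3 * c (q 1) ^ 2 * c (v 1)),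
    2 * b₁, Complex.I * (2 * b₁), 2 * b₂, Complex.I * (2 * b₂),
    Complex.I * (2 * (v 6 * (ζ ^ 3)⁻¹)), Complex.I * (2 * (v 7 * (ζ ^ 3)⁻¹))]

theorem rhoTilde_eq_re (ζ : Circle) (q : Fin 8 → ℂ) (i : Fin 8) :
    rhoTilde ζ q i = ((polyRow ζ q i).re : ℂ) := by
  have h4 : ((‖q 0‖ : ℝ) : ℂ) ^ 4 = (q 0 * starRingEnd ℂ (q 0)) ^ 2 := by
    rw [Complex.mul_conj']; ring
  have h6 : ((‖q 1‖ : ℝ) : ℂ) ^ 6 = (q 1 * starRingEnd ℂ (q 1)) ^ 3 := by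
    rw [Complex.mul_conj']; ring
  rw [Complex.re_eq_add_conj]
  fin_cases i
  all_goals simp [rhoTilde, polyRow, h4, h6, Complex.re_eq_add_conj, map_ofNat]
  all_goals ring

theorem exists_hasFDerivAt_polyRow (ζ : ℂ) (q : Fin 8 → ℂ) (i : Fin 8) :
    ∃ D : (Fin 8 → ℂ) →L[ℝ] ℂ, HasFDerivAt (fun q => polyRow ζ q i) D q ∧
      ∀ v, D v = polyRowDeriv ζ q v i := by
  have h : ∀ j : Fin 8, HasFDerivAt (𝕜 := ℝ) (fun q : Fin 8 → ℂ => q j)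
    (ContinuousLinearMap.proj j) q := fun j => hasFDerivAt_apply j q
  have hc : ∀ j : Fin 8, HasFDerivAt (𝕜 := ℝ) (fun q : Fin 8 → ℂ => starRingEnd ℂ (q j))
    (Complex.conjCLE.toContinuousLinearMap.comp (ContinuousLinearMap.proj j)) q :=
    fun j => Complex.conjCLE.toContinuousLinearMap.hasFDerivAt.comp q (h j)
  have ha := (h 4).add ((((h 6).const_mul 4).mul (h 0)).mul ((hc 0).pow 2))
  have hb := (h 5).add ((((h 7).const_mul 6).mul ((h 1).pow 2)).mul ((hc 1).pow 3))
  fin_cases i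
  · refine ⟨_, (h 2).sub (((h 0).pow 2).mul ((hc 0).pow 2)), fun v => ?_⟩
    simp [polyRowDeriv]
    ring
  · refine ⟨_, (h 3).sub (((h 1).pow 3).mul ((hc 1).pow 3)), fun v => ?_⟩
    simp [polyRowDeriv]
    ring
  · refine ⟨_, ha.const_mul 2, fun v => ?_⟩
    simp [polyRowDeriv]
    ring
  · refine ⟨_, (ha.const_mul 2).const_mul Complex.I, fun v => ?_⟩
    simp [polyRowDeriv]
    ring
  · refine ⟨_, hb.const_mul 2, fun v => ?_⟩
    simp [polyRowDeriv]
    ring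
  · refine ⟨_, (hb.const_mul 2).const_mul Complex.I, fun v => ?_⟩
    simp [polyRowDeriv]
    ring
  · refine ⟨_, (((h 6).mul_const (ζ ^ 3)⁻¹).const_mul 2).const_mul Complex.I, fun v => ?_⟩
    simp [polyRowDeriv]
    ring
  · refine ⟨_, (((h 7).mul_const (ζ ^ 3)⁻¹).const_mul 2).const_mul Complex.I, fun v => ?_⟩
    simp [polyRowDeriv]
    ring

theorem fderiv_rhoTilde (ζ : Circle) (q v : Fin 8 → ℂ) (i : Fin 8) :
    fderiv ℝ (fun q => rhoTilde ζ q i) q v = ((polyRowDeriv ζ q v i).re : ℂ) := by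
  obtain ⟨D, hD, hv⟩ := exists_hasFDerivAt_polyRow ζ q i
  have h := ((Complex.ofRealCLM.comp Complex.reCLM).hasFDerivAt (x := polyRow ζ q i)).comp q hD
  have e : (fun q => rhoTilde ζ q i) =
      (Complex.ofRealCLM.comp Complex.reCLM) ∘ fun q => polyRow ζ q i :=
    funext fun q => rhoTilde_eq_re ζ q i
  rw [e, h.fderiv, ← hv]
  rfl

/-- A real-linear form on `ℂⁿ` in terms of its values on the real and imaginary directions. -/
theorem apply_eq_sum_single {n : ℕ} (D : (Fin n → ℂ) →L[ℝ] ℂ) (v : Fin n → ℂ) :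
    D v = ∑ j, ((v j).re * D (Pi.single j 1) + (v j).im * D (Pi.single j Complex.I)) := by
  have hv : v = ∑ j, ((v j).re • (Pi.single j (1 : ℂ) : Fin n → ℂ) +
      (v j).im • (Pi.single j Complex.I : Fin n → ℂ)) := by
    funext i
    rw [Finset.sum_apply, Finset.sum_eq_single i]
    · simp
    · intro j _ hj
      simp [Pi.single_eq_of_ne hj.symm]
    · simp
  conv_lhs => rw [hv]
  simp

/-- For a real-valued function ∂φ/∂z_j is the conjugate of ∂φ/∂z̄_j, so the differential is twice
the real part of one of the two sums. -/
theorem fderiv_eq_two_mul_re {n : ℕ} {φ : (Fin n → ℂ) → ℂ} {p : Fin n → ℂ}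
    (h : ∀ v, (fderiv ℝ φ p v).im = 0) (v : Fin n → ℂ) :
    fderiv ℝ φ p v = ((2 * (∑ j, starRingEnd ℂ (wirtBar φ p j) * v j).re : ℝ) : ℂ) := by
  rw [apply_eq_sum_single, Complex.re_sum, Finset.mul_sum, Complex.ofReal_sum]
  refine Finset.sum_congr rfl fun j _ => ?_
  have h1 : ((fderiv ℝ φ p (Pi.single j 1)).re : ℂ) = fderiv ℝ φ p (Pi.single j 1) :=
    Complex.ext rfl (by rw [h, Complex.ofReal_im])
  have h2 : ((fderiv ℝ φ p (Pi.single j Complex.I)).re : ℂ) =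
    fderiv ℝ φ p (Pi.single j Complex.I) := Complex.ext rfl (by rw [h, Complex.ofReal_im])
  rw [wirtBar, ← h1, ← h2]
  have : 2 * (starRingEnd ℂ ((((fderiv ℝ φ p (Pi.single j 1)).re : ℂ) +
      Complex.I * ((fderiv ℝ φ p (Pi.single j Complex.I)).re : ℂ)) / 2) * v j).re =
      (v j).re * (fderiv ℝ φ p (Pi.single j 1)).re +
      (v j).im * (fderiv ℝ φ p (Pi.single j Complex.I)).re := by
    rw [map_div₀, map_ofNat]
    simp [Complex.mul_re]
    ring
  rw [this]
  push_cast
  ring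

variable {k : ℕ} {α : ℝ≥0}

theorem Y.eval_apply (f : Y k α) (ζ : Circle) (i : Fin 8) :
    f.eval ζ i = (1 - (ζ : ℂ)) ^ yOrd i * (f i : CComplex k α) ζ := rfl

theorem Z.eval_apply (φ : Z k α) (ζ : Circle) (i : Fin 8) :
    φ.eval ζ i = (1 - (ζ : ℂ)) ^ zOrd i * (φ i : CComplex k α) ζ := rfl

variable [hα : Fact (0 < α ∧ α < 1)]

/-! ### The model operator -/

theorem A.zp_three_mem : (CComplex.zp 3 : CComplex k α) ∈ A k α := by exact_mod_cast A.zp_mem 3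

theorem A.zp_two_mem : (CComplex.zp 2 : CComplex k α) ∈ A k α := by exact_mod_cast A.zp_mem 2

theorem A.zp_one_mem : (CComplex.zp 1 : CComplex k α) ∈ A k α := by exact_mod_cast A.zp_mem 1

/-- The initial lift as an element of `Y`. -/
noncomputable def initialDisc : Y k α :=
  ![⟨CComplex.const 1, A.const_mem _⟩, ⟨CComplex.const 1, A.const_mem _⟩,
    ⟨CComplex.const 6 - CComplex.const 2 * CComplex.zp 1,
      (A k α).sub_mem (A.const_mem _) (A.mul_mem (A.const_mem _) A.zp_one_mem)⟩,
    ⟨CComplex.const 20 - CComplex.const 10 * CComplex.zp 1 + CComplex.const 2 * CComplex.zp 2,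
      (A k α).add_mem
        ((A k α).sub_mem (A.const_mem _) (A.mul_mem (A.const_mem _) A.zp_one_mem))
        (A.mul_mem (A.const_mem _) A.zp_two_mem)⟩,
    ⟨-CComplex.zp 1, (A k α).neg_mem A.zp_one_mem⟩, ⟨CComplex.const 1, A.const_mem _⟩,
    ⟨CComplex.const (1 / 4) * CComplex.zp 3, A.mul_mem (A.const_mem _) A.zp_three_mem⟩,
    ⟨CComplex.const (1 / 6) * CComplex.zp 3, A.mul_mem (A.const_mem _) A.zp_three_mem⟩]

theorem eval_initialDisc (ζ : Circle) : (initialDisc : Y k α).eval ζ = initialLift ζ := by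
  have h2 : (ζ : ℂ) ^ (2 : ℤ) = (ζ : ℂ) ^ 2 := by norm_cast
  have h3 : (ζ : ℂ) ^ (3 : ℤ) = (ζ : ℂ) ^ 3 := by norm_cast
  funext i
  rw [Y.eval_apply]
  fin_cases i
  all_goals simp [initialDisc, initialLift, yOrd, deg, h2, h3]
  all_goals ring

/-- The operator `f ↦ n(f)` with `F(ρ, f) = Re ((1 - ζ)^m n(f))`. -/
noncomputable def modelPart (f : Y k α) : Fin 8 → CComplex k α :=
  let c := CComplex.conj (k := k) (α := α)
  let u : Fin 8 → CComplex k α := fun i => f i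
  let a₁ := u 4 + (4 : ℝ) • (CComplex.zp (-2) * (u 6 * (u 0 * (c (u 0) * c (u 0)))))
  let a₂ := u 5 - (6 : ℝ) • (CComplex.zp (-3) *
    (u 7 * (u 1 * (u 1 * (c (u 1) * (c (u 1) * c (u 1)))))))
  -- |z₁|⁴ contributes (1 - ζ)⁴ζ⁻² and |z₂|⁶ contributes -(1 - ζ)⁶ζ⁻³. One factor 1 - ζ is split off
  -- for the target space; the odd power explains the plus sign in the second row.
  ![u 2 - (CComplex.zp (-2) * (1 - CComplex.zp 1) ^ 3) *
      (u 0 * (u 0 * (c (u 0) * c (u 0)))),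
    u 3 + (CComplex.zp (-3) * (1 - CComplex.zp 1) ^ 5) *
      (u 1 * (u 1 * (u 1 * (c (u 1) * (c (u 1) * c (u 1)))))),
    (2 : ℝ) • a₁, cI * (2 : ℝ) • a₁, (2 : ℝ) • a₂, cI * (2 : ℝ) • a₂,
    cI * (2 : ℝ) • (CComplex.zp (-3) * u 6), cI * (2 : ℝ) • (CComplex.zp (-3) * u 7)]

theorem conj_one_sub (ζ : Circle) :
    starRingEnd ℂ (1 - (ζ : ℂ)) = -(ζ : ℂ)⁻¹ * (1 - ζ) := by
  rw [map_sub, map_one, CComplex.conj_circle, one_sub_inv]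

theorem mulPow_modelPart (f : Y k α) (ζ : Circle) (i : Fin 8) :
    mulPow (zOrd i) (modelPart f i) ζ = polyRow ζ (f.eval ζ) i := by
  have h2 : (ζ : ℂ) ^ (2 : ℤ) = (ζ : ℂ) ^ 2 := by norm_cast
  have h3 : (ζ : ℂ) ^ (3 : ℤ) = (ζ : ℂ) ^ 3 := by norm_cast
  have hζ := CComplex.circle_ne_zero ζ
  rw [mulPow_apply]
  fin_cases i
  all_goals simp only [modelPart, polyRow, Y.eval_apply, map_mul, map_pow, conj_one_sub]
  all_goals simp [zOrd, yOrd, deg, h2, h3]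
  all_goals ring

theorem _root_.ContDiff.cmul {E : Type*} [NormedAddCommGroup E] [NormedSpace ℝ E] {n : ℕ∞}
    {f g : E → CComplex k α} (hf : ContDiff ℝ n f) (hg : ContDiff ℝ n g) :
    ContDiff ℝ n fun x => f x * g x :=
  (CComplex.mulCLM (k := k) (α := α)).isBoundedBilinearMap.contDiff.comp (hf.prodMk hg)

theorem _root_.ContDiff.csmul {E : Type*} [NormedAddCommGroup E] [NormedSpace ℝ E] {n : ℕ∞}
    (c : ℝ) {f : E → CComplex k α} (hf : ContDiff ℝ n f) : ContDiff ℝ n fun x => c • f x :=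
  ContDiff.const_smul c hf

/-- The components of an element of `Y`. -/
noncomputable def comp (i : Fin 8) : Y k α →L[ℝ] CComplex k α :=
  (A k α).subtypeL.comp (ContinuousLinearMap.proj i)

@[simp] theorem comp_apply (i : Fin 8) (f : Y k α) : comp i f = (f i : CComplex k α) := rfl

theorem contDiff_modelPart (i : Fin 8) : ContDiff ℝ 1 fun f : Y k α => modelPart f i := by
  have h : ∀ j, ContDiff ℝ (1 : ℕ∞) fun f : Y k α => (f j : CComplex k α) :=
    fun j => ContinuousLinearMap.contDiff (𝕜 := ℝ) (E := Y k α) (F := CComplex k α) (comp j)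
  have hc : ∀ j, ContDiff ℝ (1 : ℕ∞) fun f : Y k α => CComplex.conj (f j : CComplex k α) :=
    fun j => CComplex.conj.contDiff.comp (h j)
  have hk : ∀ c : CComplex k α, ContDiff ℝ (1 : ℕ∞) fun _ : Y k α => c :=
    fun c => contDiff_const
  have ha := (h 4).add (((hk (CComplex.zp (-2))).cmul
    ((h 6).cmul ((h 0).cmul ((hc 0).cmul (hc 0))))).csmul 4)
  have hb := (h 5).sub (((hk (CComplex.zp (-3))).cmul
    ((h 7).cmul ((h 1).cmul ((h 1).cmul ((hc 1).cmul ((hc 1).cmul (hc 1))))))).csmul 6)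
  fin_cases i
  · exact (h 2).sub ((hk _).cmul ((h 0).cmul ((h 0).cmul ((hc 0).cmul (hc 0)))))
  · exact (h 3).add ((hk _).cmul ((h 1).cmul ((h 1).cmul ((h 1).cmul
      ((hc 1).cmul ((hc 1).cmul (hc 1)))))))
  · exact ha.csmul 2
  · exact (hk cI).cmul (ha.csmul 2)
  · exact hb.csmul 2
  · exact (hk cI).cmul (hb.csmul 2)
  · exact (hk cI).cmul (((hk _).cmul (h 6)).csmul 2)
  · exact (hk cI).cmul (((hk _).cmul (h 7)).csmul 2)

/-- The map `F(ρ, ·)`. -/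
noncomputable def modelMap (f : Y k α) : Z k α := fun i => realPart (zOrd i) (modelPart f i)

theorem contDiff_modelMap : ContDiff ℝ 1 (modelMap : Y k α → Z k α) :=
  contDiff_pi.2 fun i => (realPart (zOrd i)).contDiff.comp (contDiff_modelPart i)

theorem eval_modelMap (f : Y k α) (ζ : Circle) : (modelMap f).eval ζ = rhoTilde ζ (f.eval ζ) := by
  funext i
  have h := mulPow_realPart (zOrd i) (modelPart f i) ζ
  rw [rhoTilde_eq_re, ← mulPow_modelPart]
  exact h

/-- Evaluation of discs at a boundary point. -/
noncomputable def Y.evalCLM (ζ : Circle) : Y k α →L[ℝ] Fin 8 → ℂ :=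
  ContinuousLinearMap.pi fun i => ((1 - (ζ : ℂ)) ^ yOrd i) •
    (CComplex.evalCLM hα.out.1 ζ).comp (comp i)

theorem Y.evalCLM_apply (ζ : Circle) (f : Y k α) : Y.evalCLM ζ f = f.eval ζ := rfl

/-- Evaluation of an element of `Z` at a boundary point. -/
noncomputable def Z.evalCLM (ζ : Circle) (i : Fin 8) : Z k α →L[ℝ] ℂ :=
  ((1 - (ζ : ℂ)) ^ zOrd i) • (CComplex.evalCLM hα.out.1 ζ).comp
    ((CZero k α (zOrd i)).subtypeL.comp (ContinuousLinearMap.proj i))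

theorem Z.evalCLM_apply (ζ : Circle) (i : Fin 8) (φ : Z k α) : Z.evalCLM ζ i φ = φ.eval ζ i := rfl

/-- The derivative `∂₂F(ρ, f₀)`. -/
noncomputable def modelDeriv : Y k α →L[ℝ] Z k α := fderiv ℝ modelMap initialDisc

theorem hasFDerivAt_modelMap :
    HasFDerivAt (modelMap : Y k α → Z k α) modelDeriv initialDisc :=
  (contDiff_modelMap.differentiable one_ne_zero).differentiableAt.hasFDerivAt

/-- Evaluation at a boundary point is a continuous linear map. The composite of evaluation with the
model map is differentiated in two ways, and derivatives are unique. -/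
theorem eval_modelDeriv (f : Y k α) (ζ : Circle) (i : Fin 8) : (modelDeriv f).eval ζ i =
    fderiv ℝ (fun q => rhoTilde ζ q i) (initialLift ζ) (f.eval ζ) := by
  have h0 : HasFDerivAt (modelMap : Y k α → Z k α) modelDeriv initialDisc := hasFDerivAt_modelMap
  have h1 := HasFDerivAt.comp (𝕜 := ℝ) (E := Y k α) (F := Z k α) (G := ℂ) (initialDisc : Y k α)
    (Z.evalCLM ζ i).hasFDerivAt h0
  have hd : DifferentiableAt ℝ (fun q => rhoTilde ζ q i) (initialLift ζ) := by
    obtain ⟨D, hD, -⟩ := exists_hasFDerivAt_polyRow ζ (initialLift ζ) i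
    have h := ((Complex.ofRealCLM.comp Complex.reCLM).hasFDerivAt
      (x := polyRow ζ (initialLift ζ) i)).comp (initialLift ζ) hD
    have e : (fun q => rhoTilde ζ q i) =
        (Complex.ofRealCLM.comp Complex.reCLM) ∘ fun q => polyRow ζ q i :=
      funext fun q => rhoTilde_eq_re ζ q i
    rw [e]
    exact h.differentiableAt
  rw [← eval_initialDisc (k := k) (α := α)] at hd ⊢
  have h2 := HasFDerivAt.comp (𝕜 := ℝ) (E := Y k α) (F := Fin 8 → ℂ) (G := ℂ) (initialDisc : Y k α)
    hd.hasFDerivAt (Y.evalCLM ζ).hasFDerivAt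
  have e : (Z.evalCLM (k := k) (α := α) ζ i) ∘ modelMap =
      (fun q => rhoTilde ζ q i) ∘ Y.evalCLM ζ :=
    funext fun f => congrFun (eval_modelMap f ζ) i
  rw [e] at h1
  exact DFunLike.congr_fun (h1.unique h2) f

theorem eval_modelDeriv_eq_symbol (f : Y k α) (ζ : Circle) (i : Fin 8) :
    (modelDeriv f).eval ζ i =
      ((2 * (∑ j, starRingEnd ℂ (symbol ζ i j) * f.eval ζ (col j)).re : ℝ) : ℂ) := by
  rw [eval_modelDeriv, fderiv_eq_two_mul_re fun v => by
    rw [fderiv_rhoTilde, Complex.ofReal_im]]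
  have hcol : Function.Bijective col := by decide
  have e : ∑ j, starRingEnd ℂ (wirtBar (fun q => rhoTilde ζ q i) (initialLift ζ) j) * f.eval ζ j =
      ∑ j, starRingEnd ℂ (symbol ζ i j) * f.eval ζ (col j) :=
    (hcol.sum_comp fun j =>
      starRingEnd ℂ (wirtBar (fun q => rhoTilde ζ q i) (initialLift ζ) j) * f.eval ζ j).symm
  rw [e]

/-- The linear operator `f ↦ ℓ(f)` with `∂₂F(ρ, f₀) f = Re ((1 - ζ)^m ℓ(f))`. -/
noncomputable def modelLin (f : Y k α) : Fin 8 → CComplex k α :=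
  let c := CComplex.conj (k := k) (α := α)
  let u : Fin 8 → CComplex k α := fun i => f i
  -- Along the initial disc, ζ³ from w̃₁ meets ζ⁻² from conj(1 - ζ)², leaving ζu and 2ζū. In χ₂ the
  -- factors ζ³ and -ζ⁻³ cancel and leave -2u - 3ū.
  let χ₁ := u 4 + CComplex.zp 1 * u 0 + (2 : ℝ) • (CComplex.zp 1 * c (u 0)) +
    (4 : ℝ) • (CComplex.zp (-2) * u 6)
  let χ₂ := u 5 - (2 : ℝ) • u 1 - (3 : ℝ) • c (u 1) - (6 : ℝ) • (CComplex.zp (-3) * u 7)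
  ![u 2 - (4 : ℝ) • ((CComplex.zp (-2) * (1 - CComplex.zp 1) ^ 3) * u 0),
    u 3 + (6 : ℝ) • ((CComplex.zp (-3) * (1 - CComplex.zp 1) ^ 5) * u 1),
    (2 : ℝ) • χ₁, cI * (2 : ℝ) • χ₁, (2 : ℝ) • χ₂, cI * (2 : ℝ) • χ₂,
    cI * (2 : ℝ) • (CComplex.zp (-3) * u 6), cI * (2 : ℝ) • (CComplex.zp (-3) * u 7)]

theorem modelDeriv_apply (f : Y k α) (i : Fin 8) :
    modelDeriv f i = realPart (zOrd i) (modelLin f i) := by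
  refine CZero.ext_off_one fun ζ => ?_
  have h := eval_modelDeriv f ζ i
  rw [fderiv_rhoTilde] at h
  rw [mulPow_realPart]
  refine h.trans ?_
  rw [Complex.re_eq_add_conj, Complex.re_eq_add_conj]
  have h2 : (ζ : ℂ) ^ (2 : ℤ) = (ζ : ℂ) ^ 2 := by norm_cast
  have h3 : (ζ : ℂ) ^ (3 : ℤ) = (ζ : ℂ) ^ 3 := by norm_cast
  have hζ := CComplex.circle_ne_zero ζ
  congr 1
  fin_cases i
  all_goals simp [modelLin, polyRowDeriv, Y.eval_apply, initialLift, yOrd, zOrd, deg, h2, h3,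
    CComplex.conj_circle, map_ofNat]
  all_goals field_simp
  all_goals ring

end StatDisc



namespace StatDisc

variable {k : ℕ} {α : ℝ≥0}

variable [hα : Fact (0 < α ∧ α < 1)]

/-! ### Surjectivity and the kernel of the linearized model -/

/-- The space of Taylor data complementing the range of the linearized model. -/
abbrev TaylorData : Type := (ℂ × ℂ × ℂ × ℝ) × (ℂ × ℂ × ℂ × ℝ) × ℂ × ℂ × ℂ

/-- The Taylor coefficients at the origin that parametrize the kernel. -/
noncomputable def taylor : Y k α →L[ℝ] TaylorData :=
  let m := CComplex.mean (k := k) (α := α)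
  let s := CComplex.shift (k := k) (α := α)
  let t : CComplex k α →L[ℝ] ℂ × ℂ × ℂ × ℝ := m.prod ((m.comp s).prod
    ((m.comp (s.comp s)).prod (Complex.reCLM.comp (m.comp (s.comp (s.comp s))))))
  (t.comp (comp 6)).prod ((t.comp (comp 7)).prod
    ((m.comp (comp 0)).prod (((m.comp s).comp (comp 0)).prod (m.comp (comp 1)))))

theorem taylor_apply (f : Y k α) : taylor f =
    ((CComplex.mean (f 6 : CComplex k α), CComplex.mean (CComplex.shift (f 6 : CComplex k α)),
      CComplex.mean (CComplex.shift (CComplex.shift (f 6 : CComplex k α))),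
      (CComplex.mean (CComplex.shift (CComplex.shift
        (CComplex.shift (f 6 : CComplex k α))))).re),
    (CComplex.mean (f 7 : CComplex k α), CComplex.mean (CComplex.shift (f 7 : CComplex k α)),
      CComplex.mean (CComplex.shift (CComplex.shift (f 7 : CComplex k α))),
      (CComplex.mean (CComplex.shift (CComplex.shift
        (CComplex.shift (f 7 : CComplex k α))))).re),
    CComplex.mean (f 0 : CComplex k α), CComplex.mean (CComplex.shift (f 0 : CComplex k α)),
    CComplex.mean (f 1 : CComplex k α)) := rfl

/-- The system is solved from the bottom: w̃ vanishes first, then the pairs (z̃, z), and what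
remains for w is a homogeneous problem with trivial kernel. -/
theorem modelDeriv_prod_taylor_injective :
    Function.Injective ((modelDeriv (k := k) (α := α)).prod taylor) := by
  rw [injective_iff_map_eq_zero]
  intro f hf
  have h1 : modelDeriv f = 0 := congrArg Prod.fst hf
  have h2 : taylor f = 0 := congrArg Prod.snd hf
  have h : ∀ i, realPart (zOrd i) (modelLin f i) = 0 := fun i => by
    rw [← modelDeriv_apply, h1]
    rfl
  rw [taylor_apply] at h2
  simp only [Prod.mk_eq_zero] at h2
  obtain ⟨⟨a0, a1, a2, a3⟩, ⟨b0, b1, b2, b3⟩, c0, c1, d0⟩ := h2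
  have e6 := eq_zero_of_realPart_zero (f 6).2 (h 6) a0 a1 a2 a3
  have e7 := eq_zero_of_realPart_zero (f 7).2 (h 7) b0 b1 b2 b3
  have e2 := eq_zero_of_realPart_pair (h 2) (h 3)
  have e4 := eq_zero_of_realPart_pair (h 4) (h 5)
  beta_reduce at e2 e4
  rw [e6, mul_zero, smul_zero, add_zero] at e2
  rw [e7, mul_zero, smul_zero, sub_zero] at e4
  obtain ⟨p4, p0⟩ := eq_zero_of_add_two_conj (f 4).2 (f 0).2 e2 c0 c1
  obtain ⟨p5, p1⟩ := eq_zero_of_sub_three_conj (f 5).2 (f 1).2 e4 d0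
  have q2 := h 0
  have q3 := h 1
  simp only [modelLin, Matrix.cons_val_zero, Matrix.cons_val_one, p0, p1, mul_zero, smul_zero,
    sub_zero, add_zero] at q2 q3
  have p2 := eq_zero_of_realPart_one (f 2).2 q2
  have p3 := eq_zero_of_realPart_one (f 3).2 q3
  funext i
  apply Subtype.ext
  fin_cases i
  exacts [p0, p1, p2, p3, p4, p5, e6, e7]

/-- The same triangular order as for injectivity: the components found earlier enter the later
equations as part of the right-hand side. -/
theorem modelDeriv_prod_taylor_surjective :
    Function.Surjective ((modelDeriv (k := k) (α := α)).prod taylor) := by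
  rintro ⟨φ, ⟨a0, a1, a2, a3⟩, ⟨b0, b1, b2, b3⟩, c0, c1, d0⟩
  obtain ⟨s, hs, es, s0, s1, s2, s3⟩ := exists_realPart_zero_eq (φ 6) a0 a1 a2 a3
  obtain ⟨s', hs', es', s0', s1', s2', s3'⟩ := exists_realPart_zero_eq (φ 7) b0 b1 b2 b3
  obtain ⟨t, ht, u, hu, etu, u0, u1⟩ := exists_eq_add_two_conj
    ((1 / 2 : ℝ) • ((φ 2 : CComplex k α) - cI * (φ 3 : CComplex k α)) -
      (4 : ℝ) • (CComplex.zp (-2) * s)) c0 c1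
  obtain ⟨t', ht', u', hu', etu', u0'⟩ := exists_eq_sub_three_conj
    ((1 / 2 : ℝ) • ((φ 4 : CComplex k α) - cI * (φ 5 : CComplex k α)) +
      (6 : ℝ) • (CComplex.zp (-3) * s')) d0
  let φ₀ : CZero k α 1 := φ 0
  let φ₁ : CZero k α 1 := φ 1
  obtain ⟨v, hv, ev⟩ := exists_realPart_one_eq (φ₀ +
    realPart 1 ((4 : ℝ) • ((CComplex.zp (-2) * (1 - CComplex.zp 1) ^ 3) * u)))
  obtain ⟨v', hv', ev'⟩ := exists_realPart_one_eq (φ₁ -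
    realPart 1 ((6 : ℝ) • ((CComplex.zp (-3) * (1 - CComplex.zp 1) ^ 5) * u')))
  have p2 := realPart_pair (φ 2) (φ 3) (t + CComplex.zp 1 * u +
    (2 : ℝ) • (CComplex.zp 1 * CComplex.conj u) + (4 : ℝ) • (CComplex.zp (-2) * s)) (by
      rw [etu, sub_add_cancel, smul_smul]
      norm_num)
  have p4 := realPart_pair (φ 4) (φ 5) (t' - (2 : ℝ) • u' - (3 : ℝ) • CComplex.conj u' -
    (6 : ℝ) • (CComplex.zp (-3) * s')) (by
      rw [etu', add_sub_cancel_right, smul_smul]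
      norm_num)
  let f : Y k α := ![⟨u, hu⟩, ⟨u', hu'⟩, ⟨v, hv⟩, ⟨v', hv'⟩, ⟨t, ht⟩, ⟨t', ht'⟩, ⟨s, hs⟩,
    ⟨s', hs'⟩]
  refine ⟨f, Prod.ext (funext fun i => ?_) ?_⟩
  · refine (modelDeriv_apply f i).trans ?_
    fin_cases i
    · exact (map_sub (realPart 1) _ _).trans (sub_eq_of_eq_add ev)
    · exact (map_add (realPart 1) _ _).trans (add_eq_of_eq_sub ev')
    · exact p2.1
    · exact p2.2
    · exact p4.1
    · exact p4.2
    · exact es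
    · exact es'
  · refine (taylor_apply f).trans ?_
    subst s0 s1 s2 s3 s0' s1' s2' s3' u0 u1 u0'
    rfl

/-- The linearized model together with the Taylor data is an isomorphism. -/
noncomputable def modelEquiv : Y k α ≃L[ℝ] Z k α × TaylorData :=
  ContinuousLinearEquiv.ofBijective (𝕜 := ℝ) (𝕜' := ℝ) (σ := RingHom.id ℝ)
    (σ' := RingHom.id ℝ) (E := Y k α) (F := Z k α × TaylorData)
    ((modelDeriv (k := k) (α := α)).prod taylor)
    (LinearMap.ker_eq_bot.2 modelDeriv_prod_taylor_injective)
    (LinearMap.range_eq_top.2 modelDeriv_prod_taylor_surjective)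

theorem modelEquiv_apply (f : Y k α) : modelEquiv f = (modelDeriv f, taylor f) := rfl

theorem modelDeriv_surjective : Function.Surjective (modelDeriv (k := k) (α := α)) := fun φ => by
  obtain ⟨f, hf⟩ := modelDeriv_prod_taylor_surjective (k := k) (α := α) (φ, 0)
  exact ⟨f, congrArg Prod.fst hf⟩

theorem finrank_taylorData : Module.finrank ℝ TaylorData = 20 := by
  simp [TaylorData, Module.finrank_prod]

/-- Since the derivative and the Taylor data together are bijective, the Taylor data alone identify
the kernel with `TaylorData`. -/
theorem finrank_ker_modelDeriv :
    Module.finrank ℝ (LinearMap.ker (modelDeriv (k := k) (α := α) : Y k α →ₗ[ℝ] Z k α)) = 20 := by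
  rw [← finrank_taylorData]
  refine LinearEquiv.finrank_eq (LinearEquiv.ofBijective
    ((taylor (k := k) (α := α) : Y k α →ₗ[ℝ] TaylorData).domRestrict
      (LinearMap.ker (modelDeriv (k := k) (α := α) : Y k α →ₗ[ℝ] Z k α))) ⟨?_, fun w => ?_⟩)
  · rintro ⟨f, hf⟩ ⟨g, hg⟩ h
    apply Subtype.ext
    apply modelDeriv_prod_taylor_injective
    exact Prod.ext (hf.trans hg.symm) h
  · obtain ⟨f, hf⟩ := modelDeriv_prod_taylor_surjective (k := k) (α := α) (0, w)
    exact ⟨⟨f, congrArg Prod.fst hf⟩, congrArg Prod.snd hf⟩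

end StatDisc



namespace StatDisc

/-! ### Direct sums of Birkhoff factorizations -/

theorem isSmoothHolGL_of_contDiff {N : ℕ} {B : ℂ → Matrix (Fin N) (Fin N) ℂ}
    (h : ∀ i j, ContDiff ℂ ∞ fun z => B z i j) (hd : ∀ z, IsUnit (B z).det) : IsSmoothHolGL B :=
  ⟨fun z _ => hd z, fun i j => ((h i j).restrict_scalars ℝ).contDiffOn,
    fun i j => ((h i j).differentiable (by simp)).differentiableOn⟩

theorem contDiff_circle_exp : ContDiff ℝ ∞ fun t : ℝ => (Circle.exp t : ℂ) := by
  simp only [Circle.coe_exp]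
  exact (Complex.ofRealCLM.contDiff.mul contDiff_const).cexp

theorem contDiff_circle_exp_inv : ContDiff ℝ ∞ fun t : ℝ => ((Circle.exp t : ℂ))⁻¹ :=
  contDiff_circle_exp.inv fun _ => CComplex.circle_ne_zero _

theorem det_fin_four (M : Matrix (Fin 4) (Fin 4) ℂ) : M.det =
    M 0 0 * (M 1 1 * (M 2 2 * M 3 3 - M 2 3 * M 3 2) - M 1 2 * (M 2 1 * M 3 3 - M 2 3 * M 3 1) +
      M 1 3 * (M 2 1 * M 3 2 - M 2 2 * M 3 1)) -
    M 0 1 * (M 1 0 * (M 2 2 * M 3 3 - M 2 3 * M 3 2) - M 1 2 * (M 2 0 * M 3 3 - M 2 3 * M 3 0) +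
      M 1 3 * (M 2 0 * M 3 2 - M 2 2 * M 3 0)) +
    M 0 2 * (M 1 0 * (M 2 1 * M 3 3 - M 2 3 * M 3 1) - M 1 1 * (M 2 0 * M 3 3 - M 2 3 * M 3 0) +
      M 1 3 * (M 2 0 * M 3 1 - M 2 1 * M 3 0)) -
    M 0 3 * (M 1 0 * (M 2 1 * M 3 2 - M 2 2 * M 3 1) - M 1 1 * (M 2 0 * M 3 2 - M 2 2 * M 3 0) +
      M 1 2 * (M 2 0 * M 3 1 - M 2 1 * M 3 0)) := by
  have h12 : Fin.succAbove (1 : Fin 4) 2 = 3 := rfl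
  have h22 : Fin.succAbove (2 : Fin 4) 2 = 3 := rfl
  have h32 : Fin.succAbove (3 : Fin 4) 2 = 2 := rfl
  rw [Matrix.det_succ_row_zero]
  simp [Fin.sum_univ_succ, Matrix.det_fin_three, h12, h22, h32]
  ring

theorem isUnit_det_map_conj {l : ℕ} {M : Matrix (Fin l) (Fin l) ℂ} (h : IsUnit M.det) :
    IsUnit (M.map (starRingEnd ℂ)).det := by
  have := h.map (starRingEnd ℂ)
  rwa [RingHom.map_det] at this

/-- Clearing the inverse of Ā reduces a factorization to a polynomial identity, which can be checked
entry by entry. -/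
theorem HasPartialIndices.of_mul_eq {N : ℕ} {A : Circle → Matrix (Fin N) (Fin N) ℂ}
    {B C : ℂ → Matrix (Fin N) (Fin N) ℂ} {κ : Fin N → ℤ}
    (hA : ∀ i j, ContDiff ℝ ∞ (lift fun ζ => A ζ i j)) (hd : ∀ ζ, IsUnit (A ζ).det)
    (hB : IsSmoothHolGL B) (hC : IsSmoothHolGL C)
    (h : ∀ ζ : Circle, (A ζ).map (starRingEnd ℂ) * (B ζ *
      Matrix.diagonal (fun j => (ζ : ℂ) ^ κ j) * C ((ζ : ℂ)⁻¹)) = -A ζ) :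
    HasPartialIndices A κ := by
  refine ⟨hA, hd, B, C, hB, hC, fun ζ => ?_⟩
  rw [← Matrix.mul_neg, ← h, Matrix.nonsing_inv_mul_cancel_left _ _ (isUnit_det_map_conj (hd ζ))]

/-- The direct sum of two square matrices, with rows and columns relabelled. -/
def directSum {m n N : ℕ} (e : Fin N ≃ Fin m ⊕ Fin n) (A : Matrix (Fin m) (Fin m) ℂ)
    (B : Matrix (Fin n) (Fin n) ℂ) : Matrix (Fin N) (Fin N) ℂ :=
  (Matrix.fromBlocks A 0 0 B).submatrix e e

section directSum

variable {m n N : ℕ} (e : Fin N ≃ Fin m ⊕ Fin n)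

theorem directSum_mul (A A' : Matrix (Fin m) (Fin m) ℂ) (B B' : Matrix (Fin n) (Fin n) ℂ) :
    directSum e A B * directSum e A' B' = directSum e (A * A') (B * B') := by
  simp [directSum, Matrix.submatrix_mul_equiv, Matrix.fromBlocks_multiply]

theorem directSum_neg (A : Matrix (Fin m) (Fin m) ℂ) (B : Matrix (Fin n) (Fin n) ℂ) :
    directSum e (-A) (-B) = -directSum e A B := by
  ext i j
  simp only [directSum, Matrix.neg_apply, Matrix.submatrix_apply]
  rcases e i with a | a <;> rcases e j with b | b <;> simp

theorem det_directSum (A : Matrix (Fin m) (Fin m) ℂ) (B : Matrix (Fin n) (Fin n) ℂ) :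
    (directSum e A B).det = A.det * B.det := by
  rw [directSum, Matrix.det_submatrix_equiv_self, Matrix.det_fromBlocks_zero₂₁]

theorem directSum_inv {A : Matrix (Fin m) (Fin m) ℂ} {B : Matrix (Fin n) (Fin n) ℂ}
    (hA : IsUnit A.det) (hB : IsUnit B.det) : (directSum e A B)⁻¹ = directSum e A⁻¹ B⁻¹ := by
  refine Matrix.inv_eq_right_inv ?_
  rw [directSum_mul, Matrix.mul_nonsing_inv A hA, Matrix.mul_nonsing_inv B hB, directSum,
    Matrix.fromBlocks_one, Matrix.submatrix_one_equiv]

theorem directSum_map (A : Matrix (Fin m) (Fin m) ℂ) (B : Matrix (Fin n) (Fin n) ℂ) :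
    (directSum e A B).map (starRingEnd ℂ) =
      directSum e (A.map (starRingEnd ℂ)) (B.map (starRingEnd ℂ)) := by
  ext i j
  simp only [directSum, Matrix.map_apply, Matrix.submatrix_apply]
  rcases e i with a | a <;> rcases e j with b | b <;> simp

theorem diagonal_directSum (d : Fin m → ℂ) (d' : Fin n → ℂ) :
    directSum e (Matrix.diagonal d) (Matrix.diagonal d') =
      Matrix.diagonal fun j => Sum.elim d d' (e j) := by
  rw [directSum, Matrix.fromBlocks_diagonal, Matrix.submatrix_diagonal_equiv]
  rfl

theorem directSum_induction {X : Type*} {A : X → Matrix (Fin m) (Fin m) ℂ}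
    {B : X → Matrix (Fin n) (Fin n) ℂ} {p : (X → ℂ) → Prop} (h0 : p fun _ => 0)
    (hA : ∀ i j, p fun x => A x i j) (hB : ∀ i j, p fun x => B x i j) (i j : Fin N) :
    p fun x => directSum e (A x) (B x) i j := by
  simp only [directSum, Matrix.submatrix_apply]
  rcases e i with a | a <;> rcases e j with b | b
  · exact hA a b
  · exact h0
  · exact h0
  · exact hB a b

theorem IsSmoothHolGL.directSum {A : ℂ → Matrix (Fin m) (Fin m) ℂ}
    {B : ℂ → Matrix (Fin n) (Fin n) ℂ} (hA : IsSmoothHolGL A) (hB : IsSmoothHolGL B) :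
    IsSmoothHolGL fun z => StatDisc.directSum e (A z) (B z) := by
  refine ⟨fun z hz => ?_, fun i j => ?_, fun i j => ?_⟩
  · rw [det_directSum]
    exact (hA.1 z hz).mul (hB.1 z hz)
  · exact directSum_induction e (p := fun f => ContDiffOn ℝ ∞ f (Metric.closedBall 0 1))
      contDiffOn_const hA.2.1 hB.2.1 i j
  · exact directSum_induction e (p := fun f => DifferentiableOn ℂ f (Metric.ball 0 1))
      (differentiableOn_const 0) hA.2.2 hB.2.2 i j

/-- Conjugation, inversion and multiplication all respect direct sums, so the factors of the
summands can be placed side by side. -/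
theorem HasPartialIndices.directSum {A : Circle → Matrix (Fin m) (Fin m) ℂ}
    {B : Circle → Matrix (Fin n) (Fin n) ℂ} {κ : Fin m → ℤ} {κ' : Fin n → ℤ}
    (hA : HasPartialIndices A κ) (hB : HasPartialIndices B κ') :
    HasPartialIndices (fun ζ => StatDisc.directSum e (A ζ) (B ζ))
      fun j => Sum.elim κ κ' (e j) := by
  obtain ⟨sA, uA, P, C, hP, hC, fA⟩ := hA
  obtain ⟨sB, uB, P', C', hP', hC', fB⟩ := hB
  have hu : ∀ ζ, IsUnit (StatDisc.directSum e (A ζ) (B ζ)).det := fun ζ => by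
    rw [det_directSum]
    exact (uA ζ).mul (uB ζ)
  refine ⟨directSum_induction e (p := fun f : Circle → ℂ => ContDiff ℝ ∞ (lift f))
    contDiff_const sA sB, hu, _, _, hP.directSum e hP', hC.directSum e hC', fun ζ => ?_⟩
  have hc : ∀ {l : ℕ} {M : Matrix (Fin l) (Fin l) ℂ}, IsUnit M.det →
      IsUnit (M.map (starRingEnd ℂ)).det := fun h => isUnit_det_map_conj h
  have e1 : (fun j => (ζ : ℂ) ^ (Sum.elim κ κ' (e j))) =
      fun j => Sum.elim (fun i => (ζ : ℂ) ^ κ i) (fun i => (ζ : ℂ) ^ κ' i) (e j) := by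
    funext j
    rcases e j with a | a <;> rfl
  rw [e1, ← diagonal_directSum, directSum_mul, directSum_mul, ← fA, ← fB, directSum_neg]
  rw [← directSum_mul, directSum_map, directSum_inv e (hc (uA ζ)) (hc (uB ζ))]

end directSum

/-! ### Explicit Birkhoff factorizations of the two summands -/

/-- The summand of the desingularized symbol of index `1` at `z`, where
`y = z⁻¹`. -/
noncomputable def symbolOne (z y : ℂ) : Matrix (Fin 4) (Fin 4) ℂ :=
  !![1 / 2, 2 * z * (1 - z), 0, 0;
    0, -2 * z ^ 4 + y, 1, 4 * (1 - y) * (1 - z) ^ 2;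
    0, Complex.I * (-2 * z ^ 4 - y), -Complex.I, -Complex.I * (4 * (1 - y) * (1 - z) ^ 2);
    0, 0, 0, -Complex.I * z ^ 3]

/-- The matrix `-\bar{A}⁻¹ A` for `A = symbolOne`. -/
noncomputable def quotientOne (z : ℂ) : Matrix (Fin 4) (Fin 4) ℂ :=
  !![-1,
      -2 * z + 2 * z ^ 2,
      2 * z ^ 2 - 2 * z ^ 3,
      -8 * z + 32 * z ^ 2 - 48 * z ^ 3 + 32 * z ^ 4 - 8 * z ^ 5;
    0,
      1 / 2 * z ^ 3,
      1 / 2 * z ^ 4,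
      -2 * z ^ 3 + 6 * z ^ 4 - 6 * z ^ 5 + 2 * z ^ 6;
    0,
      3 / 2 * z ^ 4,
      -1 / 2 * z ^ 5,
      -2 * z ^ 4 + 6 * z ^ 5 - 6 * z ^ 6 + 2 * z ^ 7;
    0,
      0,
      0,
      z ^ 6]

/-- The left Birkhoff factor of `quotientOne`. -/
noncomputable def birkhoffPlusOne (z : ℂ) : Matrix (Fin 4) (Fin 4) ℂ :=
  !![1 - 9 * z + 8 / 5 * z ^ 2,
      -5 + z,
      1 - 2 / 5 * z,
      -12;
    8 / 5 * z + 37 / 20 * z ^ 2 - 2 / 5 * z ^ 3,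
      1 + z - 1 / 4 * z ^ 2,
      -3 / 20 - 3 / 20 * z + 1 / 10 * z ^ 2,
      3 + 3 * z;
    -3 * z - 32 / 5 * z ^ 2 + 37 / 20 * z ^ 3 - 2 / 5 * z ^ 4,
      -4 * z + z ^ 2 - 1 / 4 * z ^ 3,
      1 - 3 / 20 * z - 3 / 20 * z ^ 2 + 1 / 10 * z ^ 3,
      -17 * z + 3 * z ^ 2;
    3 / 8 * z + 13 / 40 * z ^ 2 - 1 / 5 * z ^ 3,
      1 / 8 * z - 1 / 8 * z ^ 2,
      3 / 40 * z + 1 / 20 * z ^ 2,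
      1 + 3 / 2 * z]

/-- The right Birkhoff factor of `quotientOne`, in the variable `w = z⁻¹`. -/
noncomputable def birkhoffMinusOne (w : ℂ) : Matrix (Fin 4) (Fin 4) ℂ :=
  !![-1 / 8 * w - 11 / 8 * w ^ 2 - w ^ 3,
      5 - 3 / 4 * w - 2 * w ^ 2,
      3 / 4 + 2 * w,
      -15 + 21 * w - 8 * w ^ 2;
    1 / 5 + 11 / 40 * w + 1 / 40 * w ^ 2,
      1 + 1 / 20 * w,
      -1 / 20,
      -3 / 5 + 1 / 5 * w;
    -9 / 2 * w ^ 2 - 3 * w ^ 3,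
      20 - 3 * w - 6 * w ^ 2,
      3 + 6 * w,
      -40 + 60 * w - 24 * w ^ 2;
    1 / 2 * w ^ 2 + 3 / 8 * w ^ 3,
      -2 + 1 / 4 * w + 3 / 4 * w ^ 2,
      -1 / 4 - 3 / 4 * w,
      6 - 8 * w + 3 * w ^ 2]

theorem birkhoffOne {z : ℂ} (hz : z ≠ 0) :
    birkhoffPlusOne z * Matrix.diagonal (fun j => z ^ ((![3, 3, 4, 4] : Fin 4 → ℤ) j)) *
      birkhoffMinusOne z⁻¹ = quotientOne z := by
  ext i j
  rw [Matrix.mul_apply]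
  simp only [Matrix.mul_diagonal, Fin.sum_univ_four]
  fin_cases i <;> fin_cases j <;>
    simp [birkhoffPlusOne, birkhoffMinusOne, quotientOne, zpow_ofNat] <;> field_simp <;> ring

theorem map_symbolOne_mul (ζ : Circle) :
    (symbolOne ζ (ζ : ℂ)⁻¹).map (starRingEnd ℂ) * quotientOne ζ = -symbolOne ζ (ζ : ℂ)⁻¹ := by
  have hζ := CComplex.circle_ne_zero ζ
  ext i j
  rw [Matrix.mul_apply, Fin.sum_univ_four]
  fin_cases i <;> fin_cases j <;>
    simp [symbolOne, quotientOne, map_ofNat] <;> field_simp <;> ring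

theorem contDiff_symbolOne {f g : ℝ → ℂ} (hf : ContDiff ℝ ∞ f) (hg : ContDiff ℝ ∞ g)
    (i j : Fin 4) : ContDiff ℝ ∞ fun t => symbolOne (f t) (g t) i j := by
  fin_cases i <;> fin_cases j <;> simp [symbolOne] <;> fun_prop

/-- Both factors have determinant 1, hence are invertible everywhere. The sum 14 is the winding
number of det A / conj(det A) with det A = 2ζ⁷. The individual indices differ from those of the
block-diagonal part, but the sum does not. -/
theorem hasPartialIndices_symbolOne :
    HasPartialIndices (fun ζ : Circle => symbolOne ζ (ζ : ℂ)⁻¹) ![3, 3, 4, 4] := by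
  refine HasPartialIndices.of_mul_eq (B := birkhoffPlusOne) (C := birkhoffMinusOne)
    (fun i j => ?_) (fun ζ => ?_) (isSmoothHolGL_of_contDiff (fun i j => ?_) fun z => ?_)
    (isSmoothHolGL_of_contDiff (fun i j => ?_) fun z => ?_) fun ζ => ?_
  · exact contDiff_symbolOne contDiff_circle_exp contDiff_circle_exp_inv i j
  · have h : (symbolOne ζ (ζ : ℂ)⁻¹).det = 2 * (ζ : ℂ) ^ 7 := by
      rw [det_fin_four]
      simp [symbolOne]
      linear_combination (-2 * (ζ : ℂ) ^ 7) * Complex.I_sq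
    rw [h]
    simp
  · fin_cases i <;> fin_cases j <;> simp [birkhoffPlusOne] <;> fun_prop
  · have h : (birkhoffPlusOne z).det = 1 := by
      rw [det_fin_four]
      simp [birkhoffPlusOne]
      ring
    rw [h]
    simp
  · fin_cases i <;> fin_cases j <;> simp [birkhoffMinusOne] <;> fun_prop
  · have h : (birkhoffMinusOne z).det = 1 := by
      rw [det_fin_four]
      simp [birkhoffMinusOne]
      ring
    rw [h]
    simp
  · rw [birkhoffOne (CComplex.circle_ne_zero ζ), map_symbolOne_mul]

/-- The summand of the desingularized symbol of index `1`, without the entries off the diagonal blocks, at `z`, where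
`y = z⁻¹`. -/
noncomputable def symbolOneDiag (z y : ℂ) : Matrix (Fin 4) (Fin 4) ℂ :=
  !![1 / 2, 0, 0, 0;
    0, -2 * z ^ 4 + y, 1, 0;
    0, Complex.I * (-2 * z ^ 4 - y), -Complex.I, 0;
    0, 0, 0, -Complex.I * z ^ 3]

/-- The matrix `-\bar{A}⁻¹ A` for `A = symbolOneDiag`. -/
noncomputable def quotientOneDiag (z : ℂ) : Matrix (Fin 4) (Fin 4) ℂ :=
  !![-1, 0, 0, 0; 0, z ^ 3 / 2, z ^ 4 / 2, 0; 0, 3 * z ^ 4 / 2, -z ^ 5 / 2, 0; 0, 0, 0, z ^ 6]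

/-- The left Birkhoff factor of `quotientOneDiag`. -/
noncomputable def birkhoffPlusOneDiag (z : ℂ) : Matrix (Fin 4) (Fin 4) ℂ :=
  !![1, 0, 0, 0; 0, 1, 0, 0; 0, -z, 1, 0; 0, 0, 0, 1]

/-- The right Birkhoff factor of `quotientOneDiag`, in the variable `w = z⁻¹`. -/
noncomputable def birkhoffMinusOneDiag (w : ℂ) : Matrix (Fin 4) (Fin 4) ℂ :=
  !![-1, 0, 0, 0; 0, w / 2, 1 / 2, 0; 0, 2, 0, 0; 0, 0, 0, 1]

theorem birkhoffOneDiag {z : ℂ} (hz : z ≠ 0) :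
    birkhoffPlusOneDiag z * Matrix.diagonal (fun j => z ^ ((![0, 4, 4, 6] : Fin 4 → ℤ) j)) *
      birkhoffMinusOneDiag z⁻¹ = quotientOneDiag z := by
  ext i j
  rw [Matrix.mul_apply]
  simp only [Matrix.mul_diagonal, Fin.sum_univ_four]
  fin_cases i <;> fin_cases j <;>
    simp [birkhoffPlusOneDiag, birkhoffMinusOneDiag, quotientOneDiag, zpow_ofNat] <;> field_simp <;> ring

theorem map_symbolOneDiag_mul (ζ : Circle) :
    (symbolOneDiag ζ (ζ : ℂ)⁻¹).map (starRingEnd ℂ) * quotientOneDiag ζ = -symbolOneDiag ζ (ζ : ℂ)⁻¹ := by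
  have hζ := CComplex.circle_ne_zero ζ
  ext i j
  rw [Matrix.mul_apply, Fin.sum_univ_four]
  fin_cases i <;> fin_cases j <;>
    simp [symbolOneDiag, quotientOneDiag, map_ofNat] <;> field_simp <;> ring

theorem contDiff_symbolOneDiag {f g : ℝ → ℂ} (hf : ContDiff ℝ ∞ f) (hg : ContDiff ℝ ∞ g)
    (i j : Fin 4) : ContDiff ℝ ∞ fun t => symbolOneDiag (f t) (g t) i j := by
  fin_cases i <;> fin_cases j <;> simp [symbolOneDiag] <;> fun_prop

/-- The quotient splits into -1, a 2×2 block and ζ⁶. In the block, a shear with entry -z removes the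
multiple of the first row contained in the second, and both indices become 4. -/
theorem hasPartialIndices_symbolOneDiag :
    HasPartialIndices (fun ζ : Circle => symbolOneDiag ζ (ζ : ℂ)⁻¹) ![0, 4, 4, 6] := by
  refine HasPartialIndices.of_mul_eq (B := birkhoffPlusOneDiag) (C := birkhoffMinusOneDiag)
    (fun i j => ?_) (fun ζ => ?_) (isSmoothHolGL_of_contDiff (fun i j => ?_) fun z => ?_)
    (isSmoothHolGL_of_contDiff (fun i j => ?_) fun z => ?_) fun ζ => ?_
  · exact contDiff_symbolOneDiag contDiff_circle_exp contDiff_circle_exp_inv i j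
  · have h : (symbolOneDiag ζ (ζ : ℂ)⁻¹).det = 2 * (ζ : ℂ) ^ 7 := by
      rw [det_fin_four]
      simp [symbolOneDiag]
      linear_combination (-2 * (ζ : ℂ) ^ 7) * Complex.I_sq
    rw [h]
    simp
  · fin_cases i <;> fin_cases j <;> simp [birkhoffPlusOneDiag] <;> fun_prop
  · have h : (birkhoffPlusOneDiag z).det = 1 := by
      rw [det_fin_four]
      simp [birkhoffPlusOneDiag]
    rw [h]
    simp
  · fin_cases i <;> fin_cases j <;> simp [birkhoffMinusOneDiag] <;> fun_prop
  · have h : (birkhoffMinusOneDiag z).det = 1 := by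
      rw [det_fin_four]
      simp [birkhoffMinusOneDiag]
    rw [h]
    simp
  · rw [birkhoffOneDiag (CComplex.circle_ne_zero ζ), map_symbolOneDiag_mul]

/-- The summand of the desingularized symbol of index `2` at `z`, where
`y = z⁻¹`. -/
noncomputable def symbolTwo (z y : ℂ) : Matrix (Fin 4) (Fin 4) ℂ :=
  !![1 / 2, -3 * z ^ 2 * (1 - z), 0, 0;
    0, 3 * z ^ 5 - 2, 1, 6 * (1 - y) ^ 2 * (1 - z) ^ 3;
    0, Complex.I * (3 * z ^ 5 + 2), -Complex.I, -Complex.I * (6 * (1 - y) ^ 2 * (1 - z) ^ 3);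
    0, 0, 0, -Complex.I * z ^ 3]

/-- The matrix `-\bar{A}⁻¹ A` for `A = symbolTwo`. -/
noncomputable def quotientTwo (z : ℂ) : Matrix (Fin 4) (Fin 4) ℂ :=
  !![-1,
      2 * z ^ 2 - 2 * z ^ 3,
      2 * z ^ 2 - 2 * z ^ 3,
      12 - 72 * z + 180 * z ^ 2 - 240 * z ^ 3 + 180 * z ^ 4 - 72 * z ^ 5 + 12 * z ^ 6;
    0,
      2 / 3 * z ^ 5,
      -1 / 3 * z ^ 5,
      -2 * z ^ 3 + 10 * z ^ 4 - 20 * z ^ 5 + 20 * z ^ 6 - 10 * z ^ 7 + 2 * z ^ 8;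
    0,
      -5 / 3 * z ^ 5,
      -2 / 3 * z ^ 5,
      2 * z ^ 3 - 10 * z ^ 4 + 20 * z ^ 5 - 20 * z ^ 6 + 10 * z ^ 7 - 2 * z ^ 8;
    0,
      0,
      0,
      z ^ 6]

/-- The left Birkhoff factor of `quotientTwo`. -/
noncomputable def birkhoffPlusTwo (z : ℂ) : Matrix (Fin 4) (Fin 4) ℂ :=
  !![1 - 1 / 3 * z + 1 / 21 * z ^ 2,
      8 / 5 - 14 / 15 * z + 4 / 21 * z ^ 2,
      0,
      -504 / 5 + 164 / 5 * z - 4 * z ^ 2;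
    125 / 126 * z + 5 / 42 * z ^ 2 - 1 / 21 * z ^ 3 + 1 / 126 * z ^ 4,
      1 + 40 / 63 * z + 1 / 7 * z ^ 2 - 13 / 105 * z ^ 3 + 2 / 63 * z ^ 4,
      -1,
      -40 - 256 / 3 * z - 12 * z ^ 2 + 24 / 5 * z ^ 3 - 2 / 3 * z ^ 4;
    -10 / 63 * z - 5 / 42 * z ^ 2 + 1 / 21 * z ^ 3 - 1 / 126 * z ^ 4,
      -19 / 63 * z - 1 / 7 * z ^ 2 + 13 / 105 * z ^ 3 - 2 / 63 * z ^ 4,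
      1,
      -2 + 46 / 3 * z + 12 * z ^ 2 - 24 / 5 * z ^ 3 + 2 / 3 * z ^ 4;
    -1 / 252 * z + 1 / 252 * z ^ 2,
      11 / 630 * z + 1 / 63 * z ^ 2,
      0,
      1 + 11 / 15 * z - 1 / 3 * z ^ 2]

/-- The right Birkhoff factor of `quotientTwo`, in the variable `w = z⁻¹`. -/
noncomputable def birkhoffMinusTwo (w : ℂ) : Matrix (Fin 4) (Fin 4) ℂ :=
  !![-1 - 9 / 5 * w - 9 / 5 * w ^ 2 - w ^ 3,
      8 / 5 + 2 * w,
      8 / 5 + 2 * w,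
      -168 / 5 + 72 * w - 252 / 5 * w ^ 2 + 12 * w ^ 3;
    1 / 2 * w ^ 2 + 2 / 3 * w ^ 3,
      1 / 3 - 4 / 3 * w,
      1 / 3 - 4 / 3 * w,
      70 - 84 * w + 42 * w ^ 2 - 8 * w ^ 3;
    -1 / 6 * w ^ 3 - 1 / 6 * w ^ 4,
      -2 + 1 / 3 * w ^ 2,
      -1 + 1 / 3 * w ^ 2,
      10 - 20 * w + 20 * w ^ 2 - 10 * w ^ 3 + 2 * w ^ 4;
    -1 / 84 * w - 1 / 84 * w ^ 2 - 1 / 252 * w ^ 3,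
      1 / 63 + 1 / 126 * w,
      1 / 63 + 1 / 126 * w,
      1 / 3 - 1 / 7 * w ^ 2 + 1 / 21 * w ^ 3]

theorem birkhoffTwo {z : ℂ} (hz : z ≠ 0) :
    birkhoffPlusTwo z * Matrix.diagonal (fun j => z ^ ((![3, 4, 5, 4] : Fin 4 → ℤ) j)) *
      birkhoffMinusTwo z⁻¹ = quotientTwo z := by
  ext i j
  rw [Matrix.mul_apply]
  simp only [Matrix.mul_diagonal, Fin.sum_univ_four]
  fin_cases i <;> fin_cases j <;>
    simp [birkhoffPlusTwo, birkhoffMinusTwo, quotientTwo, zpow_ofNat] <;> field_simp <;> ring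

theorem map_symbolTwo_mul (ζ : Circle) :
    (symbolTwo ζ (ζ : ℂ)⁻¹).map (starRingEnd ℂ) * quotientTwo ζ = -symbolTwo ζ (ζ : ℂ)⁻¹ := by
  have hζ := CComplex.circle_ne_zero ζ
  ext i j
  rw [Matrix.mul_apply, Fin.sum_univ_four]
  fin_cases i <;> fin_cases j <;>
    simp [symbolTwo, quotientTwo, map_ofNat] <;> field_simp <;> ring

theorem contDiff_symbolTwo {f g : ℝ → ℂ} (hf : ContDiff ℝ ∞ f) (hg : ContDiff ℝ ∞ g)
    (i j : Fin 4) : ContDiff ℝ ∞ fun t => symbolTwo (f t) (g t) i j := by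
  fin_cases i <;> fin_cases j <;> simp [symbolTwo] <;> fun_prop

/-- As for the first summand; now det A = -3ζ⁸ and the indices add up to 16, so the Maslov index of
the direct sum is 14 + 16 = 30. -/
theorem hasPartialIndices_symbolTwo :
    HasPartialIndices (fun ζ : Circle => symbolTwo ζ (ζ : ℂ)⁻¹) ![3, 4, 5, 4] := by
  refine HasPartialIndices.of_mul_eq (B := birkhoffPlusTwo) (C := birkhoffMinusTwo)
    (fun i j => ?_) (fun ζ => ?_) (isSmoothHolGL_of_contDiff (fun i j => ?_) fun z => ?_)
    (isSmoothHolGL_of_contDiff (fun i j => ?_) fun z => ?_) fun ζ => ?_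
  · exact contDiff_symbolTwo contDiff_circle_exp contDiff_circle_exp_inv i j
  · have h : (symbolTwo ζ (ζ : ℂ)⁻¹).det = -3 * (ζ : ℂ) ^ 8 := by
      rw [det_fin_four]
      simp [symbolTwo]
      linear_combination (3 * (ζ : ℂ) ^ 8) * Complex.I_sq
    rw [h]
    simp
  · fin_cases i <;> fin_cases j <;> simp [birkhoffPlusTwo] <;> fun_prop
  · have h : (birkhoffPlusTwo z).det = 1 := by
      rw [det_fin_four]
      simp [birkhoffPlusTwo]
      ring
    rw [h]
    simp
  · fin_cases i <;> fin_cases j <;> simp [birkhoffMinusTwo] <;> fun_prop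
  · have h : (birkhoffMinusTwo z).det = 1 := by
      rw [det_fin_four]
      simp [birkhoffMinusTwo]
      ring
    rw [h]
    simp
  · rw [birkhoffTwo (CComplex.circle_ne_zero ζ), map_symbolTwo_mul]

/-- The summand of the desingularized symbol of index `2`, without the entries off the diagonal blocks, at `z`, where
`y = z⁻¹`. -/
noncomputable def symbolTwoDiag (z y : ℂ) : Matrix (Fin 4) (Fin 4) ℂ :=
  !![1 / 2, 0, 0, 0;
    0, 3 * z ^ 5 - 2, 1, 0;
    0, Complex.I * (3 * z ^ 5 + 2), -Complex.I, 0;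
    0, 0, 0, -Complex.I * z ^ 3]

/-- The matrix `-\bar{A}⁻¹ A` for `A = symbolTwoDiag`. -/
noncomputable def quotientTwoDiag (z : ℂ) : Matrix (Fin 4) (Fin 4) ℂ :=
  !![-1, 0, 0, 0; 0, 2 * z ^ 5 / 3, -z ^ 5 / 3, 0; 0, -5 * z ^ 5 / 3, -2 * z ^ 5 / 3, 0;
    0, 0, 0, z ^ 6]

/-- The left Birkhoff factor of `quotientTwoDiag`. -/
noncomputable def birkhoffPlusTwoDiag (_ : ℂ) : Matrix (Fin 4) (Fin 4) ℂ :=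
  !![1, 0, 0, 0; 0, 1, 0, 0; 0, 0, 1, 0; 0, 0, 0, 1]

/-- The right Birkhoff factor of `quotientTwoDiag`, in the variable `w = z⁻¹`. -/
noncomputable def birkhoffMinusTwoDiag (_ : ℂ) : Matrix (Fin 4) (Fin 4) ℂ :=
  !![-1, 0, 0, 0; 0, 2 / 3, -1 / 3, 0; 0, -5 / 3, -2 / 3, 0; 0, 0, 0, 1]

theorem birkhoffTwoDiag {z : ℂ} (hz : z ≠ 0) :
    birkhoffPlusTwoDiag z * Matrix.diagonal (fun j => z ^ ((![0, 5, 5, 6] : Fin 4 → ℤ) j)) *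
      birkhoffMinusTwoDiag z⁻¹ = quotientTwoDiag z := by
  ext i j
  rw [Matrix.mul_apply]
  simp only [Matrix.mul_diagonal, Fin.sum_univ_four]
  fin_cases i <;> fin_cases j <;>
    simp [birkhoffPlusTwoDiag, birkhoffMinusTwoDiag, quotientTwoDiag, zpow_ofNat] <;> field_simp

theorem map_symbolTwoDiag_mul (ζ : Circle) :
    (symbolTwoDiag ζ (ζ : ℂ)⁻¹).map (starRingEnd ℂ) * quotientTwoDiag ζ = -symbolTwoDiag ζ (ζ : ℂ)⁻¹ := by
  have hζ := CComplex.circle_ne_zero ζ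
  ext i j
  rw [Matrix.mul_apply, Fin.sum_univ_four]
  fin_cases i <;> fin_cases j <;>
    simp [symbolTwoDiag, quotientTwoDiag, map_ofNat] <;> field_simp <;> ring

theorem contDiff_symbolTwoDiag {f g : ℝ → ℂ} (hf : ContDiff ℝ ∞ f) (hg : ContDiff ℝ ∞ g)
    (i j : Fin 4) : ContDiff ℝ ∞ fun t => symbolTwoDiag (f t) (g t) i j := by
  fin_cases i <;> fin_cases j <;> simp [symbolTwoDiag] <;> fun_prop

/-- The middle 2×2 block of the quotient is ζ⁵ times a constant matrix, so the left factor can be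
the identity. -/
theorem hasPartialIndices_symbolTwoDiag :
    HasPartialIndices (fun ζ : Circle => symbolTwoDiag ζ (ζ : ℂ)⁻¹) ![0, 5, 5, 6] := by
  refine HasPartialIndices.of_mul_eq (B := birkhoffPlusTwoDiag) (C := birkhoffMinusTwoDiag)
    (fun i j => ?_) (fun ζ => ?_) (isSmoothHolGL_of_contDiff (fun i j => ?_) fun z => ?_)
    (isSmoothHolGL_of_contDiff (fun i j => ?_) fun z => ?_) fun ζ => ?_
  · exact contDiff_symbolTwoDiag contDiff_circle_exp contDiff_circle_exp_inv i j
  · have h : (symbolTwoDiag ζ (ζ : ℂ)⁻¹).det = -3 * (ζ : ℂ) ^ 8 := by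
      rw [det_fin_four]
      simp [symbolTwoDiag]
      linear_combination (3 * (ζ : ℂ) ^ 8) * Complex.I_sq
    rw [h]
    simp
  · fin_cases i <;> fin_cases j <;> simp [birkhoffPlusTwoDiag] <;> fun_prop
  · have h : (birkhoffPlusTwoDiag z).det = 1 := by
      rw [det_fin_four]
      simp [birkhoffPlusTwoDiag]
    rw [h]
    simp
  · fin_cases i <;> fin_cases j <;> simp [birkhoffMinusTwoDiag] <;> fun_prop
  · have h : (birkhoffMinusTwoDiag z).det = 1 := by
      rw [det_fin_four]
      simp [birkhoffMinusTwoDiag]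
      ring
    rw [h]
    simp
  · rw [birkhoffTwoDiag (CComplex.circle_ne_zero ζ), map_symbolTwoDiag_mul]

end StatDisc



namespace StatDisc

/-! ### The desingularized symbol -/

/-- The coefficients of the derivatives of `ρ̃` along the initial lift, in the coordinates
`(z₁, z₂, w₁, w₂, z̃₁, z̃₂, w̃₁, w̃₂)`; here `b = 1 - ζ` and `y = ζ⁻¹`. -/
noncomputable def coeffHol (z y : ℂ) : Matrix (Fin 8) (Fin 8) ℂ :=
  !![-2 * (1 - z) * (1 - y) ^ 2, 0, 1, 0, 0, 0, 0, 0;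
    0, -3 * (1 - z) ^ 2 * (1 - y) ^ 3, 0, 1, 0, 0, 0, 0;
    2 * z ^ 3 * (1 - y) ^ 2, 0, 0, 0, 2, 0, 8 * (1 - z) * (1 - y) ^ 2, 0;
    Complex.I * (2 * z ^ 3 * (1 - y) ^ 2), 0, 0, 0, Complex.I * 2, 0,
      Complex.I * (8 * (1 - z) * (1 - y) ^ 2), 0;
    0, 4 * z ^ 3 * (1 - z) * (1 - y) ^ 3, 0, 0, 0, 2, 0, 12 * (1 - z) ^ 2 * (1 - y) ^ 3;
    0, Complex.I * (4 * z ^ 3 * (1 - z) * (1 - y) ^ 3), 0, 0, 0, Complex.I * 2, 0,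
      Complex.I * (12 * (1 - z) ^ 2 * (1 - y) ^ 3);
    0, 0, 0, 0, 0, 0, Complex.I * (2 * y ^ 3), 0;
    0, 0, 0, 0, 0, 0, 0, Complex.I * (2 * y ^ 3)]

/-- The coefficients of the conjugate derivatives; see `coeffHol`. -/
noncomputable def coeffBar (z y : ℂ) : Matrix (Fin 8) (Fin 8) ℂ :=
  !![-2 * (1 - z) ^ 2 * (1 - y), 0, 0, 0, 0, 0, 0, 0;
    0, -3 * (1 - z) ^ 3 * (1 - y) ^ 2, 0, 0, 0, 0, 0, 0;
    4 * z ^ 3 * (1 - z) * (1 - y), 0, 0, 0, 0, 0, 0, 0;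
    Complex.I * (4 * z ^ 3 * (1 - z) * (1 - y)), 0, 0, 0, 0, 0, 0, 0;
    0, 6 * z ^ 3 * (1 - z) ^ 2 * (1 - y) ^ 2, 0, 0, 0, 0, 0, 0;
    0, Complex.I * (6 * z ^ 3 * (1 - z) ^ 2 * (1 - y) ^ 2), 0, 0, 0, 0, 0, 0;
    0, 0, 0, 0, 0, 0, 0, 0;
    0, 0, 0, 0, 0, 0, 0, 0]

theorem polyRowDeriv_initialLift (ζ : Circle) (v : Fin 8 → ℂ) (i : Fin 8) :
    polyRowDeriv ζ (initialLift ζ) v i = ∑ j, (coeffHol ζ (ζ : ℂ)⁻¹ i j * v j +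
      coeffBar ζ (ζ : ℂ)⁻¹ i j * starRingEnd ℂ (v j)) := by
  rw [Fin.sum_univ_eight]
  fin_cases i <;> simp [polyRowDeriv, initialLift, coeffHol, coeffBar] <;> ring

/-- Each row is the real part of a function φ, and ∂̄(Re φ) = (∂̄φ + conj(∂φ))/2. -/
theorem symbol_apply (ζ : Circle) (i j : Fin 8) : symbol ζ i j =
    (coeffBar ζ (ζ : ℂ)⁻¹ i (col j) + starRingEnd ℂ (coeffHol ζ (ζ : ℂ)⁻¹ i (col j))) / 2 := by
  have h : ∀ c : ℂ, polyRowDeriv ζ (initialLift ζ) (Pi.single (col j) c) i =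
      coeffHol ζ (ζ : ℂ)⁻¹ i (col j) * c + coeffBar ζ (ζ : ℂ)⁻¹ i (col j) * starRingEnd ℂ c := by
    intro c
    rw [polyRowDeriv_initialLift, Finset.sum_eq_single (col j)]
    · simp
    · intro l _ hl
      simp [Pi.single_eq_of_ne hl]
    · simp
  rw [symbol, Matrix.of_apply, wirtBar, fderiv_rhoTilde, fderiv_rhoTilde, h, h]
  generalize coeffHol ζ (ζ : ℂ)⁻¹ i (col j) = p
  generalize coeffBar ζ (ζ : ℂ)⁻¹ i (col j) = q
  apply Complex.ext <;> simp <;> ring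

/-- The splitting of the columns `(w₁, w₂, z₁, z̃₁, z₂, z̃₂, w̃₁, w̃₂)` of the symbol. -/
def splitEquiv : Fin 8 ≃ Fin 4 ⊕ Fin 4 where
  toFun := ![.inl 0, .inr 0, .inl 1, .inl 2, .inr 1, .inr 2, .inl 3, .inr 3]
  invFun := Sum.elim ![0, 2, 3, 6] ![1, 4, 5, 7]
  left_inv := by decide
  right_inv := by decide

/-- The desingularized symbol. -/
noncomputable def desingularized (ζ : Circle) : Matrix (Fin 8) (Fin 8) ℂ :=
  directSum splitEquiv (symbolOne ζ (ζ : ℂ)⁻¹) (symbolTwo ζ (ζ : ℂ)⁻¹)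

theorem blockDiagPart_desingularized (ζ : Circle) : blockDiagPart (desingularized ζ) =
    directSum splitEquiv (symbolOneDiag ζ (ζ : ℂ)⁻¹) (symbolTwoDiag ζ (ζ : ℂ)⁻¹) := by
  ext i j
  fin_cases i <;> fin_cases j <;>
    simp [blockDiagPart, desingularized, directSum, splitEquiv, blk, symbolOne, symbolTwo,
      symbolOneDiag, symbolTwoDiag]

theorem blockTriangular_desingularized (ζ : Circle) :
    (desingularized ζ).BlockTriangular blk := by
  intro i j
  fin_cases i <;> fin_cases j <;>
    simp [desingularized, directSum, splitEquiv, blk, symbolOne, symbolTwo]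

theorem symbol_eq_desingularized_mul (ζ : Circle) :
    symbol ζ = desingularized ζ * degenFactor ζ := by
  have hζ := CComplex.circle_ne_zero ζ
  ext i j
  rw [symbol_apply, degenFactor, Matrix.mul_diagonal]
  fin_cases i <;> fin_cases j <;>
    simp [desingularized, directSum, splitEquiv, symbolOne, symbolTwo, coeffHol, coeffBar, col,
      map_ofNat] <;> field_simp <;> ring

theorem hasPartialIndices_blockDiagPart :
    HasPartialIndices (fun ζ => blockDiagPart (desingularized ζ)) ![0, 0, 4, 4, 5, 5, 6, 6] := by
  have h := hasPartialIndices_symbolOneDiag.directSum splitEquiv hasPartialIndices_symbolTwoDiag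
  have e : (fun j => Sum.elim ![0, 4, 4, 6] ![0, 5, 5, 6] (splitEquiv j)) =
      (![0, 0, 4, 4, 5, 5, 6, 6] : Fin 8 → ℤ) := by
    funext j
    fin_cases j <;> rfl
  rw [e] at h
  simpa only [blockDiagPart_desingularized] using h

theorem hasMaslovIndex_desingularized : HasMaslovIndex desingularized 30 :=
  ⟨_, hasPartialIndices_symbolOne.directSum splitEquiv hasPartialIndices_symbolTwo, by
    simp [Fin.sum_univ_eight, splitEquiv]⟩

end StatDisc



namespace StatDisc

/-! ### Zero sets of small perturbations of a map with complemented derivative -/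

section Perturbation

variable {E Z W : Type*} [NormedAddCommGroup E] [NormedSpace ℝ E] [CompleteSpace E]
  [NormedAddCommGroup Z] [NormedSpace ℝ Z] [NormedAddCommGroup W] [NormedSpace ℝ W]
  [FiniteDimensional ℝ W]

/-- A `C¹` map close to the identity in `C¹` on a ball straightens the preimage of a
finite-dimensional subspace. -/
theorem isC1Submanifold_of_near_id {Ψ : E → E} {f₀ : E} {ε : ℝ} (hε : 0 < ε)
    (hΨ : ContDiffOn ℝ 1 Ψ (Metric.ball f₀ ε))
    (hd : ∀ f ∈ Metric.ball f₀ ε, ‖fderiv ℝ Ψ f - ContinuousLinearMap.id ℝ E‖ ≤ 1 / 2)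
    (V : Submodule ℝ E) [FiniteDimensional ℝ V]
    (hV : ∃ p ∈ V, ‖p - Ψ f₀‖ ≤ ε / 8) :
    {f | ‖f - f₀‖ < ε ∧ Ψ f ∈ V}.Nonempty ∧
      IsC1Submanifold (Module.finrank ℝ V) {f | ‖f - f₀‖ < ε ∧ Ψ f ∈ V} := by
  have hdiff : ∀ f ∈ Metric.ball f₀ ε, DifferentiableAt ℝ Ψ f := fun f hf =>
    (hΨ.differentiableOn one_ne_zero).differentiableAt (Metric.isOpen_ball.mem_nhds hf)
  have happ : ApproximatesLinearOn Ψ ((ContinuousLinearEquiv.refl ℝ E : E ≃L[ℝ] E) : E →L[ℝ] E)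
      (Metric.ball f₀ ε) (1 / 2 : ℝ≥0) := by
    intro x hx y hy
    have h := (convex_ball f₀ ε).norm_image_sub_le_of_norm_hasFDerivWithin_le'
      (fun f hf => (hdiff f hf).hasFDerivAt.hasFDerivWithinAt) hd hy hx
    simpa using h
  have hc : Subsingleton E ∨ (1 / 2 : ℝ≥0) <
      ‖((ContinuousLinearEquiv.refl ℝ E).symm : E →L[ℝ] E)‖₊⁻¹ := by
    rcases subsingleton_or_nontrivial E with h | h
    · exact Or.inl h
    · right
      have : ‖((ContinuousLinearEquiv.refl ℝ E).symm : E →L[ℝ] E)‖₊ = 1 := by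
        ext
        exact ContinuousLinearMap.norm_id
      rw [this, inv_one]
      norm_num
  set Φ := happ.toOpenPartialHomeomorph Ψ (Metric.ball f₀ ε) hc Metric.isOpen_ball with hΦ
  have hsrc : Φ.source = Metric.ball f₀ ε := rfl
  have hcoe : (Φ : E → E) = Ψ := rfl
  have hmem : ∀ f, ‖f - f₀‖ < ε ↔ f ∈ Metric.ball f₀ ε := fun f => by
    rw [mem_ball_iff_norm]
  constructor
  · obtain ⟨p, hp, hpn⟩ := hV
    -- A map within 1/2 of the identity sends the closed ball of radius ε/2 onto a set containing
    -- the closed ball of radius ε/4 about Ψ f₀, which contains the given point of V.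
    have hs := (happ.mono_set (Metric.closedBall_subset_ball
      (half_lt_self hε))).surjOn_closedBall_of_nonlinearRightInverse
      ⟨id, 1, fun y => by simp, fun y => rfl⟩ (half_pos hε).le (b := f₀) le_rfl
    have hp' : p ∈ Metric.closedBall (Ψ f₀) ((((1 : ℝ≥0) : ℝ)⁻¹ - (1 / 2 : ℝ≥0)) * (ε / 2)) := by
      rw [mem_closedBall_iff_norm]
      refine hpn.trans ?_
      push_cast
      linarith
    obtain ⟨f, hf, hfp⟩ := hs hp'
    refine ⟨f, ?_, ?_⟩
    · exact (hmem f).2 (Metric.closedBall_subset_ball (half_lt_self hε) hf)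
    · show Ψ f ∈ V
      rw [hfp]
      exact hp
  · rintro p ⟨hp, -⟩
    refine ⟨Φ, V, (hmem p).1 hp, hΨ, fun y hy => ContDiffAt.contDiffWithinAt ?_, inferInstance, rfl,
      fun x hx => ⟨fun h => h.2, fun h => ⟨(hmem x).2 hx, h⟩⟩⟩
    have hx : Φ.symm y ∈ Metric.ball f₀ ε := Φ.map_target hy
    -- Being at distance less than 1 from the identity, the derivative is invertible by the Neumann
    -- series, so the inverse map is C¹.
    have hn : ‖ContinuousLinearMap.id ℝ E - fderiv ℝ Ψ (Φ.symm y)‖ < 1 := by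
      rw [norm_sub_rev]
      exact (hd _ hx).trans_lt (by norm_num)
    set e := ContinuousLinearEquiv.ofUnit (Units.oneSub _ hn)
    have he : (e : E →L[ℝ] E) = fderiv ℝ Ψ (Φ.symm y) := by
      ext v
      show (1 - (ContinuousLinearMap.id ℝ E - fderiv ℝ Ψ (Φ.symm y)) : E →L[ℝ] E) v = _
      simp
    refine Φ.contDiffAt_symm (f₀' := e) hy ?_ (hΨ.contDiffAt (Metric.isOpen_ball.mem_nhds hx))
    rw [he]
    exact (hdiff _ hx).hasFDerivAt

/-- The zero set of a small `C¹` perturbation of `F` near a zero `f₀` at which the derivative of `F`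
is the first component of an isomorphism onto `Z × W` is a submanifold of the dimension of `W`. -/
theorem exists_submanifold_of_perturbation (e : E ≃L[ℝ] Z × W) {F : E → Z} (hF : ContDiff ℝ 1 F)
    {f₀ : E} (h0 : F f₀ = 0) (he : ∀ v, (e v).1 = fderiv ℝ F f₀ v) {r : ℝ} (hr : 0 < r) :
    ∃ ε > 0, ε ≤ r ∧ ∃ σ > 0, ∀ P : E → Z, ContDiffOn ℝ 1 P (Metric.ball f₀ r) →
      (∀ f ∈ Metric.ball f₀ r, ‖P f‖ ≤ σ ∧ ‖fderiv ℝ P f‖ ≤ σ) →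
      {f | ‖f - f₀‖ < ε ∧ F f + P f = 0}.Nonempty ∧
        IsC1Submanifold (Module.finrank ℝ W) {f | ‖f - f₀‖ < ε ∧ F f + P f = 0} := by
  set c : ℝ := ‖(e.symm : Z × W →L[ℝ] E)‖ + 1
  have hc : 0 < c := by positivity
  have hes : ∀ z : Z × W, ‖e.symm z‖ ≤ c * ‖z‖ := fun z =>
    ((e.symm : Z × W →L[ℝ] E).le_opNorm z).trans
      (mul_le_mul_of_nonneg_right (by simp [c]) (norm_nonneg _))
  have hcont : ∀ᶠ f in nhds f₀, ‖fderiv ℝ F f - fderiv ℝ F f₀‖ < 1 / (4 * c) := by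
    have h := (hF.continuous_fderiv one_ne_zero).tendsto f₀
    have h2 := Metric.tendsto_nhds.1 h (1 / (4 * c)) (by positivity)
    simpa only [dist_eq_norm] using h2
  obtain ⟨ε₁, hε₁, hball⟩ := Metric.eventually_nhds_iff_ball.1 hcont
  set ε := min ε₁ r
  have hε : 0 < ε := lt_min hε₁ hr
  -- The variation of F' and the derivative of P each contribute at most c/(4c) = 1/4 to the
  -- distance of Ψ' from the identity. The bound ε/(8c) on P moves Ψ f₀ by at most ε/8.
  refine ⟨ε, hε, min_le_right _ _, min (1 / (4 * c)) (ε / (8 * c)), by positivity,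
    fun P hP hPb => ?_⟩
  set T : E →L[ℝ] W := (ContinuousLinearMap.snd ℝ Z W).comp (e : E →L[ℝ] Z × W)
  -- As e = (F'(f₀), T), this map has derivative close to the identity, and it carries the zeros of
  -- F + P to the fixed subspace e⁻¹(0 × W).
  set Ψ : E → E := fun f => e.symm (F f + P f, T f)
  set V : Submodule ℝ E := LinearMap.ker
    ((ContinuousLinearMap.fst ℝ Z W).comp (e : E →L[ℝ] Z × W) : E →ₗ[ℝ] Z)
  have hsub : Metric.ball f₀ ε ⊆ Metric.ball f₀ r := Metric.ball_subset_ball (min_le_right _ _)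
  have eV : V ≃ₗ[ℝ] W := LinearEquiv.ofBijective ((T : E →ₗ[ℝ] W).domRestrict V) (by
    refine ⟨fun x y h => ?_, fun w => ?_⟩
    · apply Subtype.ext
      apply e.injective
      exact Prod.ext ((show (e x).1 = 0 from x.2).trans (show (e y).1 = 0 from y.2).symm) h
    · refine ⟨⟨e.symm (0, w), ?_⟩, ?_⟩
      · show (e (e.symm (0, w))).1 = 0
        rw [e.apply_symm_apply]
      · show (e (e.symm (0, w))).2 = w
        rw [e.apply_symm_apply])
  have : FiniteDimensional ℝ V := eV.symm.finiteDimensional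
  have hmem : ∀ f, Ψ f ∈ V ↔ F f + P f = 0 := fun f => by
    show (e (e.symm (F f + P f, T f))).1 = 0 ↔ _
    rw [e.apply_symm_apply]
  have hΨ : ContDiffOn ℝ 1 Ψ (Metric.ball f₀ ε) :=
    e.symm.contDiff.comp_contDiffOn ((hF.contDiffOn.add (hP.mono hsub)).prodMk
      T.contDiff.contDiffOn)
  have key := isC1Submanifold_of_near_id hε hΨ (fun f hf => ?_) V ⟨e.symm (0, T f₀), ?_, ?_⟩
  · rw [eV.finrank_eq] at key
    simpa only [hmem] using key
  · have hPd : HasFDerivAt P (fderiv ℝ P f) f :=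
      ((hP.differentiableOn one_ne_zero).differentiableAt
        (Metric.isOpen_ball.mem_nhds (hsub hf))).hasFDerivAt
    have hFd : HasFDerivAt F (fderiv ℝ F f) f :=
      (hF.differentiable one_ne_zero f).hasFDerivAt
    have hΨd : HasFDerivAt Ψ ((e.symm : Z × W →L[ℝ] E).comp
        ((fderiv ℝ F f + fderiv ℝ P f).prod T)) f :=
      (e.symm : Z × W →L[ℝ] E).hasFDerivAt.comp f ((hFd.add hPd).prodMk T.hasFDerivAt)
    rw [hΨd.fderiv]
    refine ContinuousLinearMap.opNorm_le_bound _ (by norm_num) fun v => ?_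
    have e1 : ((e.symm : Z × W →L[ℝ] E).comp ((fderiv ℝ F f + fderiv ℝ P f).prod T) -
        ContinuousLinearMap.id ℝ E) v =
        e.symm ((fderiv ℝ F f - fderiv ℝ F f₀) v + fderiv ℝ P f v, 0) := by
      have hv : v = e.symm (fderiv ℝ F f₀ v, T v) := by
        rw [← he v]
        exact (e.symm_apply_apply v).symm
      show e.symm (fderiv ℝ F f v + fderiv ℝ P f v, T v) - v = _
      conv_lhs => rw [hv]
      rw [← map_sub, Prod.mk_sub_mk, ← hv, sub_self, sub_apply]
      congr 2
      abel
    rw [e1]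
    refine (hes _).trans ?_
    have h1 := (fderiv ℝ F f - fderiv ℝ F f₀).le_of_opNorm_le
      (hball f (Metric.ball_subset_ball (min_le_left _ _) hf)).le v
    have h2 := (fderiv ℝ P f).le_of_opNorm_le ((hPb f (hsub hf)).2.trans (min_le_left _ _)) v
    have h3 : ‖(((fderiv ℝ F f - fderiv ℝ F f₀) v + fderiv ℝ P f v, 0) : Z × W)‖ ≤
        1 / (4 * c) * ‖v‖ + 1 / (4 * c) * ‖v‖ := by
      rw [Prod.norm_mk, norm_zero, max_eq_left (norm_nonneg _)]
      exact (norm_add_le _ _).trans (add_le_add h1 h2)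
    calc c * _ ≤ c * (1 / (4 * c) * ‖v‖ + 1 / (4 * c) * ‖v‖) :=
          mul_le_mul_of_nonneg_left h3 hc.le
      _ = 1 / 2 * ‖v‖ := by field_simp; ring
  · show (e (e.symm (0, T f₀))).1 = 0
    rw [e.apply_symm_apply]
  · have e1 : e.symm (0, T f₀) - Ψ f₀ = e.symm (-P f₀, 0) := by
      show e.symm (0, T f₀) - e.symm (F f₀ + P f₀, T f₀) = _
      rw [← map_sub, Prod.mk_sub_mk, h0, zero_add, zero_sub, sub_self]
    rw [e1]
    refine (hes _).trans ?_
    rw [Prod.norm_mk, norm_zero, max_eq_left (norm_nonneg _), norm_neg]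
    calc c * ‖P f₀‖ ≤ c * (ε / (8 * c)) := mul_le_mul_of_nonneg_left
          ((hPb f₀ (Metric.mem_ball_self hr)).1.trans (min_le_right _ _)) hc.le
      _ = ε / 8 := by field_simp

end Perturbation

end StatDisc



namespace StatDisc

variable {k : ℕ} {α : ℝ≥0} [hα : Fact (0 < α ∧ α < 1)]

/-! ### Nemytskii operators -/

/-- `N` is of class `C¹` on the open set `B`, and `N` and its derivative are bounded by `σ`. -/
def SmallC1 {E G : Type*} [NormedAddCommGroup E] [NormedSpace ℝ E] [NormedAddCommGroup G]
    [NormedSpace ℝ G] (B : Set E) (N : E → G) (σ : ℝ) : Prop :=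
  ContDiffOn ℝ 1 N B ∧ ∀ f ∈ B, ‖N f‖ ≤ σ ∧ ‖fderiv ℝ N f‖ ≤ σ

section SmallC1

variable {E G : Type*} [NormedAddCommGroup E] [NormedSpace ℝ E] [NormedAddCommGroup G]
  [NormedSpace ℝ G] {B : Set E} {σ τ : ℝ}

theorem SmallC1.mono {N : E → G} (h : SmallC1 B N σ) (hst : σ ≤ τ) : SmallC1 B N τ :=
  ⟨h.1, fun f hf => ⟨(h.2 f hf).1.trans hst, (h.2 f hf).2.trans hst⟩⟩

theorem SmallC1.hasFDerivAt (hB : IsOpen B) {N : E → G} (h : SmallC1 B N σ) {f : E}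
    (hf : f ∈ B) : HasFDerivAt N (fderiv ℝ N f) f :=
  ((h.1.differentiableOn one_ne_zero).differentiableAt (hB.mem_nhds hf)).hasFDerivAt

theorem SmallC1.of_hasFDerivAt (hB : IsOpen B) {N : E → G} {D : E → E →L[ℝ] G}
    (hD : ∀ f ∈ B, HasFDerivAt N (D f) f) (hc : ContinuousOn D B)
    (hN : ∀ f ∈ B, ‖N f‖ ≤ σ) (hDN : ∀ f ∈ B, ‖D f‖ ≤ σ) : SmallC1 B N σ := by
  refine ⟨?_, fun f hf => ⟨hN f hf, ?_⟩⟩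
  · rw [← zero_add (1 : WithTop ℕ∞), contDiffOn_succ_iff_fderiv_of_isOpen hB]
    exact ⟨fun f hf => (hD f hf).differentiableAt.differentiableWithinAt, by simp,
      contDiffOn_zero.2 (hc.congr fun f hf => (hD f hf).fderiv)⟩
  rw [(hD f hf).fderiv]
  exact hDN f hf

theorem SmallC1.add (hB : IsOpen B) {N M : E → G} (h : SmallC1 B N σ) (h' : SmallC1 B M τ) :
    SmallC1 B (fun f => N f + M f) (σ + τ) := by
  refine ⟨h.1.add h'.1, fun f hf => ⟨norm_add_le_of_le (h.2 f hf).1 (h'.2 f hf).1, ?_⟩⟩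
  have e : HasFDerivAt (fun f => N f + M f) _ f :=
    (h.hasFDerivAt hB hf).add (h'.hasFDerivAt hB hf)
  rw [e.fderiv]
  exact norm_add_le_of_le (h.2 f hf).2 (h'.2 f hf).2

theorem SmallC1.clm (hB : IsOpen B) {H : Type*} [NormedAddCommGroup H] [NormedSpace ℝ H]
    (L : G →L[ℝ] H) {N : E → G} (h : SmallC1 B N σ) :
    SmallC1 B (fun f => L (N f)) (‖L‖ * σ) := by
  refine ⟨L.contDiff.comp_contDiffOn h.1, fun f hf => ⟨L.le_opNorm_of_le (h.2 f hf).1, ?_⟩⟩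
  have e : HasFDerivAt (fun f => L (N f)) _ f := L.hasFDerivAt.comp f (h.hasFDerivAt hB hf)
  rw [e.fderiv]
  exact (L.opNorm_comp_le _).trans (mul_le_mul_of_nonneg_left (h.2 f hf).2 (norm_nonneg _))

theorem SmallC1.const {c : G} (hσ : ‖c‖ ≤ σ) : SmallC1 B (fun _ : E => c) σ :=
  ⟨contDiffOn_const, fun f _ => ⟨hσ, by
    rw [(hasFDerivAt_const c f).fderiv, norm_zero]
    exact (norm_nonneg _).trans hσ⟩⟩

theorem SmallC1.bilin (hB : IsOpen B) {H K : Type*} [NormedAddCommGroup H] [NormedSpace ℝ H]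
    [NormedAddCommGroup K] [NormedSpace ℝ K] (L : G →L[ℝ] H →L[ℝ] K) (hσ : 0 ≤ σ) (hτ : 0 ≤ τ)
    {N : E → G} {M : E → H} (h : SmallC1 B N σ) (h' : SmallC1 B M τ) :
    SmallC1 B (fun f => L (N f) (M f)) (2 * ‖L‖ * σ * τ) := by
  have key : ∀ (x : G) (y : H) (p q : ℝ), 0 ≤ p → ‖x‖ ≤ σ * p → ‖y‖ ≤ τ * q →
      ‖L x y‖ ≤ ‖L‖ * (σ * p) * (τ * q) := fun x y p q hp hx hy =>
    (L.le_opNorm₂ x y).trans (by gcongr)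
  refine ⟨L.isBoundedBilinearMap.contDiff.comp_contDiffOn (h.1.prodMk h'.1),
    fun f hf => ⟨?_, ?_⟩⟩
  · refine (key _ _ 1 1 zero_le_one (by simpa using (h.2 f hf).1)
      (by simpa using (h'.2 f hf).1)).trans ?_
    have : 0 ≤ ‖L‖ * σ * τ := by positivity
    linarith
  · rw [(L.hasFDerivAt_of_bilinear (h.hasFDerivAt hB hf) (h'.hasFDerivAt hB hf)).fderiv]
    refine ContinuousLinearMap.opNorm_le_bound _ (by positivity) fun v => ?_
    have h1 := key (N f) (fderiv ℝ M f v) 1 ‖v‖ zero_le_one (by simpa using (h.2 f hf).1)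
      ((fderiv ℝ M f).le_of_opNorm_le (h'.2 f hf).2 v)
    have h2 := key (fderiv ℝ N f v) (M f) ‖v‖ 1 (norm_nonneg _)
      ((fderiv ℝ N f).le_of_opNorm_le (h.2 f hf).2 v) (by simpa using (h'.2 f hf).1)
    refine (norm_add_le_of_le h1 h2).trans (le_of_eq ?_)
    ring

end SmallC1

section Nemytskii

variable {E : Type*} [NormedAddCommGroup E] [NormedSpace ℝ E] {V : Type} [NormedAddCommGroup V]
  [NormedSpace ℝ V]


/-- Pointwise application of a Hölder family of linear forms to a linear family of Hölder
functions. -/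
theorem exists_clm_of_holderBound (X : E →ₗ[ℝ] Circle → V) {K : ℝ} (hK : 0 ≤ K)
    (hX : ∀ f, HolderBound α k (lift (X f)) (K * ‖f‖)) {Q : Circle → V →L[ℝ] ℂ} {L : ℝ}
    (hQ : HolderBound α k (lift Q) L) : ∃ D : E →L[ℝ] CComplex k α,
      ‖D‖ ≤ 4 * (k + 2) * 4 ^ k * K * L ∧ ∀ h ζ, D h ζ = Q ζ (X h ζ) := by
  have hb : ∀ h, HolderBound α k (lift fun ζ => Q ζ (X h ζ)) (2 * 4 ^ k * L * (K * ‖h‖)) := by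
    intro h
    have h1 := HolderBound.bilin (by exact_mod_cast hα.out.1) (by exact_mod_cast hα.out.2.le)
      (ContinuousLinearMap.id ℝ (V →L[ℝ] ℂ)) hQ (hX h)
    refine (h1.congr fun t => rfl).mono ?_
    have h2 : ‖ContinuousLinearMap.id ℝ (V →L[ℝ] ℂ)‖ ≤ 1 := ContinuousLinearMap.norm_id_le
    have h3 := hQ.nonneg
    have h4 : 0 ≤ 4 ^ k * L * (K * ‖h‖) := by positivity
    nlinarith
  let D : E →ₗ[ℝ] CComplex k α :=
    { toFun := fun h => CComplex.ofBound hα.out.1 (fun ζ => Q ζ (X h ζ)) ⟨_, hb h⟩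
      map_add' := fun h h' => DFunLike.ext _ _ fun ζ => by simp
      map_smul' := fun c h => DFunLike.ext _ _ fun ζ => by simp }
  have hD : ∀ h, ‖D h‖ ≤ 4 * (k + 2) * 4 ^ k * K * L * ‖h‖ := fun h => by
    refine (CComplex.norm_le_of_bound hα.out.1 (D h) (hb h)).trans (le_of_eq ?_)
    ring
  have hL := hQ.nonneg
  exact ⟨D.mkContinuous _ hD, D.mkContinuous_norm_le (by positivity) hD, fun h ζ => rfl⟩

/-- Composition with a smooth function is a `C¹` operator on Hölder functions, with bounds that are
linear in the bounds of the function. -/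
theorem exists_nemytskii (X : E →ₗ[ℝ] Circle → V) {K : ℝ} (hK : 0 ≤ K)
    (hX : ∀ f, HolderBound α k (lift (X f)) (K * ‖f‖)) {U C : Set V} (hU : IsOpen U)
    (hc : Convex ℝ U) (hC : IsCompact C) (hCc : Convex ℝ C) (hCU : C ⊆ U) {B : Set E}
    (hB : IsOpen B) {M : ℝ} (hBM : ∀ f ∈ B, ‖f‖ ≤ M) (hBC : ∀ f ∈ B, ∀ ζ, X f ζ ∈ C) :
    ∃ c : ℝ, 0 ≤ c ∧ ∀ (R : V → ℂ) (η : ℝ), SmoothBound (k + 2) U R η → 0 ≤ η →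
      ∃ N : E → CComplex k α, SmallC1 B N (c * η) ∧ ∀ f ∈ B, ∀ ζ, N f ζ = R (X f ζ) := by
  have ha0 : (0 : ℝ) < α := by exact_mod_cast hα.out.1
  have ha1 : (α : ℝ) ≤ 1 := by exact_mod_cast hα.out.2.le
  obtain ⟨c, hc0, hcb⟩ := HolderBound.comp_bound ha0 ha1 hU hc k (K * M)
  have hXM : ∀ f ∈ B, HolderBound α k (lift (X f)) (K * M) := fun f hf =>
    (hX f).mono (mul_le_mul_of_nonneg_left (hBM f hf) hK)
  refine ⟨2 * (k + 2) * c + 4 * (k + 2) * 4 ^ k * K * c, by positivity, fun R η hR hη => ?_⟩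
  have hR' := hR.fderiv hU
  have hN : ∀ f ∈ B, HolderBound α k (lift fun ζ => R (X f ζ)) (c * η) := fun f hf =>
    hcb ℂ R η hR.of_succ _ (hXM f hf) fun t => hCU (hBC f hf _)
  have hQ : ∀ f ∈ B, HolderBound α k (lift fun ζ => fderiv ℝ R (X f ζ)) (c * η) := fun f hf =>
    hcb (V →L[ℝ] ℂ) (fderiv ℝ R) η hR' _ (hXM f hf) fun t => hCU (hBC f hf _)
  -- The candidate derivative at f is h ↦ R'(X f)(X h), taken pointwise on the circle; off B a dummy
  -- value is used.
  have hDex : ∀ f, ∃ D : E →L[ℝ] CComplex k α, f ∈ B →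
      ‖D‖ ≤ 4 * (k + 2) * 4 ^ k * K * (c * η) ∧
        ∀ h ζ, D h ζ = fderiv ℝ R (X f ζ) (X h ζ) := fun f => by
    by_cases hf : f ∈ B
    · obtain ⟨D, hD⟩ := exists_clm_of_holderBound X hK hX (hQ f hf)
      exact ⟨D, fun _ => hD⟩
    · exact ⟨0, fun h => absurd h hf⟩
  choose D hD using hDex
  have hNex : ∀ f, ∃ N : CComplex k α, f ∈ B → ∀ ζ, N ζ = R (X f ζ) := fun f => by
    by_cases hf : f ∈ B
    · exact ⟨CComplex.ofBound hα.out.1 (fun ζ => R (X f ζ)) ⟨_, hN f hf⟩, fun _ ζ => rfl⟩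
    · exact ⟨0, fun h => absurd h hf⟩
  choose N hNv using hNex
  have hlift : ∀ f h t, lift (X (f + h)) t = lift (X f) t + lift (X h) t := fun f h t => by
    simp [lift]
  refine ⟨N, SmallC1.of_hasFDerivAt hB (D := D) (fun f hf => ?_) (fun f hf => ?_)
    (fun f hf => ?_) (fun f hf => ?_), hNv⟩
  · rw [hasFDerivAt_iff_isLittleO_nhds_zero, Asymptotics.isLittleO_iff]
    intro ε hε
    have hk : (0 : ℝ) < 2 * (k + 2) * (K + 1) := by positivity
    obtain ⟨δ, hδ, hd⟩ := HolderBound.comp_diff ha0 ha1 hU hc hC hCc hCU k ℂ R η hR (lift (X f))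
      (K * M) (hXM f hf) (fun t => hBC f hf _) (ε / (2 * (k + 2) * (K + 1))) (by positivity)
    have h1 : ∀ᶠ h in nhds (0 : E), f + h ∈ B :=
      (continuous_const.add continuous_id).continuousAt.eventually_mem
        (by simpa using hB.mem_nhds hf)
    have h2 : ∀ᶠ h in nhds (0 : E), K * ‖h‖ ≤ δ := by
      have : Continuous fun h : E => K * ‖h‖ := by fun_prop
      exact this.continuousAt.eventually_le_const (by simpa using hδ)
    filter_upwards [h1, h2] with h hfh hKh
    have h3 := hd (lift (X h)) (K * ‖h‖) hKh (hX h)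
    have h4 : HolderBound α k (lift (N (f + h) - N f - D f h))
        (ε / (2 * (k + 2) * (K + 1)) * (K * ‖h‖)) := by
      refine h3.congr fun t => ?_
      rw [← hlift]
      simp only [lift, CComplex.sub_apply, hNv _ hfh, hNv _ hf, (hD f hf).2]
    refine (CComplex.norm_le_of_bound hα.out.1 _ h4).trans ?_
    rw [← mul_assoc, ← mul_assoc]
    refine mul_le_mul_of_nonneg_right ?_ (norm_nonneg _)
    rw [mul_div_assoc', div_mul_eq_mul_div, div_le_iff₀ hk]
    nlinarith [mul_nonneg hε.le (by positivity : (0 : ℝ) ≤ 2 * (k + 2))]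
  · rw [Metric.continuousWithinAt_iff]
    intro ε hε
    set e : ℝ := ε / (2 * (4 * (k + 2) * 4 ^ k * (K + 1)))
    have he : 0 < e := by positivity
    obtain ⟨δ, hδ, hd⟩ := HolderBound.comp_cont ha0 ha1 hU hc hC hCc hCU k (V →L[ℝ] ℂ)
      (fderiv ℝ R) η hR' (lift (X f)) (K * M) (hXM f hf) (fun t => hBC f hf _) e he
    refine ⟨δ / (K + 1), by positivity, fun {g} hg hgf => ?_⟩
    have h1 : HolderBound α k (lift (X (g - f))) δ := by
      refine (hX _).mono ?_
      rw [dist_eq_norm, lt_div_iff₀ (by positivity)] at hgf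
      nlinarith [norm_nonneg (g - f)]
    have h2 : HolderBound α k (lift fun ζ => fderiv ℝ R (X g ζ) - fderiv ℝ R (X f ζ)) e := by
      refine (hd _ h1).congr fun t => ?_
      rw [← hlift, add_sub_cancel]
      rfl
    -- The difference of the derivatives at g and f is itself a pointwise operator, with coefficient
    -- R'(X g) - R'(X f). This coefficient is small in the Hölder norm by `HolderBound.comp_cont`,
    -- so the operator norm is small.
    obtain ⟨D', hD'n, hD'⟩ := exists_clm_of_holderBound X hK hX h2
    have e1 : D g - D f = D' := by
      refine ContinuousLinearMap.ext fun h => DFunLike.ext _ _ fun ζ => ?_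
      rw [hD', sub_apply, CComplex.sub_apply, (hD g hg).2, (hD f hf).2, sub_apply]
    rw [dist_eq_norm, e1]
    refine hD'n.trans_lt ?_
    have h3 : 4 * (k + 2) * 4 ^ k * K * e ≤ ε / 2 := by
      have : (4 * (k + 2) * 4 ^ k * (K + 1)) * e = ε / 2 := by
        simp only [e]
        field_simp
      rw [← this]
      gcongr
      linarith
    linarith
  · have h1 : HolderBound α k (lift (N f)) (c * η) := (hN f hf).congr fun t => (hNv f hf _).symm
    refine (CComplex.norm_le_of_bound hα.out.1 _ h1).trans ?_
    have : 0 ≤ 4 * (k + 2) * 4 ^ k * K * c * η := by positivity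
    linarith
  · refine (hD f hf).1.trans ?_
    have : 0 ≤ 2 * (k + 2) * c * η := by positivity
    linarith

end Nemytskii

end StatDisc



namespace StatDisc

variable {k : ℕ} {α : ℝ≥0} [hα : Fact (0 < α ∧ α < 1)]

/-! ### Families of operators vanishing to a given order at `1` -/

section OrderBound

variable {ι : Type*} {B : Set (Y k α)} {η : ι → ℝ} {n m : ℕ}

/-- The functions `G i f` on the circle are of the form `(1 - ζ)^n N i f`, where the operators `N i`
are of class `C¹` on `B` with bounds that are uniformly linear in `η i`. -/
def OrderBound (B : Set (Y k α)) (η : ι → ℝ) (n : ℕ) (G : ι → Y k α → Circle → ℂ) : Prop :=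
  ∃ C : ℝ, 0 ≤ C ∧ ∀ i, ∃ N : Y k α → CComplex k α, SmallC1 B N (C * η i) ∧
    ∀ f ∈ B, ∀ ζ, G i f ζ = (1 - (ζ : ℂ)) ^ n * N f ζ

variable {G H : ι → Y k α → Circle → ℂ}

theorem OrderBound.congr (h : OrderBound B η n G) (e : ∀ i, ∀ f ∈ B, ∀ ζ, H i f ζ = G i f ζ) :
    OrderBound B η n H := by
  obtain ⟨C, hC, h⟩ := h
  refine ⟨C, hC, fun i => ?_⟩
  obtain ⟨N, hN, hG⟩ := h i
  exact ⟨N, hN, fun f hf ζ => (e i f hf ζ).trans (hG f hf ζ)⟩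

theorem OrderBound.zero : OrderBound B η n fun _ _ _ => 0 :=
  ⟨0, le_rfl, fun _ => ⟨fun _ => 0, SmallC1.const (by simp), fun _ _ _ => by simp⟩⟩

theorem OrderBound.const (c : ℂ) : OrderBound B (fun _ : ι => 1) 0 fun _ _ _ => c :=
  ⟨‖(CComplex.const c : CComplex k α)‖, norm_nonneg _, fun _ => ⟨fun _ => CComplex.const c,
    SmallC1.const (by simp), fun _ _ _ => by simp⟩⟩

theorem OrderBound.add (hB : IsOpen B) (h : OrderBound B η n G) (h' : OrderBound B η n H) :
    OrderBound B η n fun i f ζ => G i f ζ + H i f ζ := by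
  obtain ⟨C, hC, h⟩ := h
  obtain ⟨C', hC', h'⟩ := h'
  refine ⟨C + C', by positivity, fun i => ?_⟩
  obtain ⟨N, hN, hG⟩ := h i
  obtain ⟨N', hN', hG'⟩ := h' i
  refine ⟨fun f => N f + N' f, add_mul C C' (η i) ▸ hN.add hB hN', fun f hf ζ => ?_⟩
  show G i f ζ + H i f ζ = (1 - (ζ : ℂ)) ^ n * (N f + N' f) ζ
  rw [hG f hf, hG' f hf, CComplex.add_apply]
  ring

theorem OrderBound.sum (hB : IsOpen B) {J : Type*} (s : Finset J)
    {G : J → ι → Y k α → Circle → ℂ} (h : ∀ j ∈ s, OrderBound B η n (G j)) :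
    OrderBound B η n fun i f ζ => ∑ j ∈ s, G j i f ζ := by
  classical
  induction s using Finset.induction_on with
  | empty => simpa using OrderBound.zero
  | insert j s hj ih =>
    simp only [Finset.sum_insert hj]
    exact (h j (Finset.mem_insert_self j s)).add hB
      (ih fun l hl => h l (Finset.mem_insert_of_mem hl))

theorem OrderBound.mul (hB : IsOpen B) (hη : ∀ i, 0 ≤ η i) (h : OrderBound B η n G)
    (h' : OrderBound B (fun _ : ι => 1) m H) :
    OrderBound B η (n + m) fun i f ζ => G i f ζ * H i f ζ := by
  obtain ⟨C, hC, h⟩ := h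
  obtain ⟨C', hC', h'⟩ := h'
  refine ⟨2 * ‖CComplex.mulCLM (k := k) (α := α)‖ * C * C', by positivity, fun i => ?_⟩
  obtain ⟨N, hN, hG⟩ := h i
  obtain ⟨N', hN', hG'⟩ := h' i
  refine ⟨fun f => N f * N' f, (hN.bilin hB CComplex.mulCLM (mul_nonneg hC (hη i)) (by simpa)
    hN').mono (le_of_eq (by ring)), fun f hf ζ => ?_⟩
  show G i f ζ * H i f ζ = (1 - (ζ : ℂ)) ^ (n + m) * (N f * N' f) ζ
  rw [hG f hf, hG' f hf, CComplex.mul_apply]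
  ring

theorem OrderBound.const_mul (hB : IsOpen B) (hη : ∀ i, 0 ≤ η i) (c : ℂ)
    (h : OrderBound B η n G) : OrderBound B η n fun i f ζ => c * G i f ζ :=
  (h.mul hB hη (OrderBound.const c)).congr fun _ _ _ _ => mul_comm _ _

/-- The surplus factor (1 - ζ)^(n-m) is absorbed into the operator. -/
theorem OrderBound.lower (hB : IsOpen B) (hmn : m ≤ n) (h : OrderBound B η n G) :
    OrderBound B η m G := by
  obtain ⟨C, hC, h⟩ := h
  set L := CComplex.mulCLM (k := k) (α := α) ((1 - CComplex.zp 1) ^ (n - m))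
  refine ⟨‖L‖ * C, by positivity, fun i => ?_⟩
  obtain ⟨N, hN, hG⟩ := h i
  refine ⟨fun f => L (N f), mul_assoc ‖L‖ C (η i) ▸ hN.clm hB L, fun f hf ζ => ?_⟩
  rw [hG f hf]
  simp only [L, CComplex.mulCLM_apply, CComplex.mul_apply, CComplex.pow_apply,
    CComplex.sub_apply, CComplex.one_apply, CComplex.zp_apply, zpow_one]
  rw [← mul_assoc, ← pow_add, Nat.add_sub_cancel' hmn]

theorem OrderBound.clm {M : ℝ} (hBM : ∀ f ∈ B, ‖f‖ ≤ M) (hM : 0 ≤ M)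
    (L : Y k α →L[ℝ] CComplex k α) (n : ℕ) :
    OrderBound B (fun _ : ι => 1) n fun _ f ζ => (1 - (ζ : ℂ)) ^ n * L f ζ := by
  refine ⟨‖L‖ * (M + 1), by positivity, fun _ => ⟨L, ⟨(ContinuousLinearMap.contDiff (𝕜 := ℝ)
    (E := Y k α) (F := CComplex k α) L).contDiffOn,
    fun f hf => ⟨?_, ?_⟩⟩, fun f _ ζ => rfl⟩⟩
  · rw [mul_one]
    exact L.le_opNorm_of_le ((hBM f hf).trans (by linarith))
  · rw [ContinuousLinearMap.fderiv (𝕜 := ℝ) (E := Y k α) (F := CComplex k α) L, mul_one]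
    exact le_mul_of_one_le_right (ContinuousLinearMap.opNorm_nonneg L) (by linarith)

end OrderBound

/-! ### The base point in the parameter space -/

/-- The point `(z, Im w)` for a covector with base point `(z, w)`. -/
noncomputable def param (q : Fin 8 → ℂ) : (Fin 2 → ℂ) × (Fin 2 → ℝ) :=
  (zPart (base q), fun j => (wPart (base q) j).im)

theorem param_fst (q : Fin 8 → ℂ) : (param q).1 = ![q 0, q 1] := rfl

theorem param_snd (q : Fin 8 → ℂ) : (param q).2 = ![(q 2).im, (q 3).im] := by
  funext j
  fin_cases j <;> rfl

theorem paramBox_eq_ball (n : ℕ) {δ : ℝ} (hδ : 0 < δ) : paramBox n δ = Metric.ball 0 δ := by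
  ext p
  rw [mem_ball_zero_iff, Prod.norm_def, max_lt_iff, pi_norm_lt_iff hδ, pi_norm_lt_iff hδ]
  rfl

/-- The map `f ↦ (z, Im w)`. -/
noncomputable def paramMap : Y k α →ₗ[ℝ] Circle → (Fin 2 → ℂ) × (Fin 2 → ℝ) where
  toFun f ζ := param (f.eval ζ)
  map_add' f g := by
    funext ζ
    refine Prod.ext ?_ ?_
    · rw [Pi.add_apply, Prod.fst_add, param_fst, param_fst, param_fst]
      funext j
      fin_cases j <;> simp [Y.eval_apply, mul_add]
    · rw [Pi.add_apply, Prod.snd_add, param_snd, param_snd, param_snd]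
      funext j
      fin_cases j <;> simp [Y.eval_apply, mul_add]
  map_smul' c f := by
    funext ζ
    refine Prod.ext ?_ ?_
    · rw [Pi.smul_apply, Prod.smul_fst, param_fst, param_fst]
      funext j
      fin_cases j <;> simp [Y.eval_apply] <;> ring
    · rw [Pi.smul_apply, Prod.smul_snd, param_snd, param_snd]
      funext j
      fin_cases j <;> simp [Y.eval_apply] <;> ring

theorem exists_holderBound_paramMap : ∃ K : ℝ, 0 ≤ K ∧
    ∀ f : Y k α, HolderBound α k (lift (paramMap f)) (K * ‖f‖) := by
  set L : Fin 8 → Y k α →L[ℝ] CComplex k α := fun j =>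
    (CComplex.mulCLM (1 - CComplex.zp 1)).comp (comp j)
  have hL : ∀ j (f : Y k α), HolderBound α k (lift (L j f)) (‖L j‖ * ‖f‖) := fun j f =>
    ((L j f).holderBound hα.out.1).mono ((L j).le_opNorm f)
  let P : Fin 2 → ℂ →L[ℝ] (Fin 2 → ℂ) × (Fin 2 → ℝ) := fun j =>
    (ContinuousLinearMap.inl ℝ _ _).comp (ContinuousLinearMap.single ℝ (fun _ => ℂ) j)
  let Q : Fin 2 → ℂ →L[ℝ] (Fin 2 → ℂ) × (Fin 2 → ℝ) := fun j =>
    (ContinuousLinearMap.inr ℝ _ _).comp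
      ((ContinuousLinearMap.single ℝ (fun _ => ℝ) j).comp Complex.imCLM)
  refine ⟨‖P 0‖ * ‖L 0‖ + ‖P 1‖ * ‖L 1‖ + ‖Q 0‖ * ‖L 2‖ + ‖Q 1‖ * ‖L 3‖, by positivity,
    fun f => ?_⟩
  refine (((((hL 0 f).clm (P 0)).add ((hL 1 f).clm (P 1))).add ((hL 2 f).clm (Q 0))).add
    ((hL 3 f).clm (Q 1))).mono (le_of_eq (by ring)) |>.congr fun t => ?_
  have e : ∀ j, yOrd j = 1 → lift (L j f) t = f.eval (Circle.exp t) j := fun j hj => by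
    simp only [lift, L, ContinuousLinearMap.comp_apply, CComplex.mulCLM_apply, Y.eval_apply, hj,
      CComplex.mul_apply, CComplex.sub_apply, CComplex.one_apply, CComplex.zp_apply, zpow_one,
      pow_one, comp_apply]
  rw [e 0 rfl, e 1 rfl, e 2 rfl, e 3 rfl]
  show _ = param (f.eval (Circle.exp t))
  generalize f.eval (Circle.exp t) = q
  refine Prod.ext ?_ ?_
  · rw [param_fst]
    funext j
    fin_cases j <;> simp [P, Q]
  · rw [param_snd]
    funext j
    fin_cases j <;> simp [P, Q]

/-! ### Families of functions of the base point -/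

section ParamOrder

variable {ι : Type*} {B : Set (Y k α)} {η : ι → ℝ} {n m : ℕ} {δ : ℝ}

/-- The functions `g i` are differentiable on the parameter box; composition with the base point
vanishes to order `n` at `1`, and derivatives vanish to order `n - 1`. -/
def ParamOrder (B : Set (Y k α)) (δ : ℝ) (η : ι → ℝ) (n : ℕ)
    (g : ι → (Fin 2 → ℂ) × (Fin 2 → ℝ) → ℂ) : Prop :=
  OrderBound B η n (fun i f ζ => g i (param (f.eval ζ))) ∧
    (∀ i, ∀ q ∈ paramBox 2 δ, DifferentiableAt ℝ (g i) q) ∧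
    ∀ v, OrderBound B η (n - 1) fun i f ζ => fderiv ℝ (g i) (param (f.eval ζ)) v

variable {g h : ι → (Fin 2 → ℂ) × (Fin 2 → ℝ) → ℂ}

theorem ParamOrder.zero : ParamOrder B δ η n fun _ _ => 0 :=
  ⟨OrderBound.zero, fun _ _ _ => differentiableAt_const _, fun v => by
    simpa using OrderBound.zero⟩

theorem ParamOrder.const (c : ℂ) : ParamOrder B δ (fun _ : ι => 1) 0 fun _ _ => c :=
  ⟨OrderBound.const c, fun _ _ _ => differentiableAt_const _, fun v => by
    simpa using OrderBound.zero⟩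

theorem ParamOrder.lower (hB : IsOpen B) (hmn : m ≤ n) (hg : ParamOrder B δ η n g) :
    ParamOrder B δ η m g :=
  ⟨hg.1.lower hB hmn, hg.2.1, fun v => (hg.2.2 v).lower hB (by omega)⟩

theorem ParamOrder.congr (hδ : 0 < δ) (hBδ : ∀ f ∈ B, ∀ ζ, param (f.eval ζ) ∈ paramBox 2 δ)
    (hg : ParamOrder B δ η n g) (e : ∀ i, ∀ q ∈ paramBox 2 δ, h i q = g i q) :
    ParamOrder B δ η n h := by
  have ho : IsOpen (paramBox 2 δ) := paramBox_eq_ball 2 hδ ▸ Metric.isOpen_ball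
  have he : ∀ i, ∀ q ∈ paramBox 2 δ, h i =ᶠ[nhds q] g i := fun i q hq =>
    Filter.eventuallyEq_of_mem (ho.mem_nhds hq) (e i)
  exact ⟨hg.1.congr fun i f hf ζ => e i _ (hBδ f hf ζ),
    fun i q hq => (hg.2.1 i q hq).congr_of_eventuallyEq (he i q hq),
    fun v => (hg.2.2 v).congr fun i f hf ζ => by rw [(he i _ (hBδ f hf ζ)).fderiv_eq]⟩

theorem ParamOrder.add (hB : IsOpen B) (hBδ : ∀ f ∈ B, ∀ ζ, param (f.eval ζ) ∈ paramBox 2 δ)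
    (hg : ParamOrder B δ η n g) (hh : ParamOrder B δ η n h) :
    ParamOrder B δ η n fun i q => g i q + h i q :=
  ⟨hg.1.add hB hh.1, fun i q hq => (hg.2.1 i q hq).add (hh.2.1 i q hq),
    fun v => ((hg.2.2 v).add hB (hh.2.2 v)).congr fun i f hf ζ => by
      rw [fderiv_fun_add (hg.2.1 i _ (hBδ f hf ζ)) (hh.2.1 i _ (hBδ f hf ζ))]
      rfl⟩

theorem ParamOrder.sum (hB : IsOpen B) (hBδ : ∀ f ∈ B, ∀ ζ, param (f.eval ζ) ∈ paramBox 2 δ)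
    {J : Type*} (s : Finset J) {g : J → ι → (Fin 2 → ℂ) × (Fin 2 → ℝ) → ℂ}
    (hg : ∀ j ∈ s, ParamOrder B δ η n (g j)) :
    ParamOrder B δ η n fun i q => ∑ j ∈ s, g j i q := by
  classical
  induction s using Finset.induction_on with
  | empty => simpa using ParamOrder.zero
  | insert j s hj ih =>
    simp only [Finset.sum_insert hj]
    exact (hg j (Finset.mem_insert_self j s)).add hB hBδ
      (ih fun l hl => hg l (Finset.mem_insert_of_mem hl))

/-- By the product rule the derivative has terms of orders n + (m - 1) and (n - 1) + m. With
truncated subtraction both are at least n + m - 1, so both can be lowered to it. -/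
theorem ParamOrder.mul (hB : IsOpen B) (hη : ∀ i, 0 ≤ η i)
    (hBδ : ∀ f ∈ B, ∀ ζ, param (f.eval ζ) ∈ paramBox 2 δ)
    (hg : ParamOrder B δ η n g) (hh : ParamOrder B δ (fun _ => 1) m h) :
    ParamOrder B δ η (n + m) fun i q => g i q * h i q := by
  refine ⟨hg.1.mul hB hη hh.1, fun i q hq => (hg.2.1 i q hq).mul (hh.2.1 i q hq), fun v => ?_⟩
  refine ((((hg.1.mul hB hη (hh.2.2 v)).lower hB (by omega)).add hB
    (((hg.2.2 v).mul hB hη hh.1).lower hB (m := n + m - 1) (by omega)))).congr fun i f hf ζ => ?_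
  rw [fderiv_fun_mul (hg.2.1 i _ (hBδ f hf ζ)) (hh.2.1 i _ (hBδ f hf ζ))]
  simp only [add_apply, smul_apply, smul_eq_mul]
  ring

theorem ParamOrder.pow (hB : IsOpen B)
    (hBδ : ∀ f ∈ B, ∀ ζ, param (f.eval ζ) ∈ paramBox 2 δ)
    (hg : ParamOrder B δ (fun _ => 1) n g) (N : ℕ) :
    ParamOrder B δ (fun _ => 1) (n * N) fun i q => g i q ^ N := by
  induction N with
  | zero => simpa using ParamOrder.const 1
  | succ N ih =>
    simp only [pow_succ]
    exact ih.mul hB (fun _ => zero_le_one) hBδ hg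

theorem ParamOrder.prod (hB : IsOpen B)
    (hBδ : ∀ f ∈ B, ∀ ζ, param (f.eval ζ) ∈ paramBox 2 δ)
    {J : Type*} (s : Finset J) (N : J → ℕ) {g : J → ι → (Fin 2 → ℂ) × (Fin 2 → ℝ) → ℂ}
    (hg : ∀ j ∈ s, ParamOrder B δ (fun _ => 1) (N j) (g j)) :
    ParamOrder B δ (fun _ => 1) (∑ j ∈ s, N j) fun i q => ∏ j ∈ s, g j i q := by
  classical
  induction s using Finset.induction_on with
  | empty => simpa using ParamOrder.const 1
  | insert j s hj ih =>
    simp only [Finset.prod_insert hj, Finset.sum_insert hj]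
    exact (hg j (Finset.mem_insert_self j s)).mul hB (fun _ => zero_le_one) hBδ
      (ih fun l hl => hg l (Finset.mem_insert_of_mem hl))

theorem ParamOrder.clm (L : (Fin 2 → ℂ) × (Fin 2 → ℝ) →L[ℝ] ℂ)
    (hL : OrderBound B (fun _ : ι => 1) 1 fun _ f ζ => L (param (f.eval ζ))) :
    ParamOrder B δ (fun _ : ι => 1) 1 fun _ => L :=
  ⟨hL, fun _ _ _ => L.differentiableAt, fun v => by
    simpa only [ContinuousLinearMap.fderiv] using OrderBound.const (L v)⟩

theorem paramOrder_z {M : ℝ} (hBM : ∀ f ∈ B, ‖f‖ ≤ M) (hM : 0 ≤ M) (j : Fin 2) :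
    ParamOrder B δ (fun _ : ι => 1) 1 fun _ q => q.1 j := by
  refine ParamOrder.clm ((ContinuousLinearMap.proj j).comp (ContinuousLinearMap.fst ℝ _ _)) ?_
  refine (OrderBound.clm hBM hM (comp (![0, 1] j)) 1).congr fun _ f _ ζ => ?_
  fin_cases j <;> rfl

theorem paramOrder_conj {M : ℝ} (hBM : ∀ f ∈ B, ‖f‖ ≤ M) (hM : 0 ≤ M) (j : Fin 2) :
    ParamOrder B δ (fun _ : ι => 1) 1 fun _ q => starRingEnd ℂ (q.1 j) := by
  refine ParamOrder.clm (Complex.conjCLE.toContinuousLinearMap.comp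
    ((ContinuousLinearMap.proj j).comp (ContinuousLinearMap.fst ℝ _ _))) ?_
  refine (OrderBound.clm hBM hM ((CComplex.mulCLM (-CComplex.zp (-1))).comp
    (CComplex.conj.comp (comp (![0, 1] j)))) 1).congr fun _ f _ ζ => ?_
  have h : ∀ l, yOrd l = 1 → starRingEnd ℂ (f.eval ζ l) = (1 - (ζ : ℂ)) ^ 1 *
      ((CComplex.mulCLM (-CComplex.zp (-1))).comp (CComplex.conj.comp (comp l)) f) ζ :=
      fun l hl => by
    rw [Y.eval_apply, hl, map_mul, map_pow, conj_one_sub]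
    simp
    ring
  fin_cases j
  · exact h 0 rfl
  · exact h 1 rfl

/-- Im w = (w - w̄)/(2i), and for w = (1 - ζ)u this equals -(i/2)(1 - ζ)(u + ζ⁻¹ū). So the imaginary
part, though only real-linear in w, is still divisible by 1 - ζ. -/
theorem paramOrder_y {M : ℝ} (hBM : ∀ f ∈ B, ‖f‖ ≤ M) (hM : 0 ≤ M) (j : Fin 2) :
    ParamOrder B δ (fun _ : ι => 1) 1 fun _ q => ((q.2 j : ℝ) : ℂ) := by
  refine ParamOrder.clm (Complex.ofRealCLM.comp
    ((ContinuousLinearMap.proj j).comp (ContinuousLinearMap.snd ℝ _ _))) ?_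
  set L : Fin 8 → Y k α →L[ℝ] CComplex k α := fun l =>
    (CComplex.mulCLM (CComplex.const (-(Complex.I / 2)))).comp
      (comp l + (CComplex.mulCLM (CComplex.zp (-1))).comp (CComplex.conj.comp (comp l)))
  refine (OrderBound.clm hBM hM (L (![2, 3] j)) 1).congr fun _ f _ ζ => ?_
  have h : ∀ l, yOrd l = 1 → (((f.eval ζ l).im : ℝ) : ℂ) = (1 - (ζ : ℂ)) ^ 1 * (L l f) ζ :=
      fun l hl => by
    rw [Complex.im_eq_sub_conj, div_eq_mul_inv, show (2 * Complex.I)⁻¹ = -(Complex.I / 2) by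
      rw [mul_inv, Complex.inv_I]; ring, Y.eval_apply, hl, map_mul, map_pow, conj_one_sub]
    simp [L]
    ring
  fin_cases j
  · exact h 2 rfl
  · exact h 3 rfl

end ParamOrder

end StatDisc



/-! ### Orders of vanishing of the expansions along discs -/

namespace StatDisc

theorem SmoothBound.clm {V F H : Type} [NormedAddCommGroup V] [NormedSpace ℝ V]
    [NormedAddCommGroup F] [NormedSpace ℝ F] [NormedAddCommGroup H] [NormedSpace ℝ H] {s : ℕ}
    {U : Set V} (hU : IsOpen U) {R : V → F} {η : ℝ} (h : SmoothBound s U R η) (L : F →L[ℝ] H) :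
    SmoothBound s U (fun p => L (R p)) (‖L‖ * η) := by
  refine ⟨L.contDiff.comp_contDiffOn h.1, fun j hj p hp => ?_⟩
  have hc : ContDiffAt ℝ s R p := h.1.contDiffAt (hU.mem_nhds hp)
  have e := L.iteratedFDeriv_comp_left hc (i := j) (by exact_mod_cast hj)
  rw [show (fun p => L (R p)) = L ∘ R from rfl, e]
  exact (L.norm_compContinuousMultilinearMap_le _).trans
    (mul_le_mul_of_nonneg_left (h.2 j hj p hp) (norm_nonneg _))

theorem fderiv_comp_clm_apply {V F H : Type*} [NormedAddCommGroup V] [NormedSpace ℝ V]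
    [NormedAddCommGroup F] [NormedSpace ℝ F] [NormedAddCommGroup H] [NormedSpace ℝ H] {g : F → H}
    (L : V →L[ℝ] F) {p : V} (hg : DifferentiableAt ℝ g (L p)) (v : V) :
    fderiv ℝ (fun q => g (L q)) p v = fderiv ℝ g (L p) (L v) :=
  DFunLike.congr_fun (hg.hasFDerivAt.comp p L.hasFDerivAt).fderiv v

variable {k : ℕ} {α : ℝ≥0} [hα : Fact (0 < α ∧ α < 1)]
variable {ι : Type*} {B : Set (Y k α)} {η : ι → ℝ} {n m : ℕ} {δ : ℝ}

/-- Bounded open sets of discs whose base points stay in a compact part of the parameter box. -/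
structure Admissible (B : Set (Y k α)) (δ : ℝ) : Prop where
  isOpen : IsOpen B
  bounded : ∃ M : ℝ, 0 ≤ M ∧ ∀ f ∈ B, ‖f‖ ≤ M
  compact : ∃ δ' < δ, 0 < δ' ∧ ∀ f ∈ B, ∀ ζ, ‖param (f.eval ζ)‖ ≤ δ'

omit hα in
theorem Admissible.pos (h : Admissible B δ) : 0 < δ := by
  obtain ⟨δ', h1, h2, -⟩ := h.compact
  exact h2.trans h1

omit hα in
theorem Admissible.param_mem (h : Admissible B δ) :
    ∀ f ∈ B, ∀ ζ, param (f.eval ζ) ∈ paramBox 2 δ := by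
  obtain ⟨δ', h1, h2, h3⟩ := h.compact
  intro f hf ζ
  rw [paramBox_eq_ball 2 h.pos, mem_ball_zero_iff]
  exact (h3 f hf ζ).trans_lt h1

/-- Composition of smooth functions with the base point. -/
theorem Admissible.paramOrder_comp (h : Admissible B δ) (hη : ∀ i, 0 ≤ η i)
    (L : (Fin 2 → ℂ) × (Fin 2 → ℝ) →L[ℝ] (Fin n → ℂ) × (Fin 2 → ℝ)) (hL : ∀ q, ‖L q‖ ≤ ‖q‖)
    {c : ι → (Fin n → ℂ) × (Fin 2 → ℝ) → ℂ}
    (hc : ∀ i, SmoothBound (k + 3) (paramBox n δ) (c i) (η i)) :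
    ParamOrder B δ η 0 fun i q => c i (L q) := by
  obtain ⟨K, hK, hX⟩ := exists_holderBound_paramMap (k := k) (α := α)
  obtain ⟨M, hM, hBM⟩ := h.bounded
  obtain ⟨δ', h1, h2, h3⟩ := h.compact
  have ho : IsOpen (paramBox n δ) := paramBox_eq_ball n h.pos ▸ Metric.isOpen_ball
  have hmem : ∀ q ∈ paramBox 2 δ, L q ∈ paramBox n δ := fun q hq => by
    rw [paramBox_eq_ball _ h.pos, mem_ball_zero_iff] at hq ⊢
    exact (hL q).trans_lt hq
  obtain ⟨X, hXe⟩ : ∃ X : Y k α →ₗ[ℝ] Circle → (Fin n → ℂ) × (Fin 2 → ℝ),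
      ∀ f ζ, X f ζ = L (param (f.eval ζ)) :=
    ⟨(L.toLinearMap.compLeft Circle).comp paramMap, fun _ _ => rfl⟩
  have hX' : ∀ f, HolderBound α k (lift (X f)) (‖L‖ * K * ‖f‖) := fun f => by
    rw [mul_assoc]
    exact ((hX f).clm L).congr fun t => (hXe f _).symm
  -- One constant serves the coefficients and their directional derivatives. The latter lose one
  -- order of differentiability, which is why C^{k+3} is required and C^{k+2} is used.
  obtain ⟨C, hC, hN⟩ := exists_nemytskii (k := k) (α := α) X
    (K := ‖L‖ * K) (by positivity) hX' (U := paramBox n δ)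
    (C := Metric.closedBall 0 δ') ho (paramBox_eq_ball n h.pos ▸ convex_ball _ _)
    (isCompact_closedBall _ _) (convex_closedBall _ _)
    (paramBox_eq_ball n h.pos ▸ Metric.closedBall_subset_ball h1) h.isOpen hBM
    (fun f hf ζ => by
      rw [hXe, mem_closedBall_zero_iff]
      exact (hL _).trans (h3 f hf ζ))
  have hd : ∀ i, ∀ q ∈ paramBox 2 δ, DifferentiableAt ℝ (c i) (L q) := fun i q hq =>
    (hc i).differentiableAt ho (hmem q hq)
  refine ⟨⟨C, hC, fun i => ?_⟩, fun i q hq => (hd i q hq).comp q L.differentiableAt, fun v =>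
    ⟨C * ‖L v‖, by positivity, fun i => ?_⟩⟩
  · obtain ⟨N, hN1, hN2⟩ := hN (c i) (η i) (hc i).of_succ (hη i)
    exact ⟨N, hN1, fun f hf ζ => by rw [hN2 f hf ζ, pow_zero, one_mul, hXe]⟩
  · have hs : SmoothBound (k + 2) (paramBox n δ) (fun p => fderiv ℝ (c i) p (L v))
        (‖L v‖ * η i) := by
      have h5 := ((hc i).fderiv ho).clm ho (ContinuousLinearMap.apply ℝ ℂ (L v))
      exact ⟨h5.1, fun j hj p hp => (h5.2 j hj p hp).trans
        (mul_le_mul_of_nonneg_right (ContinuousLinearMap.opNorm_le_bound _ (norm_nonneg _)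
          fun T => by rw [mul_comm]; exact T.le_opNorm _) (hη i))⟩
    obtain ⟨N, hN1, hN2⟩ := hN _ _ hs (mul_nonneg (norm_nonneg _) (hη i))
    refine ⟨N, hN1.mono (le_of_eq (mul_assoc C _ _).symm), fun f hf ζ => ?_⟩
    rw [hN2 f hf ζ, Nat.zero_sub, pow_zero, one_mul, hXe]
    exact fderiv_comp_clm_apply L (hd i _ (h.param_mem f hf ζ)) v

/-- Each monomial of degree D in z and z̄ contributes D factors 1 - ζ. The map `a` selects which of
z₁, z₂ are read and `T` will be zero or the identity, so that one statement covers every sum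
occurring in `expansion`. -/
theorem Admissible.paramOrder_homPart (h : Admissible B δ) (hη : ∀ i, 0 ≤ η i)
    (a : Fin n → Fin 2) (T : (Fin 2 → ℝ) →L[ℝ] (Fin 2 → ℝ)) (hT : ∀ y, ‖T y‖ ≤ ‖y‖)
    (D : ℕ) (l : Fin 2 → ℕ) {R : ι → Coeffs n} (hR : ∀ i, (R i).Small (k + 3) δ (η i)) :
    ParamOrder B δ η D fun i q => homPart D (R i) l (fun j => q.1 (a j)) (T q.2) := by
  obtain ⟨M, hM, hBM⟩ := h.bounded
  refine ParamOrder.sum h.isOpen h.param_mem _ fun p hp => ?_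
  have hD : ∑ j, p.1 j + ∑ j, p.2 j = D := (Finset.mem_filter.1 hp).2
  let L : (Fin 2 → ℂ) × (Fin 2 → ℝ) →L[ℝ] (Fin n → ℂ) × (Fin 2 → ℝ) :=
    (ContinuousLinearMap.pi fun j => ContinuousLinearMap.proj (a j)).prodMap T
  have hL : ∀ q, ‖L q‖ ≤ ‖q‖ := fun q => by
    refine max_le ((pi_norm_le_iff_of_nonneg (norm_nonneg q)).2 fun j => ?_)
      ((hT q.2).trans (norm_snd_le q))
    exact (norm_le_pi_norm q.1 (a j)).trans (norm_fst_le q)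
  have h1 := h.paramOrder_comp hη L hL fun i => hR i p.1 p.2 l
  have h2 := (ParamOrder.prod h.isOpen h.param_mem Finset.univ (fun j => 1 * p.1 j)
    fun j _ => (paramOrder_z (ι := ι) (δ := δ) hBM hM (a j)).pow h.isOpen h.param_mem (p.1 j)).mul
    h.isOpen (fun _ => zero_le_one) h.param_mem
    (ParamOrder.prod h.isOpen h.param_mem Finset.univ (fun j => 1 * p.2 j)
    fun j _ => (paramOrder_conj (ι := ι) (δ := δ) hBM hM (a j)).pow h.isOpen h.param_mem (p.2 j))
  have h3 := h1.mul h.isOpen hη h.param_mem h2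
  simp only [one_mul, zero_add, hD] at h3
  exact h3.congr h.pos h.param_mem fun i q _ => mul_comm _ _

/-- The powers of Im w supply the |l| zeros missing from the part of degree D - |l|; the first sum
even has order D + 1. -/
theorem Admissible.paramOrder_expansion (h : Admissible B δ) (hη : ∀ i, 0 ≤ η i)
    (a : Fin n → Fin 2) (D : ℕ) {R : ι → Coeffs n} (hR : ∀ i, (R i).Small (k + 3) δ (η i)) :
    ParamOrder B δ η D fun i q => expansion D (R i) (fun j => q.1 (a j)) q.2 := by
  obtain ⟨M, hM, hBM⟩ := h.bounded
  refine ParamOrder.add h.isOpen h.param_mem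
    ((h.paramOrder_homPart hη a 0 (by simp) (D + 1) 0 hR).lower h.isOpen (Nat.le_succ D))
    (ParamOrder.sum h.isOpen h.param_mem _ fun l hl => ?_)
  have hl' : ∑ j, l j ≤ D := (Finset.mem_filter.1 hl).2.2
  have h1 := h.paramOrder_homPart hη a (ContinuousLinearMap.id ℝ _) (by simp) (D - ∑ j, l j) l hR
  have h2 := ParamOrder.prod h.isOpen h.param_mem Finset.univ (fun j => 1 * l j)
    fun j _ => (paramOrder_y (ι := ι) (δ := δ) hBM hM j).pow h.isOpen h.param_mem (l j)
  have h3 := h1.mul h.isOpen hη h.param_mem h2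
  simp only [one_mul, Nat.sub_add_cancel hl'] at h3
  exact h3.congr h.pos h.param_mem fun i q _ => mul_comm _ _

end StatDisc



namespace StatDisc

/-! ### The defining functions of a perturbation -/

/-- A perturbation of the model, together with expansions of its terms. -/
structure PerturbationDatum (k : ℕ) (δ : ℝ) where
  /-- The perturbation. -/
  θ : (Fin 2 → ℂ) → (Fin 2 → ℝ) → Fin 2 → ℝ
  /-- The coefficients of the expansion in one variable. -/
  S : Fin 2 → Coeffs 1
  /-- The coefficients of the expansion in both variables. -/
  R : Fin 2 → Coeffs 2
  /-- The size of the coefficients. -/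
  η : ℝ
  nonneg : 0 ≤ η
  small_S : ∀ ℓ, (S ℓ).Small (k + 3) δ η
  small_R : ∀ ℓ, (R ℓ).Small (k + 3) δ η
  eq : ∀ z y, (z, y) ∈ paramBox 2 δ → ∀ ℓ, (θ z y ℓ : ℂ) =
    expansion (deg ℓ) (S ℓ) (fun _ => z ℓ) y + expansion (max (deg 0) (deg 1)) (R ℓ) z y

/-- The complex-valued function `(z, y) ↦ θ_ℓ(z, y)`. -/
noncomputable def cParam (θ : (Fin 2 → ℂ) → (Fin 2 → ℝ) → Fin 2 → ℝ) (ℓ : Fin 2)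
    (p : (Fin 2 → ℂ) × (Fin 2 → ℝ)) : ℂ := θ p.1 p.2 ℓ

/-- `∂θ/∂y_j`. -/
noncomputable def derivY (Θ : (Fin 2 → ℂ) × (Fin 2 → ℝ) → ℂ) (j : Fin 2)
    (p : (Fin 2 → ℂ) × (Fin 2 → ℝ)) : ℂ := fderiv ℝ Θ p (0, Pi.single j 1)

/-- `∂θ/∂z_j`. -/
noncomputable def derivZ (Θ : (Fin 2 → ℂ) × (Fin 2 → ℝ) → ℂ) (j : Fin 2)
    (p : (Fin 2 → ℂ) × (Fin 2 → ℝ)) : ℂ :=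
  (fderiv ℝ Θ p (Pi.single j 1, 0) - Complex.I * fderiv ℝ Θ p (Pi.single j Complex.I, 0)) / 2

/-- The real numbers `c_ℓ = 2 Re(ζ⁻³ w̃_ℓ)`. -/
noncomputable def multiplier (ζ : ℂ) (q : Fin 8 → ℂ) (ℓ : Fin 2) : ℂ :=
  (ζ ^ 3)⁻¹ * ![q 6, q 7] ℓ + ζ ^ 3 * starRingEnd ℂ (![q 6, q 7] ℓ)

/-- The factors `2 i z₁ z̄₁²` and `3 i z₂² z̄₂³`. -/
noncomputable def tangentFactor (q : Fin 8 → ℂ) : Fin 2 → ℂ :=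
  ![2 * Complex.I * (q 0 * starRingEnd ℂ (q 0) ^ 2),
    3 * Complex.I * (q 1 ^ 2 * starRingEnd ℂ (q 1) ^ 3)]

/-- `ζ³ ∑_ℓ c_ℓ (κ_j ∂θ_ℓ/∂y_j - ∂θ_ℓ/∂z_j)`, where `κ_j` is the tangent factor. -/
noncomputable def fibreTerm (θ : (Fin 2 → ℂ) → (Fin 2 → ℝ) → Fin 2 → ℝ) (ζ : ℂ) (q : Fin 8 → ℂ)
    (j : Fin 2) : ℂ :=
  ζ ^ 3 * ∑ ℓ, multiplier ζ q ℓ *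
    (tangentFactor q j * derivY (cParam θ ℓ) j (param q) - derivZ (cParam θ ℓ) j (param q))

/-- `∑_ℓ c_ℓ ∂θ_ℓ/∂y_j`. -/
noncomputable def normalTerm (θ : (Fin 2 → ℂ) → (Fin 2 → ℝ) → Fin 2 → ℝ) (ζ : ℂ) (q : Fin 8 → ℂ)
    (j : Fin 2) : ℂ :=
  ∑ ℓ, multiplier ζ q ℓ * derivY (cParam θ ℓ) j (param q)

/-- The terms to be added to `polyRow` for the perturbation `θ`. -/
noncomputable def perturbationRow (θ : (Fin 2 → ℂ) → (Fin 2 → ℝ) → Fin 2 → ℝ) (ζ : ℂ)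
    (q : Fin 8 → ℂ) : Fin 8 → ℂ :=
  ![cParam θ 0 (param q), cParam θ 1 (param q), 2 * fibreTerm θ ζ q 0,
    Complex.I * (2 * fibreTerm θ ζ q 0), 2 * fibreTerm θ ζ q 1,
    Complex.I * (2 * fibreTerm θ ζ q 1), -normalTerm θ ζ q 0, -normalTerm θ ζ q 1]

variable {k : ℕ} {α : ℝ≥0} [hα : Fact (0 < α ∧ α < 1)]
variable {ι : Type*} {B : Set (Y k α)} {η : ι → ℝ} {n m : ℕ} {δ : ℝ}

theorem OrderBound.fixed (χ : CComplex k α) :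
    OrderBound B (fun _ : ι => 1) 0 fun _ _ ζ => χ ζ :=
  ⟨‖χ‖, norm_nonneg _, fun _ => ⟨fun _ => χ, SmallC1.const (by simp), fun _ _ _ => by simp⟩⟩

theorem OrderBound.neg (hB : IsOpen B) (hη : ∀ i, 0 ≤ η i) {G : ι → Y k α → Circle → ℂ}
    (h : OrderBound B η n G) : OrderBound B η n fun i f ζ => -G i f ζ :=
  (h.const_mul hB hη (-1)).congr fun _ _ _ _ => by ring

theorem OrderBound.sub (hB : IsOpen B) (hη : ∀ i, 0 ≤ η i) {G H : ι → Y k α → Circle → ℂ}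
    (h : OrderBound B η n G) (h' : OrderBound B η n H) :
    OrderBound B η n fun i f ζ => G i f ζ - H i f ζ :=
  (h.add hB (h'.neg hB hη)).congr fun _ _ _ _ => sub_eq_add_neg _ _

theorem Admissible.orderBound_multiplier (h : Admissible B δ) (ℓ : Fin 2) :
    OrderBound B (fun _ : ι => 1) 0 fun _ f ζ => multiplier ζ (f.eval ζ) ℓ := by
  obtain ⟨M, hM, hBM⟩ := h.bounded
  set L : Fin 8 → Y k α →L[ℝ] CComplex k α := fun l =>
    (CComplex.mulCLM (CComplex.zp (-3))).comp (comp l) +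
      (CComplex.mulCLM (CComplex.zp 3)).comp (CComplex.conj.comp (comp l))
  refine (OrderBound.clm hBM hM (L (![6, 7] ℓ)) 0).congr fun _ f _ ζ => ?_
  have h2 : ∀ l, yOrd l = 0 → (ζ ^ 3 : ℂ)⁻¹ * f.eval ζ l + ζ ^ 3 * starRingEnd ℂ (f.eval ζ l) =
      (1 - (ζ : ℂ)) ^ 0 * (L l f) ζ := fun l hl => by
    have h3 : (ζ : ℂ) ^ (3 : ℤ) = (ζ : ℂ) ^ 3 := by norm_cast
    rw [Y.eval_apply, hl]
    simp [L, zpow_neg, h3]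
  fin_cases ℓ
  · exact h2 6 rfl
  · exact h2 7 rfl

theorem Admissible.orderBound_tangentFactor (h : Admissible B δ) (j : Fin 2) :
    OrderBound B (fun _ : ι => 1) (deg j - 1) fun _ f ζ => tangentFactor (f.eval ζ) j := by
  obtain ⟨M, hM, hBM⟩ := h.bounded
  have h1 : ∀ a b : ℕ, OrderBound B (fun _ : ι => 1) (1 * a + 1 * b) fun _ f ζ =>
      (param (f.eval ζ)).1 j ^ a * starRingEnd ℂ ((param (f.eval ζ)).1 j) ^ b := fun a b =>
    (((paramOrder_z (ι := ι) (δ := δ) hBM hM j).pow h.isOpen h.param_mem a).mul h.isOpen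
      (fun _ => zero_le_one) h.param_mem
      ((paramOrder_conj (ι := ι) (δ := δ) hBM hM j).pow h.isOpen h.param_mem b)).1
  fin_cases j
  · refine ((h1 1 2).const_mul h.isOpen (fun _ => zero_le_one) (2 * Complex.I)).congr
      fun _ f _ ζ => ?_
    simp [tangentFactor, param_fst]
  · refine ((h1 2 3).const_mul h.isOpen (fun _ => zero_le_one) (3 * Complex.I)).congr
      fun _ f _ ζ => ?_
    simp [tangentFactor, param_fst]

/-- The index set is the type of all perturbations, so the resulting constants are uniform and the
estimates are linear in the size η of the coefficients. -/
theorem Admissible.paramOrder_expansion_one (h : Admissible B δ) (ℓ : Fin 2) :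
    ParamOrder B δ (fun i : PerturbationDatum k δ => i.η) (deg ℓ)
      fun i q => expansion (deg ℓ) (i.S ℓ) (fun _ => q.1 ℓ) q.2 :=
  h.paramOrder_expansion (fun i => i.nonneg) (fun _ => ℓ) (deg ℓ) fun i => i.small_S ℓ

theorem Admissible.paramOrder_expansion_two (h : Admissible B δ) (ℓ : Fin 2) :
    ParamOrder B δ (fun i : PerturbationDatum k δ => i.η) 6
      fun i q => expansion (max (deg 0) (deg 1)) (i.R ℓ) q.1 q.2 :=
  h.paramOrder_expansion (fun i => i.nonneg) id 6 fun i => i.small_R ℓ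

theorem four_le_deg (ℓ : Fin 2) : 4 ≤ deg ℓ := by fin_cases ℓ <;> simp [deg]

theorem deg_le_six (ℓ : Fin 2) : deg ℓ ≤ 6 := by fin_cases ℓ <;> simp [deg]

theorem Admissible.paramOrder_cParam (h : Admissible B δ) (ℓ : Fin 2) :
    ParamOrder B δ (fun i : PerturbationDatum k δ => i.η) 4 fun i => cParam i.θ ℓ :=
  (((h.paramOrder_expansion_one ℓ).lower h.isOpen (four_le_deg ℓ)).add h.isOpen h.param_mem
    ((h.paramOrder_expansion_two ℓ).lower h.isOpen (by norm_num))).congr h.pos h.param_mem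
      fun i q hq => i.eq q.1 q.2 hq ℓ

theorem fderiv_eq_zero_of_const {V F : Type*} [NormedAddCommGroup V] [NormedSpace ℝ V]
    [NormedAddCommGroup F] [NormedSpace ℝ F] {g : V → F} {p v : V} (hg : DifferentiableAt ℝ g p)
    (hv : ∀ t : ℝ, g (p + t • v) = g p) : fderiv ℝ g p v = 0 := by
  rw [← hg.lineDeriv_eq_fderiv, lineDeriv]
  simp [hv]

/-- The rows for z̃_j need order deg j - 1 from the z_j-derivatives of both θ₁ and θ₂. If ℓ ≠ j, the
one-variable expansion does not involve z_j at all. The two-variable expansion has order 6 = max(d₁,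
d₂), so its derivatives have order 5, which is enough for either j. -/
theorem Admissible.orderBound_fderiv_single (h : Admissible B δ) (ℓ j : Fin 2) (c : ℂ) :
    OrderBound B (fun i : PerturbationDatum k δ => i.η) (deg j - 1)
      fun i f ζ => fderiv ℝ (cParam i.θ ℓ) (param (f.eval ζ)) (Pi.single j c, 0) := by
  have h1 := h.paramOrder_expansion_one (k := k) (δ := δ) ℓ
  have h2 := h.paramOrder_expansion_two (k := k) (δ := δ) ℓ
  have ho : IsOpen (paramBox 2 δ) := paramBox_eq_ball 2 h.pos ▸ Metric.isOpen_ball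
  have h3 : OrderBound B (fun i : PerturbationDatum k δ => i.η) (deg j - 1) fun i f ζ =>
      fderiv ℝ (fun q : (Fin 2 → ℂ) × (Fin 2 → ℝ) =>
        expansion (deg ℓ) (i.S ℓ) (fun _ => q.1 ℓ) q.2) (param (f.eval ζ)) (Pi.single j c, 0) := by
    by_cases hj : ℓ = j
    · rw [← hj]
      exact h1.2.2 _
    · refine OrderBound.zero.congr fun i f hf ζ =>
        fderiv_eq_zero_of_const (h1.2.1 i _ (h.param_mem f hf ζ)) fun t => ?_
      simp [Pi.single_eq_of_ne hj]
  have hj := deg_le_six j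
  refine (h3.add h.isOpen ((h2.2.2 (Pi.single j c, 0)).lower h.isOpen
    (show deg j - 1 ≤ 6 - 1 by omega))).congr fun i f hf ζ => ?_
  have hp := h.param_mem f hf ζ
  have e : cParam i.θ ℓ =ᶠ[nhds (param (f.eval ζ))] fun q =>
      expansion (deg ℓ) (i.S ℓ) (fun _ => q.1 ℓ) q.2 +
        expansion (max (deg 0) (deg 1)) (i.R ℓ) q.1 q.2 :=
    Filter.eventuallyEq_of_mem (ho.mem_nhds hp) fun q hq => i.eq q.1 q.2 hq ℓ
  rw [e.fderiv_eq, fderiv_fun_add (h1.2.1 i _ hp) (h2.2.1 i _ hp)]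
  rfl

theorem Admissible.orderBound_derivY (h : Admissible B δ) (ℓ j : Fin 2) :
    OrderBound B (fun i : PerturbationDatum k δ => i.η) 0
      fun i f ζ => derivY (cParam i.θ ℓ) j (param (f.eval ζ)) :=
  ((h.paramOrder_cParam ℓ).2.2 _).lower h.isOpen (Nat.zero_le _)

theorem Admissible.orderBound_derivZ (h : Admissible B δ) (ℓ j : Fin 2) :
    OrderBound B (fun i : PerturbationDatum k δ => i.η) (deg j - 1)
      fun i f ζ => derivZ (cParam i.θ ℓ) j (param (f.eval ζ)) :=
  (((h.orderBound_fderiv_single ℓ j 1).sub h.isOpen (fun i => i.nonneg)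
    ((h.orderBound_fderiv_single ℓ j Complex.I).const_mul h.isOpen (fun i => i.nonneg)
      Complex.I)).const_mul h.isOpen (fun i => i.nonneg) (1 / 2)).congr
    fun _ _ _ _ => by rw [derivZ]; ring

theorem Admissible.orderBound_normalTerm (h : Admissible B δ) (j : Fin 2) :
    OrderBound B (fun i : PerturbationDatum k δ => i.η) 0
      fun i f ζ => normalTerm i.θ ζ (f.eval ζ) j :=
  OrderBound.sum h.isOpen _ fun ℓ _ => ((h.orderBound_derivY ℓ j).mul h.isOpen
    (fun i => i.nonneg) (h.orderBound_multiplier ℓ)).congr fun _ _ _ _ => mul_comm _ _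

/-- The derivatives in Im w are multiplied by the tangent factor, which already has order deg j - 1;
the z_j-derivatives have that order by themselves. -/
theorem Admissible.orderBound_fibreTerm (h : Admissible B δ) (j : Fin 2) :
    OrderBound B (fun i : PerturbationDatum k δ => i.η) (deg j - 1)
      fun i f ζ => fibreTerm i.θ ζ (f.eval ζ) j := by
  have h1 := OrderBound.sum h.isOpen Finset.univ fun ℓ _ =>
    ((((h.orderBound_derivY ℓ j).mul h.isOpen (fun i => i.nonneg)
      (h.orderBound_tangentFactor j)).lower h.isOpen (Nat.le_add_left _ _)).sub h.isOpen
      (fun i => i.nonneg) (h.orderBound_derivZ ℓ j)).mul h.isOpen (fun i => i.nonneg)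
      (h.orderBound_multiplier ℓ)
  refine (h1.mul h.isOpen (fun i => i.nonneg) (OrderBound.fixed (CComplex.zp 3))).congr
    fun i f _ ζ => ?_
  have h3 : (ζ : ℂ) ^ (3 : ℤ) = (ζ : ℂ) ^ 3 := by norm_cast
  rw [fibreTerm, CComplex.zp_apply, h3, mul_comm]
  congr 1
  exact Finset.sum_congr rfl fun ℓ _ => by ring

/-- Every row has the order demanded by its component of the target space; in the first two rows
order 4 is available and only 1 is needed. -/
theorem Admissible.orderBound_perturbationRow (h : Admissible B δ) (l : Fin 8) :
    OrderBound B (fun i : PerturbationDatum k δ => i.η) (zOrd l)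
      fun i f ζ => perturbationRow i.θ ζ (f.eval ζ) l := by
  have hη : ∀ i : PerturbationDatum k δ, 0 ≤ i.η := fun i => i.nonneg
  have h1 := fun j => (h.orderBound_fibreTerm (k := k) j).const_mul h.isOpen hη 2
  fin_cases l
  · exact (h.paramOrder_cParam 0).1.lower h.isOpen (by decide)
  · exact (h.paramOrder_cParam 1).1.lower h.isOpen (by decide)
  · exact h1 0
  · exact (h1 0).const_mul h.isOpen hη _
  · exact h1 1
  · exact (h1 1).const_mul h.isOpen hη _
  · exact (h.orderBound_normalTerm 0).neg h.isOpen hη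
  · exact (h.orderBound_normalTerm 1).neg h.isOpen hη

/-- The defining equations of the perturbed stationary lifts are small perturbations of those of
the model. -/
theorem Admissible.exists_perturbation (h : Admissible B δ) : ∃ C : ℝ, 0 ≤ C ∧
    ∀ i : PerturbationDatum k δ, ∃ P : Y k α → Z k α, SmallC1 B P (C * i.η) ∧
      ∀ f ∈ B, ∀ ζ l, (P f).eval ζ l = ((perturbationRow i.θ ζ (f.eval ζ) l).re : ℂ) := by
  choose C hC hN using fun l => h.orderBound_perturbationRow (k := k) l
  let L : (l : Fin 8) → CComplex k α →L[ℝ] Z k α := fun l =>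
    (ContinuousLinearMap.single ℝ (fun l => CZero k α (zOrd l)) l).comp (realPart (zOrd l))
  refine ⟨∑ l, ‖L l‖ * C l, Finset.sum_nonneg fun l _ => mul_nonneg
    (ContinuousLinearMap.opNorm_nonneg (L l)) (hC l),
    fun i => ?_⟩
  choose N hN1 hN2 using fun l => hN l i
  have hs : ∀ s : Finset (Fin 8), SmallC1 B (fun f => ∑ l ∈ s, L l (N l f))
      ((∑ l ∈ s, ‖L l‖ * C l) * i.η) := fun s => by
    induction s using Finset.induction_on with
    | empty => simpa using SmallC1.const (by simp)
    | insert l s hl ih =>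
      simp only [Finset.sum_insert hl, add_mul]
      exact (((hN1 l).clm h.isOpen (L l)).mono (le_of_eq (mul_assoc _ _ _).symm)).add h.isOpen ih
  refine ⟨_, hs Finset.univ, fun f hf ζ l => ?_⟩
  have e : (∑ j, L j (N j f)) l = realPart (zOrd l) (N l f) := by
    rw [Finset.sum_apply, Finset.sum_eq_single l]
    · simp [L]
    · intro j _ hj
      simp [L, hj.symm]
    · simp
  rw [Z.eval, e, mulPow_realPart]
  exact congrArg (fun x : ℂ => ((x.re : ℝ) : ℂ)) (hN2 l f hf ζ).symm

end StatDisc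



namespace StatDisc

/-! ### Conormal vectors and the defining equations -/

/-- The linear map `(z, w) ↦ (z, Im w)`. -/
noncomputable def paramCLM : (Fin 4 → ℂ) →L[ℝ] (Fin 2 → ℂ) × (Fin 2 → ℝ) :=
  (ContinuousLinearMap.pi fun j : Fin 2 => ContinuousLinearMap.proj (![0, 1] j)).prod
    (ContinuousLinearMap.pi fun j : Fin 2 =>
      Complex.imCLM.comp (ContinuousLinearMap.proj (![2, 3] j)))

theorem paramCLM_apply (p : Fin 4 → ℂ) :
    paramCLM p = (zPart p, fun j => (wPart p j).im) := by
  refine Prod.ext (funext fun j => ?_) (funext fun j => ?_) <;> fin_cases j <;> rfl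

theorem paramCLM_single_z (j : Fin 2) (c : ℂ) :
    paramCLM (Pi.single (![0, 1] j) c) = (Pi.single j c, 0) := by
  rw [paramCLM_apply]
  refine Prod.ext (funext fun l => ?_) (funext fun l => ?_) <;> fin_cases j <;> fin_cases l <;>
    simp [zPart, wPart]

theorem paramCLM_single_w (j : Fin 2) (c : ℂ) :
    paramCLM (Pi.single (![2, 3] j) c) = (0, Pi.single j c.im) := by
  rw [paramCLM_apply]
  refine Prod.ext (funext fun l => ?_) (funext fun l => ?_) <;> fin_cases j <;> fin_cases l <;>
    simp [zPart, wPart]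

/-- Half of the degrees. -/
def halfDeg : Fin 2 → ℕ := ![2, 3]

theorem fderiv_defFun {θ : (Fin 2 → ℂ) → (Fin 2 → ℝ) → Fin 2 → ℝ} {ℓ : Fin 2} {p : Fin 4 → ℂ}
    (hθ : DifferentiableAt ℝ (cParam θ ℓ) (paramCLM p)) (v : Fin 4 → ℂ) :
    fderiv ℝ (fun p => (defFun θ p ℓ : ℂ)) p v =
      ((v (![2, 3] ℓ)).re : ℂ) - halfDeg ℓ *
        (p (![0, 1] ℓ) * starRingEnd ℂ (p (![0, 1] ℓ))) ^ (halfDeg ℓ - 1) *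
        (p (![0, 1] ℓ) * starRingEnd ℂ (v (![0, 1] ℓ)) +
          v (![0, 1] ℓ) * starRingEnd ℂ (p (![0, 1] ℓ))) +
      fderiv ℝ (cParam θ ℓ) (paramCLM p) (paramCLM v) := by
  have h : ∀ j : Fin 4, HasFDerivAt (𝕜 := ℝ) (fun q : Fin 4 → ℂ => q j)
    (ContinuousLinearMap.proj j) p := fun j => hasFDerivAt_apply j p
  have hc : ∀ j : Fin 4, HasFDerivAt (𝕜 := ℝ) (fun q : Fin 4 → ℂ => starRingEnd ℂ (q j))
    (Complex.conjCLE.toContinuousLinearMap.comp (ContinuousLinearMap.proj j)) p :=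
    fun j => Complex.conjCLE.toContinuousLinearMap.hasFDerivAt.comp p (h j)
  have hr := ((Complex.ofRealCLM.comp Complex.reCLM).hasFDerivAt
    (x := p (![2, 3] ℓ))).comp p (h (![2, 3] ℓ))
  have hp := ((h (![0, 1] ℓ)).mul (hc (![0, 1] ℓ))).pow (halfDeg ℓ)
  have ht := hθ.hasFDerivAt.comp p paramCLM.hasFDerivAt
  have e : (fun p => (defFun θ p ℓ : ℂ)) = fun p =>
      ((Complex.ofRealCLM.comp Complex.reCLM) ∘ fun q : Fin 4 → ℂ => q (![2, 3] ℓ)) p -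
        (p (![0, 1] ℓ) * starRingEnd ℂ (p (![0, 1] ℓ))) ^ halfDeg ℓ +
        (cParam θ ℓ ∘ paramCLM) p := by
    funext p
    rw [Complex.mul_conj', ← pow_mul, Function.comp_apply (f := cParam θ ℓ), paramCLM_apply]
    fin_cases ℓ <;> simp [defFun, cParam, wPart, zPart, deg, halfDeg]
  rw [e]
  refine (DFunLike.congr_fun ((hr.sub hp).add ht).fderiv v).trans ?_
  simp
  ring

theorem wirt_defFun_z {θ : (Fin 2 → ℂ) → (Fin 2 → ℝ) → Fin 2 → ℝ} {ℓ : Fin 2} {p : Fin 4 → ℂ}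
    (hθ : DifferentiableAt ℝ (cParam θ ℓ) (paramCLM p)) (j : Fin 2) :
    wirt (fun p => (defFun θ p ℓ : ℂ)) p (![0, 1] j) =
      (if j = ℓ then -(halfDeg ℓ * p (![0, 1] ℓ) ^ (halfDeg ℓ - 1) *
        starRingEnd ℂ (p (![0, 1] ℓ)) ^ halfDeg ℓ) else 0) +
      derivZ (cParam θ ℓ) j (paramCLM p) := by
  rw [wirt, fderiv_defFun hθ, fderiv_defFun hθ, paramCLM_single_z, paramCLM_single_z, derivZ]
  fin_cases j <;> fin_cases ℓ <;> simp [halfDeg] <;> ring_nf <;>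
    simp only [Complex.I_sq] <;> ring

theorem wirt_defFun_w {θ : (Fin 2 → ℂ) → (Fin 2 → ℝ) → Fin 2 → ℝ} {ℓ : Fin 2} {p : Fin 4 → ℂ}
    (hθ : DifferentiableAt ℝ (cParam θ ℓ) (paramCLM p)) (j : Fin 2) :
    wirt (fun p => (defFun θ p ℓ : ℂ)) p (![2, 3] j) =
      (if j = ℓ then 1 / 2 else 0) - Complex.I / 2 * derivY (cParam θ ℓ) j (paramCLM p) := by
  rw [wirt, fderiv_defFun hθ, fderiv_defFun hθ, paramCLM_single_w, paramCLM_single_w, derivY]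
  have h0 : ((0 : Fin 2 → ℂ), (0 : Fin 2 → ℝ)) = 0 := rfl
  fin_cases j <;> fin_cases ℓ <;> simp [halfDeg, h0] <;> ring

/-- θ is real-valued. This reality is what separates the coefficient c from the perturbation term
when real and imaginary parts of ζ⁻³w̃ are taken. -/
theorem derivY_cParam_eq_ofReal {θ : (Fin 2 → ℂ) → (Fin 2 → ℝ) → Fin 2 → ℝ} {ℓ : Fin 2}
    {p : (Fin 2 → ℂ) × (Fin 2 → ℝ)} (hθ : DifferentiableAt ℝ (cParam θ ℓ) p) (j : Fin 2) :
    derivY (cParam θ ℓ) j p = ((derivY (cParam θ ℓ) j p).re : ℂ) := by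
  have h1 := Complex.imCLM.hasFDerivAt.comp p hθ.hasFDerivAt
  have h2 : (Complex.imCLM ∘ cParam θ ℓ) = fun _ => (0 : ℝ) := funext fun q =>
    Complex.ofReal_im (θ q.1 q.2 ℓ)
  rw [h2] at h1
  have h3 := DFunLike.congr_fun (h1.unique (hasFDerivAt_const 0 p)) (0, Pi.single j 1)
  exact Complex.ext rfl h3

/-- The w̃-equations read ζ⁻³w̃_j = c_j/2 - (i/2)∑ c_ℓ ∂θ_ℓ/∂y_j with real c. Their real parts force
c_j = 2 Re(ζ⁻³w̃_j), the multiplier, and their imaginary parts are the last two rows. Substituting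
c_j = 2ζ⁻³w̃_j + i∑ c_ℓ ∂θ_ℓ/∂y_j in the leading terms of the z̃-equations produces a₁ and a₂
together with the tangent factors of `fibreTerm`. The condition on w̃₁ guarantees a nonzero
covector. -/
theorem mem_conormal_iff {δ : ℝ} {θ : (Fin 2 → ℂ) → (Fin 2 → ℝ) → Fin 2 → ℝ} {q : Fin 8 → ℂ}
    (hθ : ∀ ℓ, DifferentiableAt ℝ (cParam θ ℓ) (param q)) (hq : base q ∈ polydisc δ)
    (h6 : q 6 ≠ 0) (ζ : Circle) :
    q ∈ conormal (polydisc δ) (defFun θ) 3 ζ ↔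
      ∀ l, (polyRow ζ q l + perturbationRow θ ζ q l).re = 0 := by
  have hp : param q = paramCLM (base q) := (paramCLM_apply _).symm
  have hu : (ζ : ℂ) ^ 3 ≠ 0 := pow_ne_zero 3 (CComplex.circle_ne_zero ζ)
  have hcu : starRingEnd ℂ ((ζ : ℂ) ^ 3) = ((ζ : ℂ) ^ 3)⁻¹ := by
    rw [map_pow, CComplex.conj_circle, inv_pow]
  have hfib : fibre q ≠ 0 := fun h => h6 (congrFun h 2)
  choose Yr hY using fun ℓ j : Fin 2 =>
    (⟨_, derivY_cParam_eq_ofReal (hθ ℓ) j⟩ : ∃ y : ℝ, derivY (cParam θ ℓ) j (param q) = y)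
  set Zr := fun ℓ j : Fin 2 => derivZ (cParam θ ℓ) j (param q) with hZr
  have hw : ∀ c : Fin 2 → ℝ, (∀ j, fibre q j = (ζ : ℂ) ^ 3 *
      ∑ ℓ, (c ℓ : ℂ) * wirt (fun p => (defFun θ p ℓ : ℂ)) (base q) j) ↔
      q 4 = (ζ : ℂ) ^ 3 * (-(2 * c 0 * q 0 * starRingEnd ℂ (q 0) ^ 2) +
        c 0 * Zr 0 0 + c 1 * Zr 1 0) ∧
      q 5 = (ζ : ℂ) ^ 3 * (-(3 * c 1 * q 1 ^ 2 * starRingEnd ℂ (q 1) ^ 3) +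
        c 0 * Zr 0 1 + c 1 * Zr 1 1) ∧
      q 6 = (ζ : ℂ) ^ 3 * (c 0 / 2 - Complex.I / 2 * (c 0 * Yr 0 0 + c 1 * Yr 1 0)) ∧
      q 7 = (ζ : ℂ) ^ 3 * (c 1 / 2 - Complex.I / 2 * (c 0 * Yr 0 1 + c 1 * Yr 1 1)) := by
    intro c
    have hθ' : ∀ ℓ, DifferentiableAt ℝ (cParam θ ℓ) (paramCLM (base q)) := hp ▸ hθ
    have b0 : base q 0 = q 0 := rfl
    have b1 : base q 1 = q 1 := rfl
    have e : ∀ j, ∑ ℓ, (c ℓ : ℂ) * wirt (fun p => (defFun θ p ℓ : ℂ)) (base q) j =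
        c 0 * wirt (fun p => (defFun θ p 0 : ℂ)) (base q) j +
        c 1 * wirt (fun p => (defFun θ p 1 : ℂ)) (base q) j := fun j => Fin.sum_univ_two _
    have ez := fun ℓ j => wirt_defFun_z (hθ' ℓ) j
    have ew := fun ℓ j => wirt_defFun_w (hθ' ℓ) j
    rw [← hp] at ez ew
    have z00 := ez 0 0
    have z01 := ez 0 1
    have z10 := ez 1 0
    have z11 := ez 1 1
    have w00 := ew 0 0
    have w01 := ew 0 1
    have w10 := ew 1 0
    have w11 := ew 1 1
    simp [halfDeg, b0, b1, hY] at z00 z01 z10 z11 w00 w01 w10 w11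
    have f0 : (q 4 = (ζ : ℂ) ^ 3 * (-(2 * c 0 * q 0 * starRingEnd ℂ (q 0) ^ 2) +
        c 0 * Zr 0 0 + c 1 * Zr 1 0)) ↔ fibre q 0 = (ζ : ℂ) ^ 3 *
        ∑ ℓ, (c ℓ : ℂ) * wirt (fun p => (defFun θ p ℓ : ℂ)) (base q) 0 := by
      rw [e, z00, z10, show fibre q 0 = q 4 from rfl]
      simp only [hZr]
      ring_nf
    have f1 : (q 5 = (ζ : ℂ) ^ 3 * (-(3 * c 1 * q 1 ^ 2 * starRingEnd ℂ (q 1) ^ 3) +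
        c 0 * Zr 0 1 + c 1 * Zr 1 1)) ↔ fibre q 1 = (ζ : ℂ) ^ 3 *
        ∑ ℓ, (c ℓ : ℂ) * wirt (fun p => (defFun θ p ℓ : ℂ)) (base q) 1 := by
      rw [e, z01, z11, show fibre q 1 = q 5 from rfl]
      simp only [hZr]
      ring_nf
    have f2 : (q 6 = (ζ : ℂ) ^ 3 * (c 0 / 2 - Complex.I / 2 *
        (c 0 * Yr 0 0 + c 1 * Yr 1 0))) ↔ fibre q 2 = (ζ : ℂ) ^ 3 *
        ∑ ℓ, (c ℓ : ℂ) * wirt (fun p => (defFun θ p ℓ : ℂ)) (base q) 2 := by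
      rw [e, w00, w10, show fibre q 2 = q 6 from rfl]
      ring_nf
    have f3 : (q 7 = (ζ : ℂ) ^ 3 * (c 1 / 2 - Complex.I / 2 *
        (c 0 * Yr 0 1 + c 1 * Yr 1 1))) ↔ fibre q 3 = (ζ : ℂ) ^ 3 *
        ∑ ℓ, (c ℓ : ℂ) * wirt (fun p => (defFun θ p ℓ : ℂ)) (base q) 3 := by
      rw [e, w01, w11, show fibre q 3 = q 7 from rfl]
      ring_nf
    rw [f0, f1, f2, f3]
    exact ⟨fun h => ⟨h 0, h 1, h 2, h 3⟩, fun h j => by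
      fin_cases j
      exacts [h.1, h.2.1, h.2.2.1, h.2.2.2]⟩
  have hm : ∀ ℓ, multiplier ζ q ℓ = ((2 * ((![q 6, q 7] ℓ) * ((ζ : ℂ) ^ 3)⁻¹).re : ℝ) : ℂ) := by
    intro ℓ
    rw [multiplier, Complex.ofReal_mul, Complex.re_eq_add_conj, map_mul, ← hcu, Complex.conj_conj]
    push_cast
    ring
  set X : Fin 2 → ℂ := fun ℓ => ![q 6, q 7] ℓ * ((ζ : ℂ) ^ 3)⁻¹ with hX
  set c₀ : Fin 2 → ℝ := fun ℓ => 2 * (X ℓ).re with hc₀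
  have hm' : ∀ ℓ, multiplier ζ q ℓ = (c₀ ℓ : ℂ) := hm
  have h6X : q 6 = (ζ : ℂ) ^ 3 * X 0 := by simp [hX]; field_simp
  have h7X : q 7 = (ζ : ℂ) ^ 3 * X 1 := by simp [hX]; field_simp
  -- Real and imaginary parts of the w̃-equation, with t standing for the real sum of y-derivatives.
  have hX' : ∀ (x : ℂ) (c t : ℝ), x = c / 2 - Complex.I / 2 * t ↔
      c = 2 * x.re ∧ (Complex.I * (2 * x) - t).re = 0 := by
    intro x c t
    rw [Complex.ext_iff]
    simp
    constructor <;> rintro ⟨h1, h2⟩ <;> constructor <;> linarith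
  have hN : ∀ j, normalTerm θ ζ q j = ((c₀ 0 * Yr 0 j + c₀ 1 * Yr 1 j : ℝ) : ℂ) := by
    intro j
    rw [normalTerm, Fin.sum_univ_two, hm', hm', hY, hY, ← Complex.ofReal_mul,
      ← Complex.ofReal_mul, ← Complex.ofReal_add]
  have hF : ∀ j, fibreTerm θ ζ q j = (ζ : ℂ) ^ 3 * (c₀ 0 * (tangentFactor q j * Yr 0 j - Zr 0 j) +
      c₀ 1 * (tangentFactor q j * Yr 1 j - Zr 1 j)) := by
    intro j
    rw [fibreTerm, Fin.sum_univ_two, hm', hm', hY, hY]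
  -- Rows 3 and 4, and likewise rows 5 and 6, are the two real components of one complex equation.
  have hpair : ∀ x y : ℂ, (2 * x + 2 * y).re = 0 ∧
      (Complex.I * (2 * x) + Complex.I * (2 * y)).re = 0 ↔ x + y = 0 := by
    intro x y
    rw [Complex.ext_iff]
    simp
    constructor <;> rintro ⟨h1, h2⟩ <;> constructor <;> linarith
  have hr0 : (polyRow ζ q 0 + perturbationRow θ ζ q 0).re = defFun θ (base q) 0 := by
    have h : (((q 2).re : ℝ) : ℂ) - ((‖q 0‖ : ℝ) : ℂ) ^ 4 = ((polyRow ζ q 0).re : ℂ) :=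
      rhoTilde_eq_re ζ q 0
    have h' : (q 2).re - ‖q 0‖ ^ 4 = (polyRow ζ q 0).re := by exact_mod_cast h
    rw [Complex.add_re, ← h']
    rfl
  have hr1 : (polyRow ζ q 1 + perturbationRow θ ζ q 1).re = defFun θ (base q) 1 := by
    have h : (((q 3).re : ℝ) : ℂ) - ((‖q 1‖ : ℝ) : ℂ) ^ 6 = ((polyRow ζ q 1).re : ℂ) :=
      rhoTilde_eq_re ζ q 1
    have h' : (q 3).re - ‖q 1‖ ^ 6 = (polyRow ζ q 1).re := by exact_mod_cast h
    rw [Complex.add_re, ← h']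
    rfl
  have hrows : (∀ l, (polyRow ζ q l + perturbationRow θ ζ q l).re = 0) ↔
      (∀ ℓ, defFun θ (base q) ℓ = 0) ∧
      q 4 + 4 * q 6 * q 0 * starRingEnd ℂ (q 0) ^ 2 + fibreTerm θ ζ q 0 = 0 ∧
      q 5 + 6 * q 7 * q 1 ^ 2 * starRingEnd ℂ (q 1) ^ 3 + fibreTerm θ ζ q 1 = 0 ∧
      (Complex.I * (2 * X 0) - normalTerm θ ζ q 0).re = 0 ∧
      (Complex.I * (2 * X 1) - normalTerm θ ζ q 1).re = 0 := by
    rw [← hpair, ← hpair]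
    constructor
    · intro h
      refine ⟨fun ℓ => ?_, ⟨h 2, h 3⟩, ⟨h 4, h 5⟩, ?_, ?_⟩
      · fin_cases ℓ
        exacts [hr0 ▸ h 0, hr1 ▸ h 1]
      · rw [sub_eq_add_neg]
        exact h 6
      · rw [sub_eq_add_neg]
        exact h 7
    · rintro ⟨h, ⟨h2, h3⟩, ⟨h4, h5⟩, h6, h7⟩ l
      rw [sub_eq_add_neg] at h6 h7
      fin_cases l
      exacts [hr0.trans (h 0), hr1.trans (h 1), h2, h3, h4, h5, h6, h7]
  have hc : (∃ c : Fin 2 → ℝ, ∀ j, fibre q j = (ζ : ℂ) ^ 3 *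
      ∑ ℓ, (c ℓ : ℂ) * wirt (fun p => (defFun θ p ℓ : ℂ)) (base q) j) ↔
      q 4 + 4 * q 6 * q 0 * starRingEnd ℂ (q 0) ^ 2 + fibreTerm θ ζ q 0 = 0 ∧
      q 5 + 6 * q 7 * q 1 ^ 2 * starRingEnd ℂ (q 1) ^ 3 + fibreTerm θ ζ q 1 = 0 ∧
      (Complex.I * (2 * X 0) - normalTerm θ ζ q 0).re = 0 ∧
      (Complex.I * (2 * X 1) - normalTerm θ ζ q 1).re = 0 := by
    simp only [hw]
    have key : ∀ c : Fin 2 → ℝ, (q 6 = (ζ : ℂ) ^ 3 * (c 0 / 2 - Complex.I / 2 *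
        (c 0 * Yr 0 0 + c 1 * Yr 1 0)) ∧ q 7 = (ζ : ℂ) ^ 3 * (c 1 / 2 - Complex.I / 2 *
        (c 0 * Yr 0 1 + c 1 * Yr 1 1))) ↔ c = c₀ ∧
        (Complex.I * (2 * X 0) - normalTerm θ ζ q 0).re = 0 ∧
        (Complex.I * (2 * X 1) - normalTerm θ ζ q 1).re = 0 := by
      intro c
      have e : ∀ j, (c 0 * Yr 0 j + c 1 * Yr 1 j : ℂ) =
        ((c 0 * Yr 0 j + c 1 * Yr 1 j : ℝ) : ℂ) := fun j => by push_cast; rfl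
      rw [e, e, h6X, h7X, mul_right_inj' hu, mul_right_inj' hu, hX', hX', hN, hN]
      constructor
      · rintro ⟨⟨h1, h2⟩, h3, h4⟩
        have h5 : c = c₀ := funext fun ℓ => by fin_cases ℓ; exacts [h1, h3]
        exact ⟨h5, h5 ▸ h2, h5 ▸ h4⟩
      · rintro ⟨rfl, h2, h4⟩
        exact ⟨⟨rfl, h2⟩, rfl, h4⟩
    simp only [key]
    have t0 : tangentFactor q 0 = 2 * Complex.I * (q 0 * starRingEnd ℂ (q 0) ^ 2) := rfl
    have t1 : tangentFactor q 1 = 3 * Complex.I * (q 1 ^ 2 * starRingEnd ℂ (q 1) ^ 3) := rfl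
    constructor
    · rintro ⟨c, h4, h5, hk⟩
      have h67 := (key c).2 hk
      obtain ⟨h6, h7⟩ := h67
      obtain ⟨rfl, hk⟩ := hk
      refine ⟨?_, ?_, hk⟩
      · rw [hF, t0]
        linear_combination h4 + 4 * q 0 * starRingEnd ℂ (q 0) ^ 2 * h6
      · rw [hF, t1]
        linear_combination h5 + 6 * q 1 ^ 2 * starRingEnd ℂ (q 1) ^ 3 * h7
    · rintro ⟨h4, h5, hk⟩
      obtain ⟨h6, h7⟩ := (key c₀).2 ⟨rfl, hk⟩
      refine ⟨c₀, ?_, ?_, rfl, hk⟩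
      · rw [hF, t0] at h4
        linear_combination h4 - 4 * q 0 * starRingEnd ℂ (q 0) ^ 2 * h6
      · rw [hF, t1] at h5
        linear_combination h5 - 6 * q 1 ^ 2 * starRingEnd ℂ (q 1) ^ 3 * h7
  rw [hrows, ← hc]
  exact ⟨fun h => ⟨h.2.1, h.2.2.2⟩, fun h => ⟨hq, h.1, hfib, h.2⟩⟩

end StatDisc



namespace StatDisc

variable {k : ℕ} {α : ℝ≥0}

/-! ### Stationary lifts as zeros of an operator -/

theorem Y.exists_diffContOnCl (f : Y k α) :
    ∃ F : ℂ → Fin 8 → ℂ, DiffContOnCl ℂ F (Metric.ball 0 1) ∧ ∀ ζ : Circle, F ζ = f.eval ζ := by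
  choose F hF hFe using fun i => (f i).2
  have h : ∀ i, DiffContOnCl ℂ (fun z => (1 - z) ^ yOrd i * F i z) (Metric.ball 0 1) := fun i =>
    (Differentiable.diffContOnCl (f := fun z : ℂ => (1 - z) ^ yOrd i) (by fun_prop)).smul (hF i)
  exact ⟨fun z i => (1 - z) ^ yOrd i * F i z, ⟨differentiableOn_pi.2 fun i => (h i).1,
    continuousOn_pi.2 fun i => (h i).2⟩, fun ζ => funext fun i => by
      rw [Y.eval_apply]
      exact congrArg (_ * ·) (hFe i ζ)⟩

/-- The holomorphic extension is built into `Y`. Non-constancy is automatic because z₁ vanishes at ζ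
= 1 but not identically. Only the pointwise conormal condition remains. -/
theorem isStationaryLift_iff {δ : ℝ} {θ : (Fin 2 → ℂ) → (Fin 2 → ℝ) → Fin 2 → ℝ} {f : Y k α}
    (hθ : ∀ ζ ℓ, DifferentiableAt ℝ (cParam θ ℓ) (param (f.eval ζ)))
    (hb : ∀ ζ, base (f.eval ζ) ∈ polydisc δ) (h6 : ∀ ζ, f.eval ζ 6 ≠ 0)
    (h0 : ∃ ζ, f.eval ζ 0 ≠ 0) :
    IsStationaryLift (polydisc δ) (defFun θ) 3 f.eval ↔
      ∀ (ζ : Circle) l, (polyRow ζ (f.eval ζ) l + perturbationRow θ ζ (f.eval ζ) l).re = 0 := by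
  have hn : ¬ ∃ p, ∀ ζ : Circle, base (f.eval ζ) = p := by
    rintro ⟨p, hp⟩
    obtain ⟨ζ, hζ⟩ := h0
    refine hζ ?_
    have h1 : f.eval ζ 0 = f.eval 1 0 := congrFun ((hp ζ).trans (hp 1).symm) 0
    rw [h1, Y.eval_apply]
    simp [yOrd]
  simp only [← fun ζ => mem_conormal_iff (hθ ζ) (hb ζ) (h6 ζ) ζ]
  exact ⟨fun h => h.2.1, fun h => ⟨f.exists_diffContOnCl, h, hn⟩⟩

theorem perturbationRow_zero (ζ : ℂ) (q : Fin 8 → ℂ) (l : Fin 8) : perturbationRow 0 ζ q l = 0 := by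
  have h : ∀ ℓ, cParam 0 ℓ = fun _ => 0 := fun ℓ => funext fun p => Complex.ofReal_zero
  have h1 : ∀ ℓ j p, derivY (cParam 0 ℓ) j p = 0 := fun ℓ j p => by simp [derivY, h]
  have h2 : ∀ ℓ j p, derivZ (cParam 0 ℓ) j p = 0 := fun ℓ j p => by simp [derivZ, h]
  fin_cases l <;> simp [perturbationRow, fibreTerm, normalTerm, h1, h2] <;> simp [h]

theorem rhoTilde_initialLift (ζ : Circle) (l : Fin 8) : rhoTilde ζ (initialLift ζ) l = 0 := by
  have hn : ((‖1 - (ζ : ℂ)‖ : ℝ) : ℂ) ^ 2 = (1 - ζ) * (1 - (ζ : ℂ)⁻¹) := by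
    rw [← Complex.mul_conj', map_sub, map_one, CComplex.conj_circle]
  have h4 : ((‖1 - (ζ : ℂ)‖ : ℝ) : ℂ) ^ 4 = ((1 - ζ) * (1 - (ζ : ℂ)⁻¹)) ^ 2 := by
    rw [← hn]; ring
  have h6 : ((‖1 - (ζ : ℂ)‖ : ℝ) : ℂ) ^ 6 = ((1 - ζ) * (1 - (ζ : ℂ)⁻¹)) ^ 3 := by
    rw [← hn]; ring
  have hζ := CComplex.circle_ne_zero ζ
  fin_cases l
  · show ((6 - 8 * (ζ : ℂ) + 2 * (ζ : ℂ) ^ 2).re : ℂ) - ((‖1 - (ζ : ℂ)‖ : ℝ) : ℂ) ^ 4 = 0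
    rw [h4, Complex.re_eq_add_conj]
    simp only [map_add, map_sub, map_mul, map_pow, map_ofNat, CComplex.conj_circle]
    field_simp
    ring
  · show ((20 - 30 * (ζ : ℂ) + 12 * (ζ : ℂ) ^ 2 - 2 * (ζ : ℂ) ^ 3).re : ℂ) -
      ((‖1 - (ζ : ℂ)‖ : ℝ) : ℂ) ^ 6 = 0
    rw [h6, Complex.re_eq_add_conj]
    simp only [map_add, map_sub, map_mul, map_pow, map_ofNat, CComplex.conj_circle]
    field_simp
    ring
  all_goals simp [rhoTilde, initialLift, CComplex.conj_circle, map_ofNat]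
  all_goals field_simp
  all_goals ring

variable [hα : Fact (0 < α ∧ α < 1)]

theorem modelMap_initialDisc : modelMap (initialDisc : Y k α) = 0 := by
  funext l
  refine CZero.ext_off_one fun ζ => ?_
  have h := congrFun (eval_modelMap (initialDisc : Y k α) ζ) l
  rw [eval_initialDisc, rhoTilde_initialLift] at h
  exact h.trans (by simp [mulPow_apply])

theorem Y.norm_eval_sub_le (f g : Y k α) (ζ : Circle) (j : Fin 8) :
    ‖f.eval ζ j - g.eval ζ j‖ ≤ 2 ^ yOrd j * ‖f - g‖ := by
  have h1 : ‖1 - (ζ : ℂ)‖ ≤ 2 := (norm_sub_le _ _).trans (by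
    rw [norm_one, Circle.norm_coe]; norm_num)
  have h2 : f.eval ζ j - g.eval ζ j =
      (1 - (ζ : ℂ)) ^ yOrd j * ((f j : CComplex k α) - (g j : CComplex k α)) ζ := by
    rw [Y.eval_apply, Y.eval_apply, CComplex.sub_apply, mul_sub]
  rw [h2, norm_mul, norm_pow]
  exact mul_le_mul (pow_le_pow_left₀ (norm_nonneg _) h1 _)
    ((CComplex.norm_apply_le hα.out.1 _ ζ).trans (norm_le_pi_norm (f - g) j)) (norm_nonneg _)
    (by positivity)

/-- The initial w̃₁ = ζ³/4 has modulus 1/4 on the circle, so a change of less than 1/8 cannot make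
it vanish. -/
theorem Y.eval_six_ne_zero {f : Y k α} (hf : ‖f - initialDisc‖ < 1 / 8) (ζ : Circle) :
    f.eval ζ 6 ≠ 0 := by
  intro h
  have h1 := f.norm_eval_sub_le initialDisc ζ 6
  rw [h, eval_initialDisc] at h1
  have h2 : ‖(0 : ℂ) - initialLift ζ 6‖ = 1 / 4 := by
    have h3 : initialLift ζ 6 = (ζ : ℂ) ^ 3 / 4 := rfl
    rw [h3, zero_sub, norm_neg, norm_div, norm_pow, Circle.norm_coe]
    simp
  rw [h2] at h1
  simp [yOrd] at h1
  linarith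

/-- At ζ = -1 the initial z₁ equals 2, while the perturbation there is at most 2·(1/8). -/
theorem Y.exists_eval_zero_ne_zero {f : Y k α} (hf : ‖f - initialDisc‖ < 1 / 8) :
    ∃ ζ, f.eval ζ 0 ≠ 0 := by
  refine ⟨Circle.exp Real.pi, fun h => ?_⟩
  have h1 := f.norm_eval_sub_le initialDisc (Circle.exp Real.pi) 0
  rw [h, eval_initialDisc] at h1
  have h2 : ((Circle.exp Real.pi : Circle) : ℂ) = -1 := by simp [Circle.coe_exp]
  have h3 : ‖(0 : ℂ) - initialLift (-1) 0‖ = 2 := by simp [initialLift]; norm_num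
  rw [h2, h3] at h1
  simp [yOrd] at h1
  linarith

theorem norm_param_le (q : Fin 8 → ℂ) : ‖param q‖ ≤ ‖base q‖ := by
  refine max_le ((pi_norm_le_iff_of_nonneg (norm_nonneg _)).2 fun j => ?_)
    ((pi_norm_le_iff_of_nonneg (norm_nonneg _)).2 fun j => ?_)
  · fin_cases j
    exacts [norm_le_pi_norm (base q) 0, norm_le_pi_norm (base q) 1]
  · fin_cases j
    exacts [(Complex.abs_im_le_norm _).trans (norm_le_pi_norm (base q) 2),
      (Complex.abs_im_le_norm _).trans (norm_le_pi_norm (base q) 3)]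

/-- By compactness the initial base disc stays in a closed polydisc of radius δ' < δ, which leaves
room for a ball of nearby discs. -/
theorem exists_admissible_ball {δ : ℝ}
    (hδ : ∀ ζ : ℂ, ‖ζ‖ ≤ 1 → base (initialLift ζ) ∈ polydisc δ) :
    ∃ r > 0, r ≤ 1 / 8 ∧ Admissible (Metric.ball (initialDisc : Y k α) r) δ ∧
      ∀ f ∈ Metric.ball (initialDisc : Y k α) r, ∀ ζ, base (f.eval ζ) ∈ polydisc δ := by
  have h0 : 0 < δ := (norm_nonneg _).trans_lt (hδ 0 (by simp) 0)
  have hc : Continuous fun ζ : ℂ => ‖base (initialLift ζ)‖ := by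
    refine continuous_norm.comp (continuous_pi fun j => ?_)
    fin_cases j <;> simp [base, initialLift] <;> fun_prop
  obtain ⟨ζ₀, hζ₀, hmax⟩ := (isCompact_closedBall (0 : ℂ) 1).exists_isMaxOn
    ⟨0, by simp⟩ hc.continuousOn
  set δ' := ‖base (initialLift ζ₀)‖ with hδ'
  have h1 : δ' < δ := (pi_norm_lt_iff h0).2 (hδ ζ₀ (by simpa using hζ₀))
  have h2 : 0 ≤ δ' := norm_nonneg _
  -- As |1 - ζ| ≤ 2, base points move by at most twice the radius, hence by at most (δ - δ')/2, and
  -- stay within the mean of δ' and δ.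
  have hr : 0 < min (1 / 8) ((δ - δ') / 4) := lt_min (by norm_num) (by linarith)
  have hb : ∀ f ∈ Metric.ball (initialDisc : Y k α) (min (1 / 8) ((δ - δ') / 4)), ∀ ζ,
      ‖base (f.eval ζ)‖ ≤ (δ' + δ) / 2 := by
    intro f hf ζ
    rw [mem_ball_iff_norm] at hf
    have h3 := hf.trans_le (min_le_right _ _)
    refine (pi_norm_le_iff_of_nonneg (by linarith)).2 fun j => ?_
    have h4 : ‖base (initialLift ζ)‖ ≤ δ' :=
      hmax (mem_closedBall_zero_iff.2 (Circle.norm_coe ζ).le)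
    have h5 := f.norm_eval_sub_le initialDisc ζ (Fin.castAdd 4 j)
    have h6 : yOrd (Fin.castAdd 4 j) = 1 := by fin_cases j <;> rfl
    rw [h6, pow_one, eval_initialDisc] at h5
    have h7 := (norm_le_pi_norm (base (initialLift ζ)) j).trans h4
    have h8 := norm_le_norm_add_norm_sub' (f.eval ζ (Fin.castAdd 4 j))
      (initialLift ζ (Fin.castAdd 4 j))
    have h9 : ‖initialLift ζ (Fin.castAdd 4 j)‖ ≤ δ' := h7
    show ‖f.eval ζ (Fin.castAdd 4 j)‖ ≤ _
    linarith
  refine ⟨_, hr, min_le_left _ _, ⟨Metric.isOpen_ball, ⟨‖(initialDisc : Y k α)‖ + 1,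
    by positivity, fun f hf => ?_⟩, (δ' + δ) / 2, by linarith, by linarith,
    fun f hf ζ => (norm_param_le _).trans (hb f hf ζ)⟩, fun f hf ζ =>
    (pi_norm_lt_iff h0).1 ((hb f hf ζ).trans_lt (by linarith))⟩
  rw [mem_ball_iff_norm] at hf
  have h3 := hf.trans_le (min_le_left _ _)
  have h4 := norm_le_norm_add_norm_sub' f (initialDisc : Y k α)
  linarith

theorem isStationaryLift_initialDisc {δ : ℝ}
    (hδ : ∀ ζ : ℂ, ‖ζ‖ ≤ 1 → base (initialLift ζ) ∈ polydisc δ) :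
    IsStationaryLift (polydisc δ) rho 3 (initialDisc : Y k α).eval := by
  have h : ∀ ℓ, cParam 0 ℓ = fun _ => 0 := fun ℓ => funext fun p => Complex.ofReal_zero
  refine (isStationaryLift_iff (fun ζ ℓ => by rw [h]; exact differentiableAt_const _)
    (fun ζ => ?_) (Y.eval_six_ne_zero (by simp)) (Y.exists_eval_zero_ne_zero (by simp))).2
    fun ζ l => ?_
  · rw [eval_initialDisc]
    exact hδ ζ (Circle.norm_coe ζ).le
  · rw [perturbationRow_zero, add_zero, eval_initialDisc]
    have h1 := rhoTilde_initialLift ζ l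
    rw [rhoTilde_eq_re] at h1
    exact_mod_cast h1

/-- The case θ = 0 of the general criterion, in which the perturbation rows vanish. -/
theorem isStationaryLift_iff_modelMap_add_eq_zero {δ : ℝ} {B : Set (Y k α)} (hB : Admissible B δ)
    (i : PerturbationDatum k δ) {P : Y k α → Z k α}
    (hP : ∀ f ∈ B, ∀ (ζ : Circle) l,
      (P f).eval ζ l = ((perturbationRow i.θ ζ (f.eval ζ) l).re : ℂ))
    (hb : ∀ f ∈ B, ∀ ζ, base (f.eval ζ) ∈ polydisc δ) {f : Y k α} (hf : f ∈ B)
    (hf' : ‖f - initialDisc‖ < 1 / 8) :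
    IsStationaryLift (polydisc δ) (defFun i.θ) 3 f.eval ↔ modelMap f + P f = 0 := by
  rw [isStationaryLift_iff (fun ζ ℓ => (hB.paramOrder_cParam ℓ).2.1 i _ (hB.param_mem f hf ζ))
    (hb f hf) (Y.eval_six_ne_zero hf') (Y.exists_eval_zero_ne_zero hf')]
  have h : ∀ (ζ : Circle) l, (modelMap f + P f).eval ζ l =
      ((polyRow ζ (f.eval ζ) l + perturbationRow i.θ ζ (f.eval ζ) l).re : ℂ) := fun ζ l => by
    have h1 : (modelMap f + P f).eval ζ l = (modelMap f).eval ζ l + (P f).eval ζ l :=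
      mul_add ((1 - (ζ : ℂ)) ^ zOrd l) ((modelMap f l : CComplex k α) ζ)
        ((P f l : CComplex k α) ζ)
    rw [h1, hP f hf, eval_modelMap, rhoTilde_eq_re, Complex.add_re, Complex.ofReal_add]
  constructor
  · intro h1
    funext l
    refine CZero.ext_off_one fun ζ => ?_
    have h2 := h ζ l
    rw [h1, Complex.ofReal_zero] at h2
    exact h2.trans (by simp [mulPow_apply])
  · intro h1 ζ l
    have h2 := h ζ l
    rw [h1, Z.eval_apply] at h2
    have h3 : (((0 : Z k α) l : CZero k α (zOrd l)) : CComplex k α) ζ = 0 := rfl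
    rw [h3, mul_zero] at h2
    exact_mod_cast h2.symm

/-- The bound on P is C times the coefficient size, uniformly in the perturbation, so η = σ/(C + 1)
meets the smallness σ required by the submanifold theorem. The dimension is that of the Taylor data.
-/
theorem exists_stationaryLifts_submanifold {δ : ℝ}
    (hδ : ∀ ζ : ℂ, ‖ζ‖ ≤ 1 → base (initialLift ζ) ∈ polydisc δ) :
    ∃ ε > 0, ∃ η > 0, ∀ θ : (Fin 2 → ℂ) → (Fin 2 → ℝ) → Fin 2 → ℝ, IsPerturbation k δ η θ →
      {f : Y k α | ‖f - initialDisc‖ < ε ∧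
        IsStationaryLift (polydisc δ) (defFun θ) 3 f.eval}.Nonempty ∧
      IsC1Submanifold 20 {f : Y k α | ‖f - initialDisc‖ < ε ∧
        IsStationaryLift (polydisc δ) (defFun θ) 3 f.eval} := by
  obtain ⟨r, hr, hr8, hB, hb⟩ := exists_admissible_ball (k := k) (α := α) hδ
  obtain ⟨ε, hε, hεr, σ, hσ, h⟩ := exists_submanifold_of_perturbation (modelEquiv (k := k) (α := α))
    contDiff_modelMap modelMap_initialDisc (fun v => congrArg Prod.fst (modelEquiv_apply v)) hr
  obtain ⟨C, hC, hP⟩ := hB.exists_perturbation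
  refine ⟨ε, hε, σ / (C + 1), by positivity, ?_⟩
  rintro θ ⟨S, R, hS, hR, hθ⟩
  obtain ⟨P, hP1, hP2⟩ := hP ⟨θ, S, R, σ / (C + 1), by positivity, hS, hR, hθ⟩
  have hCσ : C * (σ / (C + 1)) ≤ σ := by
    rw [mul_div_assoc', div_le_iff₀ (by positivity)]
    nlinarith
  have hset : {f : Y k α | ‖f - initialDisc‖ < ε ∧
      IsStationaryLift (polydisc δ) (defFun θ) 3 f.eval} =
      {f | ‖f - initialDisc‖ < ε ∧ modelMap f + P f = 0} := by
    ext f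
    refine and_congr_right fun hf => ?_
    exact isStationaryLift_iff_modelMap_add_eq_zero hB _ hP2 hb
      (mem_ball_iff_norm.2 (hf.trans_le hεr)) (hf.trans_le (hεr.trans hr8))
  rw [hset, ← finrank_taylorData]
  have hP3 := hP1.mono hCσ
  exact h P hP3.1 hP3.2

end StatDisc

/-! ### Assembly of the main theorem -/

theorem mainTheorem2 (k : ℕ) (α : NNReal) (hα0 : 0 < α) (hα1 : α < 1) (δ : ℝ)
    (hδ : ∀ ζ : ℂ, ‖ζ‖ ≤ 1 → StatDisc.base (StatDisc.initialLift ζ) ∈ StatDisc.polydisc δ) :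
    ∃ f₀ : StatDisc.Y k α,
      -- `f₀` is the initial lift, and it is a 3-stationary lift for the model
      (∀ ζ : Circle, f₀.eval ζ = StatDisc.initialLift ζ) ∧
      StatDisc.IsStationaryLift (StatDisc.polydisc δ) StatDisc.rho 3 f₀.eval ∧
      -- the map `F(ρ, ·)`, its derivative `L = ∂₂F(ρ, f₀)`, surjectivity and the kernel
      (∃ (F : StatDisc.Y k α → StatDisc.Z k α) (L : StatDisc.Y k α →L[ℝ] StatDisc.Z k α),
        (∀ f ζ, (F f).eval ζ = StatDisc.rhoTilde ζ (f.eval ζ)) ∧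
        HasFDerivAt F L f₀ ∧
        (∀ f ζ i, (L f).eval ζ i =
          ((2 * (∑ j, starRingEnd ℂ (StatDisc.symbol ζ i j) *
            f.eval ζ (StatDisc.col j)).re : ℝ) : ℂ)) ∧
        Function.Surjective L ∧
        Module.finrank ℝ (LinearMap.ker (L : StatDisc.Y k α →ₗ[ℝ] StatDisc.Z k α)) = 20) ∧
      -- partial indices and Maslov index of the desingularized symbol
      (∃ Gt : Circle → Matrix (Fin 8) (Fin 8) ℂ,
        (∀ ζ, StatDisc.symbol ζ = Gt ζ * StatDisc.degenFactor ζ) ∧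
        (∀ ζ, (Gt ζ).BlockTriangular StatDisc.blk) ∧
        StatDisc.HasPartialIndices (fun ζ => StatDisc.blockDiagPart (Gt ζ))
          ![0, 0, 4, 4, 5, 5, 6, 6] ∧
        StatDisc.HasMaslovIndex Gt 30) ∧
      -- the stationary lifts near `f₀` of all small perturbations of the model
      ∃ ε > 0, ∃ η > 0, ∀ θ : (Fin 2 → ℂ) → (Fin 2 → ℝ) → Fin 2 → ℝ,
        StatDisc.IsPerturbation k δ η θ →
          {f : StatDisc.Y k α | ‖f - f₀‖ < ε ∧ StatDisc.IsStationaryLift (StatDisc.polydisc δ)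
            (StatDisc.defFun θ) 3 f.eval}.Nonempty ∧
          StatDisc.IsC1Submanifold 20
            {f : StatDisc.Y k α | ‖f - f₀‖ < ε ∧ StatDisc.IsStationaryLift (StatDisc.polydisc δ)
              (StatDisc.defFun θ) 3 f.eval} := by
  have : Fact (0 < α ∧ α < 1) := ⟨hα0, hα1⟩
  exact ⟨StatDisc.initialDisc, StatDisc.eval_initialDisc, StatDisc.isStationaryLift_initialDisc hδ,
    ⟨StatDisc.modelMap, StatDisc.modelDeriv, StatDisc.eval_modelMap,
      StatDisc.hasFDerivAt_modelMap, StatDisc.eval_modelDeriv_eq_symbol,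
      StatDisc.modelDeriv_surjective, StatDisc.finrank_ker_modelDeriv⟩,
    ⟨StatDisc.desingularized, StatDisc.symbol_eq_desingularized_mul,
      StatDisc.blockTriangular_desingularized, StatDisc.hasPartialIndices_blockDiagPart,
      StatDisc.hasMaslovIndex_desingularized⟩,
    StatDisc.exists_stationaryLifts_submanifold hδ⟩
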